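/- **Setting.** Let $\mathbb C_S=\mathbb C_{S,0}\oplus\mathbb C_{S,1}$ be the complex Grassmann algebra on generators $\beta_1,\beta_2,\dots$ (elements $\sum_\lambda X_\lambda\beta_\lambda$, $X_\lambda\in\mathbb C$, with coefficientwise topology; conjugation acts on the $X_\lambda$), with body map $\mathbb B(X)=X_\emptyset$. Let $n\ge 1$ and let $W\subset \mathbb C_{S,0}^n\times\mathbb C_{S,1}^n$ be open in the DeWitt topology, $W=\mathbb B^{-1}(O)$ with $O\subset\mathbb C^n$ open, with coordinates $(z,\xi)$; for example $W$ is a coordinate domain of a compact complex supermanifold of dimension $n|n$. A $\mathbb C_S$-valued function $F$ on $O$ with smooth coefficients is evaluated at $p=(z,\xi)\in W$ by its (real) Taylor series at $\mathbb B(z)$ in the direction of the soul $z-\mathbb B(z)$. A superfunction $\sum_\mu \xi_\mu f_\mu(z)$ is even (odd) if the $f_\mu$ are $\mathbb C_{S,0}$-valued and $f_\mu=0$ for all $|\mu|$ odd (even). Superforms are combinations, with coefficients $\mathbb C_S$-valued smooth functions on $O$ written on the right, of monomials in $dz_i,d\bar z_i,d\xi_i,d\bar\xi_i,\xi_i,\bar\xi_i$,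 in that order. Homogeneous elements of form degrees $k,l$ and parities $\varepsilon,\varepsilon'$ satisfy $KL=(-1)^{kl+\varepsilon\varepsilon'}LK$, where $dz_i,d\bar z_i$ are even and $d\xi_i,d\bar\xi_i,\xi_i,\bar\xi_i$ and the $\beta_k$ are odd. Let $\bar\partial=\sum_i d\bar z_i\,\partial_{\bar z_i}+\sum_j d\bar\xi_j\,\partial_{\bar\xi_j}$. **Hypotheses.** Let $V=\sum_i f_i\,\partial/\partial z_i+\sum_i g_i\,\partial/\partial\xi_i$ be an odd holomorphic vector field on $W$: the $f_i(z,\xi)$ are odd holomorphic superfunctions and the $g_i(z)$ are even holomorphic superfunctions without odd variables. Let $i_V$ be the contraction, i.e. the derivation with $i_V(\alpha\beta)=i_V(\alpha)\beta+(-1)^{k+\varepsilon(\alpha)}\alpha\, i_V(\beta)$ for $\alpha$ of form degree $k$, $i_V(dz_i)=f_i$, $i_V(d\xi_i)=g_i$, and zero on the other generators. Let $p\in W$ be an isolated singularity of $V$, i.e. $V(p)=0$ and, for some $r>0$, the ball of radius $r$ about $\mathbb B(p)$ contains the body of no singularity of $V$ other than $\mathbb B(p)$. Assume that $p$ is non-degenerate,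 $\det(\partial g_i/\partial z_j)(p)\ne0$, and that $\det D(p)\neq 0$, where $D=(\partial f_k/\partial\xi_l)$; both conditions mean that the determinant is invertible, i.e. has non-zero body. Let $\eta$ be a smooth superform on $W$ with $(\bar\partial+i_V)\eta=0$. Write $\eta^{(0,0)|(n,n)}$ for the function multiplying $d\xi_1\cdots d\xi_n\,d\bar\xi_1\cdots d\bar\xi_n$ in $\eta$, and $\eta^{(1,0)|(n-1,n)}_{\widehat *}$ for the sum over $j$ of the functions multiplying $dz_j\,d\xi_1\cdots\widehat{d\xi_j}\cdots d\xi_n\,d\bar\xi_1\cdots d\bar\xi_n$; a subscript $(\mu;\lambda)$ denotes the coefficient of $\xi_\mu\bar\xi_\lambda$. Assume that for both functions the coefficients with subscript $(\mu;\lambda)$ vanish unless $|\mu|\equiv n \pmod 2$, and that $\eta^{(1,0)|(n-1,n)}_{\widehat *\,(1\dots n;1\dots n)}$ is $\mathbb C_{S,0}$-valued. **Residue.** Put $\omega=\sum_i dz_i\,\bar g_i+\sum_i d\xi_i\,\bar g_i$ and $$\mathrm{Res}_p(V,\eta)=\lim_{t\to0^+}\int_{SB_\varepsilon(p)}\eta\cdot\exp\Big\{-\frac{\bar\partial\omega}{t}-\frac{i_V(\omega)}{t}\Big\},$$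 where $SB_\varepsilon(p)$ lies over the Euclidean ball of radius $\varepsilon>0$ about $\mathbb B(p)$, and $\varepsilon$ is such that the closed ball is contained in $O$ and $\mathbb B(g_1),\dots,\mathbb B(g_n)$ have no common zero in it except $\mathbb B(p)$. The integral is the Berezin integral: the coefficient of $dz_1\cdots dz_n\,d\bar z_1\cdots d\bar z_n\,d\xi_1\cdots d\xi_n\,d\bar\xi_1\cdots d\bar\xi_n\,\xi_1\cdots\xi_n\bar\xi_1\cdots\bar\xi_n$ is integrated over the ball against $dz_1\cdots dz_n\,d\bar z_1\cdots d\bar z_n=(-1)^{n(n-1)/2}(-2i)^n\,dx_1dy_1\cdots dx_ndy_n$. **Claim.** The limit exists for every such $\varepsilon$, and $$\mathrm{Res}_p(V,\eta)=\left(\frac{2\pi}{i}\right)^n\left[\frac{\eta^{(0,0)|(n,n)}_{(1\dots n;1\dots n)}+\eta^{(1,0)|(n-1,n)}_{\widehat *\,(1\dots n;1\dots n)}}{\mathrm{Ber}(V)\cdot\det D}\right](p),$$ where $$\mathrm{Ber}(V)=\mathrm{sdet}\begin{pmatrix}\partial g_i/\partial z_j&\partial f_k/\partial z_j\\ \partial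 g_i/\partial\xi_l&\partial f_k/\partial\xi_l\end{pmatrix},\qquad \mathrm{sdet}\begin{pmatrix}A&B\\C&D\end{pmatrix}=\det(A-BD^{-1}C)\,(\det D)^{-1}.$$ In particular, if $\det D(p)=1$, the denominator may be replaced by $\mathrm{Ber}(V)$. -/

import Mathlib

open scoped ContDiff Topology Nat

set_option linter.unusedSectionVars false

noncomputable section

namespace SuperResidue

/-- A set of generators, each with a form degree and a `ℤ/2`-parity (represented by `0` or `1`). -/
class GradedGen (G : Type) where
  formDeg : G → ℕ
  parity : G → ℕ

section Algebra

variable {G : Type} [LinearOrder G] [GradedGen G]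

/-- Two generators satisfy `x y = (-1)^(swapExp x y) y x`: the sign is
`(-1)^(kl) (-1)^(|x||y|)` for form degrees `k`, `l` and parities `|x|`, `|y|`. -/
def swapExp (i j : G) : ℕ :=
  GradedGen.formDeg i * GradedGen.formDeg j + GradedGen.parity i * GradedGen.parity j

/-- Exponent of the sign that arises when the product of two normally ordered (increasing) monomials
is put into normal order. -/
def normExp (a b : G →₀ ℕ) : ℕ :=
  a.sum fun i x => b.sum fun j y => if j < i then x * y * swapExp i j else 0

/-- Monomials that do not vanish: a generator that anticommutes with itself occurs at most once. -/
def Admissible (m : G →₀ ℕ) : Prop := ∀ i, Odd (swapExp i i) → m i ≤ 1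

theorem normExp_add_left (a b c : G →₀ ℕ) :
    normExp (a + b) c = normExp a c + normExp b c := by
  unfold normExp
  refine Finsupp.sum_add_index' (fun i => ?_) (fun i x y => ?_)
  · simp [Finsupp.sum]
  · simp only [Finsupp.sum, ← Finset.sum_add_distrib]
    refine Finset.sum_congr rfl fun j _ => ?_
    split_ifs <;> ring

theorem normExp_add_right (a b c : G →₀ ℕ) :
    normExp a (b + c) = normExp a b + normExp a c := by
  unfold normExp
  rw [← Finsupp.sum_add]
  refine Finsupp.sum_congr fun i _ => ?_
  refine Finsupp.sum_add_index' (fun j => ?_) (fun j x y => ?_)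
  · simp
  · split_ifs <;> ring

theorem Admissible.of_le {a m : G →₀ ℕ} (hm : Admissible m) (h : a ≤ m) : Admissible a :=
  fun i hi => (h i).trans (hm i hi)

variable (G) in
/-- Families of complex coefficients indexed by the monomials, zero on the vanishing monomials. -/
def saSubmodule : Submodule ℂ ((G →₀ ℕ) → ℂ) where
  carrier := {x | ∀ m, ¬ Admissible m → x m = 0}
  add_mem' := fun hx hy m hm => by simp [hx m hm, hy m hm]
  zero_mem' := fun _ _ => rfl
  smul_mem' := fun c x hx m hm => by simp [hx m hm]

variable (G) in
/-- The bigraded-commutative algebra on the generators `G`, as formal (possibly infinite) complex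
combinations of normally ordered monomials. -/
def SA : Type := saSubmodule G

instance : AddCommGroup (SA G) := inferInstanceAs (AddCommGroup (saSubmodule G))
instance : Module ℂ (SA G) := inferInstanceAs (Module ℂ (saSubmodule G))
/-- The topology of coefficientwise convergence. -/
instance : TopologicalSpace (SA G) := inferInstanceAs (TopologicalSpace (saSubmodule G))

/-- The coefficient of a monomial. -/
def SA.coeff (x : SA G) (m : G →₀ ℕ) : ℂ := x.1 m

/-- Build an element from its coefficients. -/
def SA.mk (x : (G →₀ ℕ) → ℂ) (h : ∀ m, ¬ Admissible m → x m = 0) : SA G := ⟨x, h⟩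

@[ext] theorem SA.ext {x y : SA G} (h : ∀ m, x.coeff m = y.coeff m) : x = y :=
  Subtype.ext (funext h)

theorem SA.coeff_of_not (x : SA G) {m : G →₀ ℕ} (h : ¬ Admissible m) : x.coeff m = 0 := x.2 m h

@[simp] theorem SA.coeff_mk (x : (G →₀ ℕ) → ℂ) (h) (m : G →₀ ℕ) :
    (SA.mk x h).coeff m = x m := rfl
@[simp] theorem SA.coeff_add (x y : SA G) (m : G →₀ ℕ) :
    (x + y).coeff m = x.coeff m + y.coeff m := rfl
@[simp] theorem SA.coeff_zero (m : G →₀ ℕ) : (0 : SA G).coeff m = 0 := rfl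
@[simp] theorem SA.coeff_neg (x : SA G) (m : G →₀ ℕ) : (-x).coeff m = -x.coeff m := rfl
@[simp] theorem SA.coeff_smul (c : ℂ) (x : SA G) (m : G →₀ ℕ) :
    (c • x).coeff m = c * x.coeff m := rfl

open Classical in
/-- The normally ordered monomial with the given exponents (zero if it is not admissible). -/
def SA.mono (m : G →₀ ℕ) : SA G :=
  SA.mk (fun k => if k = m ∧ Admissible m then 1 else 0) fun k hk => by
    by_cases h : k = m
    · subst h; simp [hk]
    · simp [h]

open Classical in
instance : Mul (SA G) where
  mul x y := SA.mk (fun m => if Admissible m then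
      ∑ p ∈ Finset.HasAntidiagonal.antidiagonal m, (-1) ^ normExp p.1 p.2 * (x.coeff p.1 * y.coeff p.2) else 0)
    fun _ hm => if_neg hm

instance : One (SA G) where
  one := SA.mono 0

theorem admissible_zero : Admissible (0 : G →₀ ℕ) := fun i _ => by simp

open Classical in
theorem SA.coeff_one (m : G →₀ ℕ) : (1 : SA G).coeff m = if m = 0 then 1 else 0 := by
  change (if m = 0 ∧ Admissible (0 : G →₀ ℕ) then (1 : ℂ) else 0) = _
  simp [admissible_zero]

theorem SA.coeff_mul (x y : SA G) {m : G →₀ ℕ} (hm : Admissible m) :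
    (x * y).coeff m =
      ∑ p ∈ Finset.HasAntidiagonal.antidiagonal m, (-1) ^ normExp p.1 p.2 * (x.coeff p.1 * y.coeff p.2) :=
  if_pos hm

theorem SA.ext_adm {x y : SA G} (h : ∀ m, Admissible m → x.coeff m = y.coeff m) : x = y := by
  ext m
  by_cases hm : Admissible m
  · exact h m hm
  · rw [x.coeff_of_not hm, y.coeff_of_not hm]

theorem normExp_zero_left (a : G →₀ ℕ) : normExp 0 a = 0 := by simp [normExp]
theorem normExp_zero_right (a : G →₀ ℕ) : normExp a 0 = 0 := by simp [normExp]

theorem SA.one_mul' (x : SA G) : 1 * x = x := by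
  refine SA.ext_adm fun m hm => ?_
  rw [SA.coeff_mul _ _ hm, Finset.sum_eq_single (0, m)]
  · simp [SA.coeff_one, normExp_zero_left]
  · rintro ⟨a, b⟩ hp hne
    have ha : a ≠ 0 := by
      rintro rfl
      apply hne
      simpa using hp
    simp [SA.coeff_one, ha]
  · simp

theorem SA.mul_one' (x : SA G) : x * 1 = x := by
  refine SA.ext_adm fun m hm => ?_
  rw [SA.coeff_mul _ _ hm, Finset.sum_eq_single (m, 0)]
  · simp [SA.coeff_one, normExp_zero_right]
  · rintro ⟨a, b⟩ hp hne
    have hb : b ≠ 0 := by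
      rintro rfl
      apply hne
      simpa using hp
    simp [SA.coeff_one, hb]
  · simp

theorem SA.mul_assoc' (x y z : SA G) : x * y * z = x * (y * z) := by
  refine SA.ext_adm fun m hm => ?_
  rw [SA.coeff_mul _ _ hm, SA.coeff_mul _ _ hm]
  have h1 : ∀ p ∈ Finset.HasAntidiagonal.antidiagonal m,
      (-1 : ℂ) ^ normExp p.1 p.2 * ((x * y).coeff p.1 * z.coeff p.2) =
      ∑ q ∈ Finset.HasAntidiagonal.antidiagonal p.1, (-1) ^ (normExp q.1 q.2 + normExp q.1 p.2 + normExp q.2 p.2) *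
        (x.coeff q.1 * y.coeff q.2 * z.coeff p.2) := by
    intro p hp
    have hp' := Finset.HasAntidiagonal.mem_antidiagonal.1 hp
    have ha : Admissible p.1 := hm.of_le (hp' ▸ le_self_add)
    rw [SA.coeff_mul _ _ ha, Finset.sum_mul, Finset.mul_sum]
    refine Finset.sum_congr rfl fun q hq => ?_
    rw [← Finset.HasAntidiagonal.mem_antidiagonal.1 hq, normExp_add_left]
    ring
  have h2 : ∀ p ∈ Finset.HasAntidiagonal.antidiagonal m,
      (-1 : ℂ) ^ normExp p.1 p.2 * (x.coeff p.1 * (y * z).coeff p.2) =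
      ∑ q ∈ Finset.HasAntidiagonal.antidiagonal p.2, (-1) ^ (normExp q.1 q.2 + normExp p.1 q.1 + normExp p.1 q.2) *
        (x.coeff p.1 * y.coeff q.1 * z.coeff q.2) := by
    intro p hp
    have hp' := Finset.HasAntidiagonal.mem_antidiagonal.1 hp
    have ha : Admissible p.2 := hm.of_le (hp' ▸ le_add_self)
    rw [SA.coeff_mul _ _ ha, Finset.mul_sum, Finset.mul_sum]
    refine Finset.sum_congr rfl fun q hq => ?_
    rw [← Finset.HasAntidiagonal.mem_antidiagonal.1 hq, normExp_add_right]
    ring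
  rw [Finset.sum_congr rfl h1, Finset.sum_congr rfl h2, Finset.sum_sigma', Finset.sum_sigma']
  refine Finset.sum_nbij' (fun ⟨⟨_i, j⟩, ⟨k, l⟩⟩ ↦ ⟨(k, l + j), (l, j)⟩)
    (fun ⟨⟨i, _j⟩, ⟨k, l⟩⟩ ↦ ⟨(i + k, l), (i, k)⟩) ?_ ?_ ?_ ?_ ?_
  · rintro ⟨⟨i, j⟩, ⟨k, l⟩⟩ h
    simp only [Finset.mem_sigma, Finset.HasAntidiagonal.mem_antidiagonal] at h ⊢
    exact ⟨by rw [← h.1, ← h.2, add_assoc], trivial⟩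
  · rintro ⟨⟨i, j⟩, ⟨k, l⟩⟩ h
    simp only [Finset.mem_sigma, Finset.HasAntidiagonal.mem_antidiagonal] at h ⊢
    exact ⟨by rw [← h.1, ← h.2, add_assoc], trivial⟩
  · rintro ⟨⟨i, j⟩, ⟨k, l⟩⟩ h
    simp only [Finset.mem_sigma, Finset.HasAntidiagonal.mem_antidiagonal] at h ⊢
    obtain ⟨h1, h2⟩ := h
    subst h2; rfl
  · rintro ⟨⟨i, j⟩, ⟨k, l⟩⟩ h
    simp only [Finset.mem_sigma, Finset.HasAntidiagonal.mem_antidiagonal] at h ⊢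
    obtain ⟨h1, h2⟩ := h
    subst h2; rfl
  · rintro ⟨⟨i, j⟩, ⟨k, l⟩⟩ h
    simp only
    congr 2
    ring

theorem SA.mul_add' (x y z : SA G) : x * (y + z) = x * y + x * z := by
  refine SA.ext_adm fun m hm => ?_
  simp only [SA.coeff_add, SA.coeff_mul _ _ hm, ← Finset.sum_add_distrib]
  exact Finset.sum_congr rfl fun p _ => by ring

theorem SA.add_mul' (x y z : SA G) : (x + y) * z = x * z + y * z := by
  refine SA.ext_adm fun m hm => ?_
  simp only [SA.coeff_add, SA.coeff_mul _ _ hm, ← Finset.sum_add_distrib]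
  exact Finset.sum_congr rfl fun p _ => by ring

instance : Ring (SA G) :=
  { (inferInstance : AddCommGroup (SA G)), (inferInstance : Mul (SA G)),
    (inferInstance : One (SA G)) with
    mul_assoc := SA.mul_assoc'
    one_mul := SA.one_mul'
    mul_one := SA.mul_one'
    left_distrib := SA.mul_add'
    right_distrib := SA.add_mul'
    zero_mul := fun x => SA.ext_adm fun m hm => by simp [SA.coeff_mul _ _ hm]
    mul_zero := fun x => SA.ext_adm fun m hm => by simp [SA.coeff_mul _ _ hm] }

instance : Algebra ℂ (SA G) := Algebra.ofModule
  (fun r x y => SA.ext_adm fun m hm => by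
    simp only [SA.coeff_smul, SA.coeff_mul _ _ hm, Finset.mul_sum]
    exact Finset.sum_congr rfl fun p _ => by ring)
  (fun r x y => SA.ext_adm fun m hm => by
    simp only [SA.coeff_smul, SA.coeff_mul _ _ hm, Finset.mul_sum]
    exact Finset.sum_congr rfl fun p _ => by ring)

/-- The exponential series, summed coefficient by coefficient. -/
def SA.exp (x : SA G) : SA G :=
  SA.mk (fun m => ∑' k : ℕ, ((k ! : ℂ))⁻¹ * (x ^ k).coeff m) fun m hm => by
    simp [fun k => SA.coeff_of_not (x ^ k) hm]

/-- The left derivative with respect to the generator `i`: it removes `i` from a monomial after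
moving it to the front. It is a bigraded derivation, of bidegree opposite to that of `i`. -/
def SA.leftDeriv (i : G) (x : SA G) : SA G :=
  SA.mk (fun m => (-1) ^ normExp (Finsupp.single i 1) m * ((m i + 1 : ℕ) : ℂ) *
      x.coeff (m + Finsupp.single i 1)) fun m hm => by
    rw [SA.coeff_of_not x fun h => hm (h.of_le le_self_add), mul_zero]

/-- The coefficientwise derivative `∂F/∂z_j = (∂F/∂x_j - i ∂F/∂y_j) / 2`. -/
def pderivZ {n : ℕ} (j : Fin n) (F : (Fin n → ℂ) → SA G) (z : Fin n → ℂ) : SA G :=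
  SA.mk (fun m => (fderiv ℝ (fun w => (F w).coeff m) z (Pi.single j 1) -
      Complex.I * fderiv ℝ (fun w => (F w).coeff m) z (Pi.single j Complex.I)) / 2) fun m hm => by
    simp [fun w => SA.coeff_of_not (F w) hm]

/-- The coefficientwise derivative `∂F/∂z̄_j = (∂F/∂x_j + i ∂F/∂y_j) / 2`. -/
def pderivZbar {n : ℕ} (j : Fin n) (F : (Fin n → ℂ) → SA G) (z : Fin n → ℂ) : SA G :=
  SA.mk (fun m => (fderiv ℝ (fun w => (F w).coeff m) z (Pi.single j 1) +
      Complex.I * fderiv ℝ (fun w => (F w).coeff m) z (Pi.single j Complex.I)) / 2) fun m hm => by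
    simp [fun w => SA.coeff_of_not (F w) hm]

/-- Smoothness (in the real sense) of all coefficients. -/
def SmoothCoeffOn {n : ℕ} (F : (Fin n → ℂ) → SA G) (O : Set (Fin n → ℂ)) : Prop :=
  ∀ m, ContDiffOn ℝ ∞ (fun z => (F z).coeff m) O

/-- Holomorphy of all coefficients. -/
def HolomorphicCoeffOn {n : ℕ} (F : (Fin n → ℂ) → SA G) (O : Set (Fin n → ℂ)) : Prop :=
  ∀ m, DifferentiableOn ℂ (fun z => (F z).coeff m) O

end Algebra

/-! ### The complex Grassmann algebra -/

/-- The generators `β_0, β_1, …` of the Grassmann algebra: form degree `0`, odd. -/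
instance : GradedGen ℕ where
  formDeg _ := 0
  parity _ := 1

/-- The complex Grassmann algebra with infinitely many generators (limit over the number of
generators): its elements are the families `∑ X_λ β_λ` with `X_λ ∈ ℂ`. -/
abbrev CS : Type := SA ℕ

/-- The body map: the coefficient of the empty monomial. -/
def body (x : CS) : ℂ := x.coeff 0

/-- Complex conjugation of the coefficients (the `β_k` are real). -/
def CS.conj (x : CS) : CS :=
  SA.mk (fun m => (starRingEnd ℂ) (x.coeff m)) fun m hm => by simp [x.coeff_of_not hm]

/-- Even elements: only monomials of even length. -/
def CS.IsEven (x : CS) : Prop := ∀ m : ℕ →₀ ℕ, Odd m.degree → x.coeff m = 0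

/-- Odd elements: only monomials of odd length. -/
def CS.IsOdd (x : CS) : Prop := ∀ m : ℕ →₀ ℕ, Even m.degree → x.coeff m = 0

/-- The even subring of the Grassmann algebra. -/
def CS0 : Subring CS where
  carrier := {x | x.IsEven}
  zero_mem' := fun _ _ => rfl
  one_mem' := fun m hm => by
    rw [SA.coeff_one, if_neg]
    rintro rfl
    simp at hm
  add_mem' := fun hx hy m hm => by simp [hx m hm, hy m hm]
  neg_mem' := fun hx m hm => by simp [hx m hm]
  mul_mem' := fun {x y} hx hy m hm => by
    by_cases ha : Admissible m
    · rw [SA.coeff_mul _ _ ha]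
      refine Finset.sum_eq_zero fun p hp => ?_
      rw [← Finset.HasAntidiagonal.mem_antidiagonal.1 hp, map_add, Nat.odd_add] at hm
      by_cases h1 : Odd p.1.degree
      · simp [hx _ h1]
      · have h2 : Odd p.2.degree := by
          rw [← Nat.not_even_iff_odd]
          exact fun h => h1 (hm.2 h)
        simp [hy _ h2]
    · exact SA.coeff_of_not _ ha

theorem normExp_add_swap {a b : ℕ →₀ ℕ} (h : Admissible (a + b)) :
    normExp a b + normExp b a = a.degree * b.degree := by
  have hd : ∀ i, a i * b i = 0 := by
    intro i
    have := h i (by simp [swapExp, GradedGen.formDeg, GradedGen.parity])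
    simp only [Finsupp.add_apply] at this
    rcases Nat.eq_zero_or_pos (a i) with h0 | h0
    · simp [h0]
    · have : b i = 0 := by omega
      simp [this]
  simp only [normExp, Finsupp.sum, Finsupp.degree_apply, swapExp, GradedGen.formDeg,
    GradedGen.parity, mul_one, zero_add, mul_zero, zero_add]
  rw [Finset.sum_comm (s := b.support), ← Finset.sum_add_distrib, Finset.sum_mul_sum]
  refine Finset.sum_congr rfl fun i _ => ?_
  rw [← Finset.sum_add_distrib]
  refine Finset.sum_congr rfl fun j _ => ?_
  rcases lt_trichotomy i j with hij | rfl | hij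
  · simp [hij, hij.not_gt, mul_comm]
  · simp [hd]
  · simp [hij, hij.not_gt]

instance : CommRing CS0 :=
  { (inferInstance : Ring CS0) with
    mul_comm := fun x y => Subtype.ext <| SA.ext_adm fun m hm => by
      change ((x : CS) * (y : CS)).coeff m = ((y : CS) * (x : CS)).coeff m
      rw [SA.coeff_mul _ _ hm, SA.coeff_mul _ _ hm]
      refine Eq.trans ?_ (Finsupp.sum_antidiagonal_swap m fun a b =>
        (-1 : ℂ) ^ normExp b a * ((y : CS).coeff b * (x : CS).coeff a))
      refine Finset.sum_congr rfl fun p hp => ?_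
      have hs := normExp_add_swap (a := p.1) (b := p.2) (by rwa [Finset.HasAntidiagonal.mem_antidiagonal.1 hp])
      by_cases h1 : Odd p.1.degree
      · simp [x.2 _ h1]
      · have he : Even (normExp p.1 p.2 + normExp p.2 p.1) := by
          rw [hs]; exact (Nat.not_odd_iff_even.1 h1).mul_right _
        have : (-1 : ℂ) ^ normExp p.2 p.1 = (-1) ^ normExp p.1 p.2 := by
          rcases Nat.even_or_odd (normExp p.1 p.2) with h | h
          · rw [h.neg_one_pow, ((Nat.even_add.1 he).1 h).neg_one_pow]
          · have h' : Odd (normExp p.2 p.1) := by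
              rw [← Nat.not_even_iff_odd] at h ⊢
              exact fun h'' => h ((Nat.even_add.1 he).2 h'')
            rw [h.neg_one_pow, h'.neg_one_pow]
        rw [this]
        ring }

open Classical in
/-- The even part of an element. -/
def CS.evenPart (x : CS) : CS0 :=
  ⟨SA.mk (fun m => if Even m.degree then x.coeff m else 0) fun m hm => by
      simp [x.coeff_of_not hm],
    fun m hm => if_neg (Nat.not_even_iff_odd.2 hm)⟩

/-- The determinant of a square matrix with even entries, in the commutative ring of even
elements. -/
def evenDet {n : ℕ} (M : Matrix (Fin n) (Fin n) CS) : CS0 := (M.map CS.evenPart).det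

/-- The Berezinian `det (A - B D⁻¹ C) (det D)⁻¹` of the even supermatrix with even blocks `A`, `D`
and odd blocks `B`, `C`. -/
def sdet {n : ℕ} (A B C D : Matrix (Fin n) (Fin n) CS) : CS0 :=
  evenDet (A - B * Ring.inverse D * C) * Ring.inverse (evenDet D)

/-! ### Superspace and superfunctions -/

/-- A point `(z, ξ)` of the superspace of dimension `n|n`. -/
structure SuperPoint (n : ℕ) where
  z : Fin n → CS
  ξ : Fin n → CS
  z_even : ∀ i, (z i).IsEven
  ξ_odd : ∀ i, (ξ i).IsOdd

/-- The body of a point. -/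
def SuperPoint.bodyPt {n : ℕ} (p : SuperPoint n) : Fin n → ℂ := fun i => body (p.z i)

/-- Open sets of the DeWitt topology: preimages of open sets under the body map. -/
def IsDeWittOpen {n : ℕ} (W : Set (SuperPoint n)) : Prop :=
  ∃ O : Set (Fin n → ℂ), IsOpen O ∧ W = SuperPoint.bodyPt ⁻¹' O

/-- The body of a set of points. -/
def bodySet {n : ℕ} (W : Set (SuperPoint n)) : Set (Fin n → ℂ) := SuperPoint.bodyPt '' W

/-- One step `F ↦ ∑ j, ∂F/∂z_j s_j + ∂F/∂z̄_j s̄_j` of the Taylor expansion in the direction of the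
soul `s`. -/
def taylorStep {n : ℕ} (s : Fin n → CS) (F : (Fin n → ℂ) → CS) : (Fin n → ℂ) → CS :=
  fun x => ∑ j, (pderivZ j F x * s j + pderivZbar j F x * (s j).conj)

/-- The value at `(z, ξ)` of a `C_S`-valued function of the body coordinates: the Taylor series
`∑ k, (1/k!) D^k F (s, …, s)` at the body of `z`, where `s` is the soul of `z`. Every `k`-th term
has coefficients only at monomials of length at least `k`, so each coefficient is a finite sum. -/
def grassmannExt {n : ℕ} (F : (Fin n → ℂ) → CS) (p : SuperPoint n) : CS :=
  SA.mk (fun m => ∑ k ∈ Finset.range (m.degree + 1), ((k ! : ℂ))⁻¹ *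
      ((taylorStep (fun j => p.z j - algebraMap ℂ CS (p.bodyPt j)))^[k] F p.bodyPt).coeff m)
    fun m hm => Finset.sum_eq_zero fun k _ => by rw [SA.coeff_of_not _ hm, mul_zero]

/-- A superfunction `∑ μ, ξ_μ f_μ(z)`, given by its coefficient functions `f_μ`. -/
abbrev SuperFun (n : ℕ) : Type := Finset (Fin n) → (Fin n → ℂ) → CS

/-- The product `ξ_{μ_1} ⋯ ξ_{μ_k}` with `μ_1 < ⋯ < μ_k`. -/
def SuperPoint.xiProd {n : ℕ} (p : SuperPoint n) (μ : Finset (Fin n)) : CS :=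
  ((μ.sort (· ≤ ·)).map p.ξ).prod

/-- The value of a superfunction at a point. -/
def SuperFun.eval {n : ℕ} (f : SuperFun n) (p : SuperPoint n) : CS :=
  ∑ μ, p.xiProd μ * grassmannExt (f μ) p

/-- `∂f/∂z_j`. -/
def SuperFun.dz {n : ℕ} (j : Fin n) (f : SuperFun n) : SuperFun n := fun μ => pderivZ j (f μ)

/-- `∂f/∂ξ_j`, the left derivative. -/
def SuperFun.dxi {n : ℕ} (j : Fin n) (f : SuperFun n) : SuperFun n := fun μ z =>
  if j ∈ μ then 0 else (-1) ^ (μ.filter (· < j)).card * f (insert j μ) z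

def SuperFun.HolomorphicOn {n : ℕ} (f : SuperFun n) (O : Set (Fin n → ℂ)) : Prop :=
  ∀ μ, HolomorphicCoeffOn (f μ) O

/-- Even superfunctions: only products of evenly many `ξ_j` occur, with even coefficients. -/
def SuperFun.IsEvenOn {n : ℕ} (f : SuperFun n) (O : Set (Fin n → ℂ)) : Prop :=
  ∀ z ∈ O, ∀ μ, (f μ z).IsEven ∧ (Odd μ.card → f μ z = 0)

/-- Odd superfunctions: only products of oddly many `ξ_j` occur, with even coefficients. -/
def SuperFun.IsOddOn {n : ℕ} (f : SuperFun n) (O : Set (Fin n → ℂ)) : Prop :=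
  ∀ z ∈ O, ∀ μ, (f μ z).IsEven ∧ (Even μ.card → f μ z = 0)

/-- Superfunctions without odd variables. -/
def SuperFun.NoOddVariablesOn {n : ℕ} (f : SuperFun n) (O : Set (Fin n → ℂ)) : Prop :=
  ∀ z ∈ O, ∀ μ, μ.Nonempty → f μ z = 0

/-- A supervector field `∑ f_i ∂/∂z_i + ∑ g_i ∂/∂ξ_i`. -/
structure SuperVectorField (n : ℕ) where
  f : Fin n → SuperFun n
  g : Fin n → SuperFun n

namespace SuperVectorField

variable {n : ℕ}

def HolomorphicOn (V : SuperVectorField n) (O : Set (Fin n → ℂ)) : Prop :=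
  ∀ i, (V.f i).HolomorphicOn O ∧ (V.g i).HolomorphicOn O

/-- Odd vector fields: the `f_i` are odd and the `g_i` are even. -/
def IsOddOn (V : SuperVectorField n) (O : Set (Fin n → ℂ)) : Prop :=
  ∀ i, (V.f i).IsOddOn O ∧ (V.g i).IsEvenOn O

/-- The singular set `{p | V(p) = 0}`. -/
def Sing (V : SuperVectorField n) (W : Set (SuperPoint n)) : Set (SuperPoint n) :=
  {p ∈ W | ∀ i, (V.f i).eval p = 0 ∧ (V.g i).eval p = 0}

/-- The block `(∂g_i/∂z_j)(p)`; in all blocks the row is the index of the variable. -/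
def blockA (V : SuperVectorField n) (p : SuperPoint n) : Matrix (Fin n) (Fin n) CS :=
  Matrix.of fun j i => ((V.g i).dz j).eval p

/-- The block `(∂f_k/∂z_j)(p)`. -/
def blockB (V : SuperVectorField n) (p : SuperPoint n) : Matrix (Fin n) (Fin n) CS :=
  Matrix.of fun j k => ((V.f k).dz j).eval p

/-- The block `(∂g_i/∂ξ_l)(p)`. -/
def blockC (V : SuperVectorField n) (p : SuperPoint n) : Matrix (Fin n) (Fin n) CS :=
  Matrix.of fun l i => ((V.g i).dxi l).eval p

/-- The block `D = (∂f_k/∂ξ_l)(p)`. -/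
def blockD (V : SuperVectorField n) (p : SuperPoint n) : Matrix (Fin n) (Fin n) CS :=
  Matrix.of fun l k => ((V.f k).dxi l).eval p

/-- `Ber(V)(p)`, the superdeterminant of the Jacobian. -/
def ber (V : SuperVectorField n) (p : SuperPoint n) : CS0 :=
  sdet (V.blockA p) (V.blockB p) (V.blockC p) (V.blockD p)

/-- `det D` at `p`. -/
def detD (V : SuperVectorField n) (p : SuperPoint n) : CS0 := evenDet (V.blockD p)

/-- Non-degeneracy: `det (∂g_i/∂z_j)(p)` is invertible, that is, has a non-zero body. -/
def NonDegenerateAt (V : SuperVectorField n) (p : SuperPoint n) : Prop :=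
  body (evenDet (V.blockA p)) ≠ 0

end SuperVectorField

/-- The Euclidean ball in the body. -/
def bodyBall {n : ℕ} (c : Fin n → ℂ) (ε : ℝ) : Set (Fin n → ℂ) :=
  {z | ∑ i, ‖z i - c i‖ ^ 2 < ε ^ 2}

/-- The closed Euclidean ball in the body. -/
def bodyClosedBall {n : ℕ} (c : Fin n → ℂ) (ε : ℝ) : Set (Fin n → ℂ) :=
  {z | ∑ i, ‖z i - c i‖ ^ 2 ≤ ε ^ 2}

/-- `p` is an isolated singularity of `V`: near the body of `p`, the body of the singular set
consists of the body of `p` only. -/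
def SuperVectorField.IsIsolatedSing {n : ℕ} (V : SuperVectorField n) (W : Set (SuperPoint n))
    (p : SuperPoint n) : Prop :=
  p ∈ V.Sing W ∧ ∃ r > 0, bodyBall p.bodyPt r ∩ bodySet (V.Sing W) = {p.bodyPt}

/-! ### Superforms -/

/-- The generators of the algebra of superforms over a body point. -/
inductive Gen (n : ℕ) : Type
  | dz (j : Fin n)
  | dzbar (j : Fin n)
  | dxi (j : Fin n)
  | dxibar (j : Fin n)
  | xi (j : Fin n)
  | xibar (j : Fin n)
  | beta (k : ℕ)

namespace Gen

variable {n : ℕ}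

/-- The normal order: `dz`, `dz̄`, `dξ`, `dξ̄`, `ξ`, `ξ̄`, `β`, each by increasing index. -/
def code : Gen n → ℕ ×ₗ ℕ
  | dz j => toLex (0, j)
  | dzbar j => toLex (1, j)
  | dxi j => toLex (2, j)
  | dxibar j => toLex (3, j)
  | xi j => toLex (4, j)
  | xibar j => toLex (5, j)
  | beta k => toLex (6, k)

theorem code_injective : Function.Injective (code : Gen n → ℕ ×ₗ ℕ) := by
  intro a b h
  cases a <;> cases b <;> simp_all [code, Fin.ext_iff]

instance : LinearOrder (Gen n) := LinearOrder.lift' code code_injective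

/-- The `d`'s have form degree `1`; `dz`, `dz̄` are even and `dξ`, `dξ̄`, `ξ`, `ξ̄`, `β` are odd. -/
instance : GradedGen (Gen n) where
  formDeg
    | dz _ => 1
    | dzbar _ => 1
    | dxi _ => 1
    | dxibar _ => 1
    | _ => 0
  parity
    | dz _ => 0
    | dzbar _ => 0
    | _ => 1

theorem beta_injective : Function.Injective (beta : ℕ → Gen n) := fun a b h => by
  injection h

end Gen

/-- A superform: at each body point an element of the algebra generated over `C_S` by `ξ`, `ξ̄`,
`dz`, `dz̄`, `dξ`, `dξ̄`. -/
abbrev SuperForm (n : ℕ) : Type := (Fin n → ℂ) → SA (Gen n)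

variable {n : ℕ}

open Classical in
/-- The inclusion of the Grassmann algebra in the algebra of superforms. -/
def ofCS (c : CS) : SA (Gen n) :=
  SA.mk (fun m => if ∀ g ∈ m.support, g ∈ Set.range (Gen.beta : ℕ → Gen n) then
      c.coeff (m.comapDomain Gen.beta Gen.beta_injective.injOn) else 0) fun m hm => by
    split_ifs with h
    · refine c.coeff_of_not fun hc => hm fun g hg => ?_
      by_cases hmg : m g = 0
      · simp [hmg]
      · obtain ⟨k, rfl⟩ := h g (Finsupp.mem_support_iff.2 hmg)
        exact hc k hg
    · rfl

/-- The coefficient in `C_S` (written on the right) of a monomial `M` in `dz`, `dz̄`, `dξ`, `dξ̄`, `ξ`,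
`ξ̄`. -/
def coefAt (M : Gen n →₀ ℕ) (x : SA (Gen n)) : CS :=
  SA.mk (fun m => x.coeff (M + m.mapDomain Gen.beta)) fun m hm => by
    refine x.coeff_of_not fun hc => hm fun k hk => ?_
    have h := hc (Gen.beta k) hk
    rw [Finsupp.add_apply, Finsupp.mapDomain_apply Gen.beta_injective] at h
    omega

/-- The exponents of `ξ_μ ξ̄_λ`. -/
def xiExp (μ lam : Finset (Fin n)) : Gen n →₀ ℕ :=
  ∑ j ∈ μ, Finsupp.single (Gen.xi j) 1 + ∑ j ∈ lam, Finsupp.single (Gen.xibar j) 1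

/-- A superfunction `∑ ξ_μ f_μ` as a superform of degree `0`. -/
def SuperFun.toForm (f : SuperFun n) : SuperForm n := fun z =>
  ∑ μ, SA.mono (xiExp μ ∅) * ofCS (f μ z)

/-- The complex conjugate `∑ ξ̄_μ f̄_μ` of a superfunction, as a superform of degree `0`. -/
def SuperFun.conjForm (f : SuperFun n) : SuperForm n := fun z =>
  ∑ μ, SA.mono (xiExp ∅ μ) * ofCS (f μ z).conj

/-- A generator as an element of the algebra of superforms. -/
def genForm (g : Gen n) : SA (Gen n) := SA.mono (Finsupp.single g 1)

/-- `∂̄η = ∑ dz̄_i ∂η/∂z̄_i + ∑ dξ̄_j ∂η/∂ξ̄_j`, where `∂/∂ξ̄_j` picks up the sign of the parity of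
what it passes. -/
def dbar (η : SuperForm n) : SuperForm n := fun z =>
  ∑ i, genForm (Gen.dzbar i) * pderivZbar i η z +
    ∑ j, genForm (Gen.dxibar j) * (η z).leftDeriv (Gen.xibar j)

/-- The graded contraction with an odd vector field: the graded derivation that maps `dz_j` to `f_j`
and `dξ_j` to `g_j` and all other generators to zero. -/
def contract (V : SuperVectorField n) (η : SuperForm n) : SuperForm n := fun z =>
  ∑ j, (V.f j).toForm z * (η z).leftDeriv (Gen.dz j) +
    ∑ j, (V.g j).toForm z * (η z).leftDeriv (Gen.dxi j)

/-- `ω = ∑ dz_i ḡ_i + ∑ dξ_i ḡ_i`. -/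
def omegaForm (V : SuperVectorField n) : SuperForm n := fun z =>
  ∑ i, genForm (Gen.dz i) * (V.g i).conjForm z + ∑ i, genForm (Gen.dxi i) * (V.g i).conjForm z

/-- The exponents of `dξ_1 ⋯ dξ_n dξ̄_1 ⋯ dξ̄_n`. -/
def exp00 (n : ℕ) : Gen n →₀ ℕ :=
  ∑ j, (Finsupp.single (Gen.dxi j) 1 + Finsupp.single (Gen.dxibar j) 1)

/-- The exponents of `dz_j dξ_1 ⋯ (omit dξ_j) ⋯ dξ_n dξ̄_1 ⋯ dξ̄_n`. -/
def exp10 (j : Fin n) : Gen n →₀ ℕ :=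
  Finsupp.single (Gen.dz j) 1 + ∑ l ∈ Finset.univ.erase j, Finsupp.single (Gen.dxi l) 1 +
    ∑ l, Finsupp.single (Gen.dxibar l) 1

/-- The exponents of `dz_1 ⋯ dz_n dz̄_1 ⋯ dz̄_n dξ_1 ⋯ dξ_n dξ̄_1 ⋯ dξ̄_n`. -/
def expTop (n : ℕ) : Gen n →₀ ℕ :=
  ∑ j, (Finsupp.single (Gen.dz j) 1 + Finsupp.single (Gen.dzbar j) 1) + exp00 n

/-- The coefficient of `ξ_μ ξ̄_λ` in the function that multiplies
`dξ_1 ⋯ dξ_n dξ̄_1 ⋯ dξ̄_n` in `η`. -/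
def eta00 (η : SuperForm n) (μ lam : Finset (Fin n)) : (Fin n → ℂ) → CS := fun z =>
  coefAt (exp00 n + xiExp μ lam) (η z)

/-- The coefficient of `ξ_μ ξ̄_λ` in the sum over `j` of the functions that multiply
`dz_j dξ_1 ⋯ (omit dξ_j) ⋯ dξ_n dξ̄_1 ⋯ dξ̄_n` in `η`. -/
def etaStar (η : SuperForm n) (μ lam : Finset (Fin n)) : (Fin n → ℂ) → CS := fun z =>
  ∑ j, coefAt (exp10 j + xiExp μ lam) (η z)

/-- The Berezin integral of a superform over the part of superspace that lies over the set `B` in the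
body: the coefficient of `dz_1 ⋯ dz_n dz̄_1 ⋯ dz̄_n dξ_1 ⋯ dξ_n dξ̄_1 ⋯ dξ̄_n ξ_1 ⋯ ξ_n ξ̄_1 ⋯ ξ̄_n` is
integrated over `B` against `dz_1 ⋯ dz_n dz̄_1 ⋯ dz̄_n`, which is `(-1)^(n(n-1)/2) (-2i)^n` times
Lebesgue measure `dx_1 dy_1 ⋯ dx_n dy_n`. -/
def berezinIntegral (B : Set (Fin n → ℂ)) (Φ : SuperForm n) : CS :=
  SA.mk (fun m => (-1) ^ (n * (n - 1) / 2) * (-2 * Complex.I) ^ n *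
      ∫ z in B, (coefAt (expTop n + xiExp Finset.univ Finset.univ) (Φ z)).coeff m) fun m hm => by
    simp [fun z => SA.coeff_of_not (coefAt (expTop n + xiExp Finset.univ Finset.univ) (Φ z)) hm]

/-- The integral over the superball of radius `ε` about `p` of
`η exp(-∂̄ω/t - i_V(ω)/t)`. -/
def residueIntegral (V : SuperVectorField n) (η : SuperForm n) (p : SuperPoint n) (ε t : ℝ) : CS :=
  berezinIntegral (bodyBall p.bodyPt ε) fun z =>
    η z * SA.exp (-(((t : ℂ)⁻¹) • (dbar (omegaForm V) z + contract V (omegaForm V) z)))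

/-- The residue at `p`, computed with the superball of radius `ε`, exists and equals `R`. -/
def HasResidue (V : SuperVectorField n) (η : SuperForm n) (p : SuperPoint n) (ε : ℝ) (R : CS) :
    Prop :=
  Filter.Tendsto (fun t : ℝ => residueIntegral V η p ε t) (𝓝[>] 0) (𝓝 R)

end SuperResidue

end

open SuperResidue

/-! Write `A` for the Jacobian `(∂g_i/∂z_j)`, `θ_l = ∂̄ḡ_l` and `gḡ = ∑ g_i ḡ_i`. The exponent `∂̄ω
+ i_V ω` equals `gḡ + ∑ θ_l dz_l + Ψ` with `Ψ = ∑ θ_i dξ_i + ∑ f_i ḡ_i`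
(`dbar_add_contract_omegaForm`). The two-forms `θ_l dz_l` are central with square zero and `Ψ² = 0`.
Hence the exponential is `exp(-gḡ/t)` times a finite sum over index sets `S` of `(-1/t)^|S| ∏_{l ∈
S} θ_l dz_l · (1 - Ψ/t)` (`exp_neg_smul_eq`).

A Gaussian integral has size `t^n`, so only the total exponent `n` of `1/t` can survive. Full `S`
without `Ψ` gives `conj(det A)` times the `(0,0)|(n,n)` coefficient, because the product of the `θ_l
dz_l` is alternating in the rows of the conjugate Jacobian. Sets that omit one index `i`, with `Ψ`,
contribute through `θ_i dξ_i` and give `conj(det A)` times the starred coefficient; their `f_k ḡ_k`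
part has the factor `ḡ_k`, which vanishes at `p`. Full `S` with `Ψ` would carry `t^{-n-1}`, but it
is zero: `θ_i² = 0`, and the parity condition on `η` excludes the odd `f_k`
(`coefAt_mul_thetaProd_univ_mul_oddForm`).

There remains the limit of `t^{-n} ∫ h exp(-gḡ/t)`, which is `π^n h(p) / J(p)` with `J = det A ·
conj(det A)`, for Grassmann-valued data and a zero `p` that has a soul
(`tendsto_gaussian_bodyBall`). On bodies this is the Laplace method (`tendsto_laplace`). Expanding
the souls directly would produce higher negative powers of `t`, so they are controlled by the
derivation `N` that multiplies a monomial in the `β_k` by its length. Put `W = exp(-gḡ/t)` and let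
`X` be the real vector field with holomorphic components `A⁻¹ N(g)`. As `J W` is the density of a
Gaussian pulled back by `g`, deforming `g` along `N` is a Lie derivative: `N(J W) = div(X J W)`
(`evalHom_divergence`, based on the Piola identity). Integration by parts then yields `deg m · ∫ (F
J W)_m = ∫ ((N F - X F) J W)_m` (`numOp_integral_eq`).

At the point, applying `N` to `g(p) = 0` shows that `N` of the soul of `p` is `-X(p)`, hence
`N(F(p)) = (N F - X F)(p)` (`grassmannExt_transportOp_div`). Both sides of the desired limit thus
satisfy the same recursion. If `F` has no coefficients of length below `d`, then `N F - d F - X F`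
has none below `d + 1`, and passing to it multiplies the `m`-th coefficient of both sides by `deg m
- d`. This reduces everything to `d = deg m`, where only the bodies of the remaining factors enter
(`tendsto_test`). Away from the zero the integrand is exponentially small (`tendsto_gaussian_tail`).

Finally `conj(det A) / J = 1 / det A`, and `det A = Ber(V) · det D` since the block `∂g/∂ξ` vanishes
(`ber_mul_detD`). All signs are collected in `berezin_sign`. -/

noncomputable section

namespace SuperResidue

/-! ### Filtration by monomial length and the coefficientwise exponential. -/

section

section Algebra

variable {G : Type} [LinearOrder G] [GradedGen G]

/-- The coefficient of a monomial, as a linear map. -/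
def SA.coeffHom (m : G →₀ ℕ) : SA G →ₗ[ℂ] ℂ where
  toFun x := x.coeff m
  map_add' _ _ := rfl
  map_smul' _ _ := rfl

theorem SA.coeff_sum {ι : Type*} (s : Finset ι) (f : ι → SA G) (m : G →₀ ℕ) :
    (∑ i ∈ s, f i).coeff m = ∑ i ∈ s, (f i).coeff m :=
  map_sum (SA.coeffHom m) f s

@[simp] theorem SA.coeff_sub (x y : SA G) (m : G →₀ ℕ) :
    (x - y).coeff m = x.coeff m - y.coeff m :=
  map_sub (SA.coeffHom m) x y

theorem SA.coeff_algebraMap (c : ℂ) (m : G →₀ ℕ) :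
    (algebraMap ℂ (SA G) c).coeff m = if m = 0 then c else 0 := by
  rw [Algebra.algebraMap_eq_smul_one, SA.coeff_smul, SA.coeff_one]
  split_ifs <;> simp

theorem SA.coeff_mul_zero (x y : SA G) : (x * y).coeff 0 = x.coeff 0 * y.coeff 0 := by
  rw [SA.coeff_mul _ _ admissible_zero]
  simp [normExp_zero_left]

/-- The filtration by the length of monomials: `x` has no monomials of length less than `d`. -/
def SA.Fil (d : ℕ) (x : SA G) : Prop := ∀ m : G →₀ ℕ, m.degree < d → x.coeff m = 0

theorem SA.fil_zero (x : SA G) : SA.Fil 0 x := fun _ h => absurd h (Nat.not_lt_zero _)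

theorem SA.fil_of_zero (d : ℕ) : SA.Fil d (0 : SA G) := fun _ _ => rfl

theorem SA.Fil.mono {a b : ℕ} {x : SA G} (h : SA.Fil b x) (hab : a ≤ b) : SA.Fil a x :=
  fun m hm => h m (hm.trans_le hab)

theorem SA.Fil.add {d : ℕ} {x y : SA G} (hx : SA.Fil d x) (hy : SA.Fil d y) : SA.Fil d (x + y) :=
  fun m hm => by rw [SA.coeff_add, hx m hm, hy m hm, add_zero]

theorem SA.Fil.neg {d : ℕ} {x : SA G} (hx : SA.Fil d x) : SA.Fil d (-x) :=
  fun m hm => by rw [SA.coeff_neg, hx m hm, neg_zero]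

theorem SA.Fil.sub {d : ℕ} {x y : SA G} (hx : SA.Fil d x) (hy : SA.Fil d y) : SA.Fil d (x - y) :=
  fun m hm => by rw [SA.coeff_sub, hx m hm, hy m hm, sub_zero]

theorem SA.Fil.smul {d : ℕ} {x : SA G} (c : ℂ) (hx : SA.Fil d x) : SA.Fil d (c • x) :=
  fun m hm => by rw [SA.coeff_smul, hx m hm, mul_zero]

theorem SA.fil_sum {ι : Type*} {s : Finset ι} {f : ι → SA G} {d : ℕ}
    (h : ∀ i ∈ s, SA.Fil d (f i)) : SA.Fil d (∑ i ∈ s, f i) :=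
  fun m hm => by
    rw [SA.coeff_sum]
    exact Finset.sum_eq_zero fun i hi => h i hi m hm

theorem SA.Fil.mul {a b : ℕ} {x y : SA G} (hx : SA.Fil a x) (hy : SA.Fil b y) :
    SA.Fil (a + b) (x * y) := fun m hm => by
  by_cases hA : Admissible m
  · rw [SA.coeff_mul _ _ hA]
    refine Finset.sum_eq_zero fun p hp => ?_
    have hd : p.1.degree + p.2.degree = m.degree := by
      rw [← Finset.HasAntidiagonal.mem_antidiagonal.1 hp, map_add]
    by_cases h1 : p.1.degree < a
    · simp [hx _ h1]
    · simp [hy p.2 (by omega)]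
  · exact SA.coeff_of_not _ hA

theorem SA.Fil.mul_left {b : ℕ} {y : SA G} (x : SA G) (hy : SA.Fil b y) : SA.Fil b (x * y) := by
  simpa using (SA.fil_zero x).mul hy

theorem SA.Fil.mul_right {b : ℕ} {y : SA G} (hy : SA.Fil b y) (x : SA G) : SA.Fil b (y * x) := by
  simpa using hy.mul (SA.fil_zero x)

theorem SA.Fil.pow {x : SA G} (hx : SA.Fil 1 x) (k : ℕ) : SA.Fil k (x ^ k) := by
  induction k with
  | zero => exact SA.fil_zero _
  | succ k ih => rw [pow_succ]; exact ih.mul hx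

theorem SA.fil_one_iff {x : SA G} : SA.Fil 1 x ↔ x.coeff 0 = 0 := by
  refine ⟨fun h => h 0 (by simp), fun h m hm => ?_⟩
  have : m = 0 := by
    rw [← Finsupp.degree_eq_zero_iff]; omega
  rw [this, h]

/-- Every monomial has finite length, so the filtration is separated. Identities between infinite
sums are proved modulo each step of the filtration and then concluded by this lemma. -/
theorem SA.eq_of_fil {x y : SA G} (h : ∀ d, SA.Fil d (x - y)) : x = y := by
  ext m
  have := h (m.degree + 1) m (Nat.lt_succ_self _)
  rw [SA.coeff_sub] at this
  exact sub_eq_zero.1 this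

/-! ### The exponential -/

theorem SA.summable_exp_scalar (c : ℂ) : Summable fun k : ℕ => ‖((k ! : ℂ))⁻¹ * c ^ k‖ := by
  have := NormedSpace.norm_expSeries_div_summable c
  exact this.congr fun k => by rw [div_eq_inv_mul]

theorem SA.tsum_exp_scalar (c : ℂ) : ∑' k : ℕ, ((k ! : ℂ))⁻¹ * c ^ k = Complex.exp c := by
  rw [Complex.exp_eq_exp_ℂ, NormedSpace.exp_eq_tsum_div]
  exact tsum_congr fun k => by rw [div_eq_inv_mul]

theorem inv_factorial_mul_choose (a b : ℕ) :
    (((a + b)! : ℕ) : ℂ)⁻¹ * (((a + b).choose a : ℕ) : ℂ) = ((a ! : ℂ))⁻¹ * ((b ! : ℂ))⁻¹ := by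
  have h2 : (((a + b).choose a : ℕ) : ℂ) * (a ! : ℂ) * (b ! : ℂ) = ((a + b)! : ℕ) := by
    rw [Nat.choose_symm_add]
    exact_mod_cast Nat.add_choose_mul_factorial_mul_factorial a b
  have e1 : (a ! : ℂ) ≠ 0 := by exact_mod_cast Nat.factorial_ne_zero _
  have e2 : (b ! : ℂ) ≠ 0 := by exact_mod_cast Nat.factorial_ne_zero _
  have e3 : (((a + b)! : ℕ) : ℂ) ≠ 0 := by exact_mod_cast Nat.factorial_ne_zero _
  field_simp
  rw [← h2]

/-- Without a constant term, `y ^ k` has no monomial shorter than `k`, so a given coefficient sees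
finitely many powers of `y`. The series is the Cauchy product of the scalar exponential series with
a finite sum, which settles all questions of convergence. -/
theorem SA.coeff_exp_add (c : ℂ) {y : SA G} (hy : SA.Fil 1 y) {N : ℕ} {m : G →₀ ℕ}
    (hm : m.degree < N) :
    (SA.exp (c • 1 + y)).coeff m =
      Complex.exp c * ∑ k ∈ Finset.range N, ((k ! : ℂ))⁻¹ * (y ^ k).coeff m := by
  have hzero : ∀ k ∉ Finset.range N, ((k ! : ℂ))⁻¹ * (y ^ k).coeff m = 0 := fun k hk => by
    rw [hy.pow k m (hm.trans_le (by simpa using hk)), mul_zero]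
  have hcomm : Commute (c • (1 : SA G)) y := by
    rw [← Algebra.algebraMap_eq_smul_one]
    exact Algebra.commutes c y
  have hsum : Summable fun k : ℕ => ‖((k ! : ℂ))⁻¹ * (y ^ k).coeff m‖ :=
    summable_of_ne_finset_zero (s := Finset.range N) fun k hk => by rw [hzero k hk, norm_zero]
  rw [← SA.tsum_exp_scalar, ← tsum_eq_sum (L := SummationFilter.unconditional ℕ) hzero,
    tsum_mul_tsum_eq_tsum_sum_antidiagonal_of_summable_norm (SA.summable_exp_scalar c) hsum]
  change ∑' k : ℕ, ((k ! : ℂ))⁻¹ * ((c • 1 + y) ^ k).coeff m = _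
  refine tsum_congr fun k => ?_
  rw [hcomm.add_pow', SA.coeff_sum, Finset.mul_sum]
  refine Finset.sum_congr rfl fun q hq => ?_
  have hq' := Finset.HasAntidiagonal.mem_antidiagonal.1 hq
  rw [smul_pow, one_pow, smul_mul_assoc, one_mul, ← Nat.cast_smul_eq_nsmul ℂ, SA.coeff_smul,
    SA.coeff_smul, ← hq']
  rw [← mul_assoc, inv_factorial_mul_choose]
  ring

theorem SA.coeff_exp_of_fil {y : SA G} (hy : SA.Fil 1 y) {N : ℕ} {m : G →₀ ℕ}
    (hm : m.degree < N) :
    (SA.exp y).coeff m = ∑ k ∈ Finset.range N, ((k ! : ℂ))⁻¹ * (y ^ k).coeff m := by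
  have := SA.coeff_exp_add 0 hy hm
  simpa using this

theorem SA.exp_fil {y : SA G} (hy : SA.Fil 1 y) (N : ℕ) :
    SA.Fil N (SA.exp y - ∑ k ∈ Finset.range N, ((k ! : ℂ))⁻¹ • y ^ k) := fun m hm => by
  rw [SA.coeff_sub, SA.coeff_exp_of_fil hy hm, SA.coeff_sum, sub_eq_zero]
  rfl

theorem SA.exp_smul_one_add (c : ℂ) {y : SA G} (hy : SA.Fil 1 y) :
    SA.exp (c • 1 + y) = Complex.exp c • SA.exp y := by
  ext m
  rw [SA.coeff_exp_add c hy (Nat.lt_succ_self _), SA.coeff_smul,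
    SA.coeff_exp_of_fil hy (Nat.lt_succ_self _)]

theorem SA.exp_body_soul (x : SA G) :
    SA.exp x = Complex.exp (x.coeff 0) • SA.exp (x - x.coeff 0 • 1) := by
  have h : SA.Fil 1 (x - x.coeff 0 • 1) := SA.fil_one_iff.2 (by simp [SA.coeff_one])
  rw [← SA.exp_smul_one_add _ h, add_sub_cancel]

/-- The Cauchy product of two sequences that converge in the filtration. -/
theorem SA.fil_cauchy_product {a b : ℕ → SA G} (ha : ∀ k, SA.Fil k (a k))
    (hb : ∀ k, SA.Fil k (b k)) (N : ℕ) :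
    SA.Fil N (∑ k ∈ Finset.range N, ∑ q ∈ Finset.HasAntidiagonal.antidiagonal k, a q.1 * b q.2 -
      (∑ k ∈ Finset.range N, a k) * ∑ k ∈ Finset.range N, b k) := by
  -- The antidiagonals fill the triangle `q.1 + q.2 < N` of the square. The pairs left over give
  -- products of length at least `N`.
  have e1 : ∑ k ∈ Finset.range N, ∑ q ∈ Finset.HasAntidiagonal.antidiagonal k, a q.1 * b q.2 =
      ∑ q ∈ (Finset.range N ×ˢ Finset.range N) with q.1 + q.2 < N, a q.1 * b q.2 := by
    rw [Finset.sum_sigma']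
    refine Finset.sum_nbij' (fun a => a.2) (fun q => ⟨q.1 + q.2, q⟩) ?_ ?_ ?_ ?_ ?_
    · rintro ⟨k, q⟩ h
      simp only [Finset.mem_sigma, Finset.mem_range, Finset.HasAntidiagonal.mem_antidiagonal] at h
      simp only [Finset.mem_filter, Finset.mem_product, Finset.mem_range]
      omega
    · rintro q h
      simp only [Finset.mem_filter, Finset.mem_product, Finset.mem_range] at h
      simp only [Finset.mem_sigma, Finset.mem_range, Finset.HasAntidiagonal.mem_antidiagonal]
      exact ⟨h.2, trivial⟩
    · rintro ⟨k, q⟩ h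
      simp only [Finset.mem_sigma, Finset.mem_range, Finset.HasAntidiagonal.mem_antidiagonal] at h
      obtain ⟨-, rfl⟩ := h
      rfl
    · intro q _; rfl
    · intro a _; rfl
  rw [e1, Finset.sum_mul_sum, ← Finset.sum_product',
    ← Finset.sum_filter_add_sum_filter_not (Finset.range N ×ˢ Finset.range N)
    (fun q => q.1 + q.2 < N), sub_add_cancel_left]
  refine (SA.fil_sum fun q hq => ?_).neg
  simp only [Finset.mem_filter, not_lt] at hq
  exact ((ha q.1).mul (hb q.2)).mono hq.2

theorem SA.exp_add {x y : SA G} (hxy : Commute x y) (hx : SA.Fil 1 x) (hy : SA.Fil 1 y) :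
    SA.exp (x + y) = SA.exp x * SA.exp y := by
  refine SA.eq_of_fil fun N => ?_
  have key := SA.fil_cauchy_product (fun k => (hx.pow k).smul ((k ! : ℂ))⁻¹)
    (fun k => (hy.pow k).smul ((k ! : ℂ))⁻¹) N
  set ex := ∑ k ∈ Finset.range N, ((k ! : ℂ))⁻¹ • x ^ k with hex
  set ey := ∑ k ∈ Finset.range N, ((k ! : ℂ))⁻¹ • y ^ k with hey
  have h1 := SA.exp_fil hx N
  have h2 := SA.exp_fil hy N
  have h3 := SA.exp_fil (hx.add hy) N
  rw [← hex] at h1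
  rw [← hey] at h2
  have hk : ∀ k ∈ Finset.range N, ∑ q ∈ Finset.HasAntidiagonal.antidiagonal k,
      (((q.1 ! : ℂ))⁻¹ • x ^ q.1) * (((q.2 ! : ℂ))⁻¹ • y ^ q.2) =
      ((k ! : ℂ))⁻¹ • (x + y) ^ k := fun k _ => by
    rw [hxy.add_pow', Finset.smul_sum]
    refine Finset.sum_congr rfl fun q hq => ?_
    rw [← Nat.cast_smul_eq_nsmul ℂ, smul_smul, ← Finset.HasAntidiagonal.mem_antidiagonal.1 hq,
      inv_factorial_mul_choose, smul_mul_smul_comm]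
  rw [Finset.sum_congr rfl hk] at key
  -- The exponentials are replaced by their truncations one factor at a time; every bracket lies in
  -- the `N`-th step of the filtration.
  have e : SA.exp (x + y) - SA.exp x * SA.exp y =
      (SA.exp (x + y) - ∑ k ∈ Finset.range N, ((k ! : ℂ))⁻¹ • (x + y) ^ k) +
      (∑ k ∈ Finset.range N, ((k ! : ℂ))⁻¹ • (x + y) ^ k - ex * ey)
      - ((SA.exp x - ex) * SA.exp y + ex * (SA.exp y - ey)) := by
    noncomm_ring
  rw [e]
  exact (h3.add key).sub ((h1.mul_right _).add (h2.mul_left _))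

theorem SA.exp_of_sq_zero {x : SA G} (h : x * x = 0) (hx : SA.Fil 1 x) : SA.exp x = 1 + x := by
  have hk : ∀ k, 2 ≤ k → x ^ k = 0 := fun k hk => by
    obtain ⟨j, rfl⟩ := Nat.exists_eq_add_of_le hk
    rw [pow_add, pow_two, h, zero_mul]
  ext m
  rw [SA.coeff_exp_of_fil hx (N := m.degree + 2) (by omega), Finset.sum_range_succ',
    Finset.sum_range_succ', Finset.sum_eq_zero fun k _ => by rw [hk _ (by omega)]; simp]
  simp [add_comm]

theorem SA.exp_zero' : SA.exp (0 : SA G) = 1 := by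
  simpa using SA.exp_of_sq_zero (x := (0 : SA G)) (by simp) (SA.fil_of_zero 1)

/-- Each exponential is `1 + q i` and the exponents commute. The center is used as index ring
because it is commutative, so the result is a `Finset.prod` that can be expanded over subsets. -/
theorem SA.exp_sum_central {ι : Type*} (s : Finset ι) (q : ι → Subring.center (SA G))
    (h0 : ∀ i, q i * q i = 0) (hf : ∀ i, SA.Fil 1 (q i : SA G)) :
    SA.exp (∑ i ∈ s, (q i : SA G)) = ((∏ i ∈ s, (1 + q i) : Subring.center (SA G)) : SA G) := by
  classical
  induction s using Finset.induction_on with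
  | empty => simp [SA.exp_zero']
  | insert a s ha ih =>
    have hc : Commute (q a : SA G) (∑ i ∈ s, (q i : SA G)) :=
      (Subring.mem_center_iff.1 (q a).2 _).symm
    have h0' : (q a : SA G) * q a = 0 := by
      rw [← Subring.coe_mul, h0, Subring.coe_zero]
    rw [Finset.sum_insert ha, SA.exp_add hc (hf a) (SA.fil_sum fun i _ => hf i),
      ih, SA.exp_of_sq_zero h0' (hf a), Finset.prod_insert ha]
    rfl

end Algebra

end

/-! ### Bigraded commutativity, the number operator, coefficientwise calculus. -/

section

section Algebra

variable {G : Type} [LinearOrder G] [GradedGen G]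

/-! ### Bigraded commutativity -/

/-- The form degree of a monomial modulo two. -/
def formDegree (a : G →₀ ℕ) : ZMod 2 := a.sum fun i x => (x * GradedGen.formDeg i : ℕ)

/-- The parity of a monomial. -/
def monoParity (a : G →₀ ℕ) : ZMod 2 := a.sum fun i x => (x * GradedGen.parity i : ℕ)

theorem formDegree_add (a b : G →₀ ℕ) : formDegree (a + b) = formDegree a + formDegree b :=
  Finsupp.sum_add_index' (by simp) (by intros; push_cast; ring)

theorem monoParity_add (a b : G →₀ ℕ) : monoParity (a + b) = monoParity a + monoParity b :=
  Finsupp.sum_add_index' (by simp) (by intros; push_cast; ring)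

theorem formDegree_single (i : G) (k : ℕ) :
    formDegree (Finsupp.single i k) = (k * GradedGen.formDeg i : ℕ) :=
  Finsupp.sum_single_index (by simp)

theorem monoParity_single (i : G) (k : ℕ) :
    monoParity (Finsupp.single i k) = (k * GradedGen.parity i : ℕ) :=
  Finsupp.sum_single_index (by simp)

/-- Two distinct generators are inverted in exactly one of the two orders, so together the exponents
count each pair once. A diagonal pair contributes an even number: if `swapExp i i` is odd,
admissibility of `a + b` keeps `i` from occurring in both monomials. -/
theorem cast_normExp_add_swap {a b : G →₀ ℕ} (h : Admissible (a + b)) :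
    ((normExp a b + normExp b a : ℕ) : ZMod 2) =
      formDegree a * formDegree b + monoParity a * monoParity b := by
  have hd : ∀ i, ((a i * b i * swapExp i i : ℕ) : ZMod 2) = 0 := by
    intro i
    rw [ZMod.natCast_eq_zero_iff_even]
    by_cases ho : Odd (swapExp i i)
    · have := h i ho
      simp only [Finsupp.add_apply] at this
      rcases Nat.eq_zero_or_pos (a i) with h0 | h0
      · simp [h0]
      · have : b i = 0 := by omega
        simp [this]
    · exact (Nat.not_odd_iff_even.1 ho).mul_left _
  have hs : ∀ i j : G, swapExp i j = swapExp j i := fun i j => by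
    unfold swapExp; ring
  simp only [normExp, Finsupp.sum, formDegree, monoParity]
  rw [Finset.sum_comm (s := b.support), ← Finset.sum_add_distrib, Finset.sum_mul_sum,
    Finset.sum_mul_sum, ← Finset.sum_add_distrib, Nat.cast_sum]
  refine Finset.sum_congr rfl fun i _ => ?_
  rw [← Finset.sum_add_distrib, ← Finset.sum_add_distrib, Nat.cast_sum]
  refine Finset.sum_congr rfl fun j _ => ?_
  have hsum : ((a i * GradedGen.formDeg i : ℕ) : ZMod 2) * (b j * GradedGen.formDeg j : ℕ) +
      ((a i * GradedGen.parity i : ℕ) : ZMod 2) * (b j * GradedGen.parity j : ℕ) =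
      (a i * b j * swapExp i j : ℕ) := by
    unfold swapExp; push_cast; ring
  rw [hsum]
  rcases lt_trichotomy i j with hij | rfl | hij
  · simp only [hij, hij.not_gt, if_true, if_false, zero_add]
    rw [hs j i, mul_comm (b j)]
  · simp [hd]
  · simp [hij, hij.not_gt]

theorem neg_one_pow_congr {a b : ℕ} (h : (a : ZMod 2) = b) : (-1 : ℂ) ^ a = (-1) ^ b := by
  rw [ZMod.natCast_eq_natCast_iff'] at h
  rw [← Nat.div_add_mod a 2, ← Nat.div_add_mod b 2, h, pow_add, pow_add, pow_mul, pow_mul]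
  simp

theorem SA.mul_swap {x y : SA G} (e : ℕ)
    (h : ∀ a b, x.coeff a ≠ 0 → y.coeff b ≠ 0 →
      formDegree a * formDegree b + monoParity a * monoParity b = (e : ZMod 2)) :
    x * y = (-1 : ℂ) ^ e • (y * x) := by
  refine SA.ext_adm fun m hm => ?_
  rw [SA.coeff_smul, SA.coeff_mul _ _ hm, SA.coeff_mul _ _ hm, Finset.mul_sum]
  refine Eq.trans ?_ (Finsupp.sum_antidiagonal_swap m fun a b =>
    (-1 : ℂ) ^ e * ((-1 : ℂ) ^ normExp b a * (y.coeff b * x.coeff a)))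
  refine Finset.sum_congr rfl fun p hp => ?_
  by_cases h1 : x.coeff p.1 = 0
  · simp [h1]
  by_cases h2 : y.coeff p.2 = 0
  · simp [h2]
  have hs := cast_normExp_add_swap (a := p.1) (b := p.2)
    (by rwa [Finset.HasAntidiagonal.mem_antidiagonal.1 hp])
  rw [h _ _ h1 h2] at hs
  have : (-1 : ℂ) ^ normExp p.1 p.2 = (-1) ^ e * (-1) ^ normExp p.2 p.1 := by
    rw [← pow_add]
    refine neg_one_pow_congr ?_
    push_cast at hs ⊢
    rw [← hs, add_assoc, CharTwo.add_self_eq_zero, add_zero]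
  rw [this]
  ring

/-- Elements all of whose monomials have form degree `k` and parity `ε` modulo two. -/
def SA.Homog (k ε : ZMod 2) (x : SA G) : Prop :=
  ∀ m, x.coeff m ≠ 0 → formDegree m = k ∧ monoParity m = ε

theorem SA.homog_zero (k ε : ZMod 2) : SA.Homog k ε (0 : SA G) := fun _ h => absurd rfl h

theorem SA.Homog.add {k ε : ZMod 2} {x y : SA G} (hx : SA.Homog k ε x) (hy : SA.Homog k ε y) :
    SA.Homog k ε (x + y) := fun m hm => by
  by_cases h : x.coeff m = 0
  · exact hy m fun h' => hm (by rw [SA.coeff_add, h, h', add_zero])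
  · exact hx m h

theorem SA.homog_sum {ι : Type*} {s : Finset ι} {f : ι → SA G} {k ε : ZMod 2}
    (h : ∀ i ∈ s, SA.Homog k ε (f i)) : SA.Homog k ε (∑ i ∈ s, f i) :=
  Finset.sum_induction f (SA.Homog k ε) (fun _ _ => SA.Homog.add) (SA.homog_zero k ε) h

theorem SA.Homog.mul {k ε k' ε' : ZMod 2} {x y : SA G} (hx : SA.Homog k ε x)
    (hy : SA.Homog k' ε' y) : SA.Homog (k + k') (ε + ε') (x * y) := fun m hm => by
  have hA : Admissible m := by
    by_contra h
    exact hm (SA.coeff_of_not _ h)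
  rw [SA.coeff_mul _ _ hA] at hm
  obtain ⟨p, hp, hne⟩ := Finset.exists_ne_zero_of_sum_ne_zero hm
  have h1 : x.coeff p.1 ≠ 0 := fun h => hne (by simp [h])
  have h2 : y.coeff p.2 ≠ 0 := fun h => hne (by simp [h])
  rw [← Finset.HasAntidiagonal.mem_antidiagonal.1 hp, formDegree_add, monoParity_add,
    (hx _ h1).1, (hx _ h1).2, (hy _ h2).1, (hy _ h2).2]
  exact ⟨rfl, rfl⟩

theorem SA.homog_mono (a : G →₀ ℕ) : SA.Homog (formDegree a) (monoParity a) (SA.mono a) :=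
  fun m hm => by
    by_cases h : m = a
    · rw [h]; exact ⟨rfl, rfl⟩
    · exact absurd (if_neg fun h' => h h'.1) hm

theorem SA.Homog.anticomm {k ε k' ε' : ZMod 2} {x y : SA G} (hx : SA.Homog k ε x)
    (hy : SA.Homog k' ε' y) (h : k * k' + ε * ε' = 1) : x * y = -(y * x) := by
  have := SA.mul_swap (x := x) (y := y) 1 fun a b ha hb => by
    rw [(hx a ha).1, (hx a ha).2, (hy b hb).1, (hy b hb).2, h, Nat.cast_one]
  simpa using this

theorem SA.Homog.central {x : SA G} (hx : SA.Homog 0 0 x) (y : SA G) : Commute x y := by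
  have := SA.mul_swap (x := x) (y := y) 0 fun a b ha hb => by
    rw [(hx a ha).1, (hx a ha).2]; simp
  exact (by simpa using this : x * y = y * x)

theorem SA.Homog.sq_zero {k ε : ZMod 2} {x : SA G} (hx : SA.Homog k ε x)
    (h : k * k + ε * ε = 1) : x * x = 0 := by
  have h1 := hx.anticomm hx h
  have h2 : (2 : ℂ) • (x * x) = 0 := by
    rw [two_smul]
    nth_rewrite 1 [h1]
    exact neg_add_cancel _
  exact (smul_eq_zero.1 h2).resolve_left two_ne_zero

/-! ### The number operator -/

/-- The derivation that multiplies each monomial by its length. -/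
def SA.numOp : SA G →ₗ[ℂ] SA G where
  toFun x := SA.mk (fun m => (m.degree : ℂ) * x.coeff m) fun m hm => by simp [x.coeff_of_not hm]
  map_add' x y := by ext m; simp [mul_add]
  map_smul' c x := by ext m; simp; ring

@[simp] theorem SA.coeff_numOp (x : SA G) (m : G →₀ ℕ) :
    (SA.numOp x).coeff m = (m.degree : ℂ) * x.coeff m := rfl

/-- Lengths add when monomials are multiplied. That `SA.numOp` is a derivation is what makes it
usable as the induction device for Gaussian integrals: it commutes with `∂/∂z` and acts on a single
coefficient as multiplication by its length. -/
theorem SA.numOp_mul (x y : SA G) : SA.numOp (x * y) = SA.numOp x * y + x * SA.numOp y := by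
  refine SA.ext_adm fun m hm => ?_
  rw [SA.coeff_numOp, SA.coeff_add, SA.coeff_mul _ _ hm, SA.coeff_mul _ _ hm, SA.coeff_mul _ _ hm,
    Finset.mul_sum, ← Finset.sum_add_distrib]
  refine Finset.sum_congr rfl fun p hp => ?_
  rw [← Finset.HasAntidiagonal.mem_antidiagonal.1 hp, map_add, SA.coeff_numOp, SA.coeff_numOp]
  push_cast
  ring

theorem SA.fil_numOp (x : SA G) : SA.Fil 1 (SA.numOp x) :=
  SA.fil_one_iff.2 (by simp)

/-! ### Coefficientwise derivatives -/

variable {n : ℕ}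

/-- The coefficientwise real directional derivative. -/
def dirDeriv (v : Fin n → ℂ) (F : (Fin n → ℂ) → SA G) (z : Fin n → ℂ) : SA G :=
  SA.mk (fun m => fderiv ℝ (fun w => (F w).coeff m) z v) fun m hm => by
    simp [fun w => SA.coeff_of_not (F w) hm]

@[simp] theorem coeff_dirDeriv (v : Fin n → ℂ) (F : (Fin n → ℂ) → SA G) (z : Fin n → ℂ)
    (m : G →₀ ℕ) : (dirDeriv v F z).coeff m = fderiv ℝ (fun w => (F w).coeff m) z v := rfl

theorem pderivZ_eq (j : Fin n) (F : (Fin n → ℂ) → SA G) (z : Fin n → ℂ) :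
    pderivZ j F z = (2⁻¹ : ℂ) • (dirDeriv (Pi.single j 1) F z -
      Complex.I • dirDeriv (Pi.single j Complex.I) F z) := by
  ext m
  change (_ - _) / 2 = _
  rw [SA.coeff_smul, SA.coeff_sub, SA.coeff_smul, div_eq_inv_mul]
  rfl

theorem pderivZbar_eq (j : Fin n) (F : (Fin n → ℂ) → SA G) (z : Fin n → ℂ) :
    pderivZbar j F z = (2⁻¹ : ℂ) • (dirDeriv (Pi.single j 1) F z +
      Complex.I • dirDeriv (Pi.single j Complex.I) F z) := by
  ext m
  change (_ + _) / 2 = _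
  rw [SA.coeff_smul, SA.coeff_add, SA.coeff_smul, div_eq_inv_mul]
  rfl

/-- Coefficientwise differentiability at a point. -/
def DiffCoeffAt (F : (Fin n → ℂ) → SA G) (z : Fin n → ℂ) : Prop :=
  ∀ m, DifferentiableAt ℝ (fun w => (F w).coeff m) z

theorem dirDeriv_mul {F H : (Fin n → ℂ) → SA G} {z : Fin n → ℂ} (hF : DiffCoeffAt F z)
    (hH : DiffCoeffAt H z) (v : Fin n → ℂ) :
    dirDeriv v (fun w => F w * H w) z = dirDeriv v F z * H z + F z * dirDeriv v H z := by
  refine SA.ext_adm fun m hm => ?_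
  rw [coeff_dirDeriv, SA.coeff_add, SA.coeff_mul _ _ hm, SA.coeff_mul _ _ hm]
  have : (fun w => (F w * H w).coeff m) = fun w => ∑ p ∈ Finset.HasAntidiagonal.antidiagonal m,
      (-1) ^ normExp p.1 p.2 * ((F w).coeff p.1 * (H w).coeff p.2) :=
    funext fun w => SA.coeff_mul _ _ hm
  rw [this, fderiv_fun_sum fun p _ => ((hF p.1).fun_mul (hH p.2)).const_mul _,
    sum_apply, ← Finset.sum_add_distrib]
  refine Finset.sum_congr rfl fun p _ => ?_
  rw [fderiv_const_mul ((hF p.1).fun_mul (hH p.2)), fderiv_fun_mul (hF p.1) (hH p.2)]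
  simp only [smul_apply, add_apply, smul_eq_mul,
    coeff_dirDeriv]
  ring

theorem pderivZ_mul {F H : (Fin n → ℂ) → SA G} {z : Fin n → ℂ} (hF : DiffCoeffAt F z)
    (hH : DiffCoeffAt H z) (j : Fin n) :
    pderivZ j (fun w => F w * H w) z = pderivZ j F z * H z + F z * pderivZ j H z := by
  simp only [pderivZ_eq, dirDeriv_mul hF hH, smul_add, smul_sub, sub_mul, mul_sub, smul_mul_assoc,
    mul_smul_comm]
  abel

theorem pderivZbar_mul {F H : (Fin n → ℂ) → SA G} {z : Fin n → ℂ} (hF : DiffCoeffAt F z)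
    (hH : DiffCoeffAt H z) (j : Fin n) :
    pderivZbar j (fun w => F w * H w) z = pderivZbar j F z * H z + F z * pderivZbar j H z := by
  simp only [pderivZbar_eq, dirDeriv_mul hF hH, smul_add, add_mul, mul_add, smul_mul_assoc,
    mul_smul_comm]
  abel

theorem dirDeriv_add {F H : (Fin n → ℂ) → SA G} {z : Fin n → ℂ} (hF : DiffCoeffAt F z)
    (hH : DiffCoeffAt H z) (v : Fin n → ℂ) :
    dirDeriv v (fun w => F w + H w) z = dirDeriv v F z + dirDeriv v H z := by
  ext m
  simp only [coeff_dirDeriv, SA.coeff_add]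
  rw [fderiv_fun_add (hF m) (hH m)]
  rfl

theorem dirDeriv_const (c : SA G) (v z : Fin n → ℂ) : dirDeriv v (fun _ => c) z = 0 := by
  ext m
  simp

theorem pderivZ_const (c : SA G) (j : Fin n) (z : Fin n → ℂ) : pderivZ j (fun _ => c) z = 0 := by
  simp [pderivZ_eq, dirDeriv_const]

theorem pderivZbar_const (c : SA G) (j : Fin n) (z : Fin n → ℂ) :
    pderivZbar j (fun _ => c) z = 0 := by
  simp [pderivZbar_eq, dirDeriv_const]

theorem pderivZbar_add {F H : (Fin n → ℂ) → SA G} {z : Fin n → ℂ} (hF : DiffCoeffAt F z)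
    (hH : DiffCoeffAt H z) (j : Fin n) :
    pderivZbar j (fun w => F w + H w) z = pderivZbar j F z + pderivZbar j H z := by
  simp only [pderivZbar_eq, dirDeriv_add hF hH, smul_add]
  abel

theorem dirDeriv_congr {F H : (Fin n → ℂ) → SA G} {z : Fin n → ℂ} (h : F =ᶠ[𝓝 z] H)
    (v : Fin n → ℂ) : dirDeriv v F z = dirDeriv v H z := by
  ext m
  have : (fun w => (F w).coeff m) =ᶠ[𝓝 z] fun w => (H w).coeff m := 
    h.mono fun w hw => congrArg (SA.coeff · m) hw
  rw [coeff_dirDeriv, coeff_dirDeriv, this.fderiv_eq]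

theorem pderivZ_congr {F H : (Fin n → ℂ) → SA G} {z : Fin n → ℂ} (h : F =ᶠ[𝓝 z] H)
    (j : Fin n) : pderivZ j F z = pderivZ j H z := by
  simp only [pderivZ_eq, dirDeriv_congr h]

theorem pderivZbar_congr {F H : (Fin n → ℂ) → SA G} {z : Fin n → ℂ} (h : F =ᶠ[𝓝 z] H)
    (j : Fin n) : pderivZbar j F z = pderivZbar j H z := by
  simp only [pderivZbar_eq, dirDeriv_congr h]

/-! ### Smoothness -/

theorem SmoothCoeffOn.diffCoeffAt {F : (Fin n → ℂ) → SA G} {O : Set (Fin n → ℂ)}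
    (h : SmoothCoeffOn F O) (hO : IsOpen O) {z : Fin n → ℂ} (hz : z ∈ O) : DiffCoeffAt F z :=
  fun m => ((h m).contDiffAt (hO.mem_nhds hz)).differentiableAt (by simp)

theorem SmoothCoeffOn.mono {F : (Fin n → ℂ) → SA G} {O O' : Set (Fin n → ℂ)}
    (h : SmoothCoeffOn F O) (hO : O' ⊆ O) : SmoothCoeffOn F O' := fun m => (h m).mono hO

theorem SmoothCoeffOn.congr {F H : (Fin n → ℂ) → SA G} {O : Set (Fin n → ℂ)}
    (h : SmoothCoeffOn F O) (he : ∀ z ∈ O, H z = F z) : SmoothCoeffOn H O :=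
  fun m => (h m).congr fun z hz => by rw [he z hz]

theorem SmoothCoeffOn.add {F H : (Fin n → ℂ) → SA G} {O : Set (Fin n → ℂ)}
    (hF : SmoothCoeffOn F O) (hH : SmoothCoeffOn H O) : SmoothCoeffOn (fun z => F z + H z) O :=
  fun m => (hF m).add (hH m)

theorem SmoothCoeffOn.sub {F H : (Fin n → ℂ) → SA G} {O : Set (Fin n → ℂ)}
    (hF : SmoothCoeffOn F O) (hH : SmoothCoeffOn H O) : SmoothCoeffOn (fun z => F z - H z) O :=
  fun m => by simpa using (hF m).sub (hH m)

theorem smoothCoeffOn_const (c : SA G) (O : Set (Fin n → ℂ)) :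
    SmoothCoeffOn (fun _ => c) O := fun _ => contDiffOn_const

theorem smoothCoeffOn_sum {ι : Type*} {s : Finset ι} {F : ι → (Fin n → ℂ) → SA G}
    {O : Set (Fin n → ℂ)} (h : ∀ i ∈ s, SmoothCoeffOn (F i) O) :
    SmoothCoeffOn (fun z => ∑ i ∈ s, F i z) O := fun m => by
  simp only [SA.coeff_sum]
  exact ContDiffOn.sum fun i hi => h i hi m

theorem SmoothCoeffOn.mul {F H : (Fin n → ℂ) → SA G} {O : Set (Fin n → ℂ)}
    (hF : SmoothCoeffOn F O) (hH : SmoothCoeffOn H O) : SmoothCoeffOn (fun z => F z * H z) O :=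
  fun m => by
    by_cases hm : Admissible m
    · simp only [SA.coeff_mul _ _ hm]
      exact ContDiffOn.sum fun p _ => contDiffOn_const.mul ((hF p.1).mul (hH p.2))
    · simp only [SA.coeff_of_not _ hm]
      exact contDiffOn_const

theorem SmoothCoeffOn.pow {F : (Fin n → ℂ) → SA G} {O : Set (Fin n → ℂ)}
    (hF : SmoothCoeffOn F O) (k : ℕ) : SmoothCoeffOn (fun z => F z ^ k) O := by
  induction k with
  | zero => simpa using smoothCoeffOn_const (1 : SA G) O
  | succ k ih => simpa only [pow_succ] using ih.mul hF

theorem SmoothCoeffOn.smul {F : (Fin n → ℂ) → SA G} {c : (Fin n → ℂ) → ℂ} {O : Set (Fin n → ℂ)}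
    (hc : ContDiffOn ℝ ∞ c O) (hF : SmoothCoeffOn F O) : SmoothCoeffOn (fun z => c z • F z) O :=
  fun m => hc.mul (hF m)

theorem SmoothCoeffOn.const_smul {F : (Fin n → ℂ) → SA G} {O : Set (Fin n → ℂ)} (c : ℂ)
    (hF : SmoothCoeffOn F O) : SmoothCoeffOn (fun z => c • F z) O :=
  SmoothCoeffOn.smul contDiffOn_const hF

theorem SmoothCoeffOn.dirDeriv {F : (Fin n → ℂ) → SA G} {O : Set (Fin n → ℂ)}
    (hF : SmoothCoeffOn F O) (hO : IsOpen O) (v : Fin n → ℂ) : SmoothCoeffOn (dirDeriv v F) O :=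
  fun m => by
    have := (hF m).fderiv_of_isOpen hO (m := ∞) (by simp)
    exact this.clm_apply contDiffOn_const

theorem SmoothCoeffOn.pderivZ {F : (Fin n → ℂ) → SA G} {O : Set (Fin n → ℂ)}
    (hF : SmoothCoeffOn F O) (hO : IsOpen O) (j : Fin n) : SmoothCoeffOn (pderivZ j F) O := by
  refine SmoothCoeffOn.congr ?_ fun z _ => pderivZ_eq j F z
  exact ((hF.dirDeriv hO _).sub ((hF.dirDeriv hO _).const_smul _)).const_smul _

theorem SmoothCoeffOn.pderivZbar {F : (Fin n → ℂ) → SA G} {O : Set (Fin n → ℂ)}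
    (hF : SmoothCoeffOn F O) (hO : IsOpen O) (j : Fin n) : SmoothCoeffOn (pderivZbar j F) O := by
  refine SmoothCoeffOn.congr ?_ fun z _ => pderivZbar_eq j F z
  exact ((hF.dirDeriv hO _).add ((hF.dirDeriv hO _).const_smul _)).const_smul _

theorem dirDeriv_comm {F : (Fin n → ℂ) → SA G} {O : Set (Fin n → ℂ)} (hF : SmoothCoeffOn F O)
    (hO : IsOpen O) (v w : Fin n → ℂ) {z : Fin n → ℂ} (hz : z ∈ O) :
    dirDeriv v (dirDeriv w F) z = dirDeriv w (dirDeriv v F) z := by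
  ext m
  simp only [coeff_dirDeriv]
  have hc : ContDiffAt ℝ ∞ (fun w => (F w).coeff m) z := (hF m).contDiffAt (hO.mem_nhds hz)
  have hd : DifferentiableAt ℝ (fderiv ℝ fun w => (F w).coeff m) z :=
    (hc.fderiv_right (m := 1) (by norm_cast)).differentiableAt (by simp)
  rw [fderiv_clm_apply hd (differentiableAt_const _), fderiv_clm_apply hd (differentiableAt_const _)]
  have := (hc.isSymmSndFDerivAt (by simpa using ENat.LEInfty.out)).eq v w
  simpa using this

theorem dirDeriv_numOp {F : (Fin n → ℂ) → SA G} {z : Fin n → ℂ} (hF : DiffCoeffAt F z)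
    (v : Fin n → ℂ) : dirDeriv v (fun w => SA.numOp (F w)) z = SA.numOp (dirDeriv v F z) := by
  ext m
  simp only [coeff_dirDeriv, SA.coeff_numOp]
  rw [fderiv_const_mul (hF m)]
  rfl

theorem SmoothCoeffOn.numOp {F : (Fin n → ℂ) → SA G} {O : Set (Fin n → ℂ)}
    (hF : SmoothCoeffOn F O) : SmoothCoeffOn (fun z => SA.numOp (F z)) O :=
  fun m => contDiffOn_const.mul (hF m)

end Algebra

end

/-! ### The Piola identity; even Grassmann elements; the ring of smooth even functions and its
derivations. -/

section

/-! ### Derivations and determinants -/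

section Piola

variable {k R ι : Type*} [CommRing k] [CommRing R] [Algebra k R] [Fintype ι] [DecidableEq ι]

theorem derivation_prod (D : Derivation k R R) (s : Finset ι) (f : ι → R) :
    D (∏ i ∈ s, f i) = ∑ i ∈ s, (∏ l ∈ s.erase i, f l) * D (f i) := by
  induction s using Finset.induction_on with
  | empty => simp
  | insert a s ha ih =>
    rw [Finset.prod_insert ha, Derivation.leibniz, ih, Finset.sum_insert ha,
      Finset.erase_insert ha, add_comm, smul_eq_mul, smul_eq_mul, Finset.mul_sum]
    congr 1
    refine Finset.sum_congr rfl fun i hi => ?_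
    rw [Finset.erase_insert_of_ne (by rintro rfl; exact ha hi),
      Finset.prod_insert (fun h => ha (Finset.mem_of_mem_erase h)), mul_assoc]

theorem derivation_det (D : Derivation k R R) (M : Matrix ι ι R) :
    D M.det = ∑ i, (M.updateRow i fun j => D (M i j)).det := by
  have h : ∀ σ : Equiv.Perm ι, D (Equiv.Perm.sign σ • ∏ i, M.transpose (σ i) i) =
      ∑ i, Equiv.Perm.sign σ •
        ∏ l, (M.updateRow i fun j => D (M i j)).transpose (σ l) l := by
    intro σ
    rw [Units.smul_def, map_zsmul, derivation_prod, Finset.smul_sum]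
    refine Finset.sum_congr rfl fun i _ => ?_
    rw [Units.smul_def]
    congr 1
    rw [← Finset.prod_erase_mul _ _ (Finset.mem_univ i)]
    congr 1
    · refine Finset.prod_congr rfl fun l hl => ?_
      rw [Matrix.transpose_apply, Matrix.transpose_apply,
        Matrix.updateRow_ne (Finset.ne_of_mem_erase hl)]
    · rw [Matrix.transpose_apply, Matrix.transpose_apply, Matrix.updateRow_self]
  rw [← Matrix.det_transpose, Matrix.det_apply, map_sum, Finset.sum_congr rfl fun σ _ => h σ,
    Finset.sum_comm]
  refine Finset.sum_congr rfl fun i _ => ?_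
  rw [← Matrix.det_transpose, Matrix.det_apply]

theorem det_updateRow_eq_sum (M : Matrix ι ι R) (i : ι) (b : ι → R) :
    (M.updateRow i b).det = ∑ j, M.adjugate j i * b j := by
  have h := Matrix.cramer_transpose_apply M b i
  rw [← h, Matrix.cramer_eq_adjugate_mulVec, ← Matrix.adjugate_transpose]
  rfl

theorem derivation_det_eq_adjugate (D : Derivation k R R) (M : Matrix ι ι R) :
    D M.det = ∑ i, ∑ j, M.adjugate j i * D (M i j) := by
  rw [derivation_det]
  exact Finset.sum_congr rfl fun i _ => det_updateRow_eq_sum M i _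

/-- The Piola identity: the columns of the adjugate of a Jacobian matrix are divergence free. -/
theorem piola (D : ι → Derivation k R R) (hD : ∀ i j x, D i (D j x) = D j (D i x)) (g : ι → R)
    (i : ι) : ∑ j, D j ((Matrix.of fun a b => D b (g a)).adjugate j i) = 0 := by
  set A : Matrix ι ι R := Matrix.of fun a b => D b (g a) with hA
  have h1 : ∀ j, D j (A.adjugate j i) = ∑ a ∈ Finset.univ.erase i, ∑ l,
      D j (D l (g a)) * ((A.updateRow i (Pi.single j 1)).updateRow a (Pi.single l 1)).det := by
    intro j
    rw [Matrix.adjugate_apply, derivation_det, ← Finset.add_sum_erase _ _ (Finset.mem_univ i)]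
    -- Row `i` of the matrix for the cofactor is constant, so its derivative is a zero row and only
    -- the other rows contribute.
    have h0 : ((A.updateRow i (Pi.single j 1)).updateRow i fun l =>
        D j ((A.updateRow i (Pi.single j 1)) i l)).det = 0 := by
      refine Matrix.det_eq_zero_of_row_eq_zero i fun l => ?_
      rw [Matrix.updateRow_self, Matrix.updateRow_self]
      by_cases h : l = j
      · subst h; simp
      · simp [h]
    rw [h0, zero_add]
    refine Finset.sum_congr rfl fun a ha => ?_
    have ha' := Finset.ne_of_mem_erase ha
    rw [det_updateRow_eq_sum]
    refine Finset.sum_congr rfl fun l _ => ?_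
    rw [Matrix.adjugate_apply, Matrix.updateRow_ne ha', mul_comm]
    rfl
  rw [Finset.sum_congr rfl fun j _ => h1 j, Finset.sum_comm]
  refine Finset.sum_eq_zero fun a ha => ?_
  have hai : i ≠ a := (Finset.ne_of_mem_erase ha).symm
  rw [← Finset.sum_product']
  -- Interchanging the two unit rows changes the sign of the minor while the second derivative is
  -- symmetric in `j` and `l`. Hence the terms for `(j, l)` and `(l, j)` cancel, and those with `j =
  -- l` vanish.
  have hswap : ∀ j l, ((A.updateRow i (Pi.single j 1)).updateRow a (Pi.single l 1)).det =
      -((A.updateRow i (Pi.single l 1)).updateRow a (Pi.single j 1)).det := by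
    intro j l
    have h := Matrix.det_permute (Equiv.swap i a)
      ((A.updateRow i (Pi.single l 1)).updateRow a (Pi.single j 1))
    rw [Equiv.Perm.sign_swap hai] at h
    have e : (((A.updateRow i (Pi.single l 1)).updateRow a (Pi.single j 1)).submatrix
        (Equiv.swap i a) id) = (A.updateRow i (Pi.single j 1)).updateRow a (Pi.single l 1) := by
      ext r c
      rw [Matrix.submatrix_apply, id]
      by_cases hra : r = a
      · subst hra
        rw [Equiv.swap_apply_right, Matrix.updateRow_ne hai, Matrix.updateRow_self,
          Matrix.updateRow_self]
      · by_cases hri : r = i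
        · subst hri
          rw [Equiv.swap_apply_left, Matrix.updateRow_self, Matrix.updateRow_ne hra,
            Matrix.updateRow_self]
        · rw [Equiv.swap_apply_of_ne_of_ne hri hra, Matrix.updateRow_ne hra,
            Matrix.updateRow_ne hra, Matrix.updateRow_ne hri, Matrix.updateRow_ne hri]
    rw [← e, h]
    simp
  refine Finset.sum_involution (fun q _ => (q.2, q.1)) ?_ ?_ ?_ ?_
  · rintro ⟨j, l⟩ -
    simp only
    rw [hswap l j, hD l j]
    ring
  · rintro ⟨j, l⟩ - hne heq
    apply hne
    simp only [Prod.mk.injEq] at heq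
    obtain ⟨rfl, -⟩ := heq
    refine mul_eq_zero_of_right _ (Matrix.det_zero_of_row_eq hai ?_)
    rw [Matrix.updateRow_ne hai, Matrix.updateRow_self, Matrix.updateRow_self]
  · simp
  · simp

/-- By the Piola identity the derivatives of the adjugate drop out; in what remains `N` commutes
past `D j`, and Jacobi's formula for the derivative of a determinant applies. This is the
infinitesimal change of variables: deforming `g` by `N` changes the Jacobian determinant by a
divergence. -/
theorem divergence_adjugate (D : ι → Derivation k R R) (hD : ∀ i j x, D i (D j x) = D j (D i x))
    (N : Derivation k R R) (hN : ∀ j x, N (D j x) = D j (N x)) (g : ι → R) :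
    ∑ j, D j (∑ i, (Matrix.of fun a b => D b (g a)).adjugate j i * N (g i)) =
      N (Matrix.of fun a b => D b (g a)).det := by
  simp only [map_sum, Derivation.leibniz, smul_eq_mul]
  rw [Finset.sum_comm, derivation_det_eq_adjugate]
  refine Finset.sum_congr rfl fun i _ => ?_
  rw [Finset.sum_add_distrib, ← Finset.mul_sum, piola D hD g i, mul_zero, add_zero]
  exact Finset.sum_congr rfl fun j _ => by rw [Matrix.of_apply, hN]

end Piola

/-! ### The Grassmann algebra -/

theorem CS.IsEven.homog {x : CS} (hx : x.IsEven) : SA.Homog 0 0 x := fun m hm => by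
  have hd : monoParity m = (m.degree : ZMod 2) := by
    simp [monoParity, Finsupp.sum, Finsupp.degree_apply, GradedGen.parity]
  have hf : formDegree m = 0 := by
    simp [formDegree, Finsupp.sum, GradedGen.formDeg]
  refine ⟨hf, ?_⟩
  rw [hd, ZMod.natCast_eq_zero_iff_even, ← Nat.not_odd_iff_even]
  exact fun h => hm (hx m h)

theorem CS.IsEven.commute {x : CS} (hx : x.IsEven) (y : CS) : Commute x y := hx.homog.central y

theorem CS0.coe_commute (x : CS0) (y : CS) : Commute (x : CS) y := CS.IsEven.commute x.2 y

theorem CS.isEven_algebraMap (c : ℂ) : (algebraMap ℂ CS c).IsEven := fun m hm => by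
  rw [SA.coeff_algebraMap, if_neg]
  rintro rfl
  simp at hm

theorem CS.IsEven.smul {x : CS} (c : ℂ) (hx : x.IsEven) : (c • x).IsEven := fun m hm => by
  rw [SA.coeff_smul, hx m hm, mul_zero]

theorem CS.IsEven.add {x y : CS} (hx : x.IsEven) (hy : y.IsEven) : (x + y).IsEven :=
  CS0.add_mem hx hy

theorem CS.IsEven.sub {x y : CS} (hx : x.IsEven) (hy : y.IsEven) : (x - y).IsEven :=
  CS0.sub_mem hx hy

theorem CS.IsEven.mul {x y : CS} (hx : x.IsEven) (hy : y.IsEven) : (x * y).IsEven :=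
  CS0.mul_mem hx hy

theorem CS.isEven_sum {ι : Type*} {s : Finset ι} {f : ι → CS} (h : ∀ i ∈ s, (f i).IsEven) :
    (∑ i ∈ s, f i).IsEven := CS0.sum_mem h

theorem CS.IsEven.pow {x : CS} (hx : x.IsEven) (k : ℕ) : (x ^ k).IsEven :=
  CS0.pow_mem hx k

instance : Algebra ℂ CS0 :=
  RingHom.toAlgebra ((algebraMap ℂ CS).codRestrict CS0 CS.isEven_algebraMap)

@[simp] theorem CS0.coe_smul (c : ℂ) (x : CS0) : ((c • x : CS0) : CS) = c • (x : CS) := by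
  rw [Algebra.smul_def, Algebra.smul_def]
  rfl

@[simp] theorem CS.coeff_conj (x : CS) (m : ℕ →₀ ℕ) :
    x.conj.coeff m = (starRingEnd ℂ) (x.coeff m) := rfl

theorem CS.conj_mul (x y : CS) : (x * y).conj = x.conj * y.conj := by
  refine SA.ext_adm fun m hm => ?_
  rw [CS.coeff_conj, SA.coeff_mul _ _ hm, SA.coeff_mul _ _ hm, map_sum]
  refine Finset.sum_congr rfl fun p _ => ?_
  simp

/-- Conjugation as a ring homomorphism. -/
def CS.conjHom : CS →+* CS where
  toFun := CS.conj
  map_one' := by ext m; rw [CS.coeff_conj, SA.coeff_one]; split_ifs <;> simp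
  map_mul' := CS.conj_mul
  map_zero' := by ext m; simp
  map_add' x y := by ext m; simp

theorem CS.IsEven.conj {x : CS} (hx : x.IsEven) : x.conj.IsEven := fun m hm => by
  rw [CS.coeff_conj, hx m hm, map_zero]

theorem CS.conj_smul (c : ℂ) (x : CS) : (c • x).conj = (starRingEnd ℂ) c • x.conj := by
  ext m; simp

theorem CS.conj_conj (x : CS) : x.conj.conj = x := by ext m; simp

theorem CS.numOp_conj (x : CS) : SA.numOp x.conj = CS.conj (SA.numOp x) := by ext m; simp

theorem CS.IsEven.numOp {x : CS} (hx : x.IsEven) : CS.IsEven (SA.numOp x) := fun m hm => by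
  rw [SA.coeff_numOp, hx m hm, mul_zero]

theorem CS.IsEven.exp {x : CS} (hx : x.IsEven) : CS.IsEven (SA.exp x) := fun m hm => by
  change ∑' k : ℕ, ((k ! : ℂ))⁻¹ * (x ^ k).coeff m = 0
  simp [fun k => hx.pow k m hm]

/-- Conjugation on the even elements. -/
def CS0.conjHom : CS0 →+* CS0 :=
  (CS.conjHom.comp CS0.subtype).codRestrict CS0 fun x => CS.IsEven.conj x.2

@[simp] theorem CS0.coe_conjHom (x : CS0) : ((CS0.conjHom x : CS0) : CS) = (x : CS).conj := rfl

theorem CS.evenPart_of_isEven {x : CS} (hx : x.IsEven) : (x.evenPart : CS) = x := by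
  ext m
  change (if Even m.degree then x.coeff m else 0) = _
  split_ifs with h
  · rfl
  · exact (hx m (Nat.not_even_iff_odd.1 h)).symm

theorem CS0.evenPart_coe (x : CS0) : (x : CS).evenPart = x :=
  Subtype.ext (CS.evenPart_of_isEven x.2)

/-- The body map on even elements, as a ring homomorphism. -/
def CS0.bodyHom : CS0 →+* ℂ where
  toFun x := body x
  map_one' := by simp [body, SA.coeff_one]
  map_mul' x y := SA.coeff_mul_zero _ _
  map_zero' := rfl
  map_add' _ _ := rfl

theorem CS0.bodyHom_apply (x : CS0) : CS0.bodyHom x = body (x : CS) := rfl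

/-! ### The ring of smooth functions with even values -/

variable {n : ℕ}

theorem dirDeriv_const_smul {G : Type} [LinearOrder G] [GradedGen G] {F : (Fin n → ℂ) → SA G}
    {z : Fin n → ℂ} (hF : DiffCoeffAt F z) (c : ℂ) (v : Fin n → ℂ) :
    dirDeriv v (fun w => c • F w) z = c • dirDeriv v F z := by
  ext m
  simp only [coeff_dirDeriv, SA.coeff_smul]
  rw [fderiv_const_mul (hF m)]
  rfl

theorem SmoothCoeffOn.conj {F : (Fin n → ℂ) → CS} {O : Set (Fin n → ℂ)}
    (hF : SmoothCoeffOn F O) : SmoothCoeffOn (fun z => (F z).conj) O := fun m =>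
  Complex.conjCLE.contDiff.comp_contDiffOn (hF m)

theorem dirDeriv_conj {F : (Fin n → ℂ) → CS} {z : Fin n → ℂ} (hF : DiffCoeffAt F z)
    (v : Fin n → ℂ) : dirDeriv v (fun w => (F w).conj) z = CS.conj (dirDeriv v F z) := by
  ext m
  rw [coeff_dirDeriv, CS.coeff_conj, coeff_dirDeriv]
  have h := (Complex.conjCLE.toContinuousLinearMap.hasFDerivAt.comp z (hF m).hasFDerivAt).fderiv
  exact congrArg (fun L => L v) h

variable (n) in
/-- Smooth functions with values in the even part of the Grassmann algebra, as a subalgebra. -/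
def smoothSubalgebra : Subalgebra ℂ ((Fin n → ℂ) → CS0) where
  carrier := {F | SmoothCoeffOn (fun z => (F z : CS)) Set.univ}
  mul_mem' hF hH := SmoothCoeffOn.mul hF hH
  add_mem' hF hH := SmoothCoeffOn.add hF hH
  algebraMap_mem' c := smoothCoeffOn_const (algebraMap ℂ CS c) _

variable (n) in
/-- Smooth functions with values in the even part of the Grassmann algebra. -/
def SmoothEven : Type := smoothSubalgebra n

instance : CommRing (SmoothEven n) := inferInstanceAs (CommRing (smoothSubalgebra n))
instance : Algebra ℂ (SmoothEven n) := inferInstanceAs (Algebra ℂ (smoothSubalgebra n))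

namespace SmoothEven

/-- The underlying function with values in the Grassmann algebra. -/
def fn (F : SmoothEven n) (z : Fin n → ℂ) : CS := (F.1 z : CS)

theorem smooth (F : SmoothEven n) : SmoothCoeffOn F.fn Set.univ := F.2

theorem isEven (F : SmoothEven n) (z : Fin n → ℂ) : (F.fn z).IsEven := (F.1 z).2

theorem diffAt (F : SmoothEven n) (z : Fin n → ℂ) : DiffCoeffAt F.fn z :=
  F.smooth.diffCoeffAt isOpen_univ (Set.mem_univ z)

/-- Construct an element from a function. -/
def mk (F : (Fin n → ℂ) → CS) (he : ∀ z, (F z).IsEven) (hs : SmoothCoeffOn F Set.univ) :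
    SmoothEven n := ⟨fun z => ⟨F z, he z⟩, hs⟩

@[simp] theorem fn_mk (F : (Fin n → ℂ) → CS) (he hs) : (mk F he hs).fn = F := rfl

@[ext] theorem ext {F H : SmoothEven n} (h : ∀ z, F.fn z = H.fn z) : F = H :=
  Subtype.ext (funext fun z => Subtype.ext (h z))

@[simp] theorem fn_add (F H : SmoothEven n) (z) : (F + H).fn z = F.fn z + H.fn z := rfl
@[simp] theorem fn_mul (F H : SmoothEven n) (z) : (F * H).fn z = F.fn z * H.fn z := rfl
@[simp] theorem fn_neg (F : SmoothEven n) (z) : (-F).fn z = -F.fn z := rfl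
@[simp] theorem fn_sub (F H : SmoothEven n) (z) : (F - H).fn z = F.fn z - H.fn z := rfl
@[simp] theorem fn_smul (c : ℂ) (F : SmoothEven n) (z) : (c • F).fn z = c • F.fn z :=
  CS0.coe_smul c (F.1 z)

/-- Evaluation at a point. -/
def evalHom (z : Fin n → ℂ) : SmoothEven n →+* CS0 :=
  (Pi.evalRingHom (fun _ => CS0) z).comp (smoothSubalgebra n).val.toRingHom

theorem coe_evalHom (z : Fin n → ℂ) (F : SmoothEven n) : (evalHom z F : CS) = F.fn z := rfl

theorem fn_sum {ι : Type*} (s : Finset ι) (f : ι → SmoothEven n) (z) :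
    (∑ i ∈ s, f i).fn z = ∑ i ∈ s, (f i).fn z :=
  map_sum (CS0.subtype.comp (evalHom z)) f s

theorem fn_pow (F : SmoothEven n) (k : ℕ) (z) : (F ^ k).fn z = F.fn z ^ k :=
  map_pow (CS0.subtype.comp (evalHom z)) F k

theorem isEven_dirDeriv {F : (Fin n → ℂ) → CS} (he : ∀ z, (F z).IsEven) (v z : Fin n → ℂ) :
    CS.IsEven (dirDeriv v F z) := fun m hm => by
  simp [fun w => he w m hm]

/-- The directional derivative. -/
def dirDer (v : Fin n → ℂ) : Derivation ℂ (SmoothEven n) (SmoothEven n) :=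
  Derivation.mk'
    { toFun := fun F => mk (dirDeriv v F.fn) (isEven_dirDeriv F.isEven v)
        (F.smooth.dirDeriv isOpen_univ v)
      map_add' := fun F H => ext fun z => dirDeriv_add (F.diffAt z) (H.diffAt z) v
      map_smul' := fun c F => ext fun z => by
        have h : (c • F).fn = fun w => c • F.fn w := funext (fn_smul c F)
        rw [RingHom.id_apply, fn_smul, fn_mk, fn_mk, h, dirDeriv_const_smul (F.diffAt z)] }
    fun F H => ext fun z => by
      change dirDeriv v (fun w => F.fn w * H.fn w) z = F.fn z * dirDeriv v H.fn z +
        H.fn z * dirDeriv v F.fn z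
      rw [dirDeriv_mul (F.diffAt z) (H.diffAt z), add_comm,
        ((H.isEven z).commute (dirDeriv v F.fn z)).eq]

theorem fn_dirDer (v : Fin n → ℂ) (F : SmoothEven n) : (dirDer v F).fn = dirDeriv v F.fn := rfl

theorem dirDer_comm (v w : Fin n → ℂ) (F : SmoothEven n) :
    dirDer v (dirDer w F) = dirDer w (dirDer v F) :=
  ext fun z => dirDeriv_comm F.smooth isOpen_univ v w (Set.mem_univ z)

/-- The derivative `∂/∂z_j`. -/
def dz (j : Fin n) : Derivation ℂ (SmoothEven n) (SmoothEven n) :=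
  (2⁻¹ : ℂ) • (dirDer (Pi.single j 1) - Complex.I • dirDer (Pi.single j Complex.I))

/-- The derivative `∂/∂z̄_j`. -/
def dzbar (j : Fin n) : Derivation ℂ (SmoothEven n) (SmoothEven n) :=
  (2⁻¹ : ℂ) • (dirDer (Pi.single j 1) + Complex.I • dirDer (Pi.single j Complex.I))

theorem dz_apply (j : Fin n) (F : SmoothEven n) : dz j F =
    (2⁻¹ : ℂ) • (dirDer (Pi.single j 1) F - Complex.I • dirDer (Pi.single j Complex.I) F) := rfl

theorem dzbar_apply (j : Fin n) (F : SmoothEven n) : dzbar j F =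
    (2⁻¹ : ℂ) • (dirDer (Pi.single j 1) F + Complex.I • dirDer (Pi.single j Complex.I) F) := rfl

theorem fn_dz (j : Fin n) (F : SmoothEven n) : (dz j F).fn = pderivZ j F.fn := by
  funext z
  rw [pderivZ_eq, dz_apply, fn_smul, fn_sub, fn_smul, fn_dirDer, fn_dirDer]

theorem fn_dzbar (j : Fin n) (F : SmoothEven n) : (dzbar j F).fn = pderivZbar j F.fn := by
  funext z
  rw [pderivZbar_eq, dzbar_apply, fn_smul, fn_add, fn_smul, fn_dirDer, fn_dirDer]

theorem dz_comm (i j : Fin n) (F : SmoothEven n) : dz i (dz j F) = dz j (dz i F) := by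
  simp only [dz_apply, map_sub, smul_sub, Derivation.map_smul]
  simp only [dirDer_comm (Pi.single i _) (Pi.single j _)]
  module

theorem dzbar_dz_comm (i j : Fin n) (F : SmoothEven n) : dzbar i (dz j F) = dz j (dzbar i F) := by
  simp only [dz_apply, dzbar_apply, map_sub, map_add, smul_sub, smul_add,
    Derivation.map_smul]
  simp only [dirDer_comm (Pi.single i _) (Pi.single j _)]
  module

/-- The number operator. -/
def num : Derivation ℂ (SmoothEven n) (SmoothEven n) :=
  Derivation.mk'
    { toFun := fun F => mk (fun z => SA.numOp (F.fn z)) (fun z => (F.isEven z).numOp) F.smooth.numOp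
      map_add' := fun F H => ext fun z => map_add SA.numOp (F.fn z) (H.fn z)
      map_smul' := fun c F => ext fun z => by
        rw [RingHom.id_apply, fn_smul, fn_mk, fn_mk, fn_smul, map_smul] }
    fun F H => ext fun z => by
      change SA.numOp (F.fn z * H.fn z) = F.fn z * SA.numOp (H.fn z) + H.fn z * SA.numOp (F.fn z)
      rw [SA.numOp_mul, add_comm, ((H.isEven z).commute (SA.numOp (F.fn z))).eq]

theorem fn_num (F : SmoothEven n) (z : Fin n → ℂ) : (num F).fn z = SA.numOp (F.fn z) := rfl

theorem num_dirDer (v : Fin n → ℂ) (F : SmoothEven n) : num (dirDer v F) = dirDer v (num F) :=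
  ext fun z => (dirDeriv_numOp (F.diffAt z) v).symm

theorem num_dz (j : Fin n) (F : SmoothEven n) : num (dz j F) = dz j (num F) := by
  rw [dz_apply, dz_apply, Derivation.map_smul, map_sub, Derivation.map_smul, num_dirDer, num_dirDer]

/-- Conjugation. -/
def conj : SmoothEven n →+* SmoothEven n where
  toFun F := mk (fun z => (F.fn z).conj) (fun z => (F.isEven z).conj) F.smooth.conj
  map_one' := ext fun _ => map_one CS.conjHom
  map_zero' := ext fun _ => map_zero CS.conjHom
  map_mul' F H := ext fun z => CS.conj_mul (F.fn z) (H.fn z)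
  map_add' F H := ext fun z => map_add CS.conjHom (F.fn z) (H.fn z)

theorem fn_conj (F : SmoothEven n) (z : Fin n → ℂ) : (conj F).fn z = (F.fn z).conj := rfl

theorem conj_conj (F : SmoothEven n) : conj (conj F) = F := ext fun z => CS.conj_conj (F.fn z)

theorem conj_smul (c : ℂ) (F : SmoothEven n) : conj (c • F) = (starRingEnd ℂ) c • conj F :=
  ext fun z => by rw [fn_conj, fn_smul, fn_smul, CS.conj_smul, fn_conj]

theorem num_conj (F : SmoothEven n) : num (conj F) = conj (num F) :=
  ext fun z => CS.numOp_conj (F.fn z)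

theorem dirDer_conj (v : Fin n → ℂ) (F : SmoothEven n) : dirDer v (conj F) = conj (dirDer v F) :=
  ext fun z => dirDeriv_conj (F.diffAt z) v

theorem dzbar_conj (j : Fin n) (F : SmoothEven n) : dzbar j (conj F) = conj (dz j F) := by
  rw [dz_apply, dzbar_apply, conj_smul, map_sub, conj_smul, dirDer_conj, dirDer_conj]
  simp [Complex.conj_ofNat]

theorem dz_conj (j : Fin n) (F : SmoothEven n) : dz j (conj F) = conj (dzbar j F) := by
  rw [dz_apply, dzbar_apply, conj_smul, map_add, conj_smul, dirDer_conj, dirDer_conj]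
  simp [sub_eq_add_neg, Complex.conj_ofNat]

end SmoothEven

end

/-! ### Exponentials of smooth even functions; inverses of elements with non-zero body. -/

section

variable {n : ℕ}

namespace SmoothEven

/-- The body of a smooth function. -/
def bodyPart (x : SmoothEven n) : SmoothEven n :=
  mk (fun z => ((x.fn z).coeff 0) • 1) (fun _ => CS.IsEven.smul _ CS0.one_mem)
    (SmoothCoeffOn.smul (x.smooth 0) (smoothCoeffOn_const 1 _))

/-- The exponential of the body of a smooth function. -/
def expBody (x : SmoothEven n) : SmoothEven n :=
  mk (fun z => Complex.exp ((x.fn z).coeff 0) • 1) (fun _ => CS.IsEven.smul _ CS0.one_mem)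
    (SmoothCoeffOn.smul (x.smooth 0).cexp (smoothCoeffOn_const 1 _))

theorem fn_bodyPart (x : SmoothEven n) (z) : x.bodyPart.fn z = ((x.fn z).coeff 0) • 1 := rfl

theorem fn_expBody (x : SmoothEven n) (z) :
    x.expBody.fn z = Complex.exp ((x.fn z).coeff 0) • 1 := rfl

theorem fil_soul (x : SmoothEven n) (z) : SA.Fil 1 ((x - x.bodyPart).fn z) :=
  SA.fil_one_iff.2 (by rw [fn_sub, fn_bodyPart]; simp [SA.coeff_one])

/-- Truncations of the exponential series. -/
def expTrunc (x : SmoothEven n) (N : ℕ) : SmoothEven n :=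
  x.expBody * ∑ k ∈ Finset.range N, ((k ! : ℂ))⁻¹ • (x - x.bodyPart) ^ k

theorem fn_expTrunc (x : SmoothEven n) (N : ℕ) (z) : (x.expTrunc N).fn z =
    Complex.exp ((x.fn z).coeff 0) • ∑ k ∈ Finset.range N, ((k ! : ℂ))⁻¹ •
      ((x - x.bodyPart).fn z) ^ k := by
  rw [expTrunc, fn_mul, fn_expBody, smul_mul_assoc, one_mul, fn_sum]
  simp only [fn_smul, fn_pow]

theorem exp_fil_expTrunc (x : SmoothEven n) (N : ℕ) (z) :
    SA.Fil N (SA.exp (x.fn z) - (x.expTrunc N).fn z) := by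
  rw [SA.exp_body_soul, fn_expTrunc, ← smul_sub]
  exact (SA.exp_fil (fil_soul x z) N).smul _

theorem coeff_exp_eq (x : SmoothEven n) {N : ℕ} {m : ℕ →₀ ℕ} (hm : m.degree < N) (z) :
    (SA.exp (x.fn z)).coeff m = ((x.expTrunc N).fn z).coeff m := by
  have := exp_fil_expTrunc x N z m hm
  rw [SA.coeff_sub] at this
  exact sub_eq_zero.1 this

/-- The exponential of a smooth function with even values. -/
def exp (x : SmoothEven n) : SmoothEven n :=
  mk (fun z => SA.exp (x.fn z)) (fun z => (x.isEven z).exp) fun m => by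
    simp only [coeff_exp_eq x (Nat.lt_succ_self m.degree)]
    exact (x.expTrunc _).smooth m

theorem fn_exp (x : SmoothEven n) (z) : (exp x).fn z = SA.exp (x.fn z) := rfl

/-- The exponential is not a polynomial in `x`, but each of its coefficients agrees with that of a
truncation. By `hloc` the derivation may be computed on the truncation, `hfil` keeps the truncation
error long enough to be invisible, and `hbody` is the scalar chain rule for the body factor. -/
theorem derivation_exp (D : Derivation ℂ (SmoothEven n) (SmoothEven n))
    (hloc : ∀ (F H : SmoothEven n) (m : ℕ →₀ ℕ), (∀ z, (F.fn z).coeff m = (H.fn z).coeff m) →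
      ∀ z, ((D F).fn z).coeff m = ((D H).fn z).coeff m)
    (hfil : ∀ F : SmoothEven n, (∀ z, SA.Fil 1 (F.fn z)) → ∀ z, SA.Fil 1 ((D F).fn z))
    (x : SmoothEven n) (hbody : D x.expBody = D x.bodyPart * x.expBody) :
    D (exp x) = D x * exp x := by
  refine ext fun z => SA.ext fun m => ?_
  set N := m.degree + 1 with hN
  set y := x - x.bodyPart with hy
  have hm : m.degree < N := Nat.lt_succ_self _
  rw [hloc (exp x) (x.expTrunc N) m (fun z => coeff_exp_eq x hm z) z]
  have hr : ((D x * exp x).fn z).coeff m = ((D x * x.expTrunc N).fn z).coeff m := by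
    rw [← sub_eq_zero, ← SA.coeff_sub, fn_mul, fn_mul, ← mul_sub]
    exact (exp_fil_expTrunc x N z).mul_left _ m hm
  rw [hr]
  -- Differentiating the truncated series lowers its order by one. The missing last term contains `y
  -- ^ (N - 1) * D y`, which has length at least `N` and does not reach the coefficient at `m`.
  have hD : D (x.expTrunc N) = D x * x.expTrunc N -
      ((N - 1)! : ℂ)⁻¹ • (x.expBody * (y ^ (N - 1) * D y)) := by
    have h1 : D (∑ k ∈ Finset.range N, ((k ! : ℂ))⁻¹ • y ^ k) =
        (∑ k ∈ Finset.range N, ((k ! : ℂ))⁻¹ • y ^ k) * D y -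
          ((N - 1)! : ℂ)⁻¹ • (y ^ (N - 1) * D y) := by
      rw [hN, Nat.add_sub_cancel, Finset.sum_range_succ, add_mul, smul_mul_assoc, add_sub_cancel_right,
        ← Finset.sum_range_succ, Finset.sum_range_succ', map_add, map_sum, Finset.sum_mul]
      simp only [pow_zero, Derivation.map_smul, Derivation.map_one_eq_zero, smul_zero, add_zero]
      refine Finset.sum_congr rfl fun k _ => ?_
      rw [Derivation.leibniz_pow, Nat.add_sub_cancel, smul_eq_mul, smul_mul_assoc,
        ← Nat.cast_smul_eq_nsmul ℂ, smul_smul, Nat.factorial_succ]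
      congr 1
      have : ((k + 1 : ℕ) : ℂ) ≠ 0 := by exact_mod_cast Nat.succ_ne_zero k
      push_cast at this ⊢
      field_simp
    have h2 : D x = D x.bodyPart + D y := by
      rw [← map_add, hy, add_sub_cancel]
    rw [expTrunc, Derivation.leibniz, hbody, h1, h2, smul_eq_mul, smul_eq_mul, mul_sub,
      mul_smul_comm]
    ring
  rw [hD, fn_sub, SA.coeff_sub, sub_eq_self, fn_smul, SA.coeff_smul, fn_mul, fn_mul, fn_pow]
  refine mul_eq_zero_of_right _ ((SA.Fil.mul_left _ ?_) m hm)
  exact ((fil_soul x z).pow (N - 1)).mul (hfil y (fil_soul x) z)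

theorem dirDer_exp (v : Fin n → ℂ) (x : SmoothEven n) :
    dirDer v (exp x) = dirDer v x * exp x := by
  refine derivation_exp _ (fun F H m h z => ?_) (fun F hF z => ?_) x (ext fun z => SA.ext fun m => ?_)
  · rw [fn_dirDer, fn_dirDer, coeff_dirDeriv, coeff_dirDeriv, funext h]
  · rw [SA.fil_one_iff, fn_dirDer, coeff_dirDeriv]
    simp [fun w => SA.fil_one_iff.1 (hF w)]
  · rw [fn_mul, fn_expBody, mul_smul_comm, mul_one, SA.coeff_smul, fn_dirDer, fn_dirDer,
      coeff_dirDeriv, coeff_dirDeriv]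
    simp only [fn_expBody, fn_bodyPart, SA.coeff_smul]
    have hd := x.diffAt z 0
    rw [fderiv_mul_const hd.cexp, fderiv_mul_const hd, hd.hasFDerivAt.cexp.fderiv]
    simp only [smul_apply, smul_eq_mul]
    ring

theorem num_exp (x : SmoothEven n) : num (exp x) = num x * exp x := by
  refine derivation_exp _ (fun F H m h z => ?_) (fun F hF z => ?_) x (ext fun z => ?_)
  · rw [fn_num, fn_num, SA.coeff_numOp, SA.coeff_numOp, h]
  · exact SA.fil_numOp _
  · have h1 : SA.numOp (1 : CS) = 0 := by
      ext m
      rw [SA.coeff_numOp, SA.coeff_one]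
      split_ifs with h <;> simp [h]
    rw [fn_num, fn_expBody, fn_mul, fn_num, fn_bodyPart, map_smul, map_smul, h1]
    simp

theorem dz_exp (j : Fin n) (x : SmoothEven n) : dz j (exp x) = dz j x * exp x := by
  rw [dz_apply, dz_apply, dirDer_exp, dirDer_exp]
  simp only [smul_mul_assoc, sub_mul]

theorem dzbar_exp (j : Fin n) (x : SmoothEven n) : dzbar j (exp x) = dzbar j x * exp x := by
  rw [dzbar_apply, dzbar_apply, dirDer_exp, dirDer_exp]
  simp only [smul_mul_assoc, add_mul]

end SmoothEven

/-! ### Inverses -/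

/-- The geometric series for the inverse of an element with non-zero body. -/
def CS.geomInv (x : CS) : CS :=
  SA.mk (fun m => (body x)⁻¹ * ∑ k ∈ Finset.range (m.degree + 1),
    ((1 - (body x)⁻¹ • x) ^ k).coeff m) fun m hm => by simp [SA.coeff_of_not _ hm]

/-- Up to the scalar `body x`, `x` is `1 - w` where `w` has no constant term. The partial sums of
the geometric series in `w` invert it modulo `w ^ N`, for every `N`. -/
theorem CS.mul_geomInv {x : CS} (hx : body x ≠ 0) : x * x.geomInv = 1 := by
  set w : CS := 1 - (body x)⁻¹ • x with hw
  have hw1 : SA.Fil 1 w := SA.fil_one_iff.2 (by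
    rw [hw, SA.coeff_sub, SA.coeff_smul, SA.coeff_one, if_pos rfl]
    exact sub_eq_zero.2 (inv_mul_cancel₀ hx).symm)
  refine SA.eq_of_fil fun N => ?_
  have hg : SA.Fil N (x.geomInv - (body x)⁻¹ • ∑ k ∈ Finset.range N, w ^ k) := fun m hm => by
    rw [SA.coeff_sub, SA.coeff_smul, SA.coeff_sum, sub_eq_zero]
    change (body x)⁻¹ * _ = _
    congr 1
    refine Finset.sum_subset (fun k hk => ?_) fun k _ hk => hw1.pow k m ?_
    · rw [Finset.mem_range] at hk ⊢; omega
    · rw [Finset.mem_range] at hk; omega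
  have hx' : x = body x • (1 - w) := by
    rw [hw, sub_sub_cancel, smul_smul, mul_inv_cancel₀ hx, one_smul]
  have e : x * x.geomInv - 1 = x * (x.geomInv - (body x)⁻¹ • ∑ k ∈ Finset.range N, w ^ k) -
      w ^ N := by
    have h2 : x * ((body x)⁻¹ • ∑ k ∈ Finset.range N, w ^ k) = 1 - w ^ N := by
      nth_rewrite 1 [hx']
      rw [smul_mul_smul_comm, mul_inv_cancel₀ hx, one_smul, mul_neg_geom_sum]
    rw [mul_sub, h2]
    abel
  rw [e]
  exact (hg.mul_left x).sub (hw1.pow N)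

theorem CS.IsEven.geomInv {x : CS} (hx : x.IsEven) : x.geomInv.IsEven := fun m hm => by
  change (body x)⁻¹ * _ = 0
  rw [Finset.sum_eq_zero fun k _ => ?_, mul_zero]
  exact (CS.IsEven.pow (CS.IsEven.sub CS0.one_mem (hx.smul _)) k) m hm

theorem SmoothCoeffOn.geomInv {F : (Fin n → ℂ) → CS} {O : Set (Fin n → ℂ)}
    (hF : SmoothCoeffOn F O) (h0 : ∀ z ∈ O, body (F z) ≠ 0) :
    SmoothCoeffOn (fun z => (F z).geomInv) O := fun m => by
  have hb : ContDiffOn ℝ ∞ (fun z => (body (F z))⁻¹) O := (hF 0).inv h0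
  refine hb.mul (ContDiffOn.sum fun k _ => ?_)
  exact SmoothCoeffOn.pow ((smoothCoeffOn_const 1 O).sub (SmoothCoeffOn.smul hb hF)) k m

/-- Even elements with non-zero body are invertible. -/
theorem CS0.mul_geomInv {x : CS0} (hx : body (x : CS) ≠ 0) :
    x * ⟨(x : CS).geomInv, CS.IsEven.geomInv x.2⟩ = 1 :=
  Subtype.ext (CS.mul_geomInv hx)

theorem CS0.isUnit_of_body_ne_zero {x : CS0} (hx : body (x : CS) ≠ 0) : IsUnit x :=
  IsUnit.of_mul_eq_one _ (CS0.mul_geomInv hx)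

end

/-! ### The Taylor extension to points with a soul. -/

section

variable {n : ℕ}

/-! ### The Taylor extension to Grassmann points -/

/-- The first order operator `F ↦ ∑ i, (∂_{v i} F) a i`. -/
def dirStep {ι : Type*} [Fintype ι] (v : ι → Fin n → ℂ) (a : ι → CS) (F : (Fin n → ℂ) → CS) :
    (Fin n → ℂ) → CS := fun z => ∑ i, dirDeriv (v i) F z * a i

section DirStep

variable {ι : Type*} [Fintype ι] {v : ι → Fin n → ℂ} {a b : ι → CS}

theorem SmoothCoeffOn.dirStep {F : (Fin n → ℂ) → CS} {O : Set (Fin n → ℂ)} (hF : SmoothCoeffOn F O)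
    (hO : IsOpen O) : SmoothCoeffOn (dirStep v a F) O :=
  smoothCoeffOn_sum fun _ _ => (hF.dirDeriv hO _).mul (smoothCoeffOn_const _ _)

theorem SmoothCoeffOn.dirStep_iterate {F : (Fin n → ℂ) → CS} {O : Set (Fin n → ℂ)}
    (hF : SmoothCoeffOn F O) (hO : IsOpen O) (k : ℕ) : SmoothCoeffOn ((SuperResidue.dirStep v a)^[k] F) O := by
  induction k with
  | zero => exact hF
  | succ k ih => rw [Function.iterate_succ_apply']; exact ih.dirStep hO

theorem dirDeriv_sum {G κ : Type} [LinearOrder G] [GradedGen G] (s : Finset κ)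
    {F : κ → (Fin n → ℂ) → SA G} {z : Fin n → ℂ} (hF : ∀ i, DiffCoeffAt (F i) z)
    (w : Fin n → ℂ) : dirDeriv w (fun x => ∑ i ∈ s, F i x) z = ∑ i ∈ s, dirDeriv w (F i) z := by
  ext m
  simp only [coeff_dirDeriv, SA.coeff_sum]
  rw [fderiv_fun_sum fun i _ => hF i m, sum_apply]

theorem dirStep_add {F H : (Fin n → ℂ) → CS} (hF : SmoothCoeffOn F Set.univ)
    (hH : SmoothCoeffOn H Set.univ) : dirStep v a (fun z => F z + H z) =
      fun z => dirStep v a F z + dirStep v a H z := by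
  funext z
  simp only [dirStep, dirDeriv_add (hF.diffCoeffAt isOpen_univ (Set.mem_univ z))
    (hH.diffCoeffAt isOpen_univ (Set.mem_univ z)), add_mul, Finset.sum_add_distrib]

theorem dirStep_sum {κ : Type} (s : Finset κ) {F : κ → (Fin n → ℂ) → CS}
    (hF : ∀ i, SmoothCoeffOn (F i) Set.univ) : dirStep v a (fun z => ∑ i ∈ s, F i z) =
      fun z => ∑ i ∈ s, dirStep v a (F i) z := by
  funext z
  simp only [dirStep]
  rw [Finset.sum_comm]
  refine Finset.sum_congr rfl fun i _ => ?_
  rw [dirDeriv_sum s fun l => (hF l).diffCoeffAt isOpen_univ (Set.mem_univ z), Finset.sum_mul]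

theorem dirStep_smul (c : ℂ) {F : (Fin n → ℂ) → CS} (hF : SmoothCoeffOn F Set.univ) :
    dirStep v a (fun z => c • F z) = fun z => c • dirStep v a F z := by
  funext z
  simp only [dirStep, dirDeriv_const_smul (hF.diffCoeffAt isOpen_univ (Set.mem_univ z)),
    Finset.smul_sum, smul_mul_assoc]

/-- Evenness of the `a i` is what makes the operator a derivation: the factor to the right of a
derivative of `F` has to pass `H z`. -/
theorem dirStep_mul (ha : ∀ i, (a i).IsEven) {F H : (Fin n → ℂ) → CS}
    (hF : SmoothCoeffOn F Set.univ) (hH : SmoothCoeffOn H Set.univ) :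
    dirStep v a (fun z => F z * H z) =
      fun z => dirStep v a F z * H z + F z * dirStep v a H z := by
  funext z
  simp only [dirStep, dirDeriv_mul (hF.diffCoeffAt isOpen_univ (Set.mem_univ z))
    (hH.diffCoeffAt isOpen_univ (Set.mem_univ z)), add_mul, Finset.sum_add_distrib,
    Finset.sum_mul, Finset.mul_sum]
  congr 1
  · refine Finset.sum_congr rfl fun i _ => ?_
    rw [mul_assoc, mul_assoc, ((ha i).commute (H z)).eq]
  · simp only [mul_assoc]

theorem dirStep_const (c : CS) : dirStep v a (fun _ => c) = fun _ => 0 := by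
  funext z
  simp [dirStep, dirDeriv_const]

theorem dirStep_comm (hb : ∀ i, (b i).IsEven) {F : (Fin n → ℂ) → CS}
    (hF : SmoothCoeffOn F Set.univ) :
    dirStep v a (dirStep v b F) = dirStep v b (dirStep v a F) := by
  have key : ∀ a b : ι → CS, dirStep v a (dirStep v b F) =
      fun z => ∑ i, ∑ j, dirDeriv (v i) (dirDeriv (v j) F) z * b j * a i := by
    intro a b
    funext z
    unfold dirStep
    refine Finset.sum_congr rfl fun i _ => ?_
    have hd : ∀ j, SmoothCoeffOn (fun z => dirDeriv (v j) F z * b j) Set.univ := fun j =>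
      (hF.dirDeriv isOpen_univ _).mul (smoothCoeffOn_const _ _)
    rw [show dirDeriv (v i) (fun z => ∑ j, dirDeriv (v j) F z * b j) z =
      ∑ j, dirDeriv (v i) (fun z => dirDeriv (v j) F z * b j) z from ?_, Finset.sum_mul]
    · refine Finset.sum_congr rfl fun j _ => ?_
      rw [dirDeriv_mul ((hF.dirDeriv isOpen_univ (v j)).diffCoeffAt isOpen_univ (Set.mem_univ z))
        ((smoothCoeffOn_const (b j) _).diffCoeffAt isOpen_univ (Set.mem_univ z)), dirDeriv_const,
        mul_zero, add_zero]
    · ext m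
      simp only [coeff_dirDeriv, SA.coeff_sum]
      rw [fderiv_fun_sum fun j _ => (hd j).diffCoeffAt isOpen_univ (Set.mem_univ z) m, sum_apply]
  rw [key a b, key b a]
  funext z
  rw [Finset.sum_comm]
  refine Finset.sum_congr rfl fun j _ => Finset.sum_congr rfl fun i _ => ?_
  rw [dirDeriv_comm hF isOpen_univ (v i) (v j) (Set.mem_univ z), mul_assoc, mul_assoc,
    ((hb j).commute (a i)).eq]

theorem dirStep_numOp {F : (Fin n → ℂ) → CS} (hF : SmoothCoeffOn F Set.univ) (z : Fin n → ℂ) :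
    SA.numOp (dirStep v a F z) = dirStep v a (fun z => SA.numOp (F z)) z +
      dirStep v (fun i => SA.numOp (a i)) F z := by
  simp only [dirStep, map_sum, SA.numOp_mul, Finset.sum_add_distrib,
    dirDeriv_numOp (hF.diffCoeffAt isOpen_univ (Set.mem_univ z))]

theorem dirStep_iterate_add {F H : (Fin n → ℂ) → CS} (hF : SmoothCoeffOn F Set.univ)
    (hH : SmoothCoeffOn H Set.univ) (k : ℕ) : (dirStep v a)^[k] (fun z => F z + H z) =
      fun z => (dirStep v a)^[k] F z + (dirStep v a)^[k] H z := by
  induction k with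
  | zero => rfl
  | succ k ih =>
    simp only [Function.iterate_succ_apply', ih]
    exact dirStep_add (hF.dirStep_iterate isOpen_univ k) (hH.dirStep_iterate isOpen_univ k)

theorem dirStep_iterate_mul (ha : ∀ i, (a i).IsEven) {F H : (Fin n → ℂ) → CS}
    (hF : SmoothCoeffOn F Set.univ) (hH : SmoothCoeffOn H Set.univ) (k : ℕ) :
    (dirStep v a)^[k] (fun z => F z * H z) = fun z =>
      ∑ q ∈ Finset.HasAntidiagonal.antidiagonal k, ((k.choose q.1 : ℕ) : ℂ) •
        ((dirStep v a)^[q.1] F z * (dirStep v a)^[q.2] H z) := by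
  induction k with
  | zero => funext z; simp
  | succ k ih =>
    rw [Function.iterate_succ_apply', ih, dirStep_sum]
    · funext z
      have h := Finset.sum_antidiagonal_choose_succ_nsmul
        (fun i j => (dirStep v a)^[i] F z * (dirStep v a)^[j] H z) k
      simp only [Nat.cast_smul_eq_nsmul]
      rw [h, ← Finset.sum_add_distrib]
      refine Finset.sum_congr rfl fun q hq => ?_
      have hs := (hF.dirStep_iterate (v := v) (a := a) isOpen_univ q.1)
      have hs' := (hH.dirStep_iterate (v := v) (a := a) isOpen_univ q.2)
      have h1 := congrFun (dirStep_smul (v := v) (a := a) ((k.choose q.1 : ℕ) : ℂ) (hs.mul hs')) z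
      simp only [Nat.cast_smul_eq_nsmul] at h1
      rw [h1, congrFun (dirStep_mul ha hs hs') z, Function.iterate_succ_apply',
        Function.iterate_succ_apply', smul_add, add_comm,
        Nat.choose_symm_of_eq_add (Finset.HasAntidiagonal.mem_antidiagonal.1 hq).symm]
    · intro q
      exact ((hF.dirStep_iterate isOpen_univ _).mul (hH.dirStep_iterate isOpen_univ _)).const_smul _

theorem fil_dirDeriv {F : (Fin n → ℂ) → CS} {d : ℕ} (h : ∀ z, SA.Fil d (F z)) (w z : Fin n → ℂ) :
    SA.Fil d (dirDeriv w F z) := fun m hm => by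
  rw [coeff_dirDeriv]
  simp [fun z => h z m hm]

theorem fil_dirStep {F : (Fin n → ℂ) → CS} {d e : ℕ} (h : ∀ z, SA.Fil d (F z))
    (ha : ∀ i, SA.Fil e (a i)) (z : Fin n → ℂ) : SA.Fil (d + e) (dirStep v a F z) :=
  SA.fil_sum fun i _ => (fil_dirDeriv h _ z).mul (ha i)

theorem fil_dirStep_iterate {F : (Fin n → ℂ) → CS} {d : ℕ} (h : ∀ z, SA.Fil d (F z))
    (ha : ∀ i, SA.Fil 1 (a i)) (k : ℕ) (z : Fin n → ℂ) :
    SA.Fil (d + k) ((dirStep v a)^[k] F z) := by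
  induction k generalizing z with
  | zero => exact h z
  | succ k ih => rw [Function.iterate_succ_apply']; exact fil_dirStep ih ha z

/-- The number operator falls either on `F` or on one of the `k + 1` factors `a`. The steps commute,
so all these factors contribute equally; the resulting `k + 1` turns `1/(k+1)!` into `1/k!` in the
Taylor series. -/
theorem numOp_dirStep_iterate (ha : ∀ i, (a i).IsEven) {F : (Fin n → ℂ) → CS}
    (hF : SmoothCoeffOn F Set.univ) (k : ℕ) (z : Fin n → ℂ) :
    SA.numOp ((dirStep v a)^[k + 1] F z) = (dirStep v a)^[k + 1] (fun z => SA.numOp (F z)) z +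
      ((k + 1 : ℕ) : ℂ) • (dirStep v a)^[k] (dirStep v (fun i => SA.numOp (a i)) F) z := by
  induction k generalizing z with
  | zero => simpa using dirStep_numOp hF z
  | succ k ih =>
    have hs := hF.dirStep_iterate (v := v) (a := a) isOpen_univ
    have hs' := (hF.dirStep (v := v) (a := fun i => SA.numOp (a i)) isOpen_univ).dirStep_iterate
      (v := v) (a := a) isOpen_univ
    have hsn := hF.numOp.dirStep_iterate (v := v) (a := a) isOpen_univ
    have hcomm : ∀ k, dirStep v (fun i => SA.numOp (a i)) ((dirStep v a)^[k] F) =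
        (dirStep v a)^[k] (dirStep v (fun i => SA.numOp (a i)) F) := by
      intro k
      induction k with
      | zero => rfl
      | succ k ih' =>
        rw [Function.iterate_succ_apply', dirStep_comm ha (hs k), ih',
          Function.iterate_succ_apply']
    rw [Function.iterate_succ_apply', dirStep_numOp (hs (k + 1)), hcomm]
    rw [show (fun z => SA.numOp ((dirStep v a)^[k + 1] F z)) = _ from funext ih]
    rw [congrFun (dirStep_add (hsn (k + 1)) ((hs' k).const_smul _)) z,
      congrFun (dirStep_smul _ (hs' k)) z, ← Function.iterate_succ_apply' (dirStep v a),
      ← Function.iterate_succ_apply' (dirStep v a), add_assoc]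
    congr 1
    rw [show ((k + 1 + 1 : ℕ) : ℂ) = ((k + 1 : ℕ) : ℂ) + 1 by push_cast; ring, add_smul, one_smul]

end DirStep

/-- The directions of the real coordinates. -/
def coordDir : Fin n ⊕ Fin n → Fin n → ℂ :=
  Sum.elim (fun j => Pi.single j 1) (fun j => Pi.single j Complex.I)

/-- The real and imaginary components of a Grassmann vector. -/
def reIm (s : Fin n → CS) : Fin n ⊕ Fin n → CS :=
  Sum.elim (fun j => (2⁻¹ : ℂ) • (s j + (s j).conj))
    (fun j => (2⁻¹ * Complex.I : ℂ) • ((s j).conj - s j))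

/-- This is `s ∂ + s̄ ∂̄ = (Re s) ∂_x + (Im s) ∂_y`. The real form treats all directions alike and
has coefficients fixed by conjugation. -/
theorem taylorStep_eq (s : Fin n → CS) : taylorStep s = dirStep coordDir (reIm s) := by
  funext F z
  simp only [taylorStep, dirStep, Fintype.sum_sum_type, coordDir, reIm, Sum.elim_inl, Sum.elim_inr]
  rw [← Finset.sum_add_distrib]
  refine Finset.sum_congr rfl fun j _ => ?_
  rw [pderivZ_eq, pderivZbar_eq]
  simp only [smul_mul_assoc, mul_smul_comm, sub_mul, mul_add, mul_sub, add_mul]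
  module

/-- The soul of the even coordinates of a point. -/
def SuperPoint.soul (p : SuperPoint n) (j : Fin n) : CS := p.z j - algebraMap ℂ CS (p.bodyPt j)

theorem SuperPoint.soul_even (p : SuperPoint n) (j : Fin n) : (p.soul j).IsEven :=
  (p.z_even j).sub (CS.isEven_algebraMap _)

theorem SuperPoint.soul_fil (p : SuperPoint n) (j : Fin n) : SA.Fil 1 (p.soul j) :=
  SA.fil_one_iff.2 (by
    rw [SuperPoint.soul, SA.coeff_sub, SA.coeff_algebraMap, if_pos rfl]
    exact sub_self _)

theorem isEven_reIm {s : Fin n → CS} (h : ∀ j, (s j).IsEven) (i) : (reIm s i).IsEven := by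
  cases i with
  | inl j => exact CS.IsEven.smul _ ((h j).add (h j).conj)
  | inr j => exact CS.IsEven.smul _ ((h j).conj.sub (h j))

theorem CS.fil_conj {x : CS} {d : ℕ} (h : SA.Fil d x) : SA.Fil d x.conj := fun m hm => by
  rw [CS.coeff_conj, h m hm, map_zero]

theorem fil_reIm {s : Fin n → CS} {d : ℕ} (h : ∀ j, SA.Fil d (s j)) (i) : SA.Fil d (reIm s i) := by
  cases i with
  | inl j => exact ((h j).add (CS.fil_conj (h j))).smul _
  | inr j => exact ((CS.fil_conj (h j)).sub (h j)).smul _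

theorem numOp_reIm (s : Fin n → CS) :
    (fun i => SA.numOp (reIm s i)) = reIm fun j => SA.numOp (s j) := by
  funext i
  cases i with
  | inl j => simp only [reIm, Sum.elim_inl, map_smul, map_add, CS.numOp_conj]
  | inr j => simp only [reIm, Sum.elim_inr, map_smul, map_sub, CS.numOp_conj]

/-- Truncations of the Taylor series. -/
def extTrunc (F : (Fin n → ℂ) → CS) (p : SuperPoint n) (N : ℕ) : CS :=
  ∑ k ∈ Finset.range N, ((k ! : ℂ))⁻¹ • (taylorStep p.soul)^[k] F p.bodyPt

theorem fil_taylorStep_iterate {F : (Fin n → ℂ) → CS} {d : ℕ} (h : ∀ z, SA.Fil d (F z))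
    (p : SuperPoint n) (k : ℕ) (z : Fin n → ℂ) :
    SA.Fil (d + k) ((taylorStep p.soul)^[k] F z) := by
  rw [taylorStep_eq]
  exact fil_dirStep_iterate h (fil_reIm p.soul_fil) k z

theorem fil_taylorStep_iterate_zero (F : (Fin n → ℂ) → CS) (p : SuperPoint n) (k : ℕ)
    (z : Fin n → ℂ) : SA.Fil k ((taylorStep p.soul)^[k] F z) := by
  simpa using fil_taylorStep_iterate (fun z => SA.fil_zero (F z)) p k z

/-- Each Taylor step multiplies by a soul and so raises the length by at least one. The cutoff in
`grassmannExt`, which depends on the coefficient, therefore agrees with any later cutoff. -/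
theorem grassmannExt_fil (F : (Fin n → ℂ) → CS) (p : SuperPoint n) (N : ℕ) :
    SA.Fil N (grassmannExt F p - extTrunc F p N) := fun m hm => by
  rw [SA.coeff_sub, extTrunc, SA.coeff_sum, sub_eq_zero]
  change ∑ k ∈ Finset.range (m.degree + 1), ((k ! : ℂ))⁻¹ *
      ((taylorStep p.soul)^[k] F p.bodyPt).coeff m = _
  refine Finset.sum_subset (fun k hk => ?_) fun k _ hk => ?_
  · rw [Finset.mem_range] at hk ⊢; omega
  · rw [fil_taylorStep_iterate_zero F p k _ m (by rw [Finset.mem_range] at hk; omega), mul_zero]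

theorem taylorStep_congr {F H : (Fin n → ℂ) → CS} {z : Fin n → ℂ} (s : Fin n → CS)
    (h : F =ᶠ[𝓝 z] H) : taylorStep s F =ᶠ[𝓝 z] taylorStep s H := by
  filter_upwards [h.eventuallyEq_nhds] with w hw
  simp only [taylorStep, pderivZ_congr hw, pderivZbar_congr hw]

/-- Only derivatives at the body point enter, so the value depends on the germ alone. This permits
replacing local data by globally smooth functions. -/
theorem grassmannExt_congr {F H : (Fin n → ℂ) → CS} {p : SuperPoint n}
    (h : F =ᶠ[𝓝 p.bodyPt] H) : grassmannExt F p = grassmannExt H p := by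
  have hk : ∀ k, (taylorStep p.soul)^[k] F =ᶠ[𝓝 p.bodyPt] (taylorStep p.soul)^[k] H := by
    intro k
    induction k with
    | zero => exact h
    | succ k ih => simp only [Function.iterate_succ_apply']; exact taylorStep_congr _ ih
  ext m
  change ∑ k ∈ Finset.range (m.degree + 1), ((k ! : ℂ))⁻¹ *
      ((taylorStep p.soul)^[k] F p.bodyPt).coeff m = ∑ k ∈ Finset.range (m.degree + 1),
      ((k ! : ℂ))⁻¹ * ((taylorStep p.soul)^[k] H p.bodyPt).coeff m
  exact Finset.sum_congr rfl fun k _ => by rw [(hk k).self_of_nhds]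

/-- If `F` starts at the length of `m`, every genuine Taylor step overshoots `m`; the soul of `p`
does not matter for this coefficient. -/
theorem coeff_grassmannExt_of_fil {F : (Fin n → ℂ) → CS} (p : SuperPoint n) {m : ℕ →₀ ℕ}
    (h : ∀ z, SA.Fil m.degree (F z)) : (grassmannExt F p).coeff m = (F p.bodyPt).coeff m := by
  change ∑ k ∈ Finset.range (m.degree + 1), ((k ! : ℂ))⁻¹ *
      ((taylorStep p.soul)^[k] F p.bodyPt).coeff m = _
  rw [Finset.sum_eq_single 0]
  · simp
  · intro k _ hk
    rw [fil_taylorStep_iterate h p k _ m (by omega), mul_zero]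
  · simp

theorem body_grassmannExt (F : (Fin n → ℂ) → CS) (p : SuperPoint n) :
    body (grassmannExt F p) = body (F p.bodyPt) :=
  coeff_grassmannExt_of_fil p fun z => by simpa using SA.fil_zero (F z)

theorem fil_grassmannExt {F : (Fin n → ℂ) → CS} (p : SuperPoint n) {d : ℕ}
    (h : ∀ z, SA.Fil d (F z)) : SA.Fil d (grassmannExt F p) := fun m hm => by
  change ∑ k ∈ Finset.range (m.degree + 1), ((k ! : ℂ))⁻¹ *
      ((taylorStep p.soul)^[k] F p.bodyPt).coeff m = _
  exact Finset.sum_eq_zero fun k _ => by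
    rw [fil_taylorStep_iterate h p k _ m (by omega), mul_zero]

theorem grassmannExt_add {F H : (Fin n → ℂ) → CS} (p : SuperPoint n)
    (hF : SmoothCoeffOn F Set.univ) (hH : SmoothCoeffOn H Set.univ) :
    grassmannExt (fun z => F z + H z) p = grassmannExt F p + grassmannExt H p := by
  ext m
  change ∑ k ∈ Finset.range (m.degree + 1), ((k ! : ℂ))⁻¹ *
      ((taylorStep p.soul)^[k] _ p.bodyPt).coeff m = ∑ k ∈ Finset.range (m.degree + 1),
      ((k ! : ℂ))⁻¹ * ((taylorStep p.soul)^[k] F p.bodyPt).coeff m +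
      ∑ k ∈ Finset.range (m.degree + 1),
      ((k ! : ℂ))⁻¹ * ((taylorStep p.soul)^[k] H p.bodyPt).coeff m
  rw [← Finset.sum_add_distrib, taylorStep_eq]
  refine Finset.sum_congr rfl fun k _ => ?_
  rw [dirStep_iterate_add hF hH, SA.coeff_add, mul_add]

/-- The extension is the exponential of a derivation. By Leibniz' rule its terms on a product are
those of the Cauchy product of the two Taylor series. -/
theorem grassmannExt_mul {F H : (Fin n → ℂ) → CS} (p : SuperPoint n)
    (hF : SmoothCoeffOn F Set.univ) (hH : SmoothCoeffOn H Set.univ) :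
    grassmannExt (fun z => F z * H z) p = grassmannExt F p * grassmannExt H p := by
  refine SA.eq_of_fil fun N => ?_
  have key := SA.fil_cauchy_product
    (fun k => (fil_taylorStep_iterate_zero F p k p.bodyPt).smul ((k ! : ℂ))⁻¹)
    (fun k => (fil_taylorStep_iterate_zero H p k p.bodyPt).smul ((k ! : ℂ))⁻¹) N
  have h1 := grassmannExt_fil F p N
  have h2 := grassmannExt_fil H p N
  have h3 := grassmannExt_fil (fun z => F z * H z) p N
  have hk : ∀ k ∈ Finset.range N, ∑ q ∈ Finset.HasAntidiagonal.antidiagonal k,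
      (((q.1 ! : ℂ))⁻¹ • (taylorStep p.soul)^[q.1] F p.bodyPt) *
        (((q.2 ! : ℂ))⁻¹ • (taylorStep p.soul)^[q.2] H p.bodyPt) =
      ((k ! : ℂ))⁻¹ • (taylorStep p.soul)^[k] (fun z => F z * H z) p.bodyPt := fun k _ => by
    rw [taylorStep_eq, dirStep_iterate_mul (isEven_reIm p.soul_even) hF hH, Finset.smul_sum]
    refine Finset.sum_congr rfl fun q hq => ?_
    rw [smul_smul, ← Finset.HasAntidiagonal.mem_antidiagonal.1 hq,
      inv_factorial_mul_choose, smul_mul_smul_comm]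
  rw [Finset.sum_congr rfl hk] at key
  change SA.Fil N (extTrunc _ p N - extTrunc F p N * extTrunc H p N) at key
  have e : grassmannExt (fun z => F z * H z) p - grassmannExt F p * grassmannExt H p =
      (grassmannExt (fun z => F z * H z) p - extTrunc (fun z => F z * H z) p N) +
      (extTrunc (fun z => F z * H z) p N - extTrunc F p N * extTrunc H p N)
      - ((grassmannExt F p - extTrunc F p N) * grassmannExt H p +
        extTrunc F p N * (grassmannExt H p - extTrunc H p N)) := by
    noncomm_ring
  rw [e]
  exact (h3.add key).sub ((h1.mul_right _).add (h2.mul_left _))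

theorem grassmannExt_const (c : CS) (p : SuperPoint n) : grassmannExt (fun _ => c) p = c := by
  have hk : ∀ k, (taylorStep p.soul)^[k + 1] (fun _ => c) = fun _ => 0 := by
    intro k
    induction k with
    | zero => rw [zero_add, Function.iterate_one, taylorStep_eq, dirStep_const]
    | succ k ih => rw [Function.iterate_succ_apply', ih, taylorStep_eq, dirStep_const]
  ext m
  change ∑ k ∈ Finset.range (m.degree + 1), ((k ! : ℂ))⁻¹ *
      ((taylorStep p.soul)^[k] _ p.bodyPt).coeff m = _
  rw [Finset.sum_range_succ', Finset.sum_eq_zero fun k _ => by rw [hk]; simp]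
  simp

theorem grassmannExt_mul_const {F : (Fin n → ℂ) → CS} (p : SuperPoint n)
    (hF : SmoothCoeffOn F Set.univ) (c : CS) :
    grassmannExt (fun z => F z * c) p = grassmannExt F p * c := by
  rw [grassmannExt_mul p hF (smoothCoeffOn_const c _), grassmannExt_const]

theorem grassmannExt_sum {ι : Type*} (s : Finset ι) {F : ι → (Fin n → ℂ) → CS} (p : SuperPoint n)
    (hF : ∀ i, SmoothCoeffOn (F i) Set.univ) :
    grassmannExt (fun z => ∑ i ∈ s, F i z) p = ∑ i ∈ s, grassmannExt (F i) p := by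
  classical
  induction s using Finset.induction_on with
  | empty => simpa using grassmannExt_const 0 p
  | insert a s ha ih =>
    simp only [Finset.sum_insert ha]
    rw [grassmannExt_add p (hF a) (smoothCoeffOn_sum fun i _ => hF i), ih]

theorem grassmannExt_smul (c : ℂ) {F : (Fin n → ℂ) → CS} (p : SuperPoint n)
    (hF : SmoothCoeffOn F Set.univ) :
    grassmannExt (fun z => c • F z) p = c • grassmannExt F p := by
  have h := grassmannExt_mul p (smoothCoeffOn_const (algebraMap ℂ CS c) Set.univ) hF
  simpa only [grassmannExt_const, ← Algebra.smul_def] using h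

theorem isEven_grassmannExt {F : (Fin n → ℂ) → CS} (p : SuperPoint n) (h : ∀ z, (F z).IsEven) :
    (grassmannExt F p).IsEven := by
  have hk : ∀ k z, CS.IsEven ((taylorStep p.soul)^[k] F z) := by
    intro k
    induction k with
    | zero => exact h
    | succ k ih =>
      intro z
      rw [taylorStep_eq] at ih ⊢
      rw [Function.iterate_succ_apply']
      exact CS.isEven_sum fun i _ => CS.IsEven.mul (SmoothEven.isEven_dirDeriv ih _ _)
        (isEven_reIm p.soul_even i)
  intro m hm
  change ∑ k ∈ Finset.range (m.degree + 1), ((k ! : ℂ))⁻¹ *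
      ((taylorStep p.soul)^[k] F p.bodyPt).coeff m = 0
  exact Finset.sum_eq_zero fun k _ => by rw [hk k _ m hm, mul_zero]

/-- In real coordinates both the derivations and the components of the soul are real, so conjugation
commutes with each Taylor step. -/
theorem grassmannExt_conj {F : (Fin n → ℂ) → CS} (p : SuperPoint n)
    (hF : SmoothCoeffOn F Set.univ) :
    grassmannExt (fun z => (F z).conj) p = (grassmannExt F p).conj := by
  have hre : ∀ i, (reIm p.soul i).conj = reIm p.soul i := by
    intro i
    ext m
    cases i with
    | inl j => simp [reIm, add_comm, Complex.conj_ofNat]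
    | inr j =>
      simp only [reIm, Sum.elim_inr, CS.coeff_conj, SA.coeff_smul, SA.coeff_sub, map_mul, map_sub,
        map_inv₀, Complex.conj_ofNat, Complex.conj_I, Complex.conj_conj]
      ring
  have hk : ∀ k, (taylorStep p.soul)^[k] (fun z => (F z).conj) =
      fun z => CS.conj ((taylorStep p.soul)^[k] F z) := by
    intro k
    rw [taylorStep_eq]
    induction k with
    | zero => rfl
    | succ k ih =>
      rw [Function.iterate_succ_apply', ih, Function.iterate_succ_apply']
      funext z
      have hs := (hF.dirStep_iterate (v := coordDir) (a := reIm p.soul) isOpen_univ k).diffCoeffAt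
        isOpen_univ (Set.mem_univ z)
      change _ = CS.conjHom _
      simp only [dirStep, map_sum, map_mul]
      refine Finset.sum_congr rfl fun i _ => ?_
      rw [dirDeriv_conj hs]
      change _ = CS.conj _ * CS.conj _
      rw [hre]
  ext m
  change ∑ k ∈ Finset.range (m.degree + 1), ((k ! : ℂ))⁻¹ *
      ((taylorStep p.soul)^[k] _ p.bodyPt).coeff m = (starRingEnd ℂ)
      (∑ k ∈ Finset.range (m.degree + 1), ((k ! : ℂ))⁻¹ *
      ((taylorStep p.soul)^[k] F p.bodyPt).coeff m)
  rw [map_sum]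
  refine Finset.sum_congr rfl fun k _ => ?_
  rw [hk, CS.coeff_conj]
  simp

theorem SA.numOp_fil {G : Type} [LinearOrder G] [GradedGen G] {x : SA G} {d : ℕ} (h : SA.Fil d x) :
    SA.Fil d (SA.numOp x) := fun m hm => by rw [SA.coeff_numOp, h m hm, mul_zero]

/-- The chain rule for the number operator: a value at `p` depends on the `β_k` both through the
coefficients of `F` and through the soul of `p`. -/
theorem numOp_grassmannExt {F : (Fin n → ℂ) → CS} (p : SuperPoint n)
    (hF : SmoothCoeffOn F Set.univ) :
    SA.numOp (grassmannExt F p) = grassmannExt (fun z => SA.numOp (F z)) p +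
      ∑ j, (grassmannExt (pderivZ j F) p * SA.numOp (p.soul j) +
        grassmannExt (pderivZbar j F) p * CS.conj (SA.numOp (p.soul j))) := by
  have hsum : ∑ j, (grassmannExt (pderivZ j F) p * SA.numOp (p.soul j) +
        grassmannExt (pderivZbar j F) p * CS.conj (SA.numOp (p.soul j))) =
      grassmannExt (taylorStep (fun j => SA.numOp (p.soul j)) F) p := by
    unfold taylorStep
    rw [grassmannExt_sum Finset.univ p fun j =>
      ((hF.pderivZ isOpen_univ j).mul (smoothCoeffOn_const _ _)).add
        ((hF.pderivZbar isOpen_univ j).mul (smoothCoeffOn_const _ _))]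
    refine Finset.sum_congr rfl fun j _ => ?_
    rw [grassmannExt_add p ((hF.pderivZ isOpen_univ j).mul (smoothCoeffOn_const _ _))
        ((hF.pderivZbar isOpen_univ j).mul (smoothCoeffOn_const _ _)),
      grassmannExt_mul_const p (hF.pderivZ isOpen_univ j),
      grassmannExt_mul_const p (hF.pderivZbar isOpen_univ j)]
  rw [hsum]
  refine SA.eq_of_fil fun N => ?_
  set F1 := fun z => SA.numOp (F z) with hF1
  set F2 := taylorStep (fun j => SA.numOp (p.soul j)) F with hF2
  have h0 := SA.numOp_fil (grassmannExt_fil F p (N + 1))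
  have h1 := grassmannExt_fil F1 p (N + 1)
  have h2 := grassmannExt_fil F2 p N
  -- One soul of the term of order `k + 1` is consumed by the number operator, so that term feeds
  -- the term of order `k` for `F2`; hence the two cutoffs differ by one.
  have e : SA.numOp (extTrunc F p (N + 1)) = extTrunc F1 p (N + 1) + extTrunc F2 p N := by
    simp only [extTrunc, map_sum, map_smul]
    rw [Finset.sum_range_succ', Finset.sum_range_succ' (fun k => ((k ! : ℂ))⁻¹ •
      (taylorStep p.soul)^[k] F1 p.bodyPt), add_right_comm, ← Finset.sum_add_distrib]
    congr 1
    refine Finset.sum_congr rfl fun k _ => ?_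
    rw [hF2, taylorStep_eq, taylorStep_eq, numOp_dirStep_iterate (isEven_reIm p.soul_even) hF,
      smul_add, smul_smul, numOp_reIm, Nat.factorial_succ]
    congr 2
    have : ((k + 1 : ℕ) : ℂ) ≠ 0 := by exact_mod_cast Nat.succ_ne_zero k
    push_cast at this ⊢
    field_simp
  rw [map_sub, e] at h0
  have e2 : SA.numOp (grassmannExt F p) - (grassmannExt F1 p + grassmannExt F2 p) =
      (SA.numOp (grassmannExt F p) - (extTrunc F1 p (N + 1) + extTrunc F2 p N)) -
      (grassmannExt F1 p - extTrunc F1 p (N + 1)) - (grassmannExt F2 p - extTrunc F2 p N) := by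
    abel
  rw [e2]
  exact ((h0.mono (Nat.le_succ N)).sub (h1.mono (Nat.le_succ N))).sub h2

end

/-! ### Gaussian integrals and the Laplace method for complex-valued functions. -/

section

variable {n : ℕ}

/-! ### Gaussian integrals and the Laplace method -/

open MeasureTheory

theorem integral_gaussian_pi (n : ℕ) :
    ∫ u : Fin n → ℂ, Real.exp (-∑ i, ‖u i‖ ^ 2) = Real.pi ^ n := by
  have h1 : ∫ v : ℂ, Real.exp (-‖v‖ ^ 2) = Real.pi := by
    have := GaussianFourier.integral_rexp_neg_mul_sq_norm (V := ℂ) (b := 1) one_pos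
    simpa [Complex.finrank_real_complex] using this
  have h2 := integral_fintype_prod_volume_eq_pow (ι := Fin n) (fun v : ℂ => Real.exp (-‖v‖ ^ 2))
  rw [h1, Fintype.card_fin] at h2
  rw [← h2]
  congr 1
  funext u
  rw [← Real.exp_sum, Finset.sum_neg_distrib]

theorem integrable_gaussian_pi (n : ℕ) {c : ℝ} (hc : 0 < c) :
    Integrable fun u : Fin n → ℂ => Real.exp (-(c * ∑ i, ‖u i‖ ^ 2)) := by
  have h1 : Integrable fun v : ℂ => Real.exp (-(c * ‖v‖ ^ 2)) := by
    have := (GaussianFourier.integrable_cexp_neg_mul_sq_norm_add (V := ℂ) (b := (c : ℂ))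
      (by simpa using hc) 0 0).norm
    refine this.congr (Filter.Eventually.of_forall fun v => ?_)
    simp only [Complex.norm_exp]
    congr 1
    simp [← Complex.ofReal_pow, ← Complex.ofReal_mul, ← Complex.ofReal_neg]
  have h2 := Integrable.fintype_prod (ι := Fin n) (μ := fun _ => (volume : Measure ℂ))
    (f := fun _ v => Real.exp (-(c * ‖v‖ ^ 2))) fun _ => h1
  refine h2.congr (Filter.Eventually.of_forall fun u => ?_)
  simp only
  rw [← Real.exp_sum, Finset.sum_neg_distrib, Finset.mul_sum]

/-- The real determinant of a complex linear map is the norm of its complex determinant from `ℂ` to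
`ℝ`. This is where the factor `det A · conj(det A)` comes from. -/
theorem det_restrictScalars_mulVec (B : Matrix (Fin n) (Fin n) ℂ) :
    LinearMap.det (B.mulVecLin.restrictScalars ℝ) = ‖B.det‖ ^ 2 := by
  rw [LinearMap.det_restrictScalars, Algebra.norm_complex_apply, Complex.normSq_eq_norm_sq,
    ← Matrix.toLin'_apply', LinearMap.det_toLin']

theorem integral_gaussian_matrix (B : Matrix (Fin n) (Fin n) ℂ) (hB : B.det ≠ 0) :
    ∫ u : Fin n → ℂ, Real.exp (-∑ i, ‖(B.mulVec u) i‖ ^ 2) = Real.pi ^ n / ‖B.det‖ ^ 2 := by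
  have hpos : 0 < ‖B.det‖ ^ 2 := by positivity
  have hdet : LinearMap.det (B.mulVecLin.restrictScalars ℝ) ≠ 0 := by
    rw [det_restrictScalars_mulVec]; exact hpos.ne'
  have hmap := Measure.map_linearMap_addHaar_eq_smul_addHaar
    (volume : Measure (Fin n → ℂ)) hdet
  have hcont : Continuous (B.mulVecLin.restrictScalars ℝ) :=
    LinearMap.continuous_of_finiteDimensional _
  have hg : AEStronglyMeasurable (fun u : Fin n → ℂ => Real.exp (-∑ i, ‖u i‖ ^ 2))
      (Measure.map (B.mulVecLin.restrictScalars ℝ) volume) :=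
    Continuous.aestronglyMeasurable (by fun_prop)
  have h1 := integral_map hcont.aemeasurable hg
  rw [hmap, integral_smul_measure, integral_gaussian_pi, det_restrictScalars_mulVec] at h1
  rw [abs_of_pos (by positivity), ENNReal.toReal_ofReal (by positivity), smul_eq_mul] at h1
  rw [div_eq_inv_mul, h1]
  rfl

theorem sum_sq_le_norm_sq (u : Fin n → ℂ) : ∑ i, ‖u i‖ ^ 2 ≤ n * ‖u‖ ^ 2 := by
  calc ∑ i, ‖u i‖ ^ 2 ≤ ∑ _i : Fin n, ‖u‖ ^ 2 :=
        Finset.sum_le_sum fun i _ => pow_le_pow_left₀ (norm_nonneg _) (norm_le_pi_norm u i) 2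
    _ = n * ‖u‖ ^ 2 := by simp

theorem norm_sq_le_sum_sq (u : Fin n → ℂ) : ‖u‖ ^ 2 ≤ ∑ i, ‖u i‖ ^ 2 := by
  have hS : 0 ≤ ∑ i, ‖u i‖ ^ 2 := Finset.sum_nonneg fun i _ => sq_nonneg _
  have h : ‖u‖ ≤ Real.sqrt (∑ i, ‖u i‖ ^ 2) := by
    refine (pi_norm_le_iff_of_nonneg (Real.sqrt_nonneg _)).2 fun i => Real.le_sqrt_of_sq_le ?_
    exact Finset.single_le_sum (f := fun i => ‖u i‖ ^ 2) (fun i _ => sq_nonneg _)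
      (Finset.mem_univ i)
  calc ‖u‖ ^ 2 ≤ Real.sqrt (∑ i, ‖u i‖ ^ 2) ^ 2 := pow_le_pow_left₀ (norm_nonneg _) h 2
    _ = _ := Real.sq_sqrt hS

/-- Near a nondegenerate zero a map is bounded below by the distance to the zero. -/
theorem eventually_lower_bound {b : (Fin n → ℂ) → Fin n → ℂ} {P : Fin n → ℂ}
    {B : Matrix (Fin n) (Fin n) ℂ} (hB : B.det ≠ 0)
    (hb : HasFDerivAt b (LinearMap.toContinuousLinearMap (B.mulVecLin.restrictScalars ℝ)) P)
    (hP : b P = 0) :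
    ∃ c > 0, ∀ᶠ z in 𝓝 P, c * ∑ i, ‖z i - P i‖ ^ 2 ≤ ∑ i, ‖b z i‖ ^ 2 := by
  set L := LinearMap.toContinuousLinearMap (B⁻¹.mulVecLin) with hL
  -- The added `1` keeps `K` positive even when the operator norm is zero.
  set K : ℝ := ‖L‖ + 1 with hK
  have hKpos : 0 < K := by positivity
  have hlow : ∀ u : Fin n → ℂ, ‖u‖ ≤ K * ‖B.mulVec u‖ := fun u => by
    have h1 : L (B.mulVec u) = u := by
      change B⁻¹.mulVec (B.mulVec u) = u
      rw [Matrix.mulVec_mulVec, Matrix.nonsing_inv_mul _ (isUnit_iff_ne_zero.2 hB),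
        Matrix.one_mulVec]
    calc ‖u‖ = ‖L (B.mulVec u)‖ := by rw [h1]
      _ ≤ ‖L‖ * ‖B.mulVec u‖ := L.le_opNorm _
      _ ≤ K * ‖B.mulVec u‖ := by
        refine mul_le_mul_of_nonneg_right ?_ (norm_nonneg _)
        rw [hK]; linarith
  have hlit := hb.isLittleO.def (c := (2 * K)⁻¹) (by positivity)
  have hmain : ∀ᶠ z in 𝓝 P, ‖z - P‖ ≤ 2 * K * ‖b z‖ := by
    filter_upwards [hlit] with z hz
    rw [hP, sub_zero] at hz
    have h2 := hlow (z - P)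
    have h3 : ‖B.mulVec (z - P)‖ ≤ ‖b z‖ + (2 * K)⁻¹ * ‖z - P‖ := by
      have : B.mulVec (z - P) = b z - (b z - B.mulVec (z - P)) := by abel
      calc ‖B.mulVec (z - P)‖ = ‖b z - (b z - B.mulVec (z - P))‖ := by rw [← this]
        _ ≤ ‖b z‖ + ‖b z - B.mulVec (z - P)‖ := norm_sub_le _ _
        _ ≤ _ := add_le_add le_rfl hz
    have h4 : ‖z - P‖ ≤ K * ‖b z‖ + ‖z - P‖ / 2 := by
      calc ‖z - P‖ ≤ K * (‖b z‖ + (2 * K)⁻¹ * ‖z - P‖) :=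
            h2.trans (mul_le_mul_of_nonneg_left h3 hKpos.le)
        _ = _ := by field_simp
    linarith
  -- The factor `(2 * K) ^ 2` squares the linear bound `hmain`, and passing from the sup norm to the
  -- sum of squares costs `n`; `n + 1` replaces `n` to be positive in all cases.
  refine ⟨((n + 1) * (2 * K) ^ 2)⁻¹, by positivity, ?_⟩
  filter_upwards [hmain] with z hz
  rw [inv_mul_le_iff₀ (by positivity)]
  have h1 := sum_sq_le_norm_sq (z - P)
  have h2 := norm_sq_le_sum_sq (b z)
  have h3 : ‖z - P‖ ^ 2 ≤ (2 * K) ^ 2 * ‖b z‖ ^ 2 := by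
    rw [← mul_pow]
    exact pow_le_pow_left₀ (norm_nonneg _) hz 2
  simp only [Pi.sub_apply] at h1
  calc ∑ i, ‖z i - P i‖ ^ 2 ≤ n * ‖z - P‖ ^ 2 := h1
    _ ≤ (n + 1) * ‖z - P‖ ^ 2 := by
      refine mul_le_mul_of_nonneg_right (by linarith) (sq_nonneg _)
    _ ≤ (n + 1) * ((2 * K) ^ 2 * ‖b z‖ ^ 2) := mul_le_mul_of_nonneg_left h3 (by positivity)
    _ ≤ (n + 1) * ((2 * K) ^ 2 * ∑ i, ‖b z i‖ ^ 2) := by gcongr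
    _ = _ := by ring

theorem tendsto_sqrt_nhdsGT_zero : Filter.Tendsto Real.sqrt (𝓝[>] 0) (𝓝[>] 0) := by
  refine tendsto_nhdsWithin_iff.2 ⟨?_, ?_⟩
  · have := Real.continuous_sqrt.tendsto 0
    rw [Real.sqrt_zero] at this
    exact this.mono_left nhdsWithin_le_nhds
  · filter_upwards [self_mem_nhdsWithin] with t ht
    exact Real.sqrt_pos.2 ht

/-- The Laplace method at a nondegenerate zero. -/
theorem tendsto_laplace {f : (Fin n → ℂ) → ℂ} (hf : Continuous f) (hfc : HasCompactSupport f)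
    {b : (Fin n → ℂ) → Fin n → ℂ} (hbc : Continuous b) {P : Fin n → ℂ}
    {B : Matrix (Fin n) (Fin n) ℂ} (hB : B.det ≠ 0)
    (hb : HasFDerivAt b (LinearMap.toContinuousLinearMap (B.mulVecLin.restrictScalars ℝ)) P)
    (hP : b P = 0) {c : ℝ} (hc : 0 < c)
    (hlow : ∀ z, f z ≠ 0 → c * ∑ i, ‖z i - P i‖ ^ 2 ≤ ∑ i, ‖b z i‖ ^ 2) :
    Filter.Tendsto (fun t : ℝ => ((t : ℂ) ^ n)⁻¹ *
        ∫ z, f z * Complex.exp (-((t : ℂ)⁻¹ * ∑ i, (‖b z i‖ : ℂ) ^ 2)))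
      (𝓝[>] 0) (𝓝 (f P * (Real.pi ^ n / (‖B.det‖ : ℂ) ^ 2))) := by
  -- Substitute `z = P + r u` with `t = r²`. The real dimension is `2n`, so the Jacobian `r^(2n)`
  -- cancels the prefactor `t^(-n)`.
  have hscale : ∀ r : ℝ, 0 < r → (((r ^ 2 : ℝ) : ℂ) ^ n)⁻¹ *
        ∫ z, f z * Complex.exp (-(((r ^ 2 : ℝ) : ℂ)⁻¹ * ∑ i, (‖b z i‖ : ℂ) ^ 2)) =
      ∫ u, f (P + r • u) * (Real.exp (-∑ i, ‖(r⁻¹ • (b (P + r • u))) i‖ ^ 2) : ℂ) := by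
    intro r hr
    set F : (Fin n → ℂ) → ℂ := fun z => f z *
      Complex.exp (-(((r ^ 2 : ℝ) : ℂ)⁻¹ * ∑ i, (‖b z i‖ : ℂ) ^ 2)) with hF
    have h1 := Measure.integral_comp_smul (volume : Measure (Fin n → ℂ)) (fun z => F (P + z)) r
    rw [integral_add_left_eq_self F P] at h1
    have hfin : Module.finrank ℝ (Fin n → ℂ) = 2 * n := by
      rw [Module.finrank_pi_fintype]
      simp [Complex.finrank_real_complex, mul_comm]
    rw [hfin, abs_of_pos (by positivity)] at h1
    have h2 : (((r ^ 2 : ℝ) : ℂ) ^ n)⁻¹ * ∫ z, F z = ∫ u, F (P + r • u) := by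
      rw [h1, Complex.real_smul]
      congr 1
      push_cast
      rw [pow_mul]
    rw [h2]
    refine integral_congr_ae (Filter.Eventually.of_forall fun u => ?_)
    simp only [hF]
    congr 1
    rw [Complex.ofReal_exp]
    congr 1
    push_cast
    rw [Finset.mul_sum]
    congr 1
    refine Finset.sum_congr rfl fun i _ => ?_
    rw [Pi.smul_apply, norm_smul, Real.norm_eq_abs, abs_of_pos (by positivity)]
    push_cast
    ring
  have hlim : Filter.Tendsto (fun r : ℝ => ∫ u, f (P + r • u) *
      (Real.exp (-∑ i, ‖(r⁻¹ • (b (P + r • u))) i‖ ^ 2) : ℂ)) (𝓝[>] 0)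
      (𝓝 (∫ u, f P * (Real.exp (-∑ i, ‖(B.mulVec u) i‖ ^ 2) : ℂ))) := by
    obtain ⟨C, hC⟩ := hf.norm.bddAbove_range_of_hasCompactSupport hfc.norm
    have hC' : ∀ z, ‖f z‖ ≤ C := fun z => hC ⟨z, rfl⟩
    -- After rescaling, `hlow` bounds the exponent below by `c ∑ ‖u i‖²` wherever `f` does not
    -- vanish, with the same `c` for all `r`. This gives an integrable Gaussian majorant.
    refine tendsto_integral_filter_of_dominated_convergence
      (fun u => C * Real.exp (-(c * ∑ i, ‖u i‖ ^ 2))) ?_ ?_ ?_ ?_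
    · filter_upwards with r
      exact Continuous.aestronglyMeasurable (by fun_prop)
    · filter_upwards [self_mem_nhdsWithin] with r hr
      have hr : 0 < r := hr
      refine Filter.Eventually.of_forall fun u => ?_
      rw [norm_mul, Complex.norm_real, Real.norm_eq_abs, Real.abs_exp]
      by_cases h0 : f (P + r • u) = 0
      · rw [h0, norm_zero, zero_mul]
        exact mul_nonneg ((norm_nonneg _).trans (hC' P)) (Real.exp_pos _).le
      · refine mul_le_mul (hC' _) ?_ (Real.exp_pos _).le ((norm_nonneg _).trans (hC' P))
        refine Real.exp_le_exp.2 (neg_le_neg ?_)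
        have h := hlow _ h0
        have e1 : ∑ i, ‖(P + r • u) i - P i‖ ^ 2 = r ^ 2 * ∑ i, ‖u i‖ ^ 2 := by
          rw [Finset.mul_sum]
          refine Finset.sum_congr rfl fun i _ => ?_
          rw [Pi.add_apply, add_sub_cancel_left, Pi.smul_apply, norm_smul, mul_pow,
            Real.norm_eq_abs, sq_abs]
        have e2 : ∑ i, ‖(r⁻¹ • (b (P + r • u))) i‖ ^ 2 =
            (r ^ 2)⁻¹ * ∑ i, ‖b (P + r • u) i‖ ^ 2 := by
          rw [Finset.mul_sum]
          refine Finset.sum_congr rfl fun i _ => ?_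
          rw [Pi.smul_apply, norm_smul, mul_pow, Real.norm_eq_abs, sq_abs, inv_pow]
        rw [e1] at h
        rw [e2, le_inv_mul_iff₀ (by positivity)]
        linarith
    · exact (integrable_gaussian_pi n hc).const_mul C
    · refine Filter.Eventually.of_forall fun u => ?_
      -- Because `b P = 0`, this is the difference quotient of `b` at `P` in the direction `u`.
      have h1 : Filter.Tendsto (fun r : ℝ => r⁻¹ • b (P + r • u)) (𝓝[>] 0) (𝓝 (B.mulVec u)) := by
        have := (hb.hasLineDerivAt u).tendsto_slope_zero_right
        simp only [hP, sub_zero] at this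
        exact this
      have h2 : Filter.Tendsto (fun r : ℝ => P + r • u) (𝓝[>] 0) (𝓝 P) := by
        have : Filter.Tendsto (fun r : ℝ => P + r • u) (𝓝 0) (𝓝 (P + (0 : ℝ) • u)) :=
          Continuous.tendsto (by fun_prop) 0
        rw [zero_smul, add_zero] at this
        exact this.mono_left nhdsWithin_le_nhds
      have h3 : Continuous fun w : Fin n → ℂ => ((Real.exp (-∑ i, ‖w i‖ ^ 2) : ℝ) : ℂ) := by
        fun_prop
      exact ((hf.tendsto P).comp h2).mul ((h3.tendsto _).comp h1)
  have hval : ∫ u, f P * (Real.exp (-∑ i, ‖(B.mulVec u) i‖ ^ 2) : ℂ) =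
      f P * (Real.pi ^ n / (‖B.det‖ : ℂ) ^ 2) := by
    rw [integral_const_mul, integral_complex_ofReal, integral_gaussian_matrix B hB]
    push_cast
    rfl
  rw [hval] at hlim
  refine (hlim.comp tendsto_sqrt_nhdsGT_zero).congr' ?_
  filter_upwards [self_mem_nhdsWithin] with t ht
  have := hscale (Real.sqrt t) (Real.sqrt_pos.2 ht)
  rw [Real.sq_sqrt (le_of_lt ht)] at this
  exact this.symm

theorem tendsto_inv_pow_mul_exp_neg_div (k : ℕ) {δ : ℝ} (hδ : 0 < δ) :
    Filter.Tendsto (fun t : ℝ => (t ^ k)⁻¹ * Real.exp (-(t⁻¹ * δ))) (𝓝[>] 0) (𝓝 0) := by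
  have h1 := Real.tendsto_pow_mul_exp_neg_atTop_nhds_zero k
  have h2 : Filter.Tendsto (fun t : ℝ => t⁻¹ * δ) (𝓝[>] 0) Filter.atTop :=
    tendsto_inv_nhdsGT_zero.atTop_mul_const hδ
  have h3 := (h1.comp h2).const_mul ((δ ^ k)⁻¹)
  rw [mul_zero] at h3
  refine h3.congr fun t => ?_
  simp only [Function.comp_apply]
  rw [mul_pow, inv_pow]
  field_simp

/-- Contributions away from the zeros are exponentially small. -/
theorem tendsto_laplace_tail {f : (Fin n → ℂ) → ℂ} {S : (Fin n → ℂ) → ℝ} {A : Set (Fin n → ℂ)}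
    (hAf : volume A < ⊤) {C : ℝ} (hC : ∀ z ∈ A, ‖f z‖ ≤ C) {δ : ℝ} (hδ : 0 < δ)
    (hS : ∀ z ∈ A, f z ≠ 0 → δ ≤ S z) (k : ℕ) :
    Filter.Tendsto (fun t : ℝ => ((t : ℂ) ^ k)⁻¹ *
        ∫ z in A, f z * Complex.exp (-((t : ℂ)⁻¹ * (S z : ℂ)))) (𝓝[>] 0) (𝓝 0) := by
  have h := (tendsto_inv_pow_mul_exp_neg_div k hδ).mul_const (|C| * volume.real A)
  rw [zero_mul] at h
  refine squeeze_zero_norm' ?_ h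
  filter_upwards [self_mem_nhdsWithin] with t ht
  have ht : 0 < t := ht
  have hb : ∀ z ∈ A, ‖f z * Complex.exp (-((t : ℂ)⁻¹ * (S z : ℂ)))‖ ≤
      |C| * Real.exp (-(t⁻¹ * δ)) := fun z hz => by
    by_cases h0 : f z = 0
    · rw [h0, zero_mul, norm_zero]; positivity
    · rw [norm_mul]
      refine mul_le_mul ((hC z hz).trans (le_abs_self C)) ?_ (norm_nonneg _) (abs_nonneg _)
      rw [show -((t : ℂ)⁻¹ * (S z : ℂ)) = ((-(t⁻¹ * S z) : ℝ) : ℂ) by push_cast; ring,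
        Complex.norm_exp, Complex.ofReal_re, Real.exp_le_exp, neg_le_neg_iff]
      exact mul_le_mul_of_nonneg_left (hS z hz h0) (by positivity)
  have h1 := norm_setIntegral_le_of_norm_le_const hAf hb
  rw [norm_mul, norm_inv, norm_pow, Complex.norm_real, Real.norm_eq_abs, abs_of_pos ht]
  calc (t ^ k)⁻¹ * ‖∫ z in A, f z * Complex.exp (-((t : ℂ)⁻¹ * (S z : ℂ)))‖
      ≤ (t ^ k)⁻¹ * (|C| * Real.exp (-(t⁻¹ * δ)) * volume.real A) :=
        mul_le_mul_of_nonneg_left h1 (by positivity)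
    _ = _ := by ring

/-- Integration by parts against the constant function `1`. -/
theorem integral_fderiv_eq_zero_of_compact {f : (Fin n → ℂ) → ℂ} (hf : ContDiff ℝ ∞ f)
    (hc : HasCompactSupport f) (v : Fin n → ℂ) : ∫ z, fderiv ℝ f z v = 0 := by
  have hd : Continuous fun z => fderiv ℝ f z v := by
    have := hf.continuous_fderiv (by simp)
    fun_prop
  have hdc : HasCompactSupport fun z => fderiv ℝ f z v := hc.fderiv_apply ℝ v
  have h := integral_mul_fderiv_eq_neg_fderiv_mul_of_integrable (μ := volume) (𝕜 := ℂ)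
    (f := fun _ => 1) (g := f) (v := v) (by simp)
    (by simpa using hd.integrable_of_hasCompactSupport hdc)
    (by simpa using hf.continuous.integrable_of_hasCompactSupport hc)
    (fun x _ => differentiableAt_const _) (fun x _ => hf.differentiable (by simp) x)
  simpa using h

end

/-! ### The number operator acts on the Gaussian density as a divergence. -/

section

variable {n : ℕ}

open MeasureTheory

/-! ### The transport identity for the Gaussian weight -/

namespace SmoothEven

/-- The holomorphic Jacobian matrix. -/
def jac (g : Fin n → SmoothEven n) : Matrix (Fin n) (Fin n) (SmoothEven n) :=
  Matrix.of fun a b => dz b (g a)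

/-- The real Jacobian `det A · conj (det A)`. -/
def jacAbs (g : Fin n → SmoothEven n) : SmoothEven n := (jac g).det * conj (jac g).det

/-- The function `g ḡ`. -/
def normSq (g : Fin n → SmoothEven n) : SmoothEven n := ∑ i, g i * conj (g i)

/-- The Gaussian weight `exp (- g ḡ / t)`. -/
def weight (g : Fin n → SmoothEven n) (t : ℝ) : SmoothEven n := exp (-((t : ℂ)⁻¹ • normSq g))

/-- The vector field that transports the Gaussian weight along the number operator, multiplied by
the real Jacobian. -/
def transport (g : Fin n → SmoothEven n) (j : Fin n) : SmoothEven n :=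
  conj (jac g).det * ∑ i, (jac g).adjugate j i * num (g i)

theorem fn_eq_zero_of_evalHom {F : SmoothEven n} {z : Fin n → ℂ} : evalHom z F = 0 ↔ F.fn z = 0 :=
  ⟨fun h => congrArg Subtype.val h, fun h => Subtype.ext h⟩

/-- The global extensions of the `g i` are holomorphic only on `U`, so identities that use
holomorphy hold only there. They are stated after `evalHom z`; openness of `U` allows a vanishing
function to be differentiated. -/
theorem evalHom_dz_eq_zero {U : Set (Fin n → ℂ)} (hU : IsOpen U) {F : SmoothEven n}
    (hF : ∀ z ∈ U, F.fn z = 0) (j : Fin n) {z : Fin n → ℂ} (hz : z ∈ U) :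
    evalHom z (dz j F) = 0 := by
  rw [fn_eq_zero_of_evalHom, fn_dz, pderivZ_congr (H := fun _ => 0), pderivZ_const]
  filter_upwards [hU.mem_nhds hz] with w hw using hF w hw

theorem evalHom_conj (z : Fin n → ℂ) (F : SmoothEven n) :
    evalHom z (conj F) = CS0.conjHom (evalHom z F) := rfl

theorem evalHom_smul (z : Fin n → ℂ) (c : ℂ) (F : SmoothEven n) :
    evalHom z (c • F) = c • evalHom z F := Subtype.ext (by
      rw [CS0.coe_smul]
      exact fn_smul c F z)

theorem conj_jacAbs (g : Fin n → SmoothEven n) : conj (jacAbs g) = jacAbs g := by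
  rw [jacAbs, map_mul, conj_conj, mul_comm]

/-- By Cramer's rule the field `transport g` is `jacAbs g` times `A⁻¹ N(g)`, written without
division. Differentiating `g l` along it therefore returns `N(g l)`. -/
theorem sum_transport_mul (g : Fin n → SmoothEven n) (l : Fin n) :
    ∑ j, transport g j * dz j (g l) = jacAbs g * num (g l) := by
  have h1 : ∀ i, ∑ j, (jac g).adjugate j i * dz j (g l) = if l = i then (jac g).det else 0 := by
    intro i
    have h := congrFun (congrFun (Matrix.mul_adjugate (jac g)) l) i
    rw [Matrix.mul_apply] at h
    simp only [Matrix.smul_apply, Matrix.one_apply, smul_eq_mul, mul_ite, mul_one, mul_zero] at h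
    rw [← h]
    exact Finset.sum_congr rfl fun j _ => mul_comm _ _
  calc ∑ j, transport g j * dz j (g l)
      = conj (jac g).det * ∑ i, (∑ j, (jac g).adjugate j i * dz j (g l)) * num (g i) := by
        simp only [transport, mul_assoc, Finset.sum_mul, Finset.mul_sum]
        rw [Finset.sum_comm]
        refine Finset.sum_congr rfl fun i _ => Finset.sum_congr rfl fun j _ => ?_
        ring
    _ = jacAbs g * num (g l) := by
        simp only [h1, ite_mul, zero_mul, Finset.sum_ite_eq, Finset.mem_univ, if_true, jacAbs]
        ring

section Holomorphic

variable {g : Fin n → SmoothEven n} {U : Set (Fin n → ℂ)} (hU : IsOpen U)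
  (hg : ∀ i j, ∀ z ∈ U, (dzbar j (g i)).fn z = 0)

include hU hg

/-- Jacobi's formula, and `∂̄` commutes with `∂`, so the entries of the Jacobian are again
holomorphic. -/
theorem evalHom_dzbar_det (j : Fin n) {z : Fin n → ℂ} (hz : z ∈ U) :
    evalHom z (dzbar j (jac g).det) = 0 := by
  rw [derivation_det_eq_adjugate, map_sum]
  refine Finset.sum_eq_zero fun a _ => ?_
  rw [map_sum]
  refine Finset.sum_eq_zero fun b _ => ?_
  rw [map_mul, jac, Matrix.of_apply, dzbar_dz_comm,
    evalHom_dz_eq_zero hU (hg a j) b hz, mul_zero]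

/-- The factor `conj (jac g).det` is antiholomorphic on `U` and passes through `∂`; for the rest
`divergence_adjugate` applies. -/
theorem evalHom_sum_dz_transport {z : Fin n → ℂ} (hz : z ∈ U) :
    evalHom z (∑ j, dz j (transport g j)) = evalHom z (conj (jac g).det * num (jac g).det) := by
  have h := divergence_adjugate dz dz_comm num num_dz g
  change ∑ j, dz j (∑ i, (jac g).adjugate j i * num (g i)) = num (jac g).det at h
  rw [← h, Finset.mul_sum, map_sum, map_sum]
  refine Finset.sum_congr rfl fun j _ => ?_
  rw [transport, Derivation.leibniz, map_add, smul_eq_mul, smul_eq_mul, dz_conj,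
    map_mul _ (∑ i, (jac g).adjugate j i * num (g i)) (conj _), evalHom_conj z (dzbar _ _),
    evalHom_dzbar_det hU hg j hz, map_zero, mul_zero, add_zero]

theorem evalHom_dz_normSq (j : Fin n) {z : Fin n → ℂ} (hz : z ∈ U) :
    evalHom z (dz j (normSq g)) = evalHom z (∑ l, dz j (g l) * conj (g l)) := by
  rw [normSq, map_sum, map_sum, map_sum]
  refine Finset.sum_congr rfl fun l _ => ?_
  rw [Derivation.leibniz, smul_eq_mul, smul_eq_mul, dz_conj, map_add, map_mul _ (g l),
    evalHom_conj, fn_eq_zero_of_evalHom.2 (hg l j z hz), map_zero, mul_zero, zero_add, mul_comm]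

theorem evalHom_dzbar_normSq (j : Fin n) {z : Fin n → ℂ} (hz : z ∈ U) :
    evalHom z (dzbar j (normSq g)) = evalHom z (∑ l, g l * conj (dz j (g l))) := by
  rw [normSq, map_sum, map_sum, map_sum]
  refine Finset.sum_congr rfl fun l _ => ?_
  rw [Derivation.leibniz, smul_eq_mul, smul_eq_mul, dzbar_conj, map_add, map_mul _ (conj (g l)),
    fn_eq_zero_of_evalHom.2 (hg l j z hz), mul_zero, add_zero]

/-- The product `jacAbs g * weight g t` is the density of a Gaussian pulled back by `g`. Deforming
`g` along the number operator amounts to moving the points along a vector field, so the density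
changes by a divergence. The divergence of the field itself accounts for the change of the Jacobian,
and its action on the exponent for the change of the weight. -/
theorem evalHom_divergence (t : ℝ) {z : Fin n → ℂ} (hz : z ∈ U) :
    evalHom z (∑ j, (dz j (transport g j * weight g t) +
      dzbar j (conj (transport g j) * weight g t))) = evalHom z (num (jacAbs g * weight g t)) := by
  set W := weight g t with hW
  set e := evalHom z with he
  have hdz : ∀ j, e (dz j W) = -((t : ℂ)⁻¹ • e (∑ l, dz j (g l) * conj (g l))) * e W := by
    intro j
    rw [hW, weight, dz_exp, map_mul, map_neg, Derivation.map_smul, map_neg, he, evalHom_smul,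
      evalHom_dz_normSq hU hg j hz]
  have hdzb : ∀ j, e (dzbar j W) = -((t : ℂ)⁻¹ • e (∑ l, g l * conj (dz j (g l)))) * e W := by
    intro j
    rw [hW, weight, dzbar_exp, map_mul, map_neg, Derivation.map_smul, map_neg, he, evalHom_smul,
      evalHom_dzbar_normSq hU hg j hz]
  have hnum : e (num W) = -((t : ℂ)⁻¹ •
      e (∑ l, (num (g l) * conj (g l) + g l * conj (num (g l))))) * e W := by
    rw [hW, weight, num_exp, map_mul, map_neg, Derivation.map_smul, map_neg, he, evalHom_smul,
      normSq, map_sum]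
    congr 4
    refine Finset.sum_congr rfl fun l _ => ?_
    rw [Derivation.leibniz, smul_eq_mul, smul_eq_mul, num_conj]
    ring
  have h1 := evalHom_sum_dz_transport hU hg hz
  have h2 : e (∑ j, dzbar j (conj (transport g j))) = e ((jac g).det * num (conj (jac g).det)) := by
    simp only [dzbar_conj]
    rw [← map_sum conj, evalHom_conj, h1, ← evalHom_conj, map_mul, conj_conj, num_conj]
  change e _ = e _ at h1
  -- The holomorphic half of the derivative of the exponent along the field; `h4` is the conjugate
  -- half, which together with this one gives the number operator on `g ḡ`.
  have h3 : ∑ j, e (transport g j) * e (∑ l, dz j (g l) * conj (g l)) =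
      e (jacAbs g) * e (∑ l, num (g l) * conj (g l)) := by
    simp only [← map_mul, ← map_sum]
    congr 1
    simp only [Finset.mul_sum]
    rw [Finset.sum_comm]
    refine Finset.sum_congr rfl fun l _ => ?_
    simp only [← mul_assoc]
    rw [← Finset.sum_mul, sum_transport_mul]
  have h4 : ∑ j, e (conj (transport g j)) * e (∑ l, g l * conj (dz j (g l))) =
      e (jacAbs g) * e (∑ l, g l * conj (num (g l))) := by
    simp only [← map_mul, ← map_sum]
    congr 1
    simp only [Finset.mul_sum]
    rw [Finset.sum_comm]
    refine Finset.sum_congr rfl fun l _ => ?_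
    have := congrArg conj (sum_transport_mul g l)
    rw [map_sum, map_mul, conj_jacAbs] at this
    simp only [map_mul] at this
    rw [mul_left_comm, ← this, Finset.mul_sum]
    refine Finset.sum_congr rfl fun j _ => by ring
  have hsplit : ∀ j, e (dz j (transport g j * W) + dzbar j (conj (transport g j) * W)) =
      e (dz j (transport g j)) * e W + e (dzbar j (conj (transport g j))) * e W -
      (t : ℂ)⁻¹ • (e (transport g j) * e (∑ l, dz j (g l) * conj (g l)) +
        e (conj (transport g j)) * e (∑ l, g l * conj (dz j (g l)))) * e W := by
    intro j
    rw [Derivation.leibniz, Derivation.leibniz]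
    simp only [smul_eq_mul, map_add, map_mul e, hdz, hdzb]
    simp only [Algebra.smul_def]
    ring
  rw [map_sum, Finset.sum_congr rfl fun j _ => hsplit j, Finset.sum_sub_distrib,
    Finset.sum_add_distrib, ← Finset.sum_mul, ← Finset.sum_mul, ← Finset.sum_mul, ← map_sum,
    ← map_sum, ← Finset.smul_sum, Finset.sum_add_distrib, h1, h2, h3, h4,
    Derivation.leibniz, jacAbs, Derivation.leibniz]
  simp only [smul_eq_mul, map_add, map_mul e, hnum, Finset.sum_add_distrib]
  simp only [Algebra.smul_def]
  ring

end Holomorphic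

/-- The Taylor extension as a ring homomorphism. -/
def extHom (p : SuperPoint n) : SmoothEven n →+* CS0 where
  toFun F := ⟨grassmannExt F.fn p, isEven_grassmannExt p F.isEven⟩
  map_one' := Subtype.ext (grassmannExt_const 1 p)
  map_zero' := Subtype.ext (grassmannExt_const 0 p)
  map_mul' F H := Subtype.ext (grassmannExt_mul p F.smooth H.smooth)
  map_add' F H := Subtype.ext (grassmannExt_add p F.smooth H.smooth)

theorem coe_extHom (p : SuperPoint n) (F : SmoothEven n) :
    (extHom p F : CS) = grassmannExt F.fn p := rfl

theorem extHom_conj (p : SuperPoint n) (F : SmoothEven n) :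
    extHom p (conj F) = CS0.conjHom (extHom p F) :=
  Subtype.ext (grassmannExt_conj p F.smooth)

/-- The number operator applied to the soul of a point. -/
def numSoul (p : SuperPoint n) (j : Fin n) : CS0 :=
  ⟨SA.numOp (p.soul j), CS.IsEven.numOp (p.soul_even j)⟩

theorem extHom_num (p : SuperPoint n) (F : SmoothEven n) :
    SA.numOp (grassmannExt F.fn p) = (extHom p (num F) + ∑ j, (extHom p (dz j F) * numSoul p j +
      extHom p (dzbar j F) * CS0.conjHom (numSoul p j)) : CS0) := by
  rw [numOp_grassmannExt p F.smooth, Subring.coe_add]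
  congr 1
  rw [← Subring.subtype_apply, map_sum]
  refine Finset.sum_congr rfl fun j _ => ?_
  rw [Subring.subtype_apply, Subring.coe_add, Subring.coe_mul, Subring.coe_mul, coe_extHom,
    coe_extHom, fn_dz, fn_dzbar]
  rfl

/-- Apply the number operator to `g(p) = 0`: by the chain rule the motion of the coefficients of `g`
is balanced by the motion of the soul of `p`. Solving with the adjugate identifies the field at `p`
with minus `jacAbs` times the number operator of the soul. -/
theorem extHom_transport {g : Fin n → SmoothEven n} {U : Set (Fin n → ℂ)} (hU : IsOpen U)
    (hg : ∀ i j, ∀ z ∈ U, (dzbar j (g i)).fn z = 0) {p : SuperPoint n} (hp : p.bodyPt ∈ U)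
    (h0 : ∀ i, grassmannExt (g i).fn p = 0) (j : Fin n) :
    extHom p (transport g j) = -(extHom p (jacAbs g) * numSoul p j) := by
  have h1 : ∀ i, extHom p (num (g i)) = -∑ l, extHom p (dz l (g i)) * numSoul p l := by
    intro i
    have h := extHom_num p (g i)
    rw [h0, map_zero] at h
    have h' := (ZeroMemClass.coe_eq_zero.1 h.symm)
    rw [eq_neg_iff_add_eq_zero, ← h']
    congr 1
    refine Finset.sum_congr rfl fun l _ => ?_
    -- Holomorphy on a neighbourhood of the body point removes the terms with conjugate souls.
    have hz : extHom p (dzbar l (g i)) = 0 := by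
      refine Subtype.ext ?_
      rw [coe_extHom, grassmannExt_congr (H := fun _ => 0), grassmannExt_const]
      · rfl
      · filter_upwards [hU.mem_nhds hp] with w hw using hg i l w hw
    rw [hz, zero_mul, add_zero]
  have h2 : ∀ l, ∑ i, extHom p ((jac g).adjugate j i) * extHom p (dz l (g i)) =
      if j = l then extHom p (jac g).det else 0 := by
    intro l
    have h := congrArg (extHom p) (congrFun (congrFun (Matrix.adjugate_mul (jac g)) j) l)
    rw [Matrix.mul_apply, map_sum] at h
    simp only [map_mul, Matrix.smul_apply, Matrix.one_apply, smul_eq_mul, apply_ite (extHom p),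
      map_zero, mul_ite, mul_one, mul_zero] at h
    exact h
  rw [transport, map_mul, map_sum]
  simp only [map_mul, h1]
  have h3 : ∑ i, extHom p ((jac g).adjugate j i) *
      -∑ l, extHom p (dz l (g i)) * numSoul p l = -(extHom p (jac g).det * numSoul p j) := by
    simp only [mul_neg, Finset.sum_neg_distrib, Finset.mul_sum]
    rw [Finset.sum_comm]
    simp only [← mul_assoc]
    simp only [← Finset.sum_mul, h2, ite_mul, zero_mul, Finset.sum_ite_eq, Finset.mem_univ, if_true]
  rw [h3, jacAbs, map_mul]
  ring

end SmoothEven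

end

/-! ### Integration by parts for test functions and the induction over the length. -/

section

variable {n : ℕ}

open MeasureTheory

/-! ### Test functions -/

/-- Smooth functions with compact support in `U`. -/
def IsTest (U : Set (Fin n → ℂ)) (F : (Fin n → ℂ) → CS) : Prop :=
  SmoothCoeffOn F Set.univ ∧ ∃ K, IsCompact K ∧ K ⊆ U ∧ ∀ z ∉ K, F z = 0

namespace IsTest

variable {U : Set (Fin n → ℂ)} {F H : (Fin n → ℂ) → CS}

theorem contDiff (hF : IsTest U F) (m : ℕ →₀ ℕ) : ContDiff ℝ ∞ fun z => (F z).coeff m :=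
  contDiffOn_univ.1 (hF.1 m)

theorem diffAt (hF : IsTest U F) (z : Fin n → ℂ) : DiffCoeffAt F z :=
  hF.1.diffCoeffAt isOpen_univ (Set.mem_univ z)

theorem eq_zero_of_notMem (hF : IsTest U F) {z : Fin n → ℂ} (hz : z ∉ U) : F z = 0 := by
  obtain ⟨K, -, hKU, h0⟩ := hF.2
  exact h0 z fun h => hz (hKU h)

theorem hasCompactSupport (hF : IsTest U F) (m : ℕ →₀ ℕ) :
    HasCompactSupport fun z => (F z).coeff m := by
  obtain ⟨K, hK, -, h0⟩ := hF.2
  exact HasCompactSupport.intro hK fun z hz => by rw [h0 z hz]; rfl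

theorem integrable (hF : IsTest U F) (m : ℕ →₀ ℕ) : Integrable fun z => (F z).coeff m :=
  (hF.contDiff m).continuous.integrable_of_hasCompactSupport (hF.hasCompactSupport m)

theorem add (hF : IsTest U F) (hH : IsTest U H) : IsTest U fun z => F z + H z := by
  refine ⟨hF.1.add hH.1, ?_⟩
  obtain ⟨K, hK, hKU, h0⟩ := hF.2
  obtain ⟨K', hK', hKU', h0'⟩ := hH.2
  refine ⟨K ∪ K', hK.union hK', Set.union_subset hKU hKU', fun z hz => ?_⟩
  simp only [h0 z fun h => hz (Or.inl h), h0' z fun h => hz (Or.inr h), add_zero]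

theorem sub (hF : IsTest U F) (hH : IsTest U H) : IsTest U fun z => F z - H z := by
  refine ⟨hF.1.sub hH.1, ?_⟩
  obtain ⟨K, hK, hKU, h0⟩ := hF.2
  obtain ⟨K', hK', hKU', h0'⟩ := hH.2
  refine ⟨K ∪ K', hK.union hK', Set.union_subset hKU hKU', fun z hz => ?_⟩
  simp only [h0 z fun h => hz (Or.inl h), h0' z fun h => hz (Or.inr h), sub_zero]

theorem const_smul (c : ℂ) (hF : IsTest U F) : IsTest U fun z => c • F z := by
  obtain ⟨K, hK, hKU, h0⟩ := hF.2
  exact ⟨hF.1.const_smul c, K, hK, hKU, fun z hz => by simp only [h0 z hz, smul_zero]⟩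

theorem mul (hF : IsTest U F) (hH : SmoothCoeffOn H Set.univ) : IsTest U fun z => F z * H z := by
  obtain ⟨K, hK, hKU, h0⟩ := hF.2
  exact ⟨hF.1.mul hH, K, hK, hKU, fun z hz => by simp only [h0 z hz, zero_mul]⟩

/-- `H` may be wild outside `U`, but the product vanishes near every point outside the compact set
that carries `F`. -/
theorem mul_smoothOn (hF : IsTest U F) (hU : IsOpen U) (hH : SmoothCoeffOn H U) :
    IsTest U fun z => F z * H z := by
  obtain ⟨K, hK, hKU, h0⟩ := hF.2
  refine ⟨fun m => ?_, K, hK, hKU, fun z hz => by simp only [h0 z hz, zero_mul]⟩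
  rw [contDiffOn_univ, contDiff_iff_contDiffAt]
  intro z
  by_cases hz : z ∈ K
  · exact ((hF.1.mono (Set.subset_univ U)).mul hH m).contDiffAt (hU.mem_nhds (hKU hz))
  · refine (contDiffAt_const (c := (0 : ℂ))).congr_of_eventuallyEq ?_
    filter_upwards [hK.isClosed.isOpen_compl.mem_nhds hz] with w hw
    rw [h0 w hw, zero_mul]
    rfl

theorem sum {ι : Type*} (s : Finset ι) {F : ι → (Fin n → ℂ) → CS} (h : ∀ i, IsTest U (F i)) :
    IsTest U fun z => ∑ i ∈ s, F i z := by
  classical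
  induction s using Finset.induction_on with
  | empty => exact ⟨smoothCoeffOn_const _ _, ∅, isCompact_empty, Set.empty_subset _, fun _ _ => rfl⟩
  | insert a s ha ih => simpa only [Finset.sum_insert ha] using (h a).add ih

theorem numOp (hF : IsTest U F) : IsTest U fun z => SA.numOp (F z) := by
  obtain ⟨K, hK, hKU, h0⟩ := hF.2
  exact ⟨hF.1.numOp, K, hK, hKU, fun z hz => by simp only [h0 z hz, map_zero]⟩

theorem pderivZ (hF : IsTest U F) (j : Fin n) : IsTest U (pderivZ j F) := by
  obtain ⟨K, hK, hKU, h0⟩ := hF.2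
  refine ⟨hF.1.pderivZ isOpen_univ j, K, hK, hKU, fun z hz => ?_⟩
  rw [pderivZ_congr (H := fun _ => 0), pderivZ_const]
  filter_upwards [hK.isClosed.isOpen_compl.mem_nhds hz] with w hw using h0 w hw

theorem pderivZbar (hF : IsTest U F) (j : Fin n) : IsTest U (pderivZbar j F) := by
  obtain ⟨K, hK, hKU, h0⟩ := hF.2
  refine ⟨hF.1.pderivZbar isOpen_univ j, K, hK, hKU, fun z hz => ?_⟩
  rw [pderivZbar_congr (H := fun _ => 0), pderivZbar_const]
  filter_upwards [hK.isClosed.isOpen_compl.mem_nhds hz] with w hw using h0 w hw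

theorem integrable_fderiv (hF : IsTest U F) (m : ℕ →₀ ℕ) (v : Fin n → ℂ) :
    Integrable fun z => fderiv ℝ (fun w => (F w).coeff m) z v := by
  have hc : Continuous fun z => fderiv ℝ (fun w => (F w).coeff m) z v := by
    have := (hF.contDiff m).continuous_fderiv (by simp)
    fun_prop
  exact hc.integrable_of_hasCompactSupport ((hF.hasCompactSupport m).fderiv_apply ℝ v)

theorem integral_pderivZ (hF : IsTest U F) (j : Fin n) (m : ℕ →₀ ℕ) :
    ∫ z, (SuperResidue.pderivZ j F z).coeff m = 0 := by
  change ∫ z, (_ - Complex.I * _) / 2 = (0 : ℂ)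
  rw [integral_div, integral_sub (hF.integrable_fderiv m _) ((hF.integrable_fderiv m _).const_mul _),
    integral_const_mul, integral_fderiv_eq_zero_of_compact (hF.contDiff m) (hF.hasCompactSupport m),
    integral_fderiv_eq_zero_of_compact (hF.contDiff m) (hF.hasCompactSupport m)]
  simp

theorem integral_pderivZbar (hF : IsTest U F) (j : Fin n) (m : ℕ →₀ ℕ) :
    ∫ z, (SuperResidue.pderivZbar j F z).coeff m = 0 := by
  change ∫ z, (_ + Complex.I * _) / 2 = (0 : ℂ)
  rw [integral_div, integral_add (hF.integrable_fderiv m _) ((hF.integrable_fderiv m _).const_mul _),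
    integral_const_mul, integral_fderiv_eq_zero_of_compact (hF.contDiff m) (hF.hasCompactSupport m),
    integral_fderiv_eq_zero_of_compact (hF.contDiff m) (hF.hasCompactSupport m)]
  simp

end IsTest

/-- If `x` starts at the length of `m`, the soul of `y` pushes everything beyond `m`. This reduces
the last case of the induction to complex-valued integrals. -/
theorem SA.coeff_mul_of_fil {G : Type} [LinearOrder G] [GradedGen G] {x : SA G} (y : SA G)
    {m : G →₀ ℕ} (hx : SA.Fil m.degree x) : (x * y).coeff m = x.coeff m * y.coeff 0 := by
  have h1 : SA.Fil 1 (y - y.coeff 0 • 1) := SA.fil_one_iff.2 (by simp [SA.coeff_one])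
  have h2 := (hx.mul h1) m (Nat.lt_succ_self _)
  rw [mul_sub, SA.coeff_sub, mul_smul_comm, mul_one, SA.coeff_smul, sub_eq_zero] at h2
  rw [h2, mul_comm]

theorem SA.coeff_exp_zero {G : Type} [LinearOrder G] [GradedGen G] (x : SA G) :
    (SA.exp x).coeff 0 = Complex.exp (x.coeff 0) := by
  have h : SA.Fil 1 (x - x.coeff 0 • 1) := SA.fil_one_iff.2 (by simp [SA.coeff_one])
  rw [SA.exp_body_soul, SA.coeff_smul, SA.coeff_exp_of_fil h (N := 1) (by simp)]
  simp [SA.coeff_one]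

/-- A function whose antiholomorphic derivatives vanish at a point is complex differentiable. -/
theorem fderiv_apply_of_pderivZbar_eq_zero {F : (Fin n → ℂ) → CS} {z : Fin n → ℂ}
    (m : ℕ →₀ ℕ)
    (h : ∀ j, (pderivZbar j F z).coeff m = 0) (v : Fin n → ℂ) :
    fderiv ℝ (fun w => (F w).coeff m) z v = ∑ j, (pderivZ j F z).coeff m * v j := by
  set L := fderiv ℝ (fun w => (F w).coeff m) z with hL
  have h1 : ∀ j, L (Pi.single j 1) = (pderivZ j F z).coeff m := fun j => by
    have e1 : (L (Pi.single j 1) + Complex.I * L (Pi.single j Complex.I)) / 2 = 0 := h j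
    change _ = (L (Pi.single j 1) - Complex.I * L (Pi.single j Complex.I)) / 2
    linear_combination e1
  have h2 : ∀ j, L (Pi.single j Complex.I) = Complex.I * (pderivZ j F z).coeff m := fun j => by
    have e1 : (L (Pi.single j 1) + Complex.I * L (Pi.single j Complex.I)) / 2 = 0 := h j
    rw [← h1]
    linear_combination (-2 * Complex.I) * e1 + L (Pi.single j Complex.I) * Complex.I_mul_I
  have hv : v = ∑ j, ((v j).re • (Pi.single j 1 : Fin n → ℂ) +
      (v j).im • (Pi.single j Complex.I : Fin n → ℂ)) := by
    funext i
    rw [Finset.sum_apply, Finset.sum_eq_single i]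
    · simp [Complex.re_add_im]
    · intro j _ hj
      simp [hj.symm]
    · simp
  conv_lhs => rw [hv]
  rw [map_sum]
  refine Finset.sum_congr rfl fun j _ => ?_
  rw [map_add, map_smul, map_smul, h1, h2, Complex.real_smul, Complex.real_smul]
  conv_rhs => rw [← Complex.re_add_im (v j)]
  ring

open SmoothEven

/-- The first order operator that compensates the number operator under the Gaussian integral. -/
def transportOp (g : Fin n → SmoothEven n) (F : (Fin n → ℂ) → CS) (z : Fin n → ℂ) : CS :=
  ∑ j, (pderivZ j F z * (transport g j).fn z + pderivZbar j F z * (conj (transport g j)).fn z)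

/-- The number operator kills bodies, so the components of the field are souls. Differentiation
along the field therefore raises the length, which drives the induction. -/
theorem fil_transport (g : Fin n → SmoothEven n) (j : Fin n) (z : Fin n → ℂ) :
    SA.Fil 1 ((transport g j).fn z) := by
  rw [transport, fn_mul, fn_sum]
  refine SA.Fil.mul_left _ (SA.fil_sum fun i _ => ?_)
  rw [fn_mul]
  exact SA.Fil.mul_left _ (SA.fil_numOp _)

theorem fil_pderivZ {F : (Fin n → ℂ) → CS} {d : ℕ} (h : ∀ z, SA.Fil d (F z)) (j : Fin n)
    (z : Fin n → ℂ) : SA.Fil d (pderivZ j F z) := by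
  rw [pderivZ_eq]
  exact ((fil_dirDeriv h _ z).sub ((fil_dirDeriv h _ z).smul _)).smul _

theorem fil_pderivZbar {F : (Fin n → ℂ) → CS} {d : ℕ} (h : ∀ z, SA.Fil d (F z)) (j : Fin n)
    (z : Fin n → ℂ) : SA.Fil d (pderivZbar j F z) := by
  rw [pderivZbar_eq]
  exact ((fil_dirDeriv h _ z).add ((fil_dirDeriv h _ z).smul _)).smul _

theorem fil_transportOp (g : Fin n → SmoothEven n) {F : (Fin n → ℂ) → CS} {d : ℕ}
    (h : ∀ z, SA.Fil d (F z)) (z : Fin n → ℂ) : SA.Fil (d + 1) (transportOp g F z) :=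
  SA.fil_sum fun j _ => ((fil_pderivZ h j z).mul (fil_transport g j z)).add
    ((fil_pderivZbar h j z).mul (CS.fil_conj (fil_transport g j z)))

theorem body_jacAbs (g : Fin n → SmoothEven n) (z : Fin n → ℂ) :
    body ((jacAbs g).fn z) = (‖body ((jac g).det.fn z)‖ : ℂ) ^ 2 := by
  have h : body ((jacAbs g).fn z) = body ((jac g).det.fn z) *
      (starRingEnd ℂ) (body ((jac g).det.fn z)) := SA.coeff_mul_zero _ _
  rw [h, Complex.mul_conj, Complex.normSq_eq_norm_sq]
  push_cast
  rfl

theorem body_weight (g : Fin n → SmoothEven n) (t : ℝ) (z : Fin n → ℂ) :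
    body ((weight g t).fn z) =
      Complex.exp (-((t : ℂ)⁻¹ * ∑ i, (‖body ((g i).fn z)‖ : ℂ) ^ 2)) := by
  have h1 : ((normSq g).fn z).coeff 0 = ∑ i, (‖body ((g i).fn z)‖ : ℂ) ^ 2 := by
    rw [normSq, fn_sum, SA.coeff_sum]
    refine Finset.sum_congr rfl fun i _ => ?_
    rw [fn_mul, SA.coeff_mul_zero, fn_conj, CS.coeff_conj, Complex.mul_conj,
      Complex.normSq_eq_norm_sq]
    push_cast
    rfl
  change (SA.exp _).coeff 0 = _
  rw [SA.coeff_exp_zero, fn_neg, fn_smul, SA.coeff_neg, SA.coeff_smul, h1]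

/-- The body of the Jacobian. -/
def bodyJac (g : Fin n → SmoothEven n) (z : Fin n → ℂ) : Matrix (Fin n) (Fin n) ℂ :=
  Matrix.of fun i j => body ((dz j (g i)).fn z)

/-- The data for the Laplace method: the body of a zero is a zero of the bodies, and by holomorphy
the real derivative there is the complex Jacobian. -/
theorem hasFDerivAt_body_jac (g : Fin n → SmoothEven n) {p : SuperPoint n}
    (h0 : ∀ i, grassmannExt (g i).fn p = 0) (hg : ∀ i j, (dzbar j (g i)).fn p.bodyPt = 0) :
    (bodyJac g p.bodyPt).det = body ((jac g).det.fn p.bodyPt) ∧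
      HasFDerivAt (fun z i => body ((g i).fn z)) (LinearMap.toContinuousLinearMap
        ((bodyJac g p.bodyPt).mulVecLin.restrictScalars ℝ)) p.bodyPt ∧
      (fun i => body ((g i).fn p.bodyPt)) = 0 := by
  refine ⟨?_, ?_, funext fun i => ?_⟩
  · have h := RingHom.map_det (CS0.bodyHom.comp (evalHom p.bodyPt)) (jac g)
    rw [RingHom.comp_apply, CS0.bodyHom_apply, coe_evalHom] at h
    rw [h]
    rfl
  · rw [hasFDerivAt_pi']
    intro i
    have hs : ContDiff ℝ ∞ fun z => body ((g i).fn z) := contDiffOn_univ.1 ((g i).smooth 0)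
    refine (hs.differentiable (by simp) p.bodyPt).hasFDerivAt.congr_fderiv
      (ContinuousLinearMap.ext fun v => ?_)
    refine (fderiv_apply_of_pderivZbar_eq_zero (F := (g i).fn) (z := p.bodyPt) 0 (fun j => by
      rw [← fn_dzbar, hg i j]; rfl) v).trans ?_
    simp only [← fn_dz]
    rfl
  · have := body_grassmannExt (g i).fn p
    rw [h0 i] at this
    exact this.symm

section Local

variable {g : Fin n → SmoothEven n} {U : Set (Fin n → ℂ)} (hU : IsOpen U)
  (hg : ∀ i j, ∀ z ∈ U, (dzbar j (g i)).fn z = 0)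

include hU hg

/-- On the `m`-th coefficient the number operator is multiplication by `m.degree`. It falls on `F`
or on the density; in the second case it is a divergence, and integration by parts moves the field
onto `F`. -/
theorem numOp_integral_eq {F : (Fin n → ℂ) → CS} (hF : IsTest U F) (t : ℝ) (m : ℕ →₀ ℕ) :
    (m.degree : ℂ) * ∫ z, (F z * (jacAbs g * weight g t).fn z).coeff m =
      (∫ z, (SA.numOp (F z) * (jacAbs g * weight g t).fn z).coeff m) -
        ∫ z, (transportOp g F z * (weight g t).fn z).coeff m := by
  set W := weight g t with hW
  set X := jacAbs g * W with hX
  have ht1 : ∀ j, IsTest U fun w => F w * (transport g j * W).fn w :=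
    fun j => hF.mul (transport g j * W).smooth
  have ht2 : ∀ j, IsTest U fun w => F w * (conj (transport g j) * W).fn w :=
    fun j => hF.mul (conj (transport g j) * W).smooth
  have htr : IsTest U (transportOp g F) := IsTest.sum _ fun j =>
    ((hF.pderivZ j).mul (transport g j).smooth).add
      ((hF.pderivZbar j).mul (conj (transport g j)).smooth)
  -- The total divergence of `F` times the field times the weight; its integral is zero by compact
  -- support.
  set Dv : (Fin n → ℂ) → CS := fun z => ∑ j,
    (pderivZ j (fun w => F w * (transport g j * W).fn w) z +
      pderivZbar j (fun w => F w * (conj (transport g j) * W).fn w) z) with hDv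
  have hDtest : IsTest U Dv := IsTest.sum _ fun j => ((ht1 j).pderivZ j).add ((ht2 j).pderivZbar j)
  have hDint : ∫ z, (Dv z).coeff m = 0 := by
    simp only [hDv, SA.coeff_sum, SA.coeff_add]
    rw [integral_finsetSum _ fun j _ => (((ht1 j).pderivZ j).integrable m).fun_add
      (((ht2 j).pderivZbar j).integrable m)]
    refine Finset.sum_eq_zero fun j _ => ?_
    rw [integral_add (((ht1 j).pderivZ j).integrable m) (((ht2 j).pderivZbar j).integrable m),
      (ht1 j).integral_pderivZ, (ht2 j).integral_pderivZbar, add_zero]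
  have hpt : ∀ z, Dv z = transportOp g F z * W.fn z + F z * (num X).fn z := by
    intro z
    have h1 : Dv z = transportOp g F z * W.fn z + F z * (∑ j, (dz j (transport g j * W) +
        dzbar j (conj (transport g j) * W))).fn z := by
      simp only [hDv, transportOp, pderivZ_mul (hF.diffAt z) (SmoothEven.diffAt _ z),
        pderivZbar_mul (hF.diffAt z) (SmoothEven.diffAt _ z)]
      rw [fn_sum, Finset.sum_mul, Finset.mul_sum, ← Finset.sum_add_distrib]
      refine Finset.sum_congr rfl fun j _ => ?_
      rw [fn_add, fn_dz, fn_dzbar, fn_mul, fn_mul]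
      noncomm_ring
    rw [h1]
    -- The divergence identity is available only on `U`; outside, `F` vanishes.
    by_cases hz : z ∈ U
    · rw [← coe_evalHom z (num X), ← evalHom_divergence hU hg t hz]
      rfl
    · rw [hF.eq_zero_of_notMem hz, zero_mul, zero_mul]
  have hnum : ∀ z, (m.degree : ℂ) * (F z * X.fn z).coeff m =
      (SA.numOp (F z) * X.fn z).coeff m + ((Dv z).coeff m -
        (transportOp g F z * W.fn z).coeff m) := by
    intro z
    rw [hpt, SA.coeff_add, add_sub_cancel_left, ← SA.coeff_numOp, SA.numOp_mul, SA.coeff_add]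
    rfl
  rw [← integral_const_mul]
  simp only [hnum]
  have hi : Integrable fun z => (Dv z).coeff m - (transportOp g F z * W.fn z).coeff m :=
    (hDtest.integrable m).sub ((htr.mul W.smooth).integrable m)
  rw [integral_add ((hF.numOp.mul X.smooth).integrable m) hi,
    integral_sub (hDtest.integrable m) ((htr.mul W.smooth).integrable m), hDint, zero_sub]
  ring

variable {p : SuperPoint n} (hp : p.bodyPt ∈ U) (h0 : ∀ i, grassmannExt (g i).fn p = 0)
  (hdet : ∀ z ∈ U, body ((jac g).det.fn z) ≠ 0)

-- Dividing by `jacAbs` turns `transportOp` into the derivative along the field `A⁻¹ N(g)`. The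
-- quotient is smooth because the derivatives of `F` live where the Jacobian is invertible.
include hdet in
theorem IsTest.transportOp_div {F : (Fin n → ℂ) → CS} (hF : IsTest U F) :
    IsTest U fun z => transportOp g F z * ((jacAbs g).fn z).geomInv := by
  have htr : IsTest U (transportOp g F) := IsTest.sum _ fun j =>
    ((hF.pderivZ j).mul (transport g j).smooth).add
      ((hF.pderivZbar j).mul (conj (transport g j)).smooth)
  refine htr.mul_smoothOn hU (SmoothCoeffOn.geomInv ((jacAbs g).smooth.mono (Set.subset_univ U)) ?_)
  intro z hz
  rw [body_jacAbs]
  exact pow_ne_zero 2 (by exact_mod_cast (norm_ne_zero_iff.2 (hdet z hz)))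

include hdet in
theorem transportOp_div_mul {F : (Fin n → ℂ) → CS} (hF : IsTest U F) (z : Fin n → ℂ) :
    transportOp g F z * ((jacAbs g).fn z).geomInv * (jacAbs g).fn z = transportOp g F z := by
  by_cases hz : z ∈ U
  · have hb : body ((jacAbs g).fn z) ≠ 0 := by
      rw [body_jacAbs]
      exact pow_ne_zero 2 (by exact_mod_cast (norm_ne_zero_iff.2 (hdet z hz)))
    rw [mul_assoc, ← (((jacAbs g).isEven z).commute _).eq, CS.mul_geomInv hb, mul_one]
  · have : transportOp g F z = 0 := Finset.sum_eq_zero fun j _ => by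
      rw [(hF.pderivZ j).eq_zero_of_notMem hz, (hF.pderivZbar j).eq_zero_of_notMem hz,
        zero_mul, zero_mul, add_zero]
    rw [this, zero_mul, zero_mul]

include hp h0 hdet

/-- The counterpart of `numOp_integral_eq` for evaluation at `p`. In the chain rule the number
operator of the soul is minus the field at `p` divided by `jacAbs`, so the same combination of `F`
appears as under the integral. -/
theorem grassmannExt_transportOp_div {F : (Fin n → ℂ) → CS} (hF : IsTest U F) :
    SA.numOp (grassmannExt F p) = grassmannExt (fun z => SA.numOp (F z)) p -
      grassmannExt (fun z => transportOp g F z * ((jacAbs g).fn z).geomInv) p := by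
  rw [numOp_grassmannExt p hF.1, sub_eq_add_neg]
  congr 1
  set R : CS := ∑ j, (grassmannExt (pderivZ j F) p * SA.numOp (p.soul j) +
        grassmannExt (pderivZbar j F) p * CS.conj (SA.numOp (p.soul j))) with hR
  have htest := IsTest.transportOp_div hU hg hdet hF
  have hJ : body (extHom p (jacAbs g) : CS) ≠ 0 := by
    rw [coe_extHom, body_grassmannExt, body_jacAbs]
    exact pow_ne_zero 2 (by exact_mod_cast (norm_ne_zero_iff.2 (hdet _ hp)))
  have h1 : grassmannExt (fun z => transportOp g F z * ((jacAbs g).fn z).geomInv) p *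
      (extHom p (jacAbs g) : CS) = grassmannExt (transportOp g F) p := by
    rw [coe_extHom, ← grassmannExt_mul p htest.1 (jacAbs g).smooth]
    congr 1
    funext z
    exact transportOp_div_mul hU hg hdet hF z
  have h2 : grassmannExt (transportOp g F) p = -(R * (extHom p (jacAbs g) : CS)) := by
    unfold transportOp
    rw [grassmannExt_sum _ p fun j => ((hF.pderivZ j).mul (transport g j).smooth).1.add
      ((hF.pderivZbar j).mul (conj (transport g j)).smooth).1, hR, Finset.sum_mul,
      ← Finset.sum_neg_distrib]
    refine Finset.sum_congr rfl fun j _ => ?_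
    have e1 : grassmannExt (transport g j).fn p =
        -((extHom p (jacAbs g) : CS) * SA.numOp (p.soul j)) :=
      congrArg Subtype.val (extHom_transport hU hg hp h0 j)
    have e2 : grassmannExt (conj (transport g j)).fn p =
        -((extHom p (jacAbs g) : CS) * CS.conj (SA.numOp (p.soul j))) := by
      have := congrArg Subtype.val (extHom_conj p (transport g j))
      rw [extHom_transport hU hg hp h0 j, map_neg, map_mul, ← extHom_conj, conj_jacAbs] at this
      exact this
    rw [grassmannExt_add p ((hF.pderivZ j).mul (transport g j).smooth).1
      ((hF.pderivZbar j).mul (conj (transport g j)).smooth).1,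
      grassmannExt_mul p (hF.pderivZ j).1 (transport g j).smooth,
      grassmannExt_mul p (hF.pderivZbar j).1 (conj (transport g j)).smooth, e1, e2,
      (CS0.coe_commute (extHom p (jacAbs g)) _).eq, (CS0.coe_commute (extHom p (jacAbs g)) _).eq]
    noncomm_ring
  rw [h2, ← neg_mul] at h1
  have h3 := congrArg (· * CS.geomInv (extHom p (jacAbs g) : CS)) h1
  simp only [mul_assoc, CS.mul_geomInv hJ, mul_one] at h3
  rw [h3, neg_neg]

/-- The asymptotics of Gaussian integrals of test functions. -/
theorem tendsto_test {c : ℝ} (hc : 0 < c)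
    (hlow : ∀ z ∈ U, c * ∑ i, ‖z i - p.bodyPt i‖ ^ 2 ≤ ∑ i, ‖body ((g i).fn z)‖ ^ 2)
    {F : (Fin n → ℂ) → CS} (hF : IsTest U F) (m : ℕ →₀ ℕ) :
    Filter.Tendsto (fun t : ℝ => ((t : ℂ) ^ n)⁻¹ *
        ∫ z, (F z * (jacAbs g * weight g t).fn z).coeff m) (𝓝[>] 0)
      (𝓝 ((Real.pi : ℂ) ^ n * (grassmannExt F p).coeff m)) := by
  set M := m.degree with hM
  -- Induction on how far the first possible length `M + 1 - e` of `F` lies below `M + 1`. At `e =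
  -- 0` the coefficient at `m` is zero on both sides; `e = M + 1` is no condition on `F`.
  suffices h : ∀ e : ℕ, ∀ F : (Fin n → ℂ) → CS, IsTest U F → (∀ z, SA.Fil (M + 1 - e) (F z)) →
      Filter.Tendsto (fun t : ℝ => ((t : ℂ) ^ n)⁻¹ *
        ∫ z, (F z * (jacAbs g * weight g t).fn z).coeff m) (𝓝[>] 0)
        (𝓝 ((Real.pi : ℂ) ^ n * (grassmannExt F p).coeff m)) from
    h (M + 1) F hF fun z => by simpa using SA.fil_zero (F z)
  intro e
  induction e with
  | zero =>
    intro F _ hfil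
    have h1 : (grassmannExt F p).coeff m = 0 := fil_grassmannExt p hfil m (by simp [hM])
    have h2 : ∀ (t : ℝ) z, (F z * (jacAbs g * weight g t).fn z).coeff m = 0 := fun t z =>
      (hfil z).mul_right _ m (by simp [hM])
    simp only [h1, h2, integral_zero, mul_zero]
    exact tendsto_const_nhds
  | succ e ih =>
    intro F hF hfil
    -- Here both truncated differences `M + 1 - e` and `M + 1 - (e + 1)` are zero, and there is
    -- nothing to gain.
    by_cases he : M < e
    · refine ih F hF fun z => (hfil z).mono ?_
      omega
    obtain ⟨d, hd, hd'⟩ : ∃ d, M + 1 - (e + 1) = d ∧ M + 1 - e = d + 1 := ⟨M - e, by omega, by omega⟩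
    rw [hd] at hfil
    rw [hd'] at ih
    -- At `d = m.degree` the number operator gives no information, since the factor `m.degree - d`
    -- vanishes. But then only the lowest coefficients of `F` and the bodies of the other factors
    -- enter, and the Laplace method applies.
    by_cases hmd : m.degree = d
    · rw [← hmd] at hfil
      rw [coeff_grassmannExt_of_fil p hfil]
      obtain ⟨hBdet, hbd, hbP⟩ := hasFDerivAt_body_jac g h0 fun i j => hg i j _ hp
      set B := bodyJac g p.bodyPt with hB
      have hBne : B.det ≠ 0 := by rw [hBdet]; exact hdet _ hp
      have hbs : ∀ i, Continuous fun z => body ((g i).fn z) :=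
        fun i => (contDiffOn_univ.1 ((g i).smooth 0)).continuous
      set f : (Fin n → ℂ) → ℂ := fun z => (F z).coeff m * body ((jacAbs g).fn z) with hf
      have hfc : Continuous f := (hF.contDiff m).continuous.mul
        (contDiffOn_univ.1 ((jacAbs g).smooth 0)).continuous
      have hfs : HasCompactSupport f := (hF.hasCompactSupport m).mul_right
      have hlap := tendsto_laplace hfc hfs (continuous_pi hbs) hBne hbd hbP
        hc fun z hz => hlow z (by
          by_contra hzU
          apply hz
          rw [hf]
          simp only
          rw [hF.eq_zero_of_notMem hzU, SA.coeff_zero, zero_mul])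
      have hval : f p.bodyPt * (Real.pi ^ n / (‖B.det‖ : ℂ) ^ 2) =
          (Real.pi : ℂ) ^ n * (F p.bodyPt).coeff m := by
        have hne : ((‖B.det‖ : ℝ) : ℂ) ≠ 0 := by exact_mod_cast (norm_ne_zero_iff.2 hBne)
        rw [hf]
        simp only
        rw [body_jacAbs, ← hBdet]
        field_simp
      rw [hval] at hlap
      refine hlap.congr fun t => ?_
      congr 1
      refine integral_congr_ae (Filter.Eventually.of_forall fun z => ?_)
      simp only
      rw [SA.coeff_mul_of_fil _ (hfil z), fn_mul, SA.coeff_mul_zero, hf]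
      simp only
      rw [mul_assoc]
      congr 2
      exact (body_weight g t z).symm
    · set F' : (Fin n → ℂ) → CS := fun z => transportOp g F z * ((jacAbs g).fn z).geomInv with hF'
      have htF' : IsTest U F' := IsTest.transportOp_div hU hg hdet hF
      -- Subtracting `d • F` cancels the coefficients of length `d`, so `H` starts one step later.
      -- Passing from `F` to `H` multiplies both the integral and the value at `p` by `m.degree -
      -- d`.
      set H : (Fin n → ℂ) → CS := fun z => SA.numOp (F z) - (d : ℂ) • F z - F' z with hH
      have htH : IsTest U H := (hF.numOp.sub (hF.const_smul _)).sub htF'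
      have hfilH : ∀ z, SA.Fil (d + 1) (H z) := fun z => by
        refine SA.Fil.sub (fun k hk => ?_) ((fil_transportOp g hfil z).mul_right _)
        rw [SA.coeff_sub, SA.coeff_numOp, SA.coeff_smul]
        by_cases hkd : k.degree = d
        · rw [hkd, sub_self]
        · rw [hfil z k (by omega), mul_zero, mul_zero, sub_zero]
      have hlim := ih H htH hfilH
      have hext : (grassmannExt H p).coeff m =
          ((m.degree : ℂ) - d) * (grassmannExt F p).coeff m := by
        have e1 : grassmannExt H p = SA.numOp (grassmannExt F p) - (d : ℂ) • grassmannExt F p := by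
          have e2 := grassmannExt_add p htH.1 (((hF.const_smul (d : ℂ)).add htF').1)
          have e3 : (fun z => H z + ((d : ℂ) • F z + F' z)) = fun z => SA.numOp (F z) := by
            funext z
            simp only [hH]
            abel
          rw [e3, grassmannExt_add p (hF.const_smul (d : ℂ)).1 htF'.1,
            grassmannExt_smul _ p hF.1] at e2
          rw [grassmannExt_transportOp_div hU hg hp h0 hdet hF, e2]
          abel
        rw [e1, SA.coeff_sub, SA.coeff_numOp, SA.coeff_smul, sub_mul]
      have hint : ∀ t : ℝ, ∫ z, (H z * (jacAbs g * weight g t).fn z).coeff m =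
          ((m.degree : ℂ) - d) * ∫ z, (F z * (jacAbs g * weight g t).fn z).coeff m := by
        intro t
        have hs := (jacAbs g * weight g t).smooth
        have e1 : ∀ z, (H z * (jacAbs g * weight g t).fn z).coeff m =
            (SA.numOp (F z) * (jacAbs g * weight g t).fn z).coeff m -
            (d : ℂ) * (F z * (jacAbs g * weight g t).fn z).coeff m -
            (F' z * (jacAbs g * weight g t).fn z).coeff m := by
          intro z
          rw [hH]
          simp only
          rw [sub_mul, sub_mul, SA.coeff_sub, SA.coeff_sub, smul_mul_assoc, SA.coeff_smul]
        have e2 : ∀ z, (F' z * (jacAbs g * weight g t).fn z).coeff m =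
            (transportOp g F z * (weight g t).fn z).coeff m := by
          intro z
          rw [fn_mul, ← mul_assoc, hF']
          simp only
          rw [transportOp_div_mul hU hg hdet hF z]
        rw [sub_mul, numOp_integral_eq hU hg hF t m, ← integral_const_mul]
        simp only [e1]
        have hi : Integrable fun z => (SA.numOp (F z) * (jacAbs g * weight g t).fn z).coeff m -
            (d : ℂ) * (F z * (jacAbs g * weight g t).fn z).coeff m :=
          ((hF.numOp.mul hs).integrable m).sub (((hF.mul hs).integrable m).const_mul _)
        rw [integral_sub hi ((htF'.mul hs).integrable m),
          integral_sub ((hF.numOp.mul hs).integrable m) (((hF.mul hs).integrable m).const_mul _)]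
        simp only [e2]
        ring
      -- The common factor can be divided out, which returns the limit for `H` to `F`.
      have hne : ((m.degree : ℂ) - d) ≠ 0 := by
        rw [sub_ne_zero]
        exact_mod_cast hmd
      have := hlim.const_mul ((m.degree : ℂ) - d)⁻¹
      rw [hext] at this
      refine (this.congr fun t => ?_).trans (le_of_eq (congrArg 𝓝 ?_))
      · rw [hint t]
        field_simp
      · field_simp

end Local

end

/-! ### Holomorphic functions of several variables are smooth. -/

section

variable {n : ℕ}

open MeasureTheory

/-! ### Holomorphic functions of several variables -/

/-- Cauchy's formula on the complex line `s ↦ z + s v` writes the directional derivative as a circle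
integral of values of `f`. This integral may be differentiated in `z` under the integral sign. -/
theorem differentiableOn_fderiv_apply {f : (Fin n → ℂ) → ℂ} {O : Set (Fin n → ℂ)} (hO : IsOpen O)
    (hf : DifferentiableOn ℂ f O) (v : Fin n → ℂ) :
    DifferentiableOn ℂ (fun z => fderiv ℂ f z v) O := by
  intro z0 hz0
  obtain ⟨R, hR, hRO⟩ := Metric.nhds_basis_closedBall.mem_iff.1 (hO.mem_nhds hz0)
  -- One `ρ` for the point `z`, one for the circle around it, and one for the ball used in the
  -- Cauchy estimate.
  obtain ⟨ρ, hρ, hρR⟩ : ∃ ρ > 0, 3 * ρ = R := ⟨R / 3, by positivity, by ring⟩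
  obtain ⟨C, hC⟩ := (isCompact_closedBall z0 R).exists_bound_of_continuousOn
    (hf.continuousOn.mono hRO)
  set r := ρ / (‖v‖ + 1) with hr
  have hr0 : 0 < r := by positivity
  have hrv : r * ‖v‖ ≤ ρ := by
    rw [hr, div_mul_eq_mul_div, div_le_iff₀ (by positivity)]
    nlinarith [norm_nonneg v]
  have hmem : ∀ z ∈ Metric.ball z0 ρ, ∀ s : ℂ, ‖s‖ ≤ r → z + s • v ∈ Metric.ball z0 (2 * ρ) := by
    intro z hz s hs
    rw [Metric.mem_ball, dist_eq_norm] at hz ⊢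
    have h1 : ‖s • v‖ ≤ ρ := by
      rw [norm_smul]
      exact (mul_le_mul_of_nonneg_right hs (norm_nonneg v)).trans hrv
    calc ‖z + s • v - z0‖ = ‖(z - z0) + s • v‖ := by congr 1; abel
      _ ≤ ‖z - z0‖ + ‖s • v‖ := norm_add_le _ _
      _ < 2 * ρ := by linarith
  have hsub : Metric.ball z0 (2 * ρ) ⊆ O := fun w hw => hRO (by
    rw [Metric.mem_closedBall]
    rw [Metric.mem_ball] at hw
    linarith)
  have hdiff : ∀ w ∈ Metric.ball z0 (2 * ρ), DifferentiableAt ℂ f w := fun w hw =>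
    hf.differentiableAt (hO.mem_nhds (hsub hw))
  -- The factor `2` appears because the estimate bounds the derivative by the oscillation `‖f x - f
  -- w‖`, which is at most `2 * C`.
  have hbound : ∀ w ∈ Metric.ball z0 (2 * ρ), ‖fderiv ℂ f w‖ ≤ 2 * C / ρ := by
    intro w hw
    have hb : Metric.ball w ρ ⊆ Metric.closedBall z0 R := fun x hx => by
      rw [Metric.mem_closedBall]
      rw [Metric.mem_ball] at hw hx
      linarith [dist_triangle x w z0]
    refine Complex.norm_fderiv_le_div_of_mapsTo_ball (hf.mono (hb.trans hRO)) (fun x hx => ?_) hρ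
    rw [Metric.mem_closedBall, dist_eq_norm]
    linarith [norm_sub_le (f x) (f w), hC x (hb hx), hC w (hb (Metric.mem_ball_self hρ))]
  set K : ℝ → ℂ := fun θ => deriv (circleMap 0 r) θ * (1 / (circleMap 0 r θ - 0) ^ 2) with hK
  have hcm : ∀ θ, circleMap 0 r θ ≠ 0 := fun θ => circleMap_ne_center hr0.ne'
  have hKc : Continuous K := by
    have h1 : Continuous fun θ => circleMap 0 r θ := continuous_circleMap 0 r
    rw [hK]
    simp only [deriv_circleMap, sub_zero]
    exact (h1.mul continuous_const).mul (continuous_const.div (h1.pow 2) fun θ => pow_ne_zero 2 (hcm θ))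
  have hrep : ∀ z ∈ Metric.ball z0 ρ, fderiv ℂ f z v = (2 * Real.pi * Complex.I)⁻¹ •
      ∫ θ in (0 : ℝ)..2 * Real.pi, K θ • f (z + circleMap 0 r θ • v) := by
    intro z hz
    have hline : ∀ s : ℂ, HasDerivAt (fun s : ℂ => z + s • v) v s := fun s => by
      simpa using ((hasDerivAt_id s).smul_const v).const_add z
    have hd : DifferentiableOn ℂ (fun s : ℂ => f (z + s • v)) (Metric.closedBall 0 r) := by
      intro s hs
      have := hdiff _ (hmem z hz s (by simpa using hs))
      exact (this.comp s (hline s).differentiableAt).differentiableWithinAt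
    have h1 := hd.deriv_eq_smul_circleIntegral hr0
    have h2 : deriv (fun s : ℂ => f (z + s • v)) 0 = fderiv ℂ f z v := by
      have h3 : HasFDerivAt f (fderiv ℂ f z) (z + (0 : ℂ) • v) := by
        rw [zero_smul, add_zero]
        refine (hdiff z ?_).hasFDerivAt
        simpa using hmem z hz 0 (by simpa using hr0.le)
      exact (h3.comp_hasDerivAt 0 (hline 0)).deriv
    rw [h2] at h1
    rw [eq_inv_smul_iff₀ Complex.two_pi_I_ne_zero, ← h1, circleIntegral]
    simp only [smul_eq_mul, hK, mul_assoc]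
  have hKb : ∀ x ∈ Metric.ball z0 ρ, ∀ θ, DifferentiableAt ℂ f (x + circleMap 0 r θ • v) := fun x hx θ =>
    hdiff _ (hmem x hx _ (by simp [abs_of_pos hr0]))
  have hcont : ∀ x ∈ Metric.ball z0 ρ, Continuous fun θ => K θ • f (x + circleMap 0 r θ • v) := by
    intro x hx
    refine hKc.smul (continuous_iff_continuousAt.2 fun θ => ?_)
    exact ContinuousAt.comp (f := fun θ : ℝ => x + circleMap 0 r θ • v) (hKb x hx θ).continuousAt
      (continuous_const.add ((continuous_circleMap 0 r).smul continuous_const)).continuousAt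
  have hmeas : Measurable fun θ : ℝ => fderiv ℂ f (z0 + circleMap 0 r θ • v) :=
    (measurable_fderiv ℂ f).comp
      (continuous_const.add ((continuous_circleMap 0 r).smul continuous_const)).measurable
  have key := intervalIntegral.hasFDerivAt_integral_of_dominated_of_fderiv_le (𝕜 := ℂ)
    (μ := volume) (a := 0) (b := 2 * Real.pi) (x₀ := z0) (s := Metric.ball z0 ρ)
    (F := fun x θ => K θ • f (x + circleMap 0 r θ • v))
    (F' := fun x θ => K θ • fderiv ℂ f (x + circleMap 0 r θ • v))
    (bound := fun θ => ‖K θ‖ * (2 * C / ρ)) (Metric.ball_mem_nhds z0 hρ)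
    (by
      filter_upwards [Metric.ball_mem_nhds z0 hρ] with x hx
      exact (hcont x hx).aestronglyMeasurable)
    ((hcont z0 (Metric.mem_ball_self hρ)).intervalIntegrable _ _)
    (hKc.measurable.smul hmeas).aestronglyMeasurable
    (Filter.Eventually.of_forall fun θ _ x hx => by
      rw [norm_smul]
      exact mul_le_mul_of_nonneg_left (hbound _ (hmem x hx _ (by simp [abs_of_pos hr0])))
        (norm_nonneg _))
    ((hKc.norm.mul continuous_const).intervalIntegrable _ _)
    (Filter.Eventually.of_forall fun θ _ x hx =>
      (((hKb x hx θ).hasFDerivAt.comp x ((hasFDerivAt_id x).add_const _)).const_smul (K θ)))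
  have hfin : DifferentiableAt ℂ (fun z => fderiv ℂ f z v) z0 := by
    refine (key.differentiableAt.const_smul (2 * Real.pi * Complex.I)⁻¹).congr_of_eventuallyEq ?_
    filter_upwards [Metric.ball_mem_nhds z0 hρ] with x hx using hrep x hx
  exact hfin.differentiableWithinAt

/-- In finite dimension the smoothness of the derivative can be tested on vectors, where the
directional derivatives are again holomorphic; induct on the order. -/
theorem contDiffOn_of_differentiableOn {f : (Fin n → ℂ) → ℂ} {O : Set (Fin n → ℂ)} (hO : IsOpen O)
    (hf : DifferentiableOn ℂ f O) : ContDiffOn ℂ ∞ f O := by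
  rw [contDiffOn_infty]
  intro k
  induction k generalizing f with
  | zero => simpa using hf.continuousOn
  | succ k ih =>
    push_cast
    rw [contDiffOn_succ_iff_fderiv_of_isOpen hO]
    refine ⟨hf, by simp, ?_⟩
    rw [contDiffOn_clm_apply]
    exact fun v => ih (differentiableOn_fderiv_apply hO hf v)

theorem HolomorphicCoeffOn.smooth {F : (Fin n → ℂ) → CS} {O : Set (Fin n → ℂ)} (hO : IsOpen O)
    (hF : HolomorphicCoeffOn F O) : SmoothCoeffOn F O := fun m =>
  (contDiffOn_of_differentiableOn hO (hF m)).restrict_scalars ℝ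

theorem HolomorphicCoeffOn.pderivZbar_eq_zero {F : (Fin n → ℂ) → CS} {O : Set (Fin n → ℂ)}
    (hO : IsOpen O) (hF : HolomorphicCoeffOn F O) (j : Fin n) {z : Fin n → ℂ} (hz : z ∈ O) :
    pderivZbar j F z = 0 := by
  ext m
  have hd : DifferentiableAt ℂ (fun w => (F w).coeff m) z := (hF m).differentiableAt (hO.mem_nhds hz)
  have h1 : fderiv ℝ (fun w => (F w).coeff m) z = (fderiv ℂ (fun w => (F w).coeff m) z).restrictScalars ℝ :=
    (hd.hasFDerivAt.restrictScalars ℝ).fderiv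
  have h2 : (Pi.single j Complex.I : Fin n → ℂ) = Complex.I • Pi.single j 1 := by
    rw [← Pi.single_smul, smul_eq_mul, mul_one]
  change (_ + Complex.I * _) / 2 = (0 : ℂ)
  rw [h1, ContinuousLinearMap.coe_restrictScalars', h2, map_smul, smul_eq_mul, ← mul_assoc,
    Complex.I_mul_I]
  ring

end

/-! ### Cutoffs and the asymptotics of Gaussian integrals over balls. -/

section

variable {n : ℕ}

open MeasureTheory SmoothEven

/-! ### Cutoff functions -/

theorem exists_cutoff {U : Set (Fin n → ℂ)} {P : Fin n → ℂ} (hU : U ∈ 𝓝 P) :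
    ∃ χ : (Fin n → ℂ) → ℂ, ContDiff ℝ ∞ χ ∧ (∃ K, IsCompact K ∧ K ⊆ U ∧ ∀ z ∉ K, χ z = 0) ∧
      ∀ᶠ z in 𝓝 P, χ z = 1 := by
  obtain ⟨R, hR, hRU⟩ := Metric.nhds_basis_closedBall.mem_iff.1 hU
  let f : ContDiffBump P := ⟨R / 2, R, by positivity, by linarith⟩
  refine ⟨fun z => (f z : ℂ), Complex.ofRealCLM.contDiff.comp f.contDiff,
    ⟨Metric.closedBall P R, isCompact_closedBall P R, hRU, fun z hz => ?_⟩, ?_⟩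
  · have : f z = 0 := f.zero_of_le_dist (le_of_lt (by simpa using hz))
    simp [this]
  · filter_upwards [f.eventuallyEq_one] with z hz
    simp [hz]

theorem isTest_cutoff_smul {U : Set (Fin n → ℂ)} (hU : IsOpen U) {χ : (Fin n → ℂ) → ℂ}
    (hχ : ContDiff ℝ ∞ χ) (hK : ∃ K, IsCompact K ∧ K ⊆ U ∧ ∀ z ∉ K, χ z = 0)
    {F : (Fin n → ℂ) → CS} (hF : SmoothCoeffOn F U) : IsTest U fun z => χ z • F z := by
  obtain ⟨K, hK, hKU, h0⟩ := hK
  have h1 : IsTest U fun z => χ z • (1 : CS) :=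
    ⟨SmoothCoeffOn.smul hχ.contDiffOn (smoothCoeffOn_const 1 _), K, hK, hKU, fun z hz => by
      simp only [h0 z hz, zero_smul]⟩
  simpa only [smul_mul_assoc, one_mul] using h1.mul_smoothOn hU hF

theorem exists_global {O : Set (Fin n → ℂ)} (hO : IsOpen O) {P : Fin n → ℂ} (hP : P ∈ O)
    {F : (Fin n → ℂ) → CS} (hF : SmoothCoeffOn F O) :
    ∃ H : (Fin n → ℂ) → CS, SmoothCoeffOn H Set.univ ∧ H =ᶠ[𝓝 P] F := by
  obtain ⟨χ, h1, h2, h3⟩ := exists_cutoff (hO.mem_nhds hP)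
  refine ⟨_, (isTest_cutoff_smul hO h1 h2 hF).1, ?_⟩
  filter_upwards [h3] with z hz
  rw [hz, one_smul]

theorem exists_global_even {O : Set (Fin n → ℂ)} (hO : IsOpen O) {P : Fin n → ℂ} (hP : P ∈ O)
    {F : (Fin n → ℂ) → CS} (hF : SmoothCoeffOn F O) (he : ∀ z ∈ O, (F z).IsEven) :
    ∃ H : SmoothEven n, H.fn =ᶠ[𝓝 P] F := by
  obtain ⟨χ, h1, h2, h3⟩ := exists_cutoff (hO.mem_nhds hP)
  refine ⟨SmoothEven.mk (fun z => χ z • F z) (fun z => ?_) (isTest_cutoff_smul hO h1 h2 hF).1, ?_⟩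
  · by_cases hz : z ∈ O
    · exact CS.IsEven.smul _ (he z hz)
    · obtain ⟨K, -, hKO, hK0⟩ := h2
      rw [hK0 z fun h => hz (hKO h), zero_smul]
      exact CS0.zero_mem
  · filter_upwards [h3] with z hz
    rw [SmoothEven.fn_mk, hz, one_smul]

/-- Functions smooth only on `O` are replaced by global ones with the same germ, since the extension
sees nothing else. -/
theorem grassmannExt_mul_of_mem {O : Set (Fin n → ℂ)} (hO : IsOpen O) {p : SuperPoint n}
    (hp : p.bodyPt ∈ O) {F H : (Fin n → ℂ) → CS} (hF : SmoothCoeffOn F O) (hH : SmoothCoeffOn H O) :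
    grassmannExt (fun z => F z * H z) p = grassmannExt F p * grassmannExt H p := by
  obtain ⟨F', h1, h2⟩ := exists_global hO hp hF
  obtain ⟨H', h3, h4⟩ := exists_global hO hp hH
  rw [← grassmannExt_congr h2, ← grassmannExt_congr h4, ← grassmannExt_mul p h1 h3]
  refine grassmannExt_congr ?_
  filter_upwards [h2, h4] with z e1 e2
  rw [e1, e2]

theorem grassmannExt_add_of_mem {O : Set (Fin n → ℂ)} (hO : IsOpen O) {p : SuperPoint n}
    (hp : p.bodyPt ∈ O) {F H : (Fin n → ℂ) → CS} (hF : SmoothCoeffOn F O) (hH : SmoothCoeffOn H O) :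
    grassmannExt (fun z => F z + H z) p = grassmannExt F p + grassmannExt H p := by
  obtain ⟨F', h1, h2⟩ := exists_global hO hp hF
  obtain ⟨H', h3, h4⟩ := exists_global hO hp hH
  rw [← grassmannExt_congr h2, ← grassmannExt_congr h4, ← grassmannExt_add p h1 h3]
  refine grassmannExt_congr ?_
  filter_upwards [h2, h4] with z e1 e2
  rw [e1, e2]

theorem grassmannExt_sum_of_mem {ι : Type*} (s : Finset ι) {O : Set (Fin n → ℂ)} (hO : IsOpen O)
    {p : SuperPoint n} (hp : p.bodyPt ∈ O) {F : ι → (Fin n → ℂ) → CS}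
    (hF : ∀ i, SmoothCoeffOn (F i) O) :
    grassmannExt (fun z => ∑ i ∈ s, F i z) p = ∑ i ∈ s, grassmannExt (F i) p := by
  classical
  induction s using Finset.induction_on with
  | empty => simpa using grassmannExt_const 0 p
  | insert a s ha ih =>
    simp only [Finset.sum_insert ha]
    rw [grassmannExt_add_of_mem hO hp (hF a) (smoothCoeffOn_sum fun i _ => hF i), ih]

theorem grassmannExt_smul_of_mem (c : ℂ) {O : Set (Fin n → ℂ)} (hO : IsOpen O)
    {p : SuperPoint n} (hp : p.bodyPt ∈ O) {F : (Fin n → ℂ) → CS} (hF : SmoothCoeffOn F O) :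
    grassmannExt (fun z => c • F z) p = c • grassmannExt F p := by
  have h := grassmannExt_mul_of_mem hO hp (smoothCoeffOn_const (algebraMap ℂ CS c) O) hF
  simpa only [grassmannExt_const, ← Algebra.smul_def] using h

theorem grassmannExt_conj_of_mem {O : Set (Fin n → ℂ)} (hO : IsOpen O) {p : SuperPoint n}
    (hp : p.bodyPt ∈ O) {F : (Fin n → ℂ) → CS} (hF : SmoothCoeffOn F O) :
    grassmannExt (fun z => CS.conj (F z)) p = CS.conj (grassmannExt F p) := by
  obtain ⟨F', h1, h2⟩ := exists_global hO hp hF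
  rw [← grassmannExt_congr h2, ← grassmannExt_conj p h1]
  refine grassmannExt_congr ?_
  filter_upwards [h2] with z e1
  rw [e1]

/-! ### Balls -/

theorem isOpen_bodyBall (c : Fin n → ℂ) (ε : ℝ) : IsOpen (bodyBall c ε) :=
  isOpen_lt (by fun_prop) continuous_const

theorem bodyBall_subset (c : Fin n → ℂ) (ε : ℝ) : bodyBall c ε ⊆ bodyClosedBall c ε := by
  intro z hz
  simp only [bodyBall, bodyClosedBall, Set.mem_ofPred_eq] at hz ⊢
  exact hz.le

theorem mem_bodyBall_self (c : Fin n → ℂ) {ε : ℝ} (hε : 0 < ε) : c ∈ bodyBall c ε := by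
  change ∑ i, ‖c i - c i‖ ^ 2 < ε ^ 2
  simpa using pow_pos hε 2

theorem isCompact_bodyClosedBall (c : Fin n → ℂ) {ε : ℝ} (hε : 0 < ε) :
    IsCompact (bodyClosedBall c ε) := by
  refine (isCompact_closedBall c ε).of_isClosed_subset
    (isClosed_le (by fun_prop) continuous_const) fun z hz => ?_
  rw [Metric.mem_closedBall, dist_pi_le_iff hε.le]
  intro i
  rw [dist_eq_norm]
  refine le_of_sq_le_sq ?_ hε.le
  exact (Finset.single_le_sum (f := fun i => ‖z i - c i‖ ^ 2) (fun i _ => by positivity)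
    (Finset.mem_univ i)).trans hz

/-! ### Expansion of the Gaussian weight -/

/-- The soul of `Q` exponentiates to a finite sum in each coefficient. Negative powers of `t`
appear, harmless for continuity and away from the zeros, where the exponential of the body beats
them. -/
theorem CS.coeff_mul_exp (f Q : CS) (t : ℝ) (m : ℕ →₀ ℕ) :
    (f * SA.exp (-((t : ℂ)⁻¹ • Q))).coeff m = ∑ k ∈ Finset.range (m.degree + 1),
      ((k ! : ℂ)⁻¹ * (-1) ^ k) * (((t : ℂ) ^ k)⁻¹ *
        ((f * (Q - Q.coeff 0 • 1) ^ k).coeff m * Complex.exp (-((t : ℂ)⁻¹ * Q.coeff 0)))) := by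
  set y : CS := -((t : ℂ)⁻¹ • (Q - Q.coeff 0 • 1)) with hy
  have e1 : -((t : ℂ)⁻¹ • Q) = (-((t : ℂ)⁻¹ * Q.coeff 0)) • (1 : CS) + y := by
    rw [hy, smul_sub, smul_smul]
    module
  have hy1 : SA.Fil 1 y := (SA.Fil.smul _ (SA.fil_one_iff.2 (by simp [SA.coeff_one]))).neg
  rw [e1, SA.exp_smul_one_add _ hy1, mul_smul_comm, SA.coeff_smul]
  have h2 := (SA.exp_fil hy1 (m.degree + 1)).mul_left f m (Nat.lt_succ_self _)
  rw [mul_sub, SA.coeff_sub, sub_eq_zero] at h2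
  rw [h2, Finset.mul_sum, SA.coeff_sum, Finset.mul_sum]
  refine Finset.sum_congr rfl fun k _ => ?_
  have h3 : y ^ k = ((-1) ^ k * ((t : ℂ) ^ k)⁻¹) • (Q - Q.coeff 0 • 1) ^ k := by
    rw [hy, ← neg_smul, smul_pow, neg_pow, inv_pow]
  rw [h3, smul_smul, mul_smul_comm, SA.coeff_smul]
  ring

section Ball

variable {O : Set (Fin n → ℂ)} {Q : (Fin n → ℂ) → CS}

theorem smoothCoeffOn_soul_pow (hQ : SmoothCoeffOn Q O) {f : (Fin n → ℂ) → CS}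
    (hf : SmoothCoeffOn f O) (k : ℕ) :
    SmoothCoeffOn (fun z => f z * (Q z - (Q z).coeff 0 • 1) ^ k) O :=
  hf.mul ((hQ.sub (SmoothCoeffOn.smul (hQ 0) (smoothCoeffOn_const 1 _))).pow k)

theorem continuousOn_coeff_mul_exp (hQ : SmoothCoeffOn Q O) {f : (Fin n → ℂ) → CS}
    (hf : SmoothCoeffOn f O) (t : ℝ) (m : ℕ →₀ ℕ) :
    ContinuousOn (fun z => (f z * SA.exp (-((t : ℂ)⁻¹ • Q z))).coeff m) O := by
  simp only [CS.coeff_mul_exp]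
  refine continuousOn_finsetSum _ fun k _ => continuousOn_const.mul (continuousOn_const.mul
    (ContinuousOn.mul (smoothCoeffOn_soul_pow hQ hf k m).continuousOn ?_))
  exact (continuousOn_const.mul (hQ 0).continuousOn).neg.cexp

variable {A C : Set (Fin n → ℂ)} (hC : IsCompact C) (hCO : C ⊆ O) (hAC : A ⊆ C)

include hC hCO hAC

theorem integrableOn_coeff_mul_exp (hQ : SmoothCoeffOn Q O) {f : (Fin n → ℂ) → CS}
    (hf : SmoothCoeffOn f O) (t : ℝ) (m : ℕ →₀ ℕ) :
    IntegrableOn (fun z => (f z * SA.exp (-((t : ℂ)⁻¹ • Q z))).coeff m) A :=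
  (((continuousOn_coeff_mul_exp hQ hf t m).mono hCO).integrableOn_compact hC).mono_set hAC

/-- Contributions away from the zeros of the exponent decay faster than every power. -/
theorem tendsto_gaussian_tail (hQ : SmoothCoeffOn Q O) {S : (Fin n → ℂ) → ℝ}
    (hS : ∀ z, (Q z).coeff 0 = S z) {f : (Fin n → ℂ) → CS} (hf : SmoothCoeffOn f O)
    {δ : ℝ} (hδ : 0 < δ) (hfS : ∀ z ∈ C, f z ≠ 0 → δ ≤ S z) (N : ℕ) (m : ℕ →₀ ℕ) :
    Filter.Tendsto (fun t : ℝ => ((t : ℂ) ^ N)⁻¹ *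
      ∫ z in A, (f z * SA.exp (-((t : ℂ)⁻¹ • Q z))).coeff m) (𝓝[>] 0) (𝓝 0) := by
  have hvol : volume A < ⊤ := (measure_mono hAC).trans_lt hC.measure_lt_top
  set F : ℕ → (Fin n → ℂ) → ℂ := fun k z => (f z * (Q z - (Q z).coeff 0 • 1) ^ k).coeff m with hF
  have hFc : ∀ k, ContinuousOn (F k) C := fun k =>
    ((smoothCoeffOn_soul_pow hQ hf k m).continuousOn).mono hCO
  -- The `k`-th term of the expansion brings `k` further factors `1/t`, absorbed by the exponential
  -- decay.
  have hterm : ∀ k, Filter.Tendsto (fun t : ℝ => ((t : ℂ) ^ (N + k))⁻¹ *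
      ∫ z in A, F k z * Complex.exp (-((t : ℂ)⁻¹ * (Q z).coeff 0))) (𝓝[>] 0) (𝓝 0) := by
    intro k
    obtain ⟨M, hM⟩ := hC.exists_bound_of_continuousOn (hFc k)
    simp only [hS]
    refine tendsto_laplace_tail hvol (fun z hz => hM z (hAC hz)) hδ (fun z hz h0 => ?_) (N + k)
    refine hfS z (hAC hz) fun h => h0 ?_
    simp only [hF, h, zero_mul, SA.coeff_zero]
  have hsum := tendsto_finsetSum (Finset.range (m.degree + 1)) fun k _ =>
    (hterm k).const_mul ((k ! : ℂ)⁻¹ * (-1) ^ k)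
  simp only [mul_zero, Finset.sum_const_zero] at hsum
  refine hsum.congr fun t => ?_
  simp only [CS.coeff_mul_exp]
  rw [integral_finsetSum, Finset.mul_sum]
  · refine Finset.sum_congr rfl fun k _ => ?_
    rw [integral_const_mul, integral_const_mul, pow_add, mul_inv]
    ring
  · intro k _
    refine Integrable.const_mul (Integrable.const_mul ?_ _) _
    refine (ContinuousOn.integrableOn_compact hC ((hFc k).mul ?_)).mono_set hAC
    exact (continuousOn_const.mul ((hQ 0).continuousOn.mono hCO)).neg.cexp

end Ball

/-! ### The asymptotics of Gaussian integrals -/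

/-- Near a non-degenerate zero the bodies are bounded below by the distance to the zero. -/
theorem exists_lower_bound (g : Fin n → SmoothEven n) {p : SuperPoint n}
    (h0 : ∀ i, grassmannExt (g i).fn p = 0)
    (hg : ∀ i j, (dzbar j (g i)).fn p.bodyPt = 0) (hdet : body ((jac g).det.fn p.bodyPt) ≠ 0) :
    ∃ c > 0, ∀ᶠ z in 𝓝 p.bodyPt, c * ∑ i, ‖z i - p.bodyPt i‖ ^ 2 ≤ ∑ i, ‖body ((g i).fn z)‖ ^ 2 := by
  obtain ⟨h1, h2, h3⟩ := hasFDerivAt_body_jac g h0 hg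
  exact eventually_lower_bound (by rwa [h1]) h2 h3

/-- The function `∑ g_i ḡ_i`. -/
def gaussExponent (g : Fin n → (Fin n → ℂ) → CS) (z : Fin n → ℂ) : CS :=
  ∑ i, g i z * CS.conj (g i z)

theorem coeff_gaussExponent_zero (g : Fin n → (Fin n → ℂ) → CS) (z : Fin n → ℂ) :
    (gaussExponent g z).coeff 0 = ((∑ i, ‖body (g i z)‖ ^ 2 : ℝ) : ℂ) := by
  rw [gaussExponent, SA.coeff_sum]
  push_cast
  refine Finset.sum_congr rfl fun i _ => ?_
  rw [SA.coeff_mul_zero, CS.coeff_conj, Complex.mul_conj, Complex.normSq_eq_norm_sq]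
  push_cast
  rfl

theorem smoothCoeffOn_gaussExponent {g : Fin n → (Fin n → ℂ) → CS} {O : Set (Fin n → ℂ)}
    (hg : ∀ i, SmoothCoeffOn (g i) O) : SmoothCoeffOn (gaussExponent g) O :=
  smoothCoeffOn_sum fun i _ => (hg i).mul (hg i).conj

/-- The determinant of the holomorphic Jacobian at a point of superspace. -/
def jacDet (g : Fin n → (Fin n → ℂ) → CS) (p : SuperPoint n) : CS0 :=
  Matrix.det (Matrix.of fun i j => CS.evenPart (grassmannExt (pderivZ j (g i)) p))

theorem extHom_jac_det {G : Fin n → SmoothEven n} {g : Fin n → (Fin n → ℂ) → CS} {p : SuperPoint n}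
    (h : ∀ i, (G i).fn =ᶠ[𝓝 p.bodyPt] g i) : extHom p (jac G).det = jacDet g p := by
  rw [RingHom.map_det, jacDet]
  refine congrArg Matrix.det (Matrix.ext fun i j => ?_)
  change extHom p (dz j (G i)) = CS.evenPart (grassmannExt (pderivZ j (g i)) p)
  rw [← CS0.evenPart_coe (extHom p (dz j (G i))), coe_extHom, fn_dz]
  congr 1
  refine grassmannExt_congr ?_
  filter_upwards [eventually_eventually_nhds.2 (h i)] with z hz
  exact pderivZ_congr hz j

/-- The asymptotics of Gaussian integrals over balls. -/
theorem tendsto_gaussian_bodyBall {O : Set (Fin n → ℂ)} (hO : IsOpen O)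
    {g : Fin n → (Fin n → ℂ) → CS} (hg : ∀ i, HolomorphicCoeffOn (g i) O)
    (he : ∀ i, ∀ z ∈ O, (g i z).IsEven) {p : SuperPoint n} (h0 : ∀ i, grassmannExt (g i) p = 0)
    (hdet : body (jacDet g p : CS) ≠ 0) {ε : ℝ} (hε : 0 < ε)
    (hball : bodyClosedBall p.bodyPt ε ⊆ O)
    (hzero : ∀ z ∈ bodyClosedBall p.bodyPt ε, z ≠ p.bodyPt → ∃ i, body (g i z) ≠ 0)
    {h : (Fin n → ℂ) → CS} (hh : SmoothCoeffOn h O) {R : CS}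
    (hR : grassmannExt h p = R * (jacDet g p * CS0.conjHom (jacDet g p) : CS0)) (m : ℕ →₀ ℕ) :
    Filter.Tendsto (fun t : ℝ => ((t : ℂ) ^ n)⁻¹ * ∫ z in bodyBall p.bodyPt ε,
        (h z * SA.exp (-((t : ℂ)⁻¹ • gaussExponent g z))).coeff m) (𝓝[>] 0)
      (𝓝 ((Real.pi : ℂ) ^ n * R.coeff m)) := by
  set P := p.bodyPt with hP
  have hPB : P ∈ bodyBall P ε := mem_bodyBall_self P hε
  have hPO : P ∈ O := hball (bodyBall_subset _ _ hPB)
  have hgs : ∀ i, SmoothCoeffOn (g i) O := fun i => (hg i).smooth hO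
  -- The transport identity lives in the ring of globally smooth even functions, so the `g i` are
  -- first extended from a neighbourhood of the zero.
  choose G hGeq using fun i => exists_global_even hO hPO (hgs i) (he i)
  have hjac : extHom p (jac G).det = jacDet g p := extHom_jac_det hGeq
  have hbodyP : body ((jac G).det.fn P) = body (jacDet g p : CS) := by
    rw [← hjac, coe_extHom, body_grassmannExt]
  have hJ : extHom p (jacAbs G) = jacDet g p * CS0.conjHom (jacDet g p) := by
    rw [jacAbs, map_mul, extHom_conj, hjac]
  have hG0 : ∀ i, grassmannExt (G i).fn p = 0 := fun i => by
    rw [grassmannExt_congr (hGeq i), h0]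
  have hzbar : ∀ i j, ∀ᶠ z in 𝓝 P, (dzbar j (G i)).fn z = 0 := fun i j => by
    filter_upwards [eventually_eventually_nhds.2 (hGeq i), hO.mem_nhds hPO] with z hz hzO
    rw [fn_dzbar, pderivZbar_congr hz]
    exact (hg i).pderivZbar_eq_zero hO j hzO
  have hdetU : ∀ᶠ z in 𝓝 P, body ((jac G).det.fn z) ≠ 0 :=
    ContinuousAt.eventually_ne (g := fun z => body ((jac G).det.fn z)) (y := 0)
      (contDiffOn_univ.1 ((jac G).det.smooth 0)).continuous.continuousAt (by rwa [← hbodyP] at hdet)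
  obtain ⟨c, hc, hlow⟩ := exists_lower_bound G hG0 (fun i j => (hzbar i j).self_of_nhds)
    (by rwa [hbodyP])
  -- On this neighbourhood the extensions are holomorphic and equal to the `g i`, the Jacobian is
  -- invertible, the quadratic lower bound holds, and the ball is not left.
  obtain ⟨U, hUsub, hUo, hPU⟩ := eventually_nhds_iff.1 ((((Filter.eventually_all.2 fun i =>
    Filter.eventually_all.2 fun j => hzbar i j).and hdetU).and hlow).and
      (((Filter.eventually_all.2 hGeq).and ((isOpen_bodyBall P ε).mem_nhds hPB))))
  obtain ⟨χ', hχ', hχK', hχ1'⟩ := exists_cutoff (hUo.mem_nhds hPU)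
  have hUO : U ⊆ O := fun z hz => hball (bodyBall_subset _ _ (hUsub z hz).2.2)
  have hdet' : ∀ z ∈ U, body ((jacAbs G).fn z) ≠ 0 := fun z hz => by
    rw [body_jacAbs]
    exact pow_ne_zero 2 (by exact_mod_cast (norm_ne_zero_iff.2 (hUsub z hz).1.1.2))
  have hT : IsTest U fun z => χ' z • h z := isTest_cutoff_smul hUo hχ' hχK' (hh.mono hUO)
  -- `tendsto_test` carries the density `jacAbs G`, so the test function is divided by it in
  -- advance; its value at `p` is then `R`.
  have hF : IsTest U fun z => χ' z • h z * ((jacAbs G).fn z).geomInv :=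
    hT.mul_smoothOn hUo (SmoothCoeffOn.geomInv ((jacAbs G).smooth.mono (Set.subset_univ U)) hdet')
  have hFJ : ∀ z, χ' z • h z * ((jacAbs G).fn z).geomInv * (jacAbs G).fn z = χ' z • h z := by
    intro z
    by_cases hz : z ∈ U
    · rw [mul_assoc, ← (((jacAbs G).isEven z).commute _).eq, CS.mul_geomInv (hdet' z hz), mul_one]
    · have := hT.eq_zero_of_notMem hz
      rw [this, zero_mul, zero_mul]
  have hFext : grassmannExt (fun z => χ' z • h z * ((jacAbs G).fn z).geomInv) p = R := by
    have e1 : grassmannExt (fun z => χ' z • h z * ((jacAbs G).fn z).geomInv) p *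
        (extHom p (jacAbs G) : CS) = R * (extHom p (jacAbs G) : CS) := by
      rw [coe_extHom, ← grassmannExt_mul p hF.1 (jacAbs G).smooth, ← coe_extHom, hJ, ← hR]
      refine grassmannExt_congr ?_
      filter_upwards [hχ1'] with z hz
      rw [hFJ, hz, one_smul]
    have hJb : body (extHom p (jacAbs G) : CS) ≠ 0 := by
      rw [coe_extHom, body_grassmannExt]
      exact hdet' _ hPU
    have e2 := congrArg (· * CS.geomInv (extHom p (jacAbs G) : CS)) e1
    simpa only [mul_assoc, CS.mul_geomInv hJb, mul_one] using e2
  have hmain := tendsto_test hUo (fun i j z hz => (hUsub z hz).1.1.1 i j) hPU hG0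
    (fun z hz => (hUsub z hz).1.1.2) hc (fun z hz => (hUsub z hz).1.2) hF m
  rw [hFext] at hmain
  have hQs := smoothCoeffOn_gaussExponent hgs
  have hcomp := isCompact_bodyClosedBall P hε
  -- the part near the zero
  have hnear : ∀ t : ℝ, ∫ z, (χ' z • h z * ((jacAbs G).fn z).geomInv *
      (jacAbs G * weight G t).fn z).coeff m =
      ∫ z in bodyBall P ε, (χ' z • h z * SA.exp (-((t : ℂ)⁻¹ • gaussExponent g z))).coeff m := by
    intro t
    have e1 : ∀ z, (χ' z • h z * ((jacAbs G).fn z).geomInv * (jacAbs G * weight G t).fn z).coeff m =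
        (χ' z • h z * SA.exp (-((t : ℂ)⁻¹ • gaussExponent g z))).coeff m := by
      intro z
      rw [fn_mul, ← mul_assoc, hFJ]
      by_cases hz : z ∈ U
      · congr 2
        rw [weight, fn_exp, fn_neg, fn_smul, normSq, fn_sum, gaussExponent]
        congr 3
        refine Finset.sum_congr rfl fun i _ => ?_
        rw [fn_mul, fn_conj, (hUsub z hz).2.1 i]
      · have := hT.eq_zero_of_notMem hz
        rw [this, zero_mul, zero_mul]
    simp only [e1]
    refine (setIntegral_eq_integral_of_forall_compl_eq_zero fun z hz => ?_).symm
    have := hT.eq_zero_of_notMem (z := z) fun hzU => hz (hUsub z hzU).2.2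
    simp only [this, zero_mul, SA.coeff_zero]
  simp only [hnear] at hmain
  -- the part away from the zero
  have hfs : SmoothCoeffOn (fun z => (1 - χ' z) • h z) O :=
    SmoothCoeffOn.smul (contDiff_const.sub hχ').contDiffOn hh
  obtain ⟨N, hN1, hNo, hPN⟩ := eventually_nhds_iff.1 hχ1'
  -- On the closed ball without a neighbourhood of the zero the bodies have no common zero, and
  -- compactness gives a positive minimum.
  obtain ⟨δ, hδ, hδS⟩ : ∃ δ > 0, ∀ z ∈ bodyClosedBall P ε \ N, δ ≤ ∑ i, ‖body (g i z)‖ ^ 2 := by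
    have hcN := hcomp.diff hNo
    have hcont : ContinuousOn (fun z => ∑ i, ‖body (g i z)‖ ^ 2) (bodyClosedBall P ε \ N) :=
      continuousOn_finsetSum _ fun i _ =>
        ((((hgs i) 0).continuousOn.mono fun z hz => hball hz.1).norm.pow 2)
    refine hcN.exists_forall_le' hcont (a := 0) fun z hz => ?_
    obtain ⟨i, hi⟩ := hzero z hz.1 fun h => hz.2 (h ▸ hPN)
    exact Finset.sum_pos' (fun i _ => by positivity)
      ⟨i, Finset.mem_univ i, by have := norm_pos_iff.2 hi; positivity⟩
  have htail := tendsto_gaussian_tail hcomp hball (bodyBall_subset P ε) hQs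
    (coeff_gaussExponent_zero g) hfs hδ (fun z hz hz0 => hδS z ⟨hz, fun hzN => hz0 (by
      simp only [hN1 z hzN, sub_self, zero_smul])⟩) n m
  have hsum := hmain.add htail
  rw [add_zero] at hsum
  refine hsum.congr fun t => ?_
  rw [← mul_add, ← integral_add]
  · congr 2
    funext z
    rw [← SA.coeff_add, ← add_mul, ← add_smul, add_sub_cancel, one_smul]
  · exact integrableOn_coeff_mul_exp hcomp hball (bodyBall_subset P ε) hQs
      (hT.1.mono (Set.subset_univ O)) t m
  · exact integrableOn_coeff_mul_exp hcomp hball (bodyBall_subset P ε) hQs hfs t m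

end

/-! ### Monomial bookkeeping and the Grassmann algebra inside the superforms. -/

section

section Algebra

variable {G : Type} [LinearOrder G] [GradedGen G]

/-! ### Multiplication by monomials -/

theorem SA.coeff_mono_self {a : G →₀ ℕ} (ha : Admissible a) : (SA.mono a).coeff a = 1 :=
  if_pos ⟨rfl, ha⟩

theorem SA.coeff_mono_of_ne {a m : G →₀ ℕ} (h : m ≠ a) : (SA.mono a).coeff m = 0 :=
  if_neg fun h' => h h'.1

theorem SA.mono_zero : SA.mono (0 : G →₀ ℕ) = 1 := rfl

theorem SA.coeff_mul_mono (x : SA G) {a b : G →₀ ℕ} (h : Admissible (b + a)) :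
    (x * SA.mono a).coeff (b + a) = (-1) ^ normExp b a * x.coeff b := by
  rw [SA.coeff_mul _ _ h, Finset.sum_eq_single (b, a)]
  · rw [SA.coeff_mono_self (h.of_le le_add_self), mul_one]
  · rintro ⟨c, d⟩ hp hne
    rw [SA.coeff_mono_of_ne, mul_zero, mul_zero]
    rintro rfl
    rw [Finset.HasAntidiagonal.mem_antidiagonal] at hp
    exact hne (Prod.ext (add_right_cancel hp) rfl)
  · intro hn
    simp at hn

theorem SA.coeff_mul_mono_eq_zero {x : SA G} {a m : G →₀ ℕ} (h : ∀ b, b + a = m → x.coeff b = 0) :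
    (x * SA.mono a).coeff m = 0 := by
  by_cases hm : Admissible m
  · rw [SA.coeff_mul _ _ hm]
    refine Finset.sum_eq_zero fun p hp => ?_
    by_cases hpa : p.2 = a
    · rw [h p.1 (by rw [← hpa]; exact Finset.HasAntidiagonal.mem_antidiagonal.1 hp)]
      simp
    · rw [SA.coeff_mono_of_ne hpa]
      simp
  · exact SA.coeff_of_not _ hm

theorem SA.coeff_mono_mul (x : SA G) {a b : G →₀ ℕ} (h : Admissible (a + b)) :
    (SA.mono a * x).coeff (a + b) = (-1) ^ normExp a b * x.coeff b := by
  rw [SA.coeff_mul _ _ h, Finset.sum_eq_single (a, b)]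
  · rw [SA.coeff_mono_self (h.of_le le_self_add), one_mul]
  · rintro ⟨c, d⟩ hp hne
    rw [SA.coeff_mono_of_ne, zero_mul, mul_zero]
    rintro rfl
    rw [Finset.HasAntidiagonal.mem_antidiagonal] at hp
    exact hne (Prod.ext rfl (add_left_cancel hp))
  · intro hn
    simp at hn

theorem SA.coeff_mono_mul_eq_zero {x : SA G} {a m : G →₀ ℕ} (h : ∀ b, a + b = m → x.coeff b = 0) :
    (SA.mono a * x).coeff m = 0 := by
  by_cases hm : Admissible m
  · rw [SA.coeff_mul _ _ hm]
    refine Finset.sum_eq_zero fun p hp => ?_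
    by_cases hpa : p.1 = a
    · rw [h p.2 (by rw [← hpa]; exact Finset.HasAntidiagonal.mem_antidiagonal.1 hp)]
      simp
    · rw [SA.coeff_mono_of_ne hpa]
      simp
  · exact SA.coeff_of_not _ hm

theorem SA.mono_mul_mono (a b : G →₀ ℕ) :
    SA.mono a * SA.mono b = (-1 : ℂ) ^ normExp a b • SA.mono (a + b) := by
  refine SA.ext_adm fun m hm => ?_
  rw [SA.coeff_smul]
  by_cases h : m = a + b
  · subst h
    rw [SA.coeff_mul_mono _ hm, SA.coeff_mono_self hm, SA.coeff_mono_self (hm.of_le le_self_add)]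
  · rw [SA.coeff_mono_of_ne h, mul_zero]
    refine SA.coeff_mul_mono_eq_zero fun c hc => SA.coeff_mono_of_ne ?_
    rintro rfl
    exact h hc.symm

theorem normExp_sum_left {ι : Type*} (s : Finset ι) (f : ι → G →₀ ℕ) (b : G →₀ ℕ) :
    normExp (∑ i ∈ s, f i) b = ∑ i ∈ s, normExp (f i) b :=
  map_sum (⟨⟨fun a => normExp a b, normExp_zero_left b⟩, fun a c => normExp_add_left a c b⟩ :
    (G →₀ ℕ) →+ ℕ) f s

theorem normExp_sum_right {ι : Type*} (s : Finset ι) (f : ι → G →₀ ℕ) (b : G →₀ ℕ) :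
    normExp b (∑ i ∈ s, f i) = ∑ i ∈ s, normExp b (f i) :=
  map_sum (⟨⟨fun a => normExp b a, normExp_zero_right b⟩, fun a c => normExp_add_right b a c⟩ :
    (G →₀ ℕ) →+ ℕ) f s

theorem normExp_single (i j : G) :
    normExp (Finsupp.single i 1) (Finsupp.single j 1) = if j < i then swapExp i j else 0 := by
  unfold normExp
  rw [Finsupp.sum_single_index (by simp [Finsupp.sum]), Finsupp.sum_single_index (by simp)]
  simp

/-- No inversions, no sign. -/
theorem normExp_eq_zero {a b : G →₀ ℕ} (h : ∀ i ∈ a.support, ∀ j ∈ b.support, i ≤ j) :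
    normExp a b = 0 :=
  Finset.sum_eq_zero fun i hi => Finset.sum_eq_zero fun j hj => if_neg (h i hi j hj).not_gt

end Algebra

variable {n : ℕ}

/-! ### The inclusion of the Grassmann algebra in the superforms -/

namespace Gen

theorem lt_iff {a b : Gen n} : a < b ↔ code a < code b := Iff.rfl

theorem le_iff {a b : Gen n} : a ≤ b ↔ code a ≤ code b := Iff.rfl

theorem le_beta {g : Gen n} (hg : ∀ k, g ≠ beta k) (k : ℕ) : g ≤ beta k := by
  cases g <;> simp_all [le_iff, code, Prod.Lex.toLex_le_toLex]

theorem beta_lt_beta {k l : ℕ} : (beta k : Gen n) < beta l ↔ k < l := by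
  simp [lt_iff, code, Prod.Lex.toLex_lt_toLex]

end Gen

/-- The exponents of a monomial in the `β_k`. -/
abbrev betaExp (m : ℕ →₀ ℕ) : Gen n →₀ ℕ := m.mapDomain Gen.beta

theorem betaExp_apply (m : ℕ →₀ ℕ) (k : ℕ) : (betaExp m : Gen n →₀ ℕ) (Gen.beta k) = m k :=
  Finsupp.mapDomain_apply Gen.beta_injective m k

theorem betaExp_apply_of_ne (m : ℕ →₀ ℕ) {g : Gen n} (hg : ∀ k, g ≠ Gen.beta k) :
    (betaExp m : Gen n →₀ ℕ) g = 0 :=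
  Finsupp.mapDomain_of_notMem_range m g fun ⟨k, hk⟩ => hg k hk.symm

theorem mem_support_betaExp {m : ℕ →₀ ℕ} {g : Gen n} (hg : g ∈ (betaExp m : Gen n →₀ ℕ).support) :
    ∃ k, g = Gen.beta k := by
  by_contra h
  exact Finsupp.mem_support_iff.1 hg (betaExp_apply_of_ne m fun k hk => h ⟨k, hk⟩)

/-- Monomials without `β_k`. -/
def BetaFree (M : Gen n →₀ ℕ) : Prop := ∀ k, M (Gen.beta k) = 0

theorem BetaFree.add {M N : Gen n →₀ ℕ} (hM : BetaFree M) (hN : BetaFree N) : BetaFree (M + N) :=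
  fun k => by rw [Finsupp.add_apply, hM, hN]

theorem BetaFree.sum {ι : Type*} {s : Finset ι} {f : ι → Gen n →₀ ℕ}
    (h : ∀ i ∈ s, BetaFree (f i)) : BetaFree (∑ i ∈ s, f i) := fun k => by
  rw [Finsupp.finsetSum_apply]
  exact Finset.sum_eq_zero fun i hi => h i hi k

theorem betaFree_single {g : Gen n} (hg : ∀ k, g ≠ Gen.beta k) (x : ℕ) :
    BetaFree (Finsupp.single g x) := fun k => Finsupp.single_eq_of_ne (hg k).symm

theorem betaFree_zero : BetaFree (0 : Gen n →₀ ℕ) := fun _ => rfl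

theorem exists_betaFree_add (m : Gen n →₀ ℕ) : ∃ M m', BetaFree M ∧ m = M + betaExp m' := by
  classical
  set m' := m.comapDomain Gen.beta Gen.beta_injective.injOn with hm'
  have hle : betaExp m' ≤ m := by
    intro g
    by_cases hg : ∃ k, g = Gen.beta k
    · obtain ⟨k, rfl⟩ := hg
      rw [betaExp_apply, hm', Finsupp.comapDomain_apply]
    · rw [betaExp_apply_of_ne m' fun k hk => hg ⟨k, hk⟩]
      exact Nat.zero_le _
  refine ⟨m - betaExp m', m', fun k => ?_, (tsub_add_cancel_of_le hle).symm⟩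
  rw [Finsupp.tsub_apply, betaExp_apply, hm', Finsupp.comapDomain_apply, Nat.sub_self]

theorem add_betaExp_inj {M N : Gen n →₀ ℕ} {a b : ℕ →₀ ℕ} (hM : BetaFree M) (hN : BetaFree N)
    (h : M + betaExp a = N + betaExp b) : M = N ∧ a = b := by
  have hab : a = b := by
    ext k
    have := DFunLike.congr_fun h (Gen.beta k)
    simpa only [Finsupp.add_apply, hM k, hN k, betaExp_apply, zero_add] using this
  subst hab
  exact ⟨add_right_cancel h, rfl⟩

theorem betaExp_add (a b : ℕ →₀ ℕ) : (betaExp (a + b) : Gen n →₀ ℕ) = betaExp a + betaExp b :=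
  Finsupp.mapDomain_add

theorem betaExp_zero : (betaExp 0 : Gen n →₀ ℕ) = 0 := Finsupp.mapDomain_zero

theorem admissible_add_betaExp {M : Gen n →₀ ℕ} {a : ℕ →₀ ℕ} (hM : BetaFree M) :
    Admissible (M + betaExp a) ↔ Admissible M ∧ Admissible a := by
  refine ⟨fun h => ⟨h.of_le le_self_add, fun k _ => ?_⟩, fun h g hg => ?_⟩
  · have := h (Gen.beta k) (by simp [swapExp, GradedGen.formDeg, GradedGen.parity])
    rwa [Finsupp.add_apply, hM, zero_add, betaExp_apply] at this
  · rw [Finsupp.add_apply]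
    by_cases hgb : ∃ k, g = Gen.beta k
    · obtain ⟨k, rfl⟩ := hgb
      rw [hM, zero_add, betaExp_apply]
      exact h.2 k (by simp [swapExp, GradedGen.formDeg, GradedGen.parity])
    · rw [betaExp_apply_of_ne a fun k hk => hgb ⟨k, hk⟩]
      exact h.1 g hg

theorem normExp_betaExp_right {M : Gen n →₀ ℕ} (hM : BetaFree M) (a : ℕ →₀ ℕ) :
    normExp M (betaExp a) = 0 :=
  normExp_eq_zero fun g hg j hj => by
    obtain ⟨k, rfl⟩ := mem_support_betaExp hj
    refine Gen.le_beta (fun l hl => ?_) k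
    rw [hl] at hg
    exact Finsupp.mem_support_iff.1 hg (hM l)

theorem normExp_betaExp_betaExp (a b : ℕ →₀ ℕ) :
    normExp (betaExp a : Gen n →₀ ℕ) (betaExp b) = normExp a b := by
  unfold normExp betaExp
  rw [Finsupp.sum_mapDomain_index_inj Gen.beta_injective]
  refine Finsupp.sum_congr fun i _ => ?_
  rw [Finsupp.sum_mapDomain_index_inj Gen.beta_injective]
  refine Finsupp.sum_congr fun j _ => ?_
  simp only [Gen.beta_lt_beta]
  rfl

@[simp] theorem coeff_coefAt (M : Gen n →₀ ℕ) (x : SA (Gen n)) (m : ℕ →₀ ℕ) :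
    (coefAt M x).coeff m = x.coeff (M + betaExp m) := rfl

theorem ext_coefAt {x y : SA (Gen n)} (h : ∀ M, BetaFree M → coefAt M x = coefAt M y) : x = y := by
  ext m
  obtain ⟨M, m', hM, rfl⟩ := exists_betaFree_add m
  rw [← coeff_coefAt, ← coeff_coefAt, h M hM]

theorem coeff_ofCS_betaExp (c : CS) (m : ℕ →₀ ℕ) :
    (ofCS c : SA (Gen n)).coeff (betaExp m) = c.coeff m := by
  classical
  unfold ofCS
  rw [SA.coeff_mk, if_pos fun g hg => ?_]
  · congr 1
    exact Finsupp.comapDomain_mapDomain Gen.beta Gen.beta_injective m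
  · obtain ⟨k, rfl⟩ := mem_support_betaExp hg
    exact ⟨k, rfl⟩

theorem coeff_ofCS_of_ne {M : Gen n →₀ ℕ} (hM : BetaFree M) (hM0 : M ≠ 0) (c : CS) (m : ℕ →₀ ℕ) :
    (ofCS c : SA (Gen n)).coeff (M + betaExp m) = 0 := by
  classical
  unfold ofCS
  rw [SA.coeff_mk, if_neg]
  intro h
  apply hM0
  ext g
  by_cases hg : ∃ k, g = Gen.beta k
  · obtain ⟨k, rfl⟩ := hg
    exact hM k
  · by_contra hne
    obtain ⟨k, hk⟩ := h g (Finsupp.mem_support_iff.2 (by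
      rw [Finsupp.add_apply]
      intro h0
      exact hne (Nat.eq_zero_of_add_eq_zero_right h0)))
    exact hg ⟨k, hk.symm⟩

theorem coefAt_zero_ofCS (c : CS) : coefAt 0 (ofCS c : SA (Gen n)) = c := by
  ext m
  rw [coeff_coefAt, zero_add, coeff_ofCS_betaExp]

theorem coefAt_ofCS_of_ne {M : Gen n →₀ ℕ} (hM : BetaFree M) (hM0 : M ≠ 0) (c : CS) :
    coefAt M (ofCS c) = 0 := by
  ext m
  exact coeff_ofCS_of_ne hM hM0 c m

/-- The `β_k` come last in the normal order, so a factor from the Grassmann algebra on the right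
passes no other generator. This is why coefficients are written on the right. -/
theorem coefAt_mul_ofCS {M : Gen n →₀ ℕ} (hM : BetaFree M) (x : SA (Gen n)) (c : CS) :
    coefAt M (x * ofCS c) = coefAt M x * c := by
  refine SA.ext_adm fun m hm => ?_
  rw [coeff_coefAt, SA.coeff_mul _ _ hm]
  by_cases hA : Admissible (M + betaExp m)
  · rw [SA.coeff_mul _ _ hA]
    refine (Finset.sum_of_injOn (fun p : (ℕ →₀ ℕ) × (ℕ →₀ ℕ) => (M + betaExp p.1, betaExp p.2))
      ?_ ?_ ?_ ?_).symm
    · rintro ⟨a, b⟩ - ⟨a', b'⟩ - h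
      simp only [Prod.mk.injEq] at h
      have h2 : (0 : Gen n →₀ ℕ) + betaExp b = 0 + betaExp b' := by rw [h.2]
      rw [(add_betaExp_inj hM hM h.1).2, (add_betaExp_inj betaFree_zero betaFree_zero h2).2]
    · rintro ⟨a, b⟩ hab
      rw [Finset.mem_coe, Finset.HasAntidiagonal.mem_antidiagonal] at hab ⊢
      simp only at hab ⊢
      rw [add_assoc, ← betaExp_add, hab]
    · rintro ⟨a, b⟩ hab hn
      rw [Finset.HasAntidiagonal.mem_antidiagonal] at hab
      obtain ⟨A, a', hA', rfl⟩ := exists_betaFree_add a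
      obtain ⟨B, b', hB', rfl⟩ := exists_betaFree_add b
      by_cases hB0 : B = 0
      · subst hB0
        refine absurd ⟨(a', b'), ?_, ?_⟩ hn
        · simp only at hab
          rw [zero_add, add_assoc, ← betaExp_add] at hab
          have := add_betaExp_inj hA' hM hab
          simpa using this.2
        · simp only at hab ⊢
          rw [zero_add, add_assoc, ← betaExp_add] at hab
          rw [(add_betaExp_inj hA' hM hab).1, zero_add]
      · simp only
        rw [coeff_ofCS_of_ne hB' hB0]
        simp
    · rintro ⟨a, b⟩ -
      simp only
      rw [normExp_add_left, normExp_betaExp_right hM, zero_add, normExp_betaExp_betaExp,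
        coeff_ofCS_betaExp, coeff_coefAt]
  · rw [SA.coeff_of_not _ hA]
    refine (Finset.sum_eq_zero fun p hp => ?_).symm
    rw [coeff_coefAt, SA.coeff_of_not x]
    · simp
    · rw [admissible_add_betaExp hM] at hA ⊢
      exact fun h => hA ⟨h.1, hm⟩

theorem ofCS_mul (c d : CS) : (ofCS (c * d) : SA (Gen n)) = ofCS c * ofCS d := by
  refine ext_coefAt fun M hM => ?_
  rw [coefAt_mul_ofCS hM]
  by_cases h : M = 0
  · subst h
    rw [coefAt_zero_ofCS, coefAt_zero_ofCS]
  · rw [coefAt_ofCS_of_ne hM h, coefAt_ofCS_of_ne hM h, zero_mul]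

theorem ofCS_add (c d : CS) : (ofCS (c + d) : SA (Gen n)) = ofCS c + ofCS d := by
  classical
  ext m
  simp only [ofCS, SA.coeff_mk, SA.coeff_add]
  split_ifs <;> simp

theorem ofCS_one : (ofCS 1 : SA (Gen n)) = 1 := by
  refine ext_coefAt fun M hM => ?_
  ext m
  by_cases h : M = 0
  · subst h
    rw [coefAt_zero_ofCS, coeff_coefAt, SA.coeff_one, SA.coeff_one, zero_add]
    congr 1
    refine propext ⟨fun h => by rw [h, betaExp_zero], fun h => ?_⟩
    exact (add_betaExp_inj (M := (0 : Gen n →₀ ℕ)) (N := 0) (b := 0) betaFree_zero betaFree_zero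
      (by simpa using h)).2
  · rw [coefAt_ofCS_of_ne hM h, coeff_coefAt, SA.coeff_one, if_neg, SA.coeff_zero]
    intro h0
    exact h (add_betaExp_inj (N := 0) (b := 0) hM betaFree_zero (by simpa using h0)).1

variable (n) in
/-- The inclusion of the Grassmann algebra as a ring homomorphism. -/
def ofCSHom : CS →+* SA (Gen n) where
  toFun := ofCS
  map_one' := ofCS_one
  map_mul' := ofCS_mul
  map_zero' := by
    classical
    ext m
    simp only [ofCS, SA.coeff_mk, SA.coeff_zero]
    split_ifs <;> rfl
  map_add' := ofCS_add

theorem ofCSHom_apply (c : CS) : ofCSHom n c = ofCS c := rfl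

theorem ofCS_smul (a : ℂ) (c : CS) : (ofCS (a • c) : SA (Gen n)) = a • ofCS c := by
  classical
  ext m
  simp only [ofCS, SA.coeff_mk, SA.coeff_smul]
  split_ifs <;> simp

theorem coefAt_add (M : Gen n →₀ ℕ) (x y : SA (Gen n)) : coefAt M (x + y) = coefAt M x + coefAt M y :=
  rfl

theorem coefAt_smul (M : Gen n →₀ ℕ) (a : ℂ) (x : SA (Gen n)) : coefAt M (a • x) = a • coefAt M x :=
  rfl

/-- The coefficient as a linear map. -/
def coefAtHom (M : Gen n →₀ ℕ) : SA (Gen n) →ₗ[ℂ] CS where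
  toFun := coefAt M
  map_add' _ _ := rfl
  map_smul' _ _ := rfl

theorem coefAt_sum (M : Gen n →₀ ℕ) {ι : Type*} (s : Finset ι) (f : ι → SA (Gen n)) :
    coefAt M (∑ i ∈ s, f i) = ∑ i ∈ s, coefAt M (f i) := map_sum (coefAtHom M) f s

/-- Every coefficient of `ofCS c` is zero or a coefficient of `c`. -/
theorem coeff_ofCS_cases (m : Gen n →₀ ℕ) :
    (∃ m', m = betaExp m' ∧ ∀ c : CS, (ofCS c : SA (Gen n)).coeff m = c.coeff m') ∨
      ((∀ m', m ≠ betaExp m') ∧ ∀ c : CS, (ofCS c : SA (Gen n)).coeff m = 0) := by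
  obtain ⟨M, m', hM, rfl⟩ := exists_betaFree_add m
  by_cases h : M = 0
  · subst h
    exact Or.inl ⟨m', zero_add _, fun c => by rw [zero_add, coeff_ofCS_betaExp]⟩
  · refine Or.inr ⟨fun m'' h' => h ?_, fun c => coeff_ofCS_of_ne hM h c m'⟩
    exact (add_betaExp_inj (N := 0) hM betaFree_zero (by simpa using h')).1

theorem ofCS_exp (c : CS) : (ofCS (SA.exp c) : SA (Gen n)) = SA.exp (ofCS c) := by
  ext m
  change _ = ∑' k : ℕ, ((k ! : ℂ))⁻¹ * (ofCS c ^ k).coeff m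
  have hk : ∀ k, (ofCS c : SA (Gen n)) ^ k = ofCS (c ^ k) := fun k =>
    (map_pow (ofCSHom n) c k).symm
  simp only [hk]
  rcases coeff_ofCS_cases m with ⟨m', -, h⟩ | ⟨-, h⟩
  · simp only [h]
    rfl
  · simp only [h, mul_zero, tsum_zero]

theorem coeff_ofCS_zero (c : CS) : (ofCS c : SA (Gen n)).coeff 0 = c.coeff 0 := by
  rw [← coeff_ofCS_betaExp (n := n) c 0, betaExp_zero]

theorem formDegree_betaExp (m : ℕ →₀ ℕ) : formDegree (betaExp m : Gen n →₀ ℕ) = formDegree m := by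
  unfold formDegree betaExp
  rw [Finsupp.sum_mapDomain_index_inj Gen.beta_injective]
  rfl

theorem monoParity_betaExp (m : ℕ →₀ ℕ) : monoParity (betaExp m : Gen n →₀ ℕ) = monoParity m := by
  unfold monoParity betaExp
  rw [Finsupp.sum_mapDomain_index_inj Gen.beta_injective]
  rfl

theorem homog_ofCS {k ε : ZMod 2} {c : CS} (hc : SA.Homog k ε c) :
    SA.Homog k ε (ofCS c : SA (Gen n)) := fun m hm => by
  rcases coeff_ofCS_cases m with ⟨m', rfl, h⟩ | ⟨-, h⟩
  · rw [h] at hm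
    rw [formDegree_betaExp, monoParity_betaExp]
    exact hc m' hm
  · exact absurd (h c) hm

theorem ofCS_commute {c : CS} (hc : c.IsEven) (y : SA (Gen n)) : Commute (ofCS c) y :=
  (homog_ofCS hc.homog).central y

/-- Even Grassmann elements are central among the superforms, so determinants of even matrices act
as scalars. -/
instance : Algebra CS0 (SA (Gen n)) :=
  RingHom.toAlgebra' ((ofCSHom n).comp CS0.subtype) fun c x => (ofCS_commute c.2 x).eq

theorem CS0.smul_superform (c : CS0) (x : SA (Gen n)) : c • x = ofCS (c : CS) * x :=
  Algebra.smul_def c x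

theorem coefAt_smul_even {M : Gen n →₀ ℕ} (hM : BetaFree M) (c : CS0) (x : SA (Gen n)) :
    coefAt M (c • x) = coefAt M x * (c : CS) := by
  rw [CS0.smul_superform, (ofCS_commute c.2 x).eq, coefAt_mul_ofCS hM]

theorem SmoothCoeffOn.ofCS {F : (Fin n → ℂ) → CS} {O : Set (Fin n → ℂ)} (hF : SmoothCoeffOn F O) :
    SmoothCoeffOn (fun z => (SuperResidue.ofCS (F z) : SA (Gen n))) O := fun m => by
  rcases coeff_ofCS_cases m with ⟨m', -, h⟩ | ⟨-, h⟩
  · simp only [h]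
    exact hF m'
  · simp only [h]
    exact contDiffOn_const

theorem SmoothCoeffOn.coefAt {F : (Fin n → ℂ) → SA (Gen n)} {O : Set (Fin n → ℂ)}
    (hF : SmoothCoeffOn F O) (M : Gen n →₀ ℕ) :
    SmoothCoeffOn (fun z => SuperResidue.coefAt M (F z)) O := fun m => hF (M + betaExp m)

theorem dirDeriv_ofCS (F : (Fin n → ℂ) → CS) (v z : Fin n → ℂ) :
    dirDeriv v (fun w => (ofCS (F w) : SA (Gen n))) z = ofCS (dirDeriv v F z) := by
  ext m
  rw [coeff_dirDeriv]
  rcases coeff_ofCS_cases m with ⟨m', -, h⟩ | ⟨-, h⟩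
  · simp only [h]
    rfl
  · simp only [h]
    simp

theorem pderivZbar_ofCS (F : (Fin n → ℂ) → CS) (j : Fin n) (z : Fin n → ℂ) :
    pderivZbar j (fun w => (ofCS (F w) : SA (Gen n))) z = ofCS (pderivZbar j F z) := by
  rw [pderivZbar_eq, pderivZbar_eq, ofCS_smul, ofCS_add, ofCS_smul, dirDeriv_ofCS, dirDeriv_ofCS]

theorem pderivZbar_conj {F : (Fin n → ℂ) → CS} {z : Fin n → ℂ} (hF : DiffCoeffAt F z) (j : Fin n) :
    pderivZbar j (fun w => CS.conj (F w)) z = CS.conj (pderivZ j F z) := by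
  rw [pderivZbar_eq, pderivZ_eq, CS.conj_smul, dirDeriv_conj hF, dirDeriv_conj hF]
  change _ = _ • CS.conjHom (_ - _)
  rw [map_sub]
  change _ = _ • (CS.conj _ - CS.conj (_ • _))
  rw [CS.conj_smul]
  simp [sub_eq_add_neg, Complex.conj_ofNat]

end

/-! ### Products of the two-forms `θ_l dz_l`, their determinant, and the expansion of the
exponential. -/

section

variable {n : ℕ}

theorem homog_genForm (g : Gen n) :
    SA.Homog (GradedGen.formDeg g : ℕ) (GradedGen.parity g : ℕ) (genForm g) := by
  have := SA.homog_mono (Finsupp.single g 1)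
  rwa [formDegree_single, monoParity_single, one_mul, one_mul] at this

theorem homog_dz (l : Fin n) : SA.Homog 1 0 (genForm (Gen.dz l)) := by
  simpa [GradedGen.formDeg, GradedGen.parity] using homog_genForm (Gen.dz l)

theorem homog_dzbar (l : Fin n) : SA.Homog 1 0 (genForm (Gen.dzbar l)) := by
  simpa [GradedGen.formDeg, GradedGen.parity] using homog_genForm (Gen.dzbar l)

theorem homog_dxi (l : Fin n) : SA.Homog 1 1 (genForm (Gen.dxi l)) := by
  simpa [GradedGen.formDeg, GradedGen.parity] using homog_genForm (Gen.dxi l)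

theorem SA.Homog.smul_even {k ε : ZMod 2} {x : SA (Gen n)} (c : CS0) (hx : SA.Homog k ε x) :
    SA.Homog k ε (c • x) := by
  rw [CS0.smul_superform]
  simpa using (homog_ofCS (n := n) (CS.IsEven.homog c.2)).mul hx

theorem fil_genForm (g : Gen n) : SA.Fil 1 (genForm g) :=
  SA.fil_one_iff.2 (SA.coeff_mono_of_ne (by
    rw [ne_comm, Finsupp.single_ne_zero]
    exact one_ne_zero))

/-! ### Combinations of the `dz̄_j` -/

variable (n) in
/-- The form `∑ r_j dz̄_j`. -/
def theta : (Fin n → CS0) →ₗ[CS0] SA (Gen n) :=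
  ∑ j, (LinearMap.proj j).smulRight (genForm (Gen.dzbar j))

theorem theta_apply (r : Fin n → CS0) : theta n r = ∑ j, r j • genForm (Gen.dzbar j) := by
  simp [theta]

theorem theta_single (l : Fin n) : theta n (Pi.single l 1) = genForm (Gen.dzbar l) := by
  rw [theta_apply, Finset.sum_eq_single l]
  · simp
  · intro j _ hj
    simp [hj]
  · simp

theorem homog_theta (r : Fin n → CS0) : SA.Homog 1 0 (theta n r) := by
  rw [theta_apply]
  exact SA.homog_sum fun j _ => (homog_dzbar j).smul_even (r j)

theorem theta_mul_self (r : Fin n → CS0) : theta n r * theta n r = 0 :=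
  (homog_theta r).sq_zero (by decide)

theorem homog_theta_mul_dz (r : Fin n → CS0) (l : Fin n) :
    SA.Homog 0 0 (theta n r * genForm (Gen.dz l)) := by
  have := (homog_theta r).mul (homog_dz l)
  rwa [show (1 : ZMod 2) + 1 = 0 by decide, add_zero] at this

/-- The two-form is central and can be moved aside; the one-form then meets itself and squares to
zero. -/
theorem theta_mul_dz_mul_theta (r : Fin n → CS0) (l : Fin n) :
    theta n r * genForm (Gen.dz l) * theta n r = 0 := by
  rw [((homog_theta_mul_dz r l).central _).eq, ← mul_assoc, theta_mul_self, zero_mul]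

/-- The central element `(∑ r_j dz̄_j) dz_l`. -/
def thetaDz (r : Fin n → CS0) (l : Fin n) : Subring.center (SA (Gen n)) :=
  ⟨theta n r * genForm (Gen.dz l), Subring.mem_center_iff.2 fun y =>
    ((homog_theta_mul_dz r l).central y).eq.symm⟩

theorem thetaDz_mul_theta (r : Fin n → CS0) (l : Fin n) :
    (thetaDz r l : SA (Gen n)) * theta n r = 0 := theta_mul_dz_mul_theta r l

theorem thetaDz_mul_thetaDz (r : Fin n → CS0) (l k : Fin n) : thetaDz r l * thetaDz r k = 0 :=
  Subtype.ext (by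
    change (thetaDz r l : SA (Gen n)) * (theta n r * _) = 0
    rw [← mul_assoc, thetaDz_mul_theta, zero_mul])

/-- The product of the two-forms `(∑ r_{lj} dz̄_j) dz_l` over a set of indices `l`. -/
def thetaProd (r : Fin n → Fin n → CS0) (S : Finset (Fin n)) : SA (Gen n) :=
  ((∏ l ∈ S, thetaDz (r l) l : Subring.center (SA (Gen n))) : SA (Gen n))

theorem thetaProd_erase (r : Fin n → Fin n → CS0) {S : Finset (Fin n)} {l : Fin n} (hl : l ∈ S) :
    thetaProd r S = thetaProd r (S.erase l) * (theta n (r l) * genForm (Gen.dz l)) := by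
  rw [thetaProd, ← Finset.prod_erase_mul _ _ hl]
  rfl

theorem thetaProd_congr {r r' : Fin n → Fin n → CS0} {S : Finset (Fin n)}
    (h : ∀ l ∈ S, r l = r' l) : thetaProd r S = thetaProd r' S := by
  unfold thetaProd
  rw [Finset.prod_congr rfl fun l hl => by rw [h l hl]]

theorem thetaProd_mul_theta {r : Fin n → Fin n → CS0} {S : Finset (Fin n)} {a : Fin n} (ha : a ∈ S)
    {v : Fin n → CS0} (hv : r a = v) : thetaProd r S * theta n v = 0 := by
  rw [thetaProd_erase r ha, hv, mul_assoc, theta_mul_dz_mul_theta, mul_zero]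

theorem thetaProd_eq_zero {r : Fin n → Fin n → CS0} {S : Finset (Fin n)} {a b : Fin n} (ha : a ∈ S)
    (hb : b ∈ S) (hab : a ≠ b) (h : r a = r b) : thetaProd r S = 0 := by
  rw [thetaProd_erase r ha, ← mul_assoc,
    thetaProd_mul_theta (Finset.mem_erase.2 ⟨hab.symm, hb⟩) h.symm, zero_mul]

/-- The form `(∏_{l ≠ i} (∑ r_{lj} dz̄_j) dz_l) (∑ r_{ij} dz̄_j)` as an alternating function of the
rows of `r`. -/
def thetaAlternating (i : Fin n) : (Fin n → CS0) [⋀^Fin n]→ₗ[CS0] SA (Gen n) where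
  toFun r := thetaProd r (Finset.univ.erase i) * theta n (r i)
  map_update_add' {inst} r k x y := by
    have hinst : inst = instDecidableEqFin n := Subsingleton.elim _ _
    subst hinst
    by_cases hk : k = i
    · subst hk
      have h : ∀ x, thetaProd (Function.update r k x) (Finset.univ.erase k) =
          thetaProd r (Finset.univ.erase k) := fun x => thetaProd_congr fun l hl => by
        rw [Function.update_of_ne (Finset.ne_of_mem_erase hl)]
      rw [h, h, h, Function.update_self, Function.update_self, Function.update_self, map_add, mul_add]
    · have hk' : k ∈ Finset.univ.erase i := Finset.mem_erase.2 ⟨hk, Finset.mem_univ k⟩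
      have h : ∀ x, thetaProd (Function.update r k x) ((Finset.univ.erase i).erase k) =
          thetaProd r ((Finset.univ.erase i).erase k) := fun x => thetaProd_congr fun l hl => by
        rw [Function.update_of_ne (Finset.ne_of_mem_erase hl)]
      rw [thetaProd_erase _ hk', thetaProd_erase _ hk', thetaProd_erase _ hk', h, h, h,
        Function.update_self, Function.update_self, Function.update_self,
        Function.update_of_ne (Ne.symm hk), Function.update_of_ne (Ne.symm hk),
        Function.update_of_ne (Ne.symm hk), map_add, add_mul, mul_add, add_mul]
  map_update_smul' {inst} r k c x := by
    have hinst : inst = instDecidableEqFin n := Subsingleton.elim _ _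
    subst hinst
    by_cases hk : k = i
    · subst hk
      have h : ∀ x, thetaProd (Function.update r k x) (Finset.univ.erase k) =
          thetaProd r (Finset.univ.erase k) := fun x => thetaProd_congr fun l hl => by
        rw [Function.update_of_ne (Finset.ne_of_mem_erase hl)]
      rw [h, h, Function.update_self, Function.update_self, map_smul, mul_smul_comm]
    · have hk' : k ∈ Finset.univ.erase i := Finset.mem_erase.2 ⟨hk, Finset.mem_univ k⟩
      have h : ∀ x, thetaProd (Function.update r k x) ((Finset.univ.erase i).erase k) =
          thetaProd r ((Finset.univ.erase i).erase k) := fun x => thetaProd_congr fun l hl => by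
        rw [Function.update_of_ne (Finset.ne_of_mem_erase hl)]
      rw [thetaProd_erase _ hk', thetaProd_erase _ hk', h, h,
        Function.update_self, Function.update_self,
        Function.update_of_ne (Ne.symm hk), Function.update_of_ne (Ne.symm hk),
        map_smul, smul_mul_assoc, mul_smul_comm, smul_mul_assoc]
  map_eq_zero_of_eq' r a b h hab := by
    change thetaProd r (Finset.univ.erase i) * theta n (r i) = 0
    by_cases ha : a = i
    · subst ha
      exact thetaProd_mul_theta (Finset.mem_erase.2 ⟨hab.symm, Finset.mem_univ b⟩) h.symm
    by_cases hb : b = i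
    · subst hb
      exact thetaProd_mul_theta (Finset.mem_erase.2 ⟨hab, Finset.mem_univ a⟩) h
    · rw [thetaProd_eq_zero (Finset.mem_erase.2 ⟨ha, Finset.mem_univ a⟩)
        (Finset.mem_erase.2 ⟨hb, Finset.mem_univ b⟩) hab h, zero_mul]

/-- An alternating map of `n` vectors is determined by its values on permutations of the basis, and
there it changes sign exactly as the determinant does. -/
theorem alternatingMap_eq_det_smul {R M : Type*} [CommRing R] [AddCommGroup M] [Module R M]
    (f : (Fin n → R) [⋀^Fin n]→ₗ[R] M) (r : Fin n → Fin n → R) :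
    f r = (Matrix.of r).det • f fun l => Pi.single l 1 := by
  have h : f = (LinearMap.toSpanSingleton R M (f fun l => Pi.single l 1)).compAlternatingMap
      Matrix.detRowAlternating := by
    refine Module.Basis.ext_alternating (Pi.basisFun R (Fin n)) fun v hv => ?_
    obtain ⟨σ, rfl⟩ : ∃ σ : Equiv.Perm (Fin n), v = σ :=
      ⟨Equiv.ofBijective v (Finite.injective_iff_bijective.1 hv), rfl⟩
    have h1 := f.map_perm (fun l => Pi.basisFun R (Fin n) l) σ
    have h2 := (Matrix.detRowAlternating (R := R) (n := Fin n)).map_perm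
      (fun l => Pi.basisFun R (Fin n) l) σ
    have h3 : Matrix.detRowAlternating (R := R) (fun l => Pi.basisFun R (Fin n) l) = 1 := by
      have : (fun l => Pi.basisFun R (Fin n) l) = (1 : Matrix (Fin n) (Fin n) R) := by
        funext l j
        simp [Matrix.one_apply, Pi.single_apply, eq_comm]
      rw [this]
      exact Matrix.det_one
    change f ((fun l => Pi.basisFun R (Fin n) l) ∘ σ) =
      (Matrix.detRowAlternating (R := R) ((fun l => Pi.basisFun R (Fin n) l) ∘ σ)) • _
    rw [h1, h2, h3, smul_assoc, one_smul]
    simp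
  conv_lhs => rw [h]
  rfl

/-- The product of the `dz̄_l dz_l`. -/
def pairProd (S : Finset (Fin n)) : SA (Gen n) := thetaProd (fun l => Pi.single l 1) S

/-- The last one-form is left without `dz_i` so that one determinant formula serves twice:
multiplied by `dz_i` it gives the full product, multiplied by `dξ_i` the contribution of the odd
part of the exponent. -/
theorem thetaProd_erase_mul_theta (r : Fin n → Fin n → CS0) (i : Fin n) :
    thetaProd r (Finset.univ.erase i) * theta n (r i) =
      (Matrix.of r).det • (pairProd (Finset.univ.erase i) * genForm (Gen.dzbar i)) := by
  have h := alternatingMap_eq_det_smul (thetaAlternating i) r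
  change _ = _ • (thetaProd _ _ * theta n (Pi.single i 1)) at h
  rw [theta_single] at h
  exact h

theorem thetaProd_univ (hn : 0 < n) (r : Fin n → Fin n → CS0) :
    thetaProd r Finset.univ = (Matrix.of r).det • pairProd Finset.univ := by
  have i : Fin n := ⟨0, hn⟩
  rw [pairProd, thetaProd_erase r (Finset.mem_univ i), thetaProd_erase _ (Finset.mem_univ i),
    ← mul_assoc, thetaProd_erase_mul_theta, theta_single, smul_mul_assoc, pairProd, mul_assoc]

theorem thetaProd_univ_mul_theta (r : Fin n → Fin n → CS0) (i : Fin n) :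
    thetaProd r Finset.univ * theta n (r i) = 0 := thetaProd_mul_theta (Finset.mem_univ i) rfl

/-! ### The exponential -/

theorem fil_theta_mul (r : Fin n → CS0) (x : SA (Gen n)) : SA.Fil 1 (theta n r * x) := by
  rw [theta_apply]
  refine SA.Fil.mul_right (SA.fil_sum fun j _ => ?_) x
  rw [CS0.smul_superform]
  exact (fil_genForm _).mul_left _

/-- The expansion of the exponential over sets of two-forms. -/
theorem exp_neg_smul_eq {Q : CS} (hQ : Q.IsEven) (r : Fin n → Fin n → CS0) {Ψ : SA (Gen n)}
    (hΨ : SA.Homog 0 1 Ψ) (hΨ1 : SA.Fil 1 Ψ) (a : ℂ) :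
    SA.exp (-(a • (ofCS Q + ∑ l, theta n (r l) * genForm (Gen.dz l) + Ψ))) =
      ofCS (SA.exp (-(a • Q))) * ∑ S : Finset (Fin n), (-a) ^ S.card •
        (thetaProd r S * (1 - a • Ψ)) := by
  set C : Subring.center (SA (Gen n)) := ⟨algebraMap ℂ _ (-a), Subring.mem_center_iff.2 fun y =>
    (Algebra.commutes (-a) y).symm⟩ with hC
  set q : Fin n → Subring.center (SA (Gen n)) := fun l => C * thetaDz (r l) l with hq
  have hq0 : ∀ l, q l * q l = 0 := fun l => by
    rw [hq]
    simp only
    rw [mul_mul_mul_comm, thetaDz_mul_thetaDz, mul_zero]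
  have hqf : ∀ l, SA.Fil 1 (q l : SA (Gen n)) := fun l =>
    SA.Fil.mul_left _ (fil_theta_mul (r l) _)
  have hqs : ∀ l, (q l : SA (Gen n)) = (-a) • (theta n (r l) * genForm (Gen.dz l)) := fun l =>
    (Algebra.smul_def _ _).symm
  set Q' : CS := -(a • (Q - Q.coeff 0 • 1)) with hQ'
  have hQ'e : Q'.IsEven := CS0.neg_mem (CS.IsEven.smul _ (hQ.sub (CS.IsEven.smul _ CS0.one_mem)))
  have hQ'f : SA.Fil 1 (ofCS Q' : SA (Gen n)) := SA.fil_one_iff.2 (by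
    rw [coeff_ofCS_zero, hQ']
    simp [SA.coeff_one])
  -- The exponent splits into a scalar and three commuting parts without constant term: the soul of
  -- `Q`, the central two-forms, and `Ψ`.
  have hsum : -(a • (ofCS Q + ∑ l, theta n (r l) * genForm (Gen.dz l) + Ψ)) =
      (-(a * Q.coeff 0)) • (1 : SA (Gen n)) + (ofCS Q' + (∑ l, (q l : SA (Gen n)) + -(a • Ψ))) := by
    have e1 : (ofCS Q' : SA (Gen n)) = -(a • (ofCS Q - Q.coeff 0 • 1)) := by
      rw [← ofCSHom_apply, hQ', map_neg, ofCSHom_apply, ofCS_smul, ← ofCSHom_apply, map_sub,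
        ofCSHom_apply, ofCSHom_apply, ofCS_smul, ofCS_one]
    rw [e1, Finset.sum_congr rfl fun l _ => hqs l, ← Finset.smul_sum]
    module
  have hqsum : SA.Fil 1 (∑ l, (q l : SA (Gen n))) := SA.fil_sum fun l _ => hqf l
  have hΨ' : SA.Fil 1 (-(a • Ψ)) := (hΨ1.smul a).neg
  -- Even form degree with odd parity: `Ψ` anticommutes with itself.
  have hsq : (-(a • Ψ)) * (-(a • Ψ)) = 0 := by
    rw [neg_mul_neg, smul_mul_smul_comm, hΨ.sq_zero (by decide), smul_zero]
  rw [hsum, SA.exp_smul_one_add _ (hQ'f.add (hqsum.add hΨ')),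
    SA.exp_add (ofCS_commute hQ'e _) hQ'f (hqsum.add hΨ'), SA.exp_add ?_ hqsum hΨ',
    SA.exp_sum_central _ q hq0 hqf, SA.exp_of_sq_zero hsq hΨ', Finset.prod_one_add,
    ← smul_mul_assoc, ← ofCS_exp, ← ofCS_smul]
  · have e2 : Complex.exp (-(a * Q.coeff 0)) • SA.exp Q' = SA.exp (-(a • Q)) := by
      rw [← SA.exp_smul_one_add _ (SA.fil_one_iff.2 (by rw [hQ']; simp [SA.coeff_one])), hQ']
      congr 1
      module
    rw [e2, ← sub_eq_add_neg, Finset.powerset_univ]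
    congr 1
    have e3 : ((∑ S : Finset (Fin n), ∏ l ∈ S, q l : Subring.center (SA (Gen n))) : SA (Gen n)) =
        ∑ S : Finset (Fin n), (-a) ^ S.card • thetaProd r S := by
      rw [AddSubmonoidClass.coe_finsetSum]
      refine Finset.sum_congr rfl fun S _ => ?_
      rw [hq, Finset.prod_mul_distrib, Finset.prod_const, Algebra.smul_def, map_pow]
      rfl
    rw [e3, Finset.sum_mul]
    exact Finset.sum_congr rfl fun S _ => smul_mul_assoc _ _ _
  · refine Commute.sum_left _ _ _ fun l _ => ?_
    exact (Subring.mem_center_iff.1 (q l).2 _).symm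

end

/-! ### Signs and the top coefficient. -/

section

variable {n : ℕ}

/-! ### Signs -/

namespace Gen

theorem dz_lt_dz {i j : Fin n} : dz i < dz j ↔ i < j := by
  simp [lt_iff, code, Prod.Lex.toLex_lt_toLex]

theorem dzbar_lt_dzbar {i j : Fin n} : dzbar i < dzbar j ↔ i < j := by
  simp [lt_iff, code, Prod.Lex.toLex_lt_toLex]

theorem dz_lt_dzbar (i j : Fin n) : dz i < dzbar j := by
  simp [lt_iff, code, Prod.Lex.toLex_lt_toLex]

/-- The generators above all `dz` and `dz̄`. -/
def IsHigh (g : Gen n) : Prop := ∀ i : Fin n, dzbar i < g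

theorem IsHigh.dz_lt {g : Gen n} (hg : g.IsHigh) (i : Fin n) : dz i < g :=
  (dz_lt_dzbar i i).trans (hg i)

theorem isHigh_dxi (j : Fin n) : (dxi j).IsHigh := fun i => by
  simp [lt_iff, code, Prod.Lex.toLex_lt_toLex]

theorem isHigh_dxibar (j : Fin n) : (dxibar j).IsHigh := fun i => by
  simp [lt_iff, code, Prod.Lex.toLex_lt_toLex]

theorem isHigh_xi (j : Fin n) : (xi j).IsHigh := fun i => by
  simp [lt_iff, code, Prod.Lex.toLex_lt_toLex]

theorem isHigh_xibar (j : Fin n) : (xibar j).IsHigh := fun i => by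
  simp [lt_iff, code, Prod.Lex.toLex_lt_toLex]

theorem isHigh_beta (k : ℕ) : (beta k : Gen n).IsHigh := fun i => by
  simp [lt_iff, code, Prod.Lex.toLex_lt_toLex]

theorem dxi_lt_dxibar (i j : Fin n) : dxi i < dxibar j := by
  simp [lt_iff, code, Prod.Lex.toLex_lt_toLex]

theorem dxi_lt_xi (i j : Fin n) : dxi i < xi j := by
  simp [lt_iff, code, Prod.Lex.toLex_lt_toLex]

theorem dxi_lt_xibar (i j : Fin n) : dxi i < xibar j := by
  simp [lt_iff, code, Prod.Lex.toLex_lt_toLex]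

theorem dxi_lt_beta (i : Fin n) (k : ℕ) : dxi i < beta k := by
  simp [lt_iff, code, Prod.Lex.toLex_lt_toLex]

end Gen

/-- Monomials in the generators above all `dz` and `dz̄`. -/
def HighExp (b : Gen n →₀ ℕ) : Prop := ∀ g ∈ b.support, g.IsHigh

theorem HighExp.add {b c : Gen n →₀ ℕ} (hb : HighExp b) (hc : HighExp c) : HighExp (b + c) := by
  classical
  intro g hg
  rcases Finset.mem_union.1 (Finsupp.support_add hg) with h | h
  · exact hb g h
  · exact hc g h

theorem highExp_single {g : Gen n} (hg : g.IsHigh) : HighExp (Finsupp.single g 1) := fun h hh => by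
  rw [Finset.mem_singleton.1 (Finsupp.support_single_subset hh)]
  exact hg

theorem highExp_sum {ι : Type*} {s : Finset ι} {f : ι → Gen n →₀ ℕ}
    (h : ∀ i ∈ s, HighExp (f i)) : HighExp (∑ i ∈ s, f i) :=
  Finset.sum_induction f HighExp (fun _ _ => HighExp.add) (fun g hg => by simp at hg) h

theorem highExp_betaExp (m : ℕ →₀ ℕ) : HighExp (betaExp m : Gen n →₀ ℕ) := fun g hg => by
  obtain ⟨k, rfl⟩ := mem_support_betaExp hg
  exact Gen.isHigh_beta k

theorem highExp_xiExp (μ lam : Finset (Fin n)) : HighExp (xiExp μ lam) :=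
  (highExp_sum fun j _ => highExp_single (Gen.isHigh_xi j)).add
    (highExp_sum fun j _ => highExp_single (Gen.isHigh_xibar j))

theorem highExp_exp00 : HighExp (exp00 n) := highExp_sum fun j _ =>
  (highExp_single (Gen.isHigh_dxi j)).add (highExp_single (Gen.isHigh_dxibar j))

theorem HighExp.cast_normExp_dzbar {b : Gen n →₀ ℕ} (hb : HighExp b) (i : Fin n) :
    (normExp b (Finsupp.single (Gen.dzbar i) 1) : ZMod 2) = formDegree b := by
  unfold normExp formDegree
  rw [Finsupp.sum, Finsupp.sum, Nat.cast_sum]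
  refine Finset.sum_congr rfl fun g hg => ?_
  rw [Finsupp.sum_single_index (by simp), if_pos (hb g hg i)]
  simp [swapExp, GradedGen.formDeg, GradedGen.parity]

theorem HighExp.cast_normExp_dz {b : Gen n →₀ ℕ} (hb : HighExp b) (i : Fin n) :
    (normExp b (Finsupp.single (Gen.dz i) 1) : ZMod 2) = formDegree b := by
  unfold normExp formDegree
  rw [Finsupp.sum, Finsupp.sum, Nat.cast_sum]
  refine Finset.sum_congr rfl fun g hg => ?_
  rw [Finsupp.sum_single_index (by simp), if_pos ((hb g hg).dz_lt i)]
  simp [swapExp, GradedGen.formDeg, GradedGen.parity]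

/-- The exponents of the product of the `dz_l dz̄_l`. -/
def pairExp (S : Finset (Fin n)) : Gen n →₀ ℕ :=
  ∑ l ∈ S, (Finsupp.single (Gen.dz l) 1 + Finsupp.single (Gen.dzbar l) 1)

/-- A generator passing `dz_l` and `dz̄_l` picks up the same sign twice. -/
theorem HighExp.cast_normExp_pairExp {b : Gen n →₀ ℕ} (hb : HighExp b) (S : Finset (Fin n)) :
    (normExp b (pairExp S) : ZMod 2) = 0 := by
  rw [pairExp, normExp_sum_right, Nat.cast_sum]
  refine Finset.sum_eq_zero fun l _ => ?_
  rw [normExp_add_right, Nat.cast_add, hb.cast_normExp_dz, hb.cast_normExp_dzbar,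
    CharTwo.add_self_eq_zero]

/-- Each earlier pair costs an odd number of transpositions: `dz_l` always passes `dz̄_k`, and for
`l < k` also `dz_l` passes `dz_k` and `dz̄_l` passes `dz̄_k`. -/
theorem normExp_pairExp_insert {S : Finset (Fin n)} {l : Fin n} (hl : l ∉ S) :
    (normExp (pairExp S) (Finsupp.single (Gen.dz l) 1 + Finsupp.single (Gen.dzbar l) 1) : ZMod 2) =
      S.card := by
  rw [pairExp, normExp_sum_left, Nat.cast_sum, Finset.sum_congr rfl (g := fun _ => 1)]
  · simp
  intro k hk
  have hkl : k ≠ l := fun h => hl (h ▸ hk)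
  rw [normExp_add_left, normExp_add_right, normExp_add_right, normExp_single, normExp_single,
    normExp_single, normExp_single, if_neg (Gen.dz_lt_dzbar k l).not_gt,
    if_pos (Gen.dz_lt_dzbar l k)]
  simp only [Gen.dz_lt_dz, Gen.dzbar_lt_dzbar]
  rcases lt_or_gt_of_ne hkl with h | h
  · simp [h.not_gt, swapExp, GradedGen.formDeg, GradedGen.parity]
  · simp only [h, if_true, swapExp, GradedGen.formDeg, GradedGen.parity]
    decide

theorem genForm_dzbar_mul_dz (l : Fin n) : genForm (Gen.dzbar l) * genForm (Gen.dz l) =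
    (-1 : ℂ) • SA.mono (Finsupp.single (Gen.dz l) 1 + Finsupp.single (Gen.dzbar l) 1) := by
  rw [genForm, genForm, SA.mono_mul_mono, normExp_single, if_pos (Gen.dz_lt_dzbar l l), add_comm]
  simp [swapExp, GradedGen.formDeg, GradedGen.parity]

/-- Adding a pair to `S` costs one sign for turning `dz̄_l dz_l` into `dz_l dz̄_l`, and `S.card`
signs for sorting it in. The total is a triangular number. -/
theorem pairProd_eq (S : Finset (Fin n)) :
    pairProd S = (-1 : ℂ) ^ (S.card * (S.card + 1) / 2) • SA.mono (pairExp S) := by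
  induction S using Finset.induction_on with
  | empty => simp [pairProd, thetaProd, pairExp, SA.mono_zero]
  | insert l S hl ih =>
    rw [pairProd, thetaProd_erase _ (Finset.mem_insert_self l S), Finset.erase_insert hl,
      theta_single, genForm_dzbar_mul_dz]
    change pairProd S * _ = _
    rw [ih, smul_mul_smul_comm, SA.mono_mul_mono, smul_smul,
      neg_one_pow_congr (normExp_pairExp_insert hl), Finset.card_insert_of_notMem hl]
    congr 1
    · have h : (S.card + 1) * (S.card + 1 + 1) / 2 = S.card * (S.card + 1) / 2 + (S.card + 1) := by
        rw [show (S.card + 1) * (S.card + 1 + 1) = S.card * (S.card + 1) + 2 * (S.card + 1) by ring,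
          Nat.add_mul_div_left _ _ two_pos]
      rw [h, pow_add, pow_succ]
      ring
    · congr 1
      rw [pairExp, pairExp, Finset.sum_insert hl, add_comm]

/-! ### The top coefficient -/

variable (n) in
/-- The exponents of the top monomial. -/
def fullExp : Gen n →₀ ℕ := expTop n + xiExp Finset.univ Finset.univ

theorem betaFree_xiExp (μ lam : Finset (Fin n)) : BetaFree (xiExp μ lam) :=
  (BetaFree.sum fun _ _ => betaFree_single (by simp) 1).add
    (BetaFree.sum fun _ _ => betaFree_single (by simp) 1)

theorem betaFree_exp00 : BetaFree (exp00 n) :=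
  BetaFree.sum fun _ _ => (betaFree_single (by simp) 1).add (betaFree_single (by simp) 1)

theorem betaFree_fullExp : BetaFree (fullExp n) :=
  ((BetaFree.sum fun _ _ => (betaFree_single (by simp) 1).add (betaFree_single (by simp) 1)).add
    betaFree_exp00).add (betaFree_xiExp _ _)

theorem admissible_fullExp : Admissible (fullExp n) := by
  classical
  intro g _
  cases g <;> simp [fullExp, expTop, exp00, xiExp, Finsupp.single_apply]

theorem fullExp_eq : fullExp n = exp00 n + xiExp Finset.univ Finset.univ + pairExp Finset.univ := by
  rw [fullExp, expTop, pairExp]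
  abel

theorem coefAt_mul_pairProd_univ (x : SA (Gen n)) :
    coefAt (fullExp n) (x * pairProd Finset.univ) =
      (-1 : ℂ) ^ (n * (n + 1) / 2) • coefAt (exp00 n + xiExp Finset.univ Finset.univ) x := by
  rw [pairProd_eq, mul_smul_comm, coefAt_smul, Finset.card_univ, Fintype.card_fin]
  congr 1
  refine SA.ext_adm fun m hm => ?_
  have hA : Admissible (fullExp n + betaExp m) :=
    (admissible_add_betaExp betaFree_fullExp).2 ⟨admissible_fullExp, hm⟩
  have hs : fullExp n + betaExp m = exp00 n + xiExp Finset.univ Finset.univ + betaExp m +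
      pairExp Finset.univ := by
    rw [fullExp_eq, add_right_comm]
  have hh : HighExp (exp00 n + xiExp Finset.univ Finset.univ + betaExp m : Gen n →₀ ℕ) :=
    (highExp_exp00.add (highExp_xiExp _ _)).add (highExp_betaExp m)
  rw [coeff_coefAt, coeff_coefAt, hs, SA.coeff_mul_mono _ (hs ▸ hA),
    neg_one_pow_congr (b := 0) (by rw [hh.cast_normExp_pairExp, Nat.cast_zero]), pow_zero, one_mul]

theorem xiExp_compl_add (μ : Finset (Fin n)) :
    xiExp Finset.univ Finset.univ = xiExp μᶜ Finset.univ + xiExp μ ∅ := by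
  rw [xiExp, xiExp, xiExp, Finset.sum_empty, add_zero, ← Finset.sum_compl_add_sum μ]
  abel

/-- Stripping the factor on the right from the top monomial leaves `ξ` with the complementary index
set, so the claim is about that coefficient of `x`. -/
theorem coefAt_mul_pairProd_mul_mono_xi {x : SA (Gen n)} {μ : Finset (Fin n)}
    (h : coefAt (exp00 n + xiExp μᶜ Finset.univ) x = 0) :
    coefAt (fullExp n) (x * pairProd Finset.univ * SA.mono (xiExp μ ∅)) = 0 := by
  ext m
  rw [coeff_coefAt, pairProd_eq, mul_assoc, smul_mul_assoc, SA.mono_mul_mono, smul_smul,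
    mul_smul_comm, SA.coeff_smul, SA.coeff_mul_mono_eq_zero, mul_zero, SA.coeff_zero]
  intro b hb
  have hs : fullExp n + betaExp m = exp00 n + xiExp μᶜ Finset.univ + betaExp m +
      (pairExp Finset.univ + xiExp μ ∅) := by
    rw [fullExp_eq, xiExp_compl_add μ]
    abel
  rw [hs] at hb
  rw [add_right_cancel hb]
  exact congrArg (fun y => SA.coeff y m) h

theorem monoParity_of_betaExp (m : ℕ →₀ ℕ) : (monoParity m : ZMod 2) = m.degree := by
  simp [monoParity, Finsupp.sum, Finsupp.degree_apply, GradedGen.parity]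

theorem cast_normExp_dxi {b : Gen n →₀ ℕ} (hb : ∀ g ∈ b.support, ∀ i : Fin n, Gen.dxi i < g)
    (i : Fin n) : (normExp b (Finsupp.single (Gen.dxi i) 1) : ZMod 2) =
      formDegree b + monoParity b := by
  unfold normExp formDegree monoParity
  rw [Finsupp.sum, Finsupp.sum, Finsupp.sum, Nat.cast_sum, ← Finset.sum_add_distrib]
  refine Finset.sum_congr rfl fun g hg => ?_
  rw [Finsupp.sum_single_index (by simp), if_pos (hb g hg i)]
  simp [swapExp, GradedGen.formDeg, GradedGen.parity, mul_add]

theorem triangular_eq_add {c n : ℕ} (h : c + 1 = n) :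
    n * (n + 1) / 2 = c * (c + 1) / 2 + (c + 1) := by
  rw [← h, show (c + 1) * (c + 1 + 1) = c * (c + 1) + 2 * (c + 1) by ring,
    Nat.add_mul_div_left _ _ two_pos]

theorem genForm_mul_genForm_of_lt {g h : Gen n} (hgh : g < h) :
    genForm g * genForm h = SA.mono (Finsupp.single g 1 + Finsupp.single h 1) := by
  rw [genForm, genForm, SA.mono_mul_mono, normExp_single, if_neg hgh.not_gt, pow_zero, one_smul]

/-- For each `l ≠ i` exactly one of two transpositions is needed: `dz̄_i` passes `dz̄_l` when `i <
l`, and `dz_i` passes `dz_l` when `l < i`. -/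
theorem normExp_pairExp_dzbar_add (i : Fin n) :
    (normExp (pairExp (Finset.univ.erase i)) (Finsupp.single (Gen.dzbar i) 1) : ZMod 2) +
      normExp (Finsupp.single (Gen.dz i) 1) (pairExp (Finset.univ.erase i)) =
      (Finset.univ.erase i).card := by
  rw [pairExp, normExp_sum_left, normExp_sum_right, Nat.cast_sum, Nat.cast_sum,
    ← Finset.sum_add_distrib, Finset.sum_congr rfl (g := fun _ => 1)]
  · simp
  intro l hl
  have hli : l ≠ i := Finset.ne_of_mem_erase hl
  rw [normExp_add_left, normExp_add_right, normExp_single, normExp_single,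
    normExp_single, normExp_single, if_neg (Gen.dz_lt_dzbar l i).not_gt,
    if_neg (Gen.dz_lt_dzbar i l).not_gt]
  simp only [Gen.dz_lt_dz, Gen.dzbar_lt_dzbar]
  rcases lt_or_gt_of_ne hli with h | h
  · simp [h, h.not_gt, swapExp, GradedGen.formDeg, GradedGen.parity]
  · simp [h, h.not_gt, swapExp, GradedGen.formDeg, GradedGen.parity]

theorem formDegree_sum {G ι : Type} [LinearOrder G] [GradedGen G] (s : Finset ι) (f : ι → G →₀ ℕ) :
    formDegree (∑ i ∈ s, f i) = ∑ i ∈ s, formDegree (f i) :=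
  map_sum (⟨⟨formDegree, Finsupp.sum_zero_index⟩, formDegree_add⟩ : (G →₀ ℕ) →+ ZMod 2) f s

theorem monoParity_sum {G ι : Type} [LinearOrder G] [GradedGen G] (s : Finset ι) (f : ι → G →₀ ℕ) :
    monoParity (∑ i ∈ s, f i) = ∑ i ∈ s, monoParity (f i) :=
  map_sum (⟨⟨monoParity, Finsupp.sum_zero_index⟩, monoParity_add⟩ : (G →₀ ℕ) →+ ZMod 2) f s

theorem formDegree_xiExp (μ lam : Finset (Fin n)) : formDegree (xiExp μ lam) = 0 := by
  simp [xiExp, formDegree_add, formDegree_sum, formDegree_single, GradedGen.formDeg]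

theorem monoParity_xiExp (μ lam : Finset (Fin n)) :
    monoParity (xiExp μ lam) = (μ.card : ZMod 2) + lam.card := by
  simp [xiExp, monoParity_add, monoParity_sum, monoParity_single, GradedGen.parity]

theorem formDegree_of_betaExp (m : ℕ →₀ ℕ) : (formDegree m : ZMod 2) = 0 := by
  simp [formDegree, Finsupp.sum, GradedGen.formDeg]

/-- The part of the monomial that is complementary to `dz_i` and to the two-forms. -/
def restExp (i : Fin n) (m : ℕ →₀ ℕ) : Gen n →₀ ℕ :=
  ∑ l ∈ Finset.univ.erase i, Finsupp.single (Gen.dxi l) 1 +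
    (∑ l, Finsupp.single (Gen.dxibar l) 1 + (xiExp Finset.univ Finset.univ + betaExp m))

theorem highExp_restExp (i : Fin n) (m : ℕ →₀ ℕ) : HighExp (restExp i m) :=
  (highExp_sum fun l _ => highExp_single (Gen.isHigh_dxi l)).add
    ((highExp_sum fun l _ => highExp_single (Gen.isHigh_dxibar l)).add
      ((highExp_xiExp _ _).add (highExp_betaExp m)))

/-- The `dξ` and `dξ̄` commute among each other, and the `2n` signs from the `ξ` and `ξ̄` cancel.
Only the `β` of the coefficient leave a trace. -/
theorem cast_normExp_restExp_dxi (i : Fin n) (m : ℕ →₀ ℕ) :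
    (normExp (restExp i m) (Finsupp.single (Gen.dxi i) 1) : ZMod 2) = m.degree := by
  classical
  have h1 : (normExp (∑ l ∈ Finset.univ.erase i, Finsupp.single (Gen.dxi l) 1)
      (Finsupp.single (Gen.dxi i) 1) : ZMod 2) = 0 := by
    rw [normExp_sum_left, Nat.cast_sum]
    refine Finset.sum_eq_zero fun l _ => ?_
    rw [normExp_single]
    split_ifs
    · simp only [swapExp, GradedGen.formDeg, GradedGen.parity]
      decide
    · rfl
  have h2 : (2 : ZMod 2) = 0 := rfl
  rw [restExp, normExp_add_left, Nat.cast_add, h1, zero_add, cast_normExp_dxi]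
  · rw [formDegree_add, formDegree_add, formDegree_xiExp, formDegree_betaExp,
      formDegree_of_betaExp, monoParity_add, monoParity_add, monoParity_xiExp, monoParity_betaExp,
      monoParity_of_betaExp, formDegree_sum, monoParity_sum]
    simp only [formDegree_single, monoParity_single, GradedGen.formDeg, GradedGen.parity]
    simp only [mul_one, Nat.cast_one, Finset.sum_const, Finset.card_univ, Fintype.card_fin,
      nsmul_eq_mul, add_zero]
    linear_combination (2 * (n : ZMod 2)) * h2
  · intro g hg j
    rcases Finset.mem_union.1 (Finsupp.support_add hg) with h | h
    · have h' := Finsupp.support_finsetSum h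
      simp only [Finset.mem_biUnion] at h'
      obtain ⟨l, -, hl⟩ := h'
      rw [Finset.mem_singleton.1 (Finsupp.support_single_subset hl)]
      exact Gen.dxi_lt_dxibar j l
    rcases Finset.mem_union.1 (Finsupp.support_add h) with h | h
    · rcases Finset.mem_union.1 (Finsupp.support_add h) with h | h
      · have h' := Finsupp.support_finsetSum h
        simp only [Finset.mem_biUnion] at h'
        obtain ⟨l, -, hl⟩ := h'
        rw [Finset.mem_singleton.1 (Finsupp.support_single_subset hl)]
        exact Gen.dxi_lt_xi j l
      · have h' := Finsupp.support_finsetSum h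
        simp only [Finset.mem_biUnion] at h'
        obtain ⟨l, -, hl⟩ := h'
        rw [Finset.mem_singleton.1 (Finsupp.support_single_subset hl)]
        exact Gen.dxi_lt_xibar j l
    · obtain ⟨k, rfl⟩ := mem_support_betaExp h
      exact Gen.dxi_lt_beta j k

theorem formDegree_restExp (i : Fin n) (m : ℕ →₀ ℕ) : formDegree (restExp i m) = 1 := by
  have hn : 0 < n := i.pos
  have h2 : (2 : ZMod 2) = 0 := rfl
  rw [restExp, formDegree_add, formDegree_add, formDegree_add, formDegree_xiExp,
    formDegree_betaExp, formDegree_of_betaExp, formDegree_sum, formDegree_sum]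
  simp only [formDegree_single, GradedGen.formDeg]
  simp only [mul_one, Nat.cast_one, Finset.sum_const, Finset.card_univ, Fintype.card_fin,
      nsmul_eq_mul, add_zero, Finset.card_erase_of_mem (Finset.mem_univ i)]
  rw [Nat.cast_sub hn, Nat.cast_one]
  linear_combination ((n : ZMod 2) - 1) * h2

/-- The sorting sign is the same as for the full product of pairs, independent of `i`, except for
`(-1) ^ m.degree` from carrying `dξ_i` across the coefficient. The evenness assumption on the
starred coefficient later disposes of this factor. -/
theorem coeff_coefAt_mul_pairProd_mul_dxi (x : SA (Gen n)) (i : Fin n) (m : ℕ →₀ ℕ) :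
    (coefAt (fullExp n) (x * (pairProd (Finset.univ.erase i) * genForm (Gen.dzbar i) *
      genForm (Gen.dxi i)))).coeff m = (-1) ^ (n * (n + 1) / 2 + m.degree) *
        (coefAt (exp10 i + xiExp Finset.univ Finset.univ) x).coeff m := by
  by_cases hm : Admissible m
  swap
  · rw [SA.coeff_of_not _ hm, SA.coeff_of_not _ hm, mul_zero]
  have hA : Admissible (fullExp n + betaExp m) :=
    (admissible_add_betaExp betaFree_fullExp).2 ⟨admissible_fullExp, hm⟩
  set E := Finset.univ.erase i with hE
  set e := normExp (pairExp E) (Finsupp.single (Gen.dzbar i) 1) with he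
  have hprod : pairProd E * genForm (Gen.dzbar i) * genForm (Gen.dxi i) =
      (-1 : ℂ) ^ (E.card * (E.card + 1) / 2 + e) •
        SA.mono (pairExp E + (Finsupp.single (Gen.dzbar i) 1 + Finsupp.single (Gen.dxi i) 1)) := by
    have h0 : normExp (pairExp E) (Finsupp.single (Gen.dxi i) 1) = 0 := by
      rw [pairExp, normExp_sum_left]
      refine Finset.sum_eq_zero fun l _ => ?_
      rw [normExp_add_left, normExp_single, normExp_single,
        if_neg (Gen.isHigh_dxi i l).not_gt, if_neg ((Gen.isHigh_dxi i).dz_lt l).not_gt, add_zero]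
    rw [mul_assoc, genForm_mul_genForm_of_lt (Gen.isHigh_dxi i i), pairProd_eq, smul_mul_assoc,
      SA.mono_mul_mono, normExp_add_right, h0, add_zero, smul_smul, ← pow_add]
  have hs : fullExp n + betaExp m = Finsupp.single (Gen.dz i) 1 + restExp i m +
      (pairExp E + (Finsupp.single (Gen.dzbar i) 1 + Finsupp.single (Gen.dxi i) 1)) := by
    have e1 : pairExp (Finset.univ : Finset (Fin n)) = Finsupp.single (Gen.dz i) 1 +
        Finsupp.single (Gen.dzbar i) 1 + pairExp E :=
      (Finset.add_sum_erase _ _ (Finset.mem_univ i)).symm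
    have e2 : exp00 n = Finsupp.single (Gen.dxi i) 1 + ∑ l ∈ E, Finsupp.single (Gen.dxi l) 1 +
        ∑ l, Finsupp.single (Gen.dxibar l) 1 := by
      rw [exp00, Finset.sum_add_distrib, ← Finset.add_sum_erase _ _ (Finset.mem_univ i)]
    rw [fullExp_eq, e1, e2, restExp]
    abel
  have hs' : Finsupp.single (Gen.dz i) 1 + restExp i m =
      exp10 i + xiExp Finset.univ Finset.univ + betaExp m := by
    rw [restExp, exp10]
    abel
  rw [hprod, mul_smul_comm, coefAt_smul, SA.coeff_smul, coeff_coefAt, hs,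
    SA.coeff_mul_mono _ (hs ▸ hA), hs', coeff_coefAt, ← mul_assoc, ← pow_add, ← hs']
  congr 1
  refine neg_one_pow_congr ?_
  have hcard : E.card + 1 = n := by
    rw [hE, Finset.card_erase_of_mem (Finset.mem_univ i), Finset.card_univ, Fintype.card_fin]
    have := i.pos
    omega
  have hN : (normExp (Finsupp.single (Gen.dz i) 1 + restExp i m) (pairExp E +
      (Finsupp.single (Gen.dzbar i) 1 + Finsupp.single (Gen.dxi i) 1)) : ZMod 2) =
      normExp (Finsupp.single (Gen.dz i) 1) (pairExp E) + 1 + m.degree := by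
    rw [normExp_add_left, normExp_add_right, normExp_add_right, normExp_add_right,
      normExp_add_right, normExp_single, normExp_single, if_neg (Gen.dz_lt_dzbar i i).not_gt,
      if_neg ((Gen.isHigh_dxi i).dz_lt i).not_gt]
    push_cast
    rw [(highExp_restExp i m).cast_normExp_pairExp, (highExp_restExp i m).cast_normExp_dzbar,
      formDegree_restExp, cast_normExp_restExp_dxi]
    ring
  have hq := triangular_eq_add hcard
  have h3 := normExp_pairExp_dzbar_add i
  rw [hq]
  push_cast
  rw [hN]
  linear_combination h3

end

/-! ### The exponent of the integrand. -/

section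

variable {n : ℕ}

/-! ### Left derivatives of linear forms -/

theorem leftDeriv_add (g : Gen n) (x y : SA (Gen n)) :
    (x + y).leftDeriv g = x.leftDeriv g + y.leftDeriv g := by
  ext m
  simp only [SA.leftDeriv, SA.coeff_mk, SA.coeff_add]
  ring

theorem leftDeriv_zero (g : Gen n) : (0 : SA (Gen n)).leftDeriv g = 0 := by
  ext m
  simp [SA.leftDeriv]

theorem leftDeriv_sum {ι : Type*} (s : Finset ι) (f : ι → SA (Gen n)) (g : Gen n) :
    (∑ i ∈ s, f i).leftDeriv g = ∑ i ∈ s, (f i).leftDeriv g :=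
  map_sum (⟨⟨SA.leftDeriv g, leftDeriv_zero g⟩, leftDeriv_add g⟩ : SA (Gen n) →+ SA (Gen n)) f s

theorem coeff_ofCS_of_apply_ne {m : Gen n →₀ ℕ} {g : Gen n} (hg : ∀ k, g ≠ Gen.beta k)
    (hm : m g ≠ 0) (c : CS) : (ofCS c : SA (Gen n)).coeff m = 0 := by
  rcases coeff_ofCS_cases m with ⟨m', rfl, -⟩ | ⟨-, h⟩
  · exact absurd (betaExp_apply_of_ne m' hg) hm
  · exact h c

theorem leftDeriv_genForm_mul_ofCS_of_ne {g h : Gen n} (hg : ∀ k, g ≠ Gen.beta k) (hgh : g ≠ h)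
    (c : CS) : (genForm h * ofCS c).leftDeriv g = 0 := by
  ext m
  simp only [SA.leftDeriv, SA.coeff_mk, SA.coeff_zero]
  rw [genForm, SA.coeff_mono_mul_eq_zero, mul_zero]
  intro b hb
  refine coeff_ofCS_of_apply_ne hg ?_ c
  have := DFunLike.congr_fun hb g
  rw [Finsupp.add_apply, Finsupp.add_apply, Finsupp.single_eq_of_ne hgh, Finsupp.single_eq_same,
    zero_add] at this
  omega

/-- The sign in the left derivative and the sign of sorting `g` into the monomial are equal and
cancel. -/
theorem leftDeriv_genForm_mul_ofCS_self {g : Gen n} (hg : ∀ k, g ≠ Gen.beta k) (c : CS) :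
    (genForm g * ofCS c).leftDeriv g = ofCS c := by
  ext m
  simp only [SA.leftDeriv, SA.coeff_mk]
  by_cases hmg : m g = 0
  · by_cases hA : Admissible m
    · have hA' : Admissible (Finsupp.single g 1 + m) := fun h hh => by
        rw [Finsupp.add_apply]
        by_cases hgh : h = g
        · rw [hgh, Finsupp.single_eq_same, hmg]
        · rw [Finsupp.single_eq_of_ne hgh, zero_add]
          exact hA h hh
      rw [add_comm m, genForm, SA.coeff_mono_mul _ hA', hmg, zero_add, Nat.cast_one, mul_one,
        ← mul_assoc, ← pow_add, ← two_mul, pow_mul]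
      simp
    · rw [SA.coeff_of_not _ hA, SA.coeff_of_not _ fun h => hA (h.of_le le_self_add), mul_zero]
  · rw [coeff_ofCS_of_apply_ne hg hmg, genForm, SA.coeff_mono_mul_eq_zero, mul_zero]
    intro b hb
    refine coeff_ofCS_of_apply_ne hg ?_ c
    rw [add_comm m] at hb
    rwa [add_left_cancel hb]

/-! ### Superfunctions without odd variables, odd superfunctions -/

theorem xiExp_empty : xiExp (∅ : Finset (Fin n)) ∅ = 0 := by simp [xiExp]

theorem ofCS_zero : (ofCS 0 : SA (Gen n)) = 0 := map_zero (ofCSHom n)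

theorem conj_zero' : CS.conj 0 = 0 := map_zero CS.conjHom

theorem toForm_of_noOdd {f : SuperFun n} {z : Fin n → ℂ} (h : ∀ μ, μ.Nonempty → f μ z = 0) :
    f.toForm z = ofCS (f ∅ z) := by
  rw [SuperFun.toForm, Finset.sum_eq_single ∅]
  · rw [xiExp_empty, SA.mono_zero, one_mul]
  · intro μ _ hμ
    rw [h μ (Finset.nonempty_iff_ne_empty.2 hμ), ofCS_zero, mul_zero]
  · simp

theorem conjForm_of_noOdd {f : SuperFun n} {z : Fin n → ℂ} (h : ∀ μ, μ.Nonempty → f μ z = 0) :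
    f.conjForm z = ofCS (CS.conj (f ∅ z)) := by
  rw [SuperFun.conjForm, Finset.sum_eq_single ∅]
  · rw [xiExp_empty, SA.mono_zero, one_mul]
  · intro μ _ hμ
    rw [h μ (Finset.nonempty_iff_ne_empty.2 hμ), conj_zero', ofCS_zero, mul_zero]
  · simp

theorem homog_toForm {f : SuperFun n} {z : Fin n → ℂ}
    (h : ∀ μ, (f μ z).IsEven ∧ (Even μ.card → f μ z = 0)) : SA.Homog 0 1 (f.toForm z) := by
  refine SA.homog_sum fun μ _ => ?_
  by_cases hμ : Even μ.card
  · rw [(h μ).2 hμ, ofCS_zero, mul_zero]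
    exact SA.homog_zero _ _
  · have h1 := (SA.homog_mono (xiExp μ ∅)).mul (homog_ofCS (n := n) (h μ).1.homog)
    rw [formDegree_xiExp, monoParity_xiExp] at h1
    have h2 : (μ.card : ZMod 2) = 1 := ZMod.natCast_eq_one_iff_odd.2 (Nat.not_even_iff_odd.1 hμ)
    simpa [h2] using h1

theorem SA.Homog.fil_one {G : Type} [LinearOrder G] [GradedGen G] {k : ZMod 2} {x : SA G}
    (hx : SA.Homog k 1 x) : SA.Fil 1 x := SA.fil_one_iff.2 (by
  by_contra h
  have := (hx 0 h).2
  simp [monoParity] at this)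

/-! ### The exponent -/

theorem DiffCoeffAt.sum {G : Type} [LinearOrder G] [GradedGen G] {ι : Type*} {s : Finset ι}
    {F : ι → (Fin n → ℂ) → SA G} {z : Fin n → ℂ} (hF : ∀ i, DiffCoeffAt (F i) z) :
    DiffCoeffAt (fun w => ∑ i ∈ s, F i w) z := fun m => by
  simp only [SA.coeff_sum]
  exact DifferentiableAt.fun_sum fun i _ => hF i m

theorem pderivZbar_sum {G : Type} [LinearOrder G] [GradedGen G] {ι : Type*} {s : Finset ι}
    {F : ι → (Fin n → ℂ) → SA G} {z : Fin n → ℂ} (hF : ∀ i, DiffCoeffAt (F i) z) (j : Fin n) :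
    pderivZbar j (fun w => ∑ i ∈ s, F i w) z = ∑ i ∈ s, pderivZbar j (F i) z := by
  classical
  induction s using Finset.induction_on with
  | empty => simpa using pderivZbar_const (0 : SA G) j z
  | insert a s ha ih =>
    simp only [Finset.sum_insert ha]
    rw [pderivZbar_add (hF a) (DiffCoeffAt.sum hF), ih]

theorem isEven_pderivZ {F : (Fin n → ℂ) → CS} {O : Set (Fin n → ℂ)} (hO : IsOpen O)
    (he : ∀ z ∈ O, (F z).IsEven) (j : Fin n) {z : Fin n → ℂ} (hz : z ∈ O) :
    CS.IsEven (pderivZ j F z) := fun m hm => by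
  have h : (fun w => (F w).coeff m) =ᶠ[𝓝 z] fun _ => (0 : ℂ) := by
    filter_upwards [hO.mem_nhds hz] with w hw using he w hw m hm
  change (fderiv ℝ (fun w => (F w).coeff m) z _ - _ * fderiv ℝ (fun w => (F w).coeff m) z _) / 2 = 0
  rw [h.fderiv_eq]
  simp

section Exponent

variable {O : Set (Fin n → ℂ)} {V : SuperVectorField n}

/-- The coefficients of the forms `∂̄ ḡ_l`. -/
def conjJac (V : SuperVectorField n) (z : Fin n → ℂ) : Fin n → Fin n → CS0 := fun l j =>
  CS.evenPart (CS.conj (pderivZ j (V.g l ∅) z))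

/-- The form `∑ f_i ḡ_i`. -/
def mixedForm (V : SuperVectorField n) (z : Fin n → ℂ) : SA (Gen n) :=
  ∑ i, (V.f i).toForm z * ofCS (CS.conj (V.g i ∅ z))

/-- The part of the exponent that is odd for the parity. -/
def oddForm (V : SuperVectorField n) (z : Fin n → ℂ) : SA (Gen n) :=
  ∑ i, theta n (conjJac V z i) * genForm (Gen.dxi i) + mixedForm V z

/-- Both parts have even form degree and odd parity. This is used through its consequence that the
square is zero. -/
theorem homog_oddForm {z : Fin n → ℂ} (hodd : V.IsOddOn O) (hz : z ∈ O) :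
    SA.Homog 0 1 (oddForm V z) := by
  refine SA.Homog.add (SA.homog_sum fun i _ => ?_) (SA.homog_sum fun i _ => ?_)
  · have := (homog_theta (conjJac V z i)).mul (homog_dxi i)
    rwa [show (1 : ZMod 2) + 1 = 0 by decide, zero_add] at this
  · have := (homog_toForm fun μ => (hodd i).1 z hz μ).mul
      (homog_ofCS (n := n) (((hodd i).2 z hz ∅).1.conj).homog)
    rwa [add_zero, add_zero] at this

/-- The exponent of the integrand. -/
theorem dbar_add_contract_omegaForm (hO : IsOpen O) (hhol : V.HolomorphicOn O)
    (hodd : V.IsOddOn O) (hg : ∀ i, (V.g i).NoOddVariablesOn O) {z : Fin n → ℂ} (hz : z ∈ O) :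
    dbar (omegaForm V) z + contract V (omegaForm V) z =
      ofCS (gaussExponent (fun i => V.g i ∅) z) +
        ∑ l, theta n (conjJac V z l) * genForm (Gen.dz l) + oddForm V z := by
  have hω : ∀ w ∈ O, omegaForm V w =
      ∑ l, (genForm (Gen.dz l) + genForm (Gen.dxi l)) * ofCS (CS.conj (V.g l ∅ w)) := by
    intro w hw
    rw [omegaForm, ← Finset.sum_add_distrib]
    refine Finset.sum_congr rfl fun l _ => ?_
    rw [conjForm_of_noOdd (hg l w hw), add_mul]
  have hsm : ∀ l, SmoothCoeffOn (V.g l ∅) O := fun l => ((hhol l).2 ∅).smooth hO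
  have hdiff : ∀ l, DiffCoeffAt (fun w => (ofCS (CS.conj (V.g l ∅ w)) : SA (Gen n))) z := fun l =>
    ((hsm l).conj.ofCS).diffCoeffAt hO hz
  have hcj : ∀ l j, (conjJac V z l j : CS) = CS.conj (pderivZ j (V.g l ∅) z) := fun l j =>
    CS.evenPart_of_isEven (isEven_pderivZ hO (fun w hw => ((hodd l).2 w hw ∅).1) j hz).conj
  have hd : ∀ i, pderivZbar i (omegaForm V) z =
      ∑ l, (genForm (Gen.dz l) + genForm (Gen.dxi l)) * ofCS (conjJac V z l i : CS) := by
    intro i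
    have hev : omegaForm V =ᶠ[𝓝 z] fun w =>
        ∑ l, (genForm (Gen.dz l) + genForm (Gen.dxi l)) * ofCS (CS.conj (V.g l ∅ w)) := by
      filter_upwards [hO.mem_nhds hz] with w hw using hω w hw
    have hconst : ∀ c : SA (Gen n), DiffCoeffAt (fun _ => c) z := fun c m =>
      differentiableAt_const _
    have hprod : ∀ l, DiffCoeffAt (fun w => (genForm (Gen.dz l) + genForm (Gen.dxi l)) *
        (ofCS (CS.conj (V.g l ∅ w)) : SA (Gen n))) z := fun l =>
      ((smoothCoeffOn_const _ O).mul (hsm l).conj.ofCS).diffCoeffAt hO hz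
    rw [pderivZbar_congr hev, pderivZbar_sum hprod]
    refine Finset.sum_congr rfl fun l _ => ?_
    rw [pderivZbar_mul (hconst _) (hdiff l), pderivZbar_const, zero_mul, zero_add,
      pderivZbar_ofCS, pderivZbar_conj ((hsm l).diffCoeffAt hO hz), hcj]
  -- The derivative `∂̄` turns `ḡ_l` into the one-form `θ_l`. The derivatives in `ξ̄` vanish because
  -- the `g_l` have no odd variables, and the contraction replaces `dz_j` by `f_j` and `dξ_j` by
  -- `g_j`.
  have h1 : ∑ i, genForm (Gen.dzbar i) * pderivZbar i (omegaForm V) z =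
      ∑ l, theta n (conjJac V z l) * (genForm (Gen.dz l) + genForm (Gen.dxi l)) := by
    simp only [hd, Finset.mul_sum, theta_apply, Finset.sum_mul]
    rw [Finset.sum_comm]
    refine Finset.sum_congr rfl fun l _ => Finset.sum_congr rfl fun i _ => ?_
    rw [CS0.smul_superform, (ofCS_commute (conjJac V z l i).2 _).eq, mul_assoc,
      (ofCS_commute (conjJac V z l i).2 _).eq]
  have h2 : ∀ j, (omegaForm V z).leftDeriv (Gen.xibar j) = 0 := by
    intro j
    rw [hω z hz, leftDeriv_sum]
    refine Finset.sum_eq_zero fun l _ => ?_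
    rw [add_mul, leftDeriv_add, leftDeriv_genForm_mul_ofCS_of_ne (by simp) (by simp),
      leftDeriv_genForm_mul_ofCS_of_ne (by simp) (by simp), add_zero]
  have h3 : ∀ j, (omegaForm V z).leftDeriv (Gen.dz j) = ofCS (CS.conj (V.g j ∅ z)) := by
    intro j
    rw [hω z hz, leftDeriv_sum, Finset.sum_eq_single j]
    · rw [add_mul, leftDeriv_add, leftDeriv_genForm_mul_ofCS_self (by simp),
        leftDeriv_genForm_mul_ofCS_of_ne (by simp) (by simp), add_zero]
    · intro l _ hl
      rw [add_mul, leftDeriv_add, leftDeriv_genForm_mul_ofCS_of_ne (by simp) (by simpa using hl.symm),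
        leftDeriv_genForm_mul_ofCS_of_ne (by simp) (by simp), add_zero]
    · simp
  have h4 : ∀ j, (omegaForm V z).leftDeriv (Gen.dxi j) = ofCS (CS.conj (V.g j ∅ z)) := by
    intro j
    rw [hω z hz, leftDeriv_sum, Finset.sum_eq_single j]
    · rw [add_mul, leftDeriv_add, leftDeriv_genForm_mul_ofCS_self (by simp),
        leftDeriv_genForm_mul_ofCS_of_ne (by simp) (by simp), zero_add]
    · intro l _ hl
      rw [add_mul, leftDeriv_add, leftDeriv_genForm_mul_ofCS_of_ne (by simp) (by simp),
        leftDeriv_genForm_mul_ofCS_of_ne (by simp) (by simpa using hl.symm), add_zero]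
    · simp
  have h5 : (ofCS (gaussExponent (fun i => V.g i ∅) z) : SA (Gen n)) =
      ∑ j, (V.g j).toForm z * ofCS (CS.conj (V.g j ∅ z)) := by
    rw [gaussExponent, ← ofCSHom_apply, map_sum]
    refine Finset.sum_congr rfl fun j _ => ?_
    rw [map_mul, ofCSHom_apply, ofCSHom_apply, toForm_of_noOdd (hg j z hz)]
  rw [dbar, contract, h1, h5, oddForm, mixedForm]
  simp only [h2, h3, h4, mul_zero, Finset.sum_const_zero, add_zero, mul_add, Finset.sum_add_distrib]
  abel

end Exponent

end

/-! ### The Berezinian at the point; smoothness and evaluation of the coefficients. -/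

section

variable {n : ℕ}

/-! ### Values at a point of superspace -/

theorem bodyPt_surjective : Function.Surjective (SuperPoint.bodyPt : SuperPoint n → Fin n → ℂ) :=
  fun c => ⟨⟨fun i => algebraMap ℂ CS (c i), fun _ => 0, fun i => CS.isEven_algebraMap (c i),
    fun _ _ _ => rfl⟩, funext fun i => by
      change (algebraMap ℂ CS (c i)).coeff 0 = c i
      rw [SA.coeff_algebraMap, if_pos rfl]⟩

theorem IsDeWittOpen.isOpen_bodySet {W : Set (SuperPoint n)} (hW : IsDeWittOpen W) :
    IsOpen (bodySet W) := by
  obtain ⟨O, hO, rfl⟩ := hW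
  rwa [bodySet, Set.image_preimage_eq _ bodyPt_surjective]

section Eval

variable {O : Set (Fin n → ℂ)} {p : SuperPoint n}

theorem grassmannExt_eq_zero (hO : IsOpen O) (hp : p.bodyPt ∈ O) {F : (Fin n → ℂ) → CS}
    (hF : ∀ z ∈ O, F z = 0) : grassmannExt F p = 0 := by
  rw [grassmannExt_congr (H := fun _ => 0), grassmannExt_const]
  filter_upwards [hO.mem_nhds hp] with z hz using hF z hz

theorem SuperFun.eval_of_noOdd (hO : IsOpen O) (hp : p.bodyPt ∈ O) {f : SuperFun n}
    (hf : f.NoOddVariablesOn O) : f.eval p = grassmannExt (f ∅) p := by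
  rw [SuperFun.eval, Finset.sum_eq_single ∅]
  · simp [SuperPoint.xiProd]
  · intro μ _ hμ
    rw [grassmannExt_eq_zero hO hp fun z hz => hf z hz μ (Finset.nonempty_iff_ne_empty.2 hμ),
      mul_zero]
  · simp

theorem SuperFun.NoOddVariablesOn.dz (hO : IsOpen O) {f : SuperFun n}
    (hf : f.NoOddVariablesOn O) (j : Fin n) : (f.dz j).NoOddVariablesOn O := fun z hz μ hμ => by
  rw [SuperFun.dz, pderivZ_congr (H := fun _ => 0), pderivZ_const]
  filter_upwards [hO.mem_nhds hz] with w hw using hf w hw μ hμ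

theorem SuperFun.eval_dxi_of_noOdd (hO : IsOpen O) (hp : p.bodyPt ∈ O) {f : SuperFun n}
    (hf : f.NoOddVariablesOn O) (j : Fin n) : (f.dxi j).eval p = 0 := by
  refine Finset.sum_eq_zero fun μ _ => ?_
  rw [grassmannExt_eq_zero hO hp, mul_zero]
  intro z hz
  rw [SuperFun.dxi, hf z hz _ (Finset.insert_nonempty j μ), mul_zero, ite_self]

variable {V : SuperVectorField n}

theorem evenDet_blockA (hO : IsOpen O) (hp : p.bodyPt ∈ O)
    (hg : ∀ i, (V.g i).NoOddVariablesOn O) :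
    evenDet (V.blockA p) = jacDet (fun i => V.g i ∅) p := by
  -- Rows of `blockA` are indexed by the variables, rows of the Jacobian in `jacDet` by the
  -- functions.
  rw [evenDet, jacDet, ← Matrix.det_transpose]
  congr 1
  ext1 i j
  change CS.evenPart (((V.g i).dz j).eval p) = _
  rw [SuperFun.eval_of_noOdd hO hp ((hg i).dz hO j)]
  rfl

/-- The `g_i` do not involve the `ξ_l`, so block `C` is zero and the Berezinian reduces to `det A /
det D`. -/
theorem ber_mul_detD (hO : IsOpen O) (hp : p.bodyPt ∈ O)
    (hg : ∀ i, (V.g i).NoOddVariablesOn O) (hD : body (V.detD p : CS) ≠ 0) :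
    V.ber p * V.detD p = jacDet (fun i => V.g i ∅) p := by
  have hC : V.blockC p = 0 := by
    ext1 l i
    exact SuperFun.eval_dxi_of_noOdd hO hp (hg i) l
  rw [SuperVectorField.ber, sdet, hC, mul_zero, sub_zero, ← SuperVectorField.detD, mul_assoc,
    Ring.inverse_mul_cancel _ (CS0.isUnit_of_body_ne_zero hD), mul_one, evenDet_blockA hO hp hg]

end Eval

/-! ### Smoothness of the coefficients of the integrand -/

section Smooth

variable {O : Set (Fin n → ℂ)} {V : SuperVectorField n}

theorem coe_conjJac (hO : IsOpen O) (hodd : V.IsOddOn O) {z : Fin n → ℂ} (hz : z ∈ O)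
    (l j : Fin n) : (conjJac V z l j : CS) = CS.conj (pderivZ j (V.g l ∅) z) :=
  CS.evenPart_of_isEven (isEven_pderivZ hO (fun w hw => ((hodd l).2 w hw ∅).1) j hz).conj

theorem smoothCoeffOn_conjJac (hO : IsOpen O) (hhol : V.HolomorphicOn O) (hodd : V.IsOddOn O)
    (l j : Fin n) : SmoothCoeffOn (fun z => (conjJac V z l j : CS)) O :=
  ((((hhol l).2 ∅).smooth hO).pderivZ hO j).conj.congr fun _ hz => coe_conjJac hO hodd hz l j

theorem smoothCoeffOn_theta (hO : IsOpen O) (hhol : V.HolomorphicOn O) (hodd : V.IsOddOn O)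
    (l : Fin n) : SmoothCoeffOn (fun z => theta n (conjJac V z l)) O := by
  simp only [theta_apply, CS0.smul_superform]
  exact smoothCoeffOn_sum fun j _ =>
    (smoothCoeffOn_conjJac hO hhol hodd l j).ofCS.mul (smoothCoeffOn_const _ O)

theorem smoothCoeffOn_thetaProd (hO : IsOpen O) (hhol : V.HolomorphicOn O) (hodd : V.IsOddOn O)
    (S : Finset (Fin n)) : SmoothCoeffOn (fun z => thetaProd (conjJac V z) S) O := by
  induction S using Finset.induction_on with
  | empty => exact smoothCoeffOn_const _ O
  | insert l S hl ih =>
    simp only [thetaProd_erase _ (Finset.mem_insert_self l S), Finset.erase_insert hl]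
    exact ih.mul ((smoothCoeffOn_theta hO hhol hodd l).mul (smoothCoeffOn_const _ O))

theorem smoothCoeffOn_toForm {f : SuperFun n} (hO : IsOpen O) (hf : f.HolomorphicOn O) :
    SmoothCoeffOn f.toForm O :=
  smoothCoeffOn_sum fun μ _ => (smoothCoeffOn_const _ O).mul ((hf μ).smooth hO).ofCS

theorem smoothCoeffOn_oddForm (hO : IsOpen O) (hhol : V.HolomorphicOn O) (hodd : V.IsOddOn O) :
    SmoothCoeffOn (oddForm V) O :=
  (smoothCoeffOn_sum fun i _ => (smoothCoeffOn_theta hO hhol hodd i).mul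
    (smoothCoeffOn_const _ O)).add (smoothCoeffOn_sum fun i _ =>
      (smoothCoeffOn_toForm hO (hhol i).1).mul (((hhol i).2 ∅).smooth hO).conj.ofCS)

open SmoothEven in
-- Near a given point the determinant is an element of the ring of smooth even functions. Its
-- smoothness and its value at a superpoint are then read off from ring homomorphisms.
theorem exists_det_conjJac_eq (hO : IsOpen O) (hhol : V.HolomorphicOn O) (hodd : V.IsOddOn O)
    {P : Fin n → ℂ} (hP : P ∈ O) : ∃ G : Fin n → SmoothEven n,
      (∀ i, (G i).fn =ᶠ[𝓝 P] V.g i ∅) ∧ (fun z => ((Matrix.of (conjJac V z)).det : CS)) =ᶠ[𝓝 P]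
        (SmoothEven.conj (jac G).det).fn := by
  choose G hG using fun i => exists_global_even hO hP (((hhol i).2 ∅).smooth hO)
    fun z hz => ((hodd i).2 z hz ∅).1
  refine ⟨G, hG, ?_⟩
  filter_upwards [eventually_eventually_nhds.2 (Filter.eventually_all.2 hG), hO.mem_nhds hP]
    with z hz hzO
  rw [fn_conj]
  change _ = CS.conj (evalHom z (jac G).det : CS)
  rw [← CS0.coe_conjHom, RingHom.map_det, RingHom.map_det]
  congr 2
  ext1 l j
  refine Subtype.ext ?_
  change (conjJac V z l j : CS) = CS.conj ((SmoothEven.dz j (G l)).fn z)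
  rw [coe_conjJac hO hodd hzO, fn_dz, pderivZ_congr (hz.mono fun w hw => hw l)]

theorem smoothCoeffOn_det (hO : IsOpen O) (hhol : V.HolomorphicOn O) (hodd : V.IsOddOn O) :
    SmoothCoeffOn (fun z => ((Matrix.of (conjJac V z)).det : CS)) O := fun m z hz => by
  obtain ⟨G, -, hG⟩ := exists_det_conjJac_eq hO hhol hodd hz
  refine ContDiffAt.contDiffWithinAt ?_
  refine ((contDiffOn_univ.1 ((SmoothEven.conj (SmoothEven.jac G).det).smooth m)).contDiffAt
    (x := z)).congr_of_eventuallyEq ?_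
  filter_upwards [hG] with w hw
  simp only [← hw]

theorem grassmannExt_det (hO : IsOpen O) (hhol : V.HolomorphicOn O) (hodd : V.IsOddOn O)
    {p : SuperPoint n} (hp : p.bodyPt ∈ O) :
    grassmannExt (fun z => ((Matrix.of (conjJac V z)).det : CS)) p =
      (CS0.conjHom (jacDet (fun i => V.g i ∅) p) : CS) := by
  obtain ⟨G, hG, hG'⟩ := exists_det_conjJac_eq hO hhol hodd hp
  rw [grassmannExt_congr hG', ← extHom_jac_det hG, ← SmoothEven.extHom_conj]
  rfl

end Smooth

/-! ### The top coefficients -/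

section Coefficients

variable {V : SuperVectorField n} {z : Fin n → ℂ} (x : SA (Gen n))

theorem coefAt_mul_thetaProd_univ (hn : 0 < n) (r : Fin n → Fin n → CS0) :
    coefAt (fullExp n) (x * thetaProd r Finset.univ) = (-1 : ℂ) ^ (n * (n + 1) / 2) •
      (coefAt (exp00 n + xiExp Finset.univ Finset.univ) x * ((Matrix.of r).det : CS)) := by
  rw [thetaProd_univ hn, mul_smul_comm, coefAt_smul_even betaFree_fullExp,
    coefAt_mul_pairProd_univ, smul_mul_assoc]

/-- This term would carry `t^{-n-1}` and spoil the limit. The part with `θ_i dξ_i` vanishes since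
`θ_i` already occurs in the product. The part with `f_k` contains `ξ_μ` with `|μ|` odd, and needs a
coefficient of `x` whose `ξ`-degree has the wrong parity. -/
theorem coefAt_mul_thetaProd_univ_mul_oddForm (hn : 0 < n)
    (hx : ∀ μ lam : Finset (Fin n), ¬ μ.card ≡ n [MOD 2] → coefAt (exp00 n + xiExp μ lam) x = 0)
    (hf : ∀ i μ, Even μ.card → V.f i μ z = 0) :
    coefAt (fullExp n) (x * (thetaProd (conjJac V z) Finset.univ * oddForm V z)) = 0 := by
  have h1 : thetaProd (conjJac V z) Finset.univ *
      ∑ i, theta n (conjJac V z i) * genForm (Gen.dxi i) = 0 := by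
    rw [Finset.mul_sum]
    refine Finset.sum_eq_zero fun i _ => ?_
    rw [← mul_assoc, thetaProd_univ_mul_theta, zero_mul]
  rw [oddForm, mul_add, h1, zero_add, mixedForm, Finset.mul_sum, Finset.mul_sum, coefAt_sum]
  refine Finset.sum_eq_zero fun k _ => ?_
  rw [← mul_assoc, ← mul_assoc, coefAt_mul_ofCS betaFree_fullExp, SuperFun.toForm, Finset.mul_sum,
    coefAt_sum, Finset.sum_mul]
  refine Finset.sum_eq_zero fun μ _ => ?_
  rw [← mul_assoc, coefAt_mul_ofCS betaFree_fullExp, thetaProd_univ hn, mul_smul_comm,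
    smul_mul_assoc, coefAt_smul_even betaFree_fullExp]
  by_cases hμ : Even μ.card
  · rw [hf k μ hμ, mul_zero, zero_mul]
  · rw [coefAt_mul_pairProd_mul_mono_xi, zero_mul, zero_mul, zero_mul]
    refine hx _ _ fun h => hμ ?_
    have hc : μ.card + μᶜ.card = n := by rw [Finset.card_add_card_compl, Fintype.card_fin]
    unfold Nat.ModEq at h
    rw [Nat.even_iff]
    omega

/-- Of the `θ_k dξ_k` only the one with the omitted index survives, and it completes the
determinant. The terms with `f_k` are kept with their factor `ḡ_k`, which vanishes at `p`. -/
theorem coefAt_mul_thetaProd_erase_mul_oddForm (i : Fin n) :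
    coefAt (fullExp n) (x * (thetaProd (conjJac V z) (Finset.univ.erase i) * oddForm V z)) =
      coefAt (fullExp n) (x * (pairProd (Finset.univ.erase i) * genForm (Gen.dzbar i) *
        genForm (Gen.dxi i))) * ((Matrix.of (conjJac V z)).det : CS) +
      ∑ k, coefAt (fullExp n) (x * (thetaProd (conjJac V z) (Finset.univ.erase i) *
        (V.f k).toForm z)) * CS.conj (V.g k ∅ z) := by
  have h1 : thetaProd (conjJac V z) (Finset.univ.erase i) *
      ∑ k, theta n (conjJac V z k) * genForm (Gen.dxi k) = (Matrix.of (conjJac V z)).det •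
        (pairProd (Finset.univ.erase i) * genForm (Gen.dzbar i) * genForm (Gen.dxi i)) := by
    rw [Finset.mul_sum, Finset.sum_eq_single i]
    · rw [← mul_assoc, thetaProd_erase_mul_theta, smul_mul_assoc]
    · intro k _ hk
      rw [← mul_assoc, thetaProd_mul_theta (Finset.mem_erase.2 ⟨hk, Finset.mem_univ k⟩) rfl, zero_mul]
    · simp
  rw [oddForm, mul_add, h1, mul_add, coefAt_add, mul_smul_comm, coefAt_smul_even betaFree_fullExp,
    mixedForm, Finset.mul_sum, Finset.mul_sum, coefAt_sum]
  congr 1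
  refine Finset.sum_congr rfl fun k _ => ?_
  rw [← mul_assoc, ← mul_assoc, coefAt_mul_ofCS betaFree_fullExp, mul_assoc]

/-- The factor `(-1) ^ m.degree` is common to all `i`, so evenness is needed only for the sum: where
the factor is `-1`, the coefficient of the sum is zero. -/
theorem sum_coefAt_mul_pairProd_mul_dxi
    (hx : CS.IsEven (∑ i, coefAt (exp10 i + xiExp Finset.univ Finset.univ) x)) :
    ∑ i, coefAt (fullExp n) (x * (pairProd (Finset.univ.erase i) * genForm (Gen.dzbar i) *
        genForm (Gen.dxi i))) = (-1 : ℂ) ^ (n * (n + 1) / 2) •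
      ∑ i, coefAt (exp10 i + xiExp Finset.univ Finset.univ) x := by
  ext m
  simp only [SA.coeff_sum, coeff_coefAt_mul_pairProd_mul_dxi, SA.coeff_smul]
  rw [← Finset.mul_sum, ← SA.coeff_sum]
  by_cases hm : Even m.degree
  · rw [pow_add, hm.neg_one_pow, mul_one]
  · rw [hx m (Nat.not_even_iff_odd.1 hm), mul_zero, mul_zero]

end Coefficients

end

/-! ### The limit `t → 0` of the expanded integrand. -/

section

variable {n : ℕ}

open MeasureTheory

/-! ### The integrand -/

theorem coefAt_mul_exp {Q : CS} (hQ : Q.IsEven) (r : Fin n → Fin n → CS0) {Ψ : SA (Gen n)}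
    (hΨ : SA.Homog 0 1 Ψ) (a : ℂ) {M : Gen n →₀ ℕ} (hM : BetaFree M) (x : SA (Gen n)) :
    coefAt M (x * SA.exp (-(a • (ofCS Q + ∑ l, theta n (r l) * genForm (Gen.dz l) + Ψ)))) =
      ∑ S : Finset (Fin n), ((-a) ^ S.card • (coefAt M (x * thetaProd r S) * SA.exp (-(a • Q))) +
        (-a) ^ (S.card + 1) • (coefAt M (x * (thetaProd r S * Ψ)) * SA.exp (-(a • Q)))) := by
  have hE : CS.IsEven (SA.exp (-(a • Q))) := CS.IsEven.exp (CS0.neg_mem (hQ.smul a))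
  rw [exp_neg_smul_eq hQ r hΨ hΨ.fil_one, (ofCS_commute hE _).eq, ← mul_assoc,
    coefAt_mul_ofCS hM, Finset.mul_sum, coefAt_sum, Finset.sum_mul]
  refine Finset.sum_congr rfl fun S _ => ?_
  have h : x * (-a) ^ S.card • (thetaProd r S * (1 - a • Ψ)) =
      (-a) ^ S.card • (x * thetaProd r S) + (-a) ^ (S.card + 1) • (x * (thetaProd r S * Ψ)) := by
    rw [mul_sub, mul_one, mul_smul_comm, mul_smul_comm, mul_sub, mul_smul_comm, pow_succ]
    module
  rw [h, coefAt_add, coefAt_smul, coefAt_smul, add_mul, smul_mul_assoc, smul_mul_assoc]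

/-! ### The limit -/

section Limit

variable {O : Set (Fin n → ℂ)} (hO : IsOpen O) {g : Fin n → (Fin n → ℂ) → CS}
  (hg : ∀ i, HolomorphicCoeffOn (g i) O) (he : ∀ i, ∀ z ∈ O, (g i z).IsEven) {p : SuperPoint n}
  (h0 : ∀ i, grassmannExt (g i) p = 0) (hdet : body (jacDet g p : CS) ≠ 0) {ε : ℝ} (hε : 0 < ε)
  (hball : bodyClosedBall p.bodyPt ε ⊆ O)
  (hzero : ∀ z ∈ bodyClosedBall p.bodyPt ε, z ≠ p.bodyPt → ∃ i, body (g i z) ≠ 0)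

theorem CS0.body_conjHom_ne_zero {x : CS0} (hx : body (x : CS) ≠ 0) :
    body (CS0.conjHom x : CS) ≠ 0 := fun h =>
  hx ((map_eq_zero (starRingEnd ℂ)).1 h)

theorem isUnit_jacDet_mul_conj {x : CS0} (hx : body (x : CS) ≠ 0) : IsUnit (x * CS0.conjHom x) :=
  (CS0.isUnit_of_body_ne_zero hx).mul (CS0.isUnit_of_body_ne_zero (CS0.body_conjHom_ne_zero hx))

include hO hg he h0 hdet hε hball hzero

/-- The contribution of a coefficient that is multiplied by a power of `1/t` of exponent at most
`n`: only the exponent `n` matters. -/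
theorem tendsto_pow_mul_gaussian {h : (Fin n → ℂ) → CS} (hh : SmoothCoeffOn h O) {k : ℕ}
    (hk : k ≤ n) (m : ℕ →₀ ℕ) :
    Filter.Tendsto (fun t : ℝ => (-(t : ℂ)⁻¹) ^ k * ∫ z in bodyBall p.bodyPt ε,
        (h z * SA.exp (-((t : ℂ)⁻¹ • gaussExponent g z))).coeff m) (𝓝[>] 0)
      (𝓝 (if k = n then (-1) ^ n * ((Real.pi : ℂ) ^ n * (grassmannExt h p *
        (Ring.inverse (jacDet g p * CS0.conjHom (jacDet g p)) : CS0)).coeff m) else 0)) := by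
  have hR : grassmannExt h p = grassmannExt h p *
      (Ring.inverse (jacDet g p * CS0.conjHom (jacDet g p)) : CS0) *
        (jacDet g p * CS0.conjHom (jacDet g p) : CS0) := by
    rw [mul_assoc, ← Subring.coe_mul, Ring.inverse_mul_cancel _ (isUnit_jacDet_mul_conj hdet),
      Subring.coe_one, mul_one]
  have hmain := tendsto_gaussian_bodyBall hO hg he h0 hdet hε hball hzero hh hR m
  have hcast : Filter.Tendsto (fun t : ℝ => (t : ℂ)) (𝓝[>] 0) (𝓝 0) := by
    have := (Complex.continuous_ofReal.tendsto 0).mono_left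
      (nhdsWithin_le_nhds (s := Set.Ioi (0 : ℝ)))
    simpa using this
  -- Relative to the normalization `t^(-n)` there remains `t^(n - k)`, which tends to zero unless `k
  -- = n`.
  have hpow : Filter.Tendsto (fun t : ℝ => (-1 : ℂ) ^ k * (t : ℂ) ^ (n - k)) (𝓝[>] 0)
      (𝓝 (if k = n then (-1) ^ n else 0)) := by
    have h1 := (hcast.pow (n - k)).const_mul ((-1 : ℂ) ^ k)
    convert h1 using 2
    split_ifs with hkn
    · simp [hkn]
    · rw [zero_pow (by omega), mul_zero]
  have h2 := hpow.mul hmain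
  rw [ite_mul, zero_mul] at h2
  refine h2.congr' ?_
  filter_upwards [self_mem_nhdsWithin] with t ht
  have ht0 : (t : ℂ) ≠ 0 := by exact_mod_cast (ne_of_gt ht)
  rw [← mul_assoc]
  congr 1
  have hn : (t : ℂ) ^ n = (t : ℂ) ^ (n - k) * (t : ℂ) ^ k := by
    rw [← pow_add, Nat.sub_add_cancel hk]
  rw [neg_pow (t : ℂ)⁻¹, inv_pow, mul_assoc, hn]
  congr 1
  field_simp

/-- Only the coefficients of `t^{-n}` contribute to the limit. -/
theorem tendsto_sum_gaussian {a b : Finset (Fin n) → (Fin n → ℂ) → CS}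
    (ha : ∀ S, SmoothCoeffOn (a S) O) (hb : ∀ S, SmoothCoeffOn (b S) O)
    (hb0 : ∀ z ∈ O, b Finset.univ z = 0) (m : ℕ →₀ ℕ) :
    Filter.Tendsto (fun t : ℝ => ∫ z in bodyBall p.bodyPt ε, (∑ S,
        ((-(t : ℂ)⁻¹) ^ S.card • (a S z * SA.exp (-((t : ℂ)⁻¹ • gaussExponent g z))) +
        (-(t : ℂ)⁻¹) ^ (S.card + 1) •
          (b S z * SA.exp (-((t : ℂ)⁻¹ • gaussExponent g z))))).coeff m) (𝓝[>] 0)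
      (𝓝 ((-1) ^ n * ((Real.pi : ℂ) ^ n * ((grassmannExt (a Finset.univ) p +
        ∑ i, grassmannExt (b (Finset.univ.erase i)) p) *
        (Ring.inverse (jacDet g p * CS0.conjHom (jacDet g p)) : CS0)).coeff m))) := by
  classical
  set K : CS := ((Ring.inverse (jacDet g p * CS0.conjHom (jacDet g p)) : CS0) : CS) with hK
  have hcomp := isCompact_bodyClosedBall p.bodyPt hε
  have hQ := smoothCoeffOn_gaussExponent fun i => (hg i).smooth hO
  have hsub := bodyBall_subset p.bodyPt ε
  have h1 := tendsto_finsetSum Finset.univ fun S _ => tendsto_pow_mul_gaussian hO hg he h0 hdet hε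
    hball hzero (ha S) ((Finset.card_le_univ S).trans_eq (Fintype.card_fin n)) m
  -- For the full set the exponent `n + 1` is beyond reach of the Gaussian asymptotics; there the
  -- coefficient is zero by `hb0`.
  have hbS : ∀ S, Filter.Tendsto (fun t : ℝ => (-(t : ℂ)⁻¹) ^ (S.card + 1) *
      ∫ z in bodyBall p.bodyPt ε, (b S z * SA.exp (-((t : ℂ)⁻¹ • gaussExponent g z))).coeff m)
      (𝓝[>] 0) (𝓝 (if S.card + 1 = n then
        (-1) ^ n * ((Real.pi : ℂ) ^ n * (grassmannExt (b S) p * K).coeff m) else 0)) := by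
    intro S
    by_cases hS : S = Finset.univ
    · subst hS
      rw [if_neg (by rw [Finset.card_univ, Fintype.card_fin]; omega)]
      refine tendsto_const_nhds.congr fun t => ?_
      rw [setIntegral_eq_zero_of_forall_eq_zero, mul_zero]
      intro z hz
      rw [hb0 z (hball (hsub hz)), zero_mul, SA.coeff_zero]
    · refine tendsto_pow_mul_gaussian hO hg he h0 hdet hε hball hzero (hb S) ?_ m
      have := Finset.card_lt_univ_of_notMem (s := S) (x := _)
        (Classical.not_forall.1 fun h => hS (Finset.eq_univ_of_forall h)).choose_spec
      rwa [Fintype.card_fin] at this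
  have h2 := h1.add (tendsto_finsetSum Finset.univ fun S _ => hbS S)
  convert h2.congr fun t => ?_ using 2
  · rw [Finset.sum_eq_single_of_mem Finset.univ (Finset.mem_univ _), if_pos (by simp), add_mul,
      SA.coeff_add, mul_add, mul_add]
    · congr 1
      rw [Finset.sum_mul, SA.coeff_sum, Finset.mul_sum, Finset.mul_sum]
      -- The sets with `n - 1` elements are the complements of single indices.
      refine Finset.sum_of_injOn (fun i => Finset.univ.erase i) ?_ ?_ ?_ ?_
      · intro i _ j _ hij
        by_contra hne
        have : j ∈ Finset.univ.erase j := by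
          rw [← show Finset.univ.erase i = Finset.univ.erase j from hij]
          exact Finset.mem_erase.2 ⟨Ne.symm hne, Finset.mem_univ j⟩
        exact Finset.notMem_erase j _ this
      · intro i _
        exact Finset.mem_coe.2 (Finset.mem_univ _)
      · intro S _ hS
        rw [if_neg]
        intro hc
        have h3 := Finset.card_add_card_compl S
        rw [Fintype.card_fin] at h3
        obtain ⟨i, hi⟩ := Finset.card_eq_one.1 (show Sᶜ.card = 1 by omega)
        refine hS ⟨i, Finset.mem_coe.2 (Finset.mem_univ i), ?_⟩
        change Finset.univ.erase i = S
        rw [← compl_compl S, hi, Finset.compl_singleton]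
      · intro i _
        rw [if_pos]
        rw [Finset.card_erase_of_mem (Finset.mem_univ i), Finset.card_univ, Fintype.card_fin]
        have := i.pos
        omega
    · intro S _ hS
      rw [if_neg]
      intro hc
      exact hS ((Finset.card_eq_iff_eq_univ S).1 (by rw [hc, Fintype.card_fin]))
  · simp only [SA.coeff_sum, SA.coeff_add, SA.coeff_smul]
    have hia := fun S => (integrableOn_coeff_mul_exp hcomp hball hsub hQ (ha S) t m).const_mul
      ((-(t : ℂ)⁻¹) ^ S.card)
    have hib := fun S => (integrableOn_coeff_mul_exp hcomp hball hsub hQ (hb S) t m).const_mul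
      ((-(t : ℂ)⁻¹) ^ (S.card + 1))
    rw [← Finset.sum_add_distrib]
    refine Eq.trans ?_ (integral_finsetSum _ fun S _ => (hia S).add (hib S)).symm
    refine Finset.sum_congr rfl fun S _ => Eq.symm ?_
    simp only [Pi.add_apply]
    rw [integral_add (hia S) (hib S), integral_const_mul, integral_const_mul]

end Limit

/-- The factors come from the Berezin normalization, from `(-1/t)^n`, from the Gaussian integral,
and from sorting the `dz̄_l dz_l`. Modulo `2` the two triangular numbers differ by `n`, which
cancels `(-1)^n`. -/
theorem berezin_sign (hn : 0 < n) :
    (-1 : ℂ) ^ (n * (n - 1) / 2) * (-2 * Complex.I) ^ n *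
      ((-1) ^ n * ((Real.pi : ℂ) ^ n * (-1) ^ (n * (n + 1) / 2))) =
      (2 * (Real.pi : ℂ) / Complex.I) ^ n := by
  obtain ⟨c, rfl⟩ := Nat.exists_eq_add_of_lt hn
  rw [zero_add, triangular_eq_add (c := c) rfl, Nat.add_sub_cancel, mul_comm (c + 1) c,
    show 2 * (Real.pi : ℂ) / Complex.I = -2 * Complex.I * Real.pi by
      rw [div_eq_mul_inv, Complex.inv_I]; ring, mul_pow, pow_add _ (c * (c + 1) / 2)]
  have h1 : ((-1 : ℂ) ^ (c * (c + 1) / 2)) * (-1) ^ (c * (c + 1) / 2) = 1 := by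
    rw [← mul_pow]; simp
  have h2 : ((-1 : ℂ) ^ (c + 1)) * (-1) ^ (c + 1) = 1 := by
    rw [← mul_pow]; simp
  linear_combination (-2 * Complex.I) ^ (c + 1) * (Real.pi : ℂ) ^ (c + 1) *
    ((-1) ^ (c + 1) * (-1) ^ (c + 1) * h1 + h2)

theorem SA.tendsto_of_coeff {ι : Type*} {l : Filter ι} {f : ι → CS} {x : CS}
    (h : ∀ m, Filter.Tendsto (fun i => (f i).coeff m) l (𝓝 (x.coeff m))) :
    Filter.Tendsto f l (𝓝 x) :=
  tendsto_subtype_rng.2 (tendsto_pi_nhds.2 h)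

end

/-! ### The residue formula. -/

section

variable {n : ℕ}

/-! ### The residue -/

section Residue

variable {O : Set (Fin n → ℂ)} {V : SuperVectorField n} {p : SuperPoint n} {η : SuperForm n}

section Coefficients

variable (hn : 0 < n) (hO : IsOpen O) (hVhol : V.HolomorphicOn O) (hVodd : V.IsOddOn O)
  (hpO : p.bodyPt ∈ O) (h0 : ∀ i, grassmannExt (V.g i ∅) p = 0) (hη : SmoothCoeffOn η O)

include hn hO hVhol hVodd hpO hη

theorem grassmannExt_coefAt_mul_thetaProd_univ :
    grassmannExt (fun z => coefAt (fullExp n) (η z * thetaProd (conjJac V z) Finset.univ)) p =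
      (-1 : ℂ) ^ (n * (n + 1) / 2) • (grassmannExt (eta00 η Finset.univ Finset.univ) p *
        (CS0.conjHom (jacDet (fun i => V.g i ∅) p) : CS)) := by
  have hdet := smoothCoeffOn_det hO hVhol hVodd
  have hs : SmoothCoeffOn (eta00 η Finset.univ Finset.univ) O := hη.coefAt _
  simp only [coefAt_mul_thetaProd_univ _ hn]
  rw [← grassmannExt_det hO hVhol hVodd hpO, ← grassmannExt_mul_of_mem hO hpO hs hdet,
    ← grassmannExt_smul_of_mem _ hO hpO (hs.mul hdet)]
  rfl

-- Each index contributes the same factor `conj(det A)`, so the sum over `i` assembles the starred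
-- coefficient. The Taylor extension is multiplicative and respects conjugation, so the terms with
-- `ḡ_k` vanish at `p` including its soul.
include h0 in
theorem sum_grassmannExt_coefAt_mul_oddForm
    (hstar : ∀ z ∈ O, (etaStar η Finset.univ Finset.univ z).IsEven) :
    ∑ i, grassmannExt (fun z => coefAt (fullExp n)
        (η z * (thetaProd (conjJac V z) (Finset.univ.erase i) * oddForm V z))) p =
      (-1 : ℂ) ^ (n * (n + 1) / 2) • (grassmannExt (etaStar η Finset.univ Finset.univ) p *
        (CS0.conjHom (jacDet (fun i => V.g i ∅) p) : CS)) := by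
  have hdet := smoothCoeffOn_det hO hVhol hVodd
  have hs : SmoothCoeffOn (etaStar η Finset.univ Finset.univ) O :=
    smoothCoeffOn_sum fun j _ => hη.coefAt _
  have hgs : ∀ k, SmoothCoeffOn (fun z => CS.conj (V.g k ∅ z)) O := fun k =>
    (((hVhol k).2 ∅).smooth hO).conj
  have hd : ∀ i, SmoothCoeffOn (fun z => coefAt (fullExp n) (η z *
      (pairProd (Finset.univ.erase i) * genForm (Gen.dzbar i) * genForm (Gen.dxi i)))) O :=
    fun i => (hη.mul (smoothCoeffOn_const _ O)).coefAt _
  have hm : ∀ i k, SmoothCoeffOn (fun z => coefAt (fullExp n) (η z *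
      (thetaProd (conjJac V z) (Finset.univ.erase i) * (V.f k).toForm z))) O := fun i k =>
    (hη.mul ((smoothCoeffOn_thetaProd hO hVhol hVodd _).mul
      (smoothCoeffOn_toForm hO (hVhol k).1))).coefAt _
  have hterm : ∀ i, grassmannExt (fun z => coefAt (fullExp n)
        (η z * (thetaProd (conjJac V z) (Finset.univ.erase i) * oddForm V z))) p =
      grassmannExt (fun z => coefAt (fullExp n) (η z * (pairProd (Finset.univ.erase i) *
        genForm (Gen.dzbar i) * genForm (Gen.dxi i)))) p *
        (CS0.conjHom (jacDet (fun i => V.g i ∅) p) : CS) := by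
    intro i
    simp only [coefAt_mul_thetaProd_erase_mul_oddForm]
    rw [grassmannExt_add_of_mem hO hpO ((hd i).mul hdet)
        (smoothCoeffOn_sum fun k _ => (hm i k).mul (hgs k)),
      grassmannExt_mul_of_mem hO hpO (hd i) hdet, grassmannExt_det hO hVhol hVodd hpO,
      grassmannExt_sum_of_mem _ hO hpO fun k => (hm i k).mul (hgs k), Finset.sum_eq_zero, add_zero]
    intro k _
    rw [grassmannExt_mul_of_mem hO hpO (hm i k) (hgs k),
      grassmannExt_conj_of_mem hO hpO (((hVhol k).2 ∅).smooth hO), h0, conj_zero', mul_zero]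
  rw [Finset.sum_congr rfl fun i _ => hterm i, ← Finset.sum_mul, ← smul_mul_assoc]
  congr 1
  rw [← grassmannExt_sum_of_mem _ hO hpO hd, ← grassmannExt_smul_of_mem _ hO hpO hs]
  refine grassmannExt_congr ?_
  filter_upwards [hO.mem_nhds hpO] with z hz
  exact sum_coefAt_mul_pairProd_mul_dxi (η z) (hstar z hz)

end Coefficients

/-- The residue formula with the determinant of the Jacobian of the `g_i` in the denominator. -/
theorem hasResidue_jacDet (hn : 0 < n) (hO : IsOpen O) (hVhol : V.HolomorphicOn O)
    (hVodd : V.IsOddOn O) (hg : ∀ i, (V.g i).NoOddVariablesOn O)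
    (h0 : ∀ i, grassmannExt (V.g i ∅) p = 0)
    (hdet : body (jacDet (fun i => V.g i ∅) p : CS) ≠ 0) (hη : SmoothCoeffOn η O)
    (hpar00 : ∀ z ∈ O, ∀ μ lam : Finset (Fin n), ¬ μ.card ≡ n [MOD 2] → eta00 η μ lam z = 0)
    (hstar : ∀ z ∈ O, (etaStar η Finset.univ Finset.univ z).IsEven)
    {ε : ℝ} (hε : 0 < ε) (hball : bodyClosedBall p.bodyPt ε ⊆ O)
    (hzero : ∀ z ∈ bodyClosedBall p.bodyPt ε, z ≠ p.bodyPt → ∃ i, body (V.g i ∅ z) ≠ 0) :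
    HasResidue V η p ε ((2 * (Real.pi : ℂ) / Complex.I) ^ n •
      ((grassmannExt (eta00 η Finset.univ Finset.univ) p +
        grassmannExt (etaStar η Finset.univ Finset.univ) p) *
          (Ring.inverse (jacDet (fun i => V.g i ∅) p) : CS0))) := by
  set J := jacDet (fun i => V.g i ∅) p with hJ
  have hpO : p.bodyPt ∈ O := hball (bodyBall_subset _ _ (mem_bodyBall_self _ hε))
  have hgev : ∀ i, ∀ z ∈ O, CS.IsEven (V.g i ∅ z) := fun i z hz => ((hVodd i).2 z hz ∅).1
  -- The conjugate determinant produced by the forms cancels half of the Gaussian factor and leaves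
  -- the inverse of the holomorphic determinant.
  have hinv : (CS0.conjHom J : CS) * (Ring.inverse (J * CS0.conjHom J) : CS0) =
      (Ring.inverse J : CS0) := by
    rw [← Subring.coe_mul]
    congr 1
    refine (CS0.isUnit_of_body_ne_zero hdet).mul_left_cancel ?_
    rw [← mul_assoc, Ring.mul_inverse_cancel _ (isUnit_jacDet_mul_conj hdet),
      Ring.mul_inverse_cancel _ (CS0.isUnit_of_body_ne_zero hdet)]
  have hθ := smoothCoeffOn_thetaProd hO hVhol hVodd
  refine SA.tendsto_of_coeff fun m => ?_
  have hlim := (tendsto_sum_gaussian (g := fun i => V.g i ∅) hO (fun i => (hVhol i).2 ∅) hgev h0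
    hdet hε hball hzero
    (a := fun S z => coefAt (fullExp n) (η z * thetaProd (conjJac V z) S))
    (b := fun S z => coefAt (fullExp n) (η z * (thetaProd (conjJac V z) S * oddForm V z)))
    (fun S => (hη.mul (hθ S)).coefAt _)
    (fun S => (hη.mul ((hθ S).mul (smoothCoeffOn_oddForm hO hVhol hVodd))).coefAt _)
    (fun z hz => coefAt_mul_thetaProd_univ_mul_oddForm (η z) hn (hpar00 z hz)
      fun i μ hμ => ((hVodd i).1 z hz μ).2 hμ) m).const_mul
    ((-1 : ℂ) ^ (n * (n - 1) / 2) * (-2 * Complex.I) ^ n)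
  convert hlim.congr fun t => ?_ using 2
  · rw [grassmannExt_coefAt_mul_thetaProd_univ hn hO hVhol hVodd hpO hη,
      sum_grassmannExt_coefAt_mul_oddForm hn hO hVhol hVodd hpO h0 hη hstar, ← smul_add, ← add_mul,
      smul_mul_assoc, mul_assoc _ _ ((Ring.inverse (J * CS0.conjHom J) : CS0) : CS), hinv,
      SA.coeff_smul, SA.coeff_smul, ← berezin_sign hn]
    ring
  · change _ = (-1 : ℂ) ^ (n * (n - 1) / 2) * (-2 * Complex.I) ^ n * _
    congr 1
    refine MeasureTheory.setIntegral_congr_fun (isOpen_bodyBall _ _).measurableSet fun z hz => ?_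
    have hzO := hball (bodyBall_subset _ _ hz)
    have hQ : CS.IsEven (gaussExponent (fun i => V.g i ∅) z) := CS.isEven_sum fun i _ =>
      (hgev i z hzO).mul (hgev i z hzO).conj
    simp only
    rw [dbar_add_contract_omegaForm hO hVhol hVodd hg hzO, ← fullExp,
      coefAt_mul_exp hQ _ (homog_oddForm hVodd hzO) _ betaFree_fullExp]

end Residue

end

end SuperResidue

end

theorem corollary3p16 {n : ℕ} (hn : 0 < n)
    (W : Set (SuperPoint n)) (hW : IsDeWittOpen W)
    (V : SuperVectorField n)
    (hVhol : V.HolomorphicOn (bodySet W)) (hVodd : V.IsOddOn (bodySet W))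
    (hg : ∀ i, (V.g i).NoOddVariablesOn (bodySet W))
    (p : SuperPoint n) (hp : V.IsIsolatedSing W p) (hnd : V.NonDegenerateAt p)
    (hD : body (V.detD p) ≠ 0)
    (η : SuperForm n) (hη : SmoothCoeffOn η (bodySet W))
    (hclosed : ∀ z ∈ bodySet W, dbar η z + contract V η z = 0)
    (hpar00 : ∀ z ∈ bodySet W, ∀ μ lam : Finset (Fin n), ¬ μ.card ≡ n [MOD 2] →
      eta00 η μ lam z = 0)
    (hparStar : ∀ z ∈ bodySet W, ∀ μ lam : Finset (Fin n), ¬ μ.card ≡ n [MOD 2] →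
      etaStar η μ lam z = 0)
    (hevenStar : ∀ z ∈ bodySet W, (etaStar η Finset.univ Finset.univ z).IsEven)
    (ε : ℝ) (hε : 0 < ε) (hball : bodyClosedBall p.bodyPt ε ⊆ bodySet W)
    (hzero : ∀ z ∈ bodyClosedBall p.bodyPt ε, z ≠ p.bodyPt → ∃ i, body (V.g i ∅ z) ≠ 0) :
    HasResidue V η p ε
      ((2 * (Real.pi : ℂ) / Complex.I) ^ n •
        ((grassmannExt (eta00 η Finset.univ Finset.univ) p +
            grassmannExt (etaStar η Finset.univ Finset.univ) p) *
          (Ring.inverse (V.ber p * V.detD p) : CS0))) ∧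
    (V.detD p = 1 →
      HasResidue V η p ε
        ((2 * (Real.pi : ℂ) / Complex.I) ^ n •
          ((grassmannExt (eta00 η Finset.univ Finset.univ) p +
              grassmannExt (etaStar η Finset.univ Finset.univ) p) *
            (Ring.inverse (V.ber p) : CS0)))) := by
  obtain ⟨hpS, -⟩ := hp
  have hO := hW.isOpen_bodySet
  have hpO : p.bodyPt ∈ bodySet W := ⟨p, hpS.1, rfl⟩
  -- Without odd variables the value of `g_i` at `p` is its Taylor extension, so `V(p) = 0` supplies
  -- the zero, soul included, that the Gaussian asymptotics need.
  have hmain := hasResidue_jacDet hn hO hVhol hVodd hg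
    (fun i => by rw [← SuperFun.eval_of_noOdd hO hpO (hg i), (hpS.2 i).2])
    (by rw [← evenDet_blockA hO hpO hg]; exact hnd) hη hpar00 hevenStar hε hball hzero
  have hJ := ber_mul_detD hO hpO hg hD
  refine ⟨?_, fun h1 => ?_⟩
  · rw [hJ]
    exact hmain
  · rw [h1, mul_one] at hJ
    rw [hJ]
    exact hmain
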